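/- **Theorem 3.6 (batch prime factorization).** The prime factorizations of $n$ given numbers in $[s]=\{1,\dots,s\}$ can be computed deterministically in time $\widetilde O(n+\sqrt s)$, where $\widetilde O(T)$ denotes any function bounded by $O(T\log^c T)$ for some constant $c>0$. Precisely: the machine is a deterministic random access machine whose registers and memory cells hold natural numbers, with logarithmic (bit) cost: accessing a register, a constant or a memory cell costs the bit length of the value (and of the address, if computed); addition, subtraction, shifts and comparisons cost the total bit length of operands and result; multiplication, division and remainder cost the product of the bit lengths of the operands (schoolbook cost); all up to additive constants per step. There are a single program for this machine and constants $C$ and $c$ such that for all $n\ge 1$, $s\ge 1$ and all $m_1,\dots,m_n\in[s]$ (repetitions allowed), the program, started with $n$ in a register and $m_1,\dots,m_n$ in consecutive memory cells, halts after time at most $$C\,(n+\sqrt s)\,\bigl(\log(n+\sqrt s)\bigr)^c,$$ having printed, for each $i=1,\dots,n$ in order, the number of prime factors of $m_i$ counted with multiplicity, followed by these prime factors with multiplicity in nondecreasing order. -/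

import Mathlib

/-! A deterministic random access machine over the natural numbers with the logarithmic (bit) cost
criterion. Programs are written in structured form (sequence, conditional, loop). Every access to
a register or memory cell is charged the bit length of the value (and of the address, if it is
computed); addition-like operations are charged a linear number of bit operations; multiplication
and division are charged the *schoolbook* number of bit operations, i.e. the product of the bit
lengths. In particular no fast arithmetic on long integers is built in. -/

namespace LogRAM

/-- Binary operations. -/
inductive Op where
  | add | sub | mul | div | mod | shl | shr | lt | eq
  deriving DecidableEq

/-- The value of an operation. Subtraction is truncated at `0`, `a / 0 = 0`, `a % 0 = a`, and the
comparisons return `1` (true) or `0` (false). -/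
def Op.eval : Op → ℕ → ℕ → ℕ
  | .add, a, b => a + b
  | .sub, a, b => a - b
  | .mul, a, b => a * b
  | .div, a, b => a / b
  | .mod, a, b => a % b
  | .shl, a, b => a * 2 ^ b
  | .shr, a, b => a / 2 ^ b
  | .lt, a, b => if a < b then 1 else 0
  | .eq, a, b => if a = b then 1 else 0

/-- The bit cost of an operation on the operands `a` and `b` (`Nat.size` is the bit length). -/
def Op.cost : Op → ℕ → ℕ → ℕ
  | .mul, a, b => (1 + Nat.size a) * (1 + Nat.size b)
  | .div, a, b => (1 + Nat.size a) * (1 + Nat.size b)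
  | .mod, a, b => (1 + Nat.size a) * (1 + Nat.size b)
  | o, a, b => 1 + Nat.size a + Nat.size b + Nat.size (o.eval a b)

/-- A machine state: registers (addressed by fixed names in the program text), random access
memory (addressed by computed values), and a write-only output tape. -/
structure State where
  reg : ℕ → ℕ
  mem : ℕ → ℕ
  out : List ℕ

/-- Expressions: constants, registers, indirect memory reads, and binary operations. -/
inductive Expr where
  | lit (k : ℕ)
  | var (r : ℕ)
  | read (addr : Expr)
  | bin (o : Op) (e₁ e₂ : Expr)

/-- The value of an expression in a state. -/
def Expr.eval (σ : State) : Expr → ℕ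
  | .lit k => k
  | .var r => σ.reg r
  | .read e => σ.mem (e.eval σ)
  | .bin o e₁ e₂ => o.eval (e₁.eval σ) (e₂.eval σ)

/-- The cost of evaluating an expression in a state. -/
def Expr.cost (σ : State) : Expr → ℕ
  | .lit k => 1 + Nat.size k
  | .var r => 1 + Nat.size (σ.reg r)
  | .read e => e.cost σ + 1 + Nat.size (e.eval σ) + Nat.size (σ.mem (e.eval σ))
  | .bin o e₁ e₂ => e₁.cost σ + e₂.cost σ + o.cost (e₁.eval σ) (e₂.eval σ)

/-- Programs. `set r e` writes the value of `e` into register `r`; `store a e` writes it into the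
memory cell whose address is the value of `a`; `print e` appends it to the output tape. Conditions
count as true when their value is nonzero. -/
inductive Prog where
  | skip
  | set (r : ℕ) (e : Expr)
  | store (a e : Expr)
  | print (e : Expr)
  | seq (p q : Prog)
  | ite (e : Expr) (p q : Prog)
  | while (e : Expr) (p : Prog)

/-- `Exec p σ t σ'`: started in state `σ`, the program `p` halts in state `σ'` after time
exactly `t`. -/
inductive Exec : Prog → State → ℕ → State → Prop
  | skip (σ : State) : Exec .skip σ 1 σ
  | set (r : ℕ) (e : Expr) (σ : State) :
      Exec (.set r e) σ (1 + e.cost σ) { σ with reg := Function.update σ.reg r (e.eval σ) }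
  | store (a e : Expr) (σ : State) :
      Exec (.store a e) σ (1 + a.cost σ + e.cost σ)
        { σ with mem := Function.update σ.mem (a.eval σ) (e.eval σ) }
  | print (e : Expr) (σ : State) :
      Exec (.print e) σ (1 + e.cost σ) { σ with out := σ.out ++ [e.eval σ] }
  | seq {p q : Prog} {σ₁ σ₂ σ₃ : State} {t₁ t₂ : ℕ} :
      Exec p σ₁ t₁ σ₂ → Exec q σ₂ t₂ σ₃ → Exec (.seq p q) σ₁ (t₁ + t₂) σ₃
  | iteTrue {e : Expr} {p q : Prog} {σ₁ σ₂ : State} {t : ℕ} :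
      e.eval σ₁ ≠ 0 → Exec p σ₁ t σ₂ → Exec (.ite e p q) σ₁ (1 + e.cost σ₁ + t) σ₂
  | iteFalse {e : Expr} {p q : Prog} {σ₁ σ₂ : State} {t : ℕ} :
      e.eval σ₁ = 0 → Exec q σ₁ t σ₂ → Exec (.ite e p q) σ₁ (1 + e.cost σ₁ + t) σ₂
  | whileTrue {e : Expr} {p : Prog} {σ₁ σ₂ σ₃ : State} {t₁ t₂ : ℕ} :
      e.eval σ₁ ≠ 0 → Exec p σ₁ t₁ σ₂ → Exec (.while e p) σ₂ t₂ σ₃ →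
      Exec (.while e p) σ₁ (1 + e.cost σ₁ + t₁ + t₂) σ₃
  | whileFalse {e : Expr} {p : Prog} {σ : State} :
      e.eval σ = 0 → Exec (.while e p) σ (1 + e.cost σ) σ

/-- The machine is deterministic: the final state and the running time are determined by the
program and the initial state. -/
theorem Exec.deterministic {p : Prog} {σ σ₁ : State} {t₁ : ℕ} (h₁ : Exec p σ t₁ σ₁) :
    ∀ {t₂ : ℕ} {σ₂ : State}, Exec p σ t₂ σ₂ → t₁ = t₂ ∧ σ₁ = σ₂ := by
  induction h₁ with
  | skip | set | store | print => intro t₂ σ₂ h; cases h; exact ⟨rfl, rfl⟩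
  | seq _ _ ih₁ ih₂ =>
    intro t₂ σ₂ h
    cases h with
    | seq a b =>
      obtain ⟨rfl, rfl⟩ := ih₁ a
      obtain ⟨rfl, rfl⟩ := ih₂ b
      exact ⟨rfl, rfl⟩
  | iteTrue hc _ ih =>
    intro t₂ σ₂ h
    cases h with
    | iteTrue _ a => obtain ⟨rfl, rfl⟩ := ih a; exact ⟨rfl, rfl⟩
    | iteFalse hn _ => exact absurd hn hc
  | iteFalse hc _ ih =>
    intro t₂ σ₂ h
    cases h with
    | iteTrue hn _ => exact absurd hc hn
    | iteFalse _ a => obtain ⟨rfl, rfl⟩ := ih a; exact ⟨rfl, rfl⟩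
  | whileTrue hc _ _ ih₁ ih₂ =>
    intro t₂ σ₂ h
    cases h with
    | whileTrue _ a b =>
      obtain ⟨rfl, rfl⟩ := ih₁ a
      obtain ⟨rfl, rfl⟩ := ih₂ b
      exact ⟨rfl, rfl⟩
    | whileFalse hn => exact absurd hn hc
  | whileFalse hc =>
    intro t₂ σ₂ h
    cases h with
    | whileTrue hn _ _ => exact absurd hc hn
    | whileFalse _ => exact ⟨rfl, rfl⟩

/-- The initial state on input `m = [m₀, …, mₙ₋₁]`: register `0` holds `n`, memory cell `i` holds
`mᵢ` for `i < n`, and everything else is zero or empty. -/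
def State.init (m : List ℕ) : State where
  reg := fun r => if r = 0 then m.length else 0
  mem := fun i => m.getD i 0
  out := []

/-- The prime factorizations of the numbers in `m`, in order, each written as the number of its
prime factors followed by these prime factors (with multiplicity, in nondecreasing order). -/
def factorizations (m : List ℕ) : List ℕ :=
  m.flatMap fun x => x.primeFactorsList.length :: x.primeFactorsList

end LogRAM

namespace LogRAM

set_option linter.unusedSimpArgs false

-- Let h be least with n < 2^h and all inputs below (2^h - 1)^2. Minimality gives 2^h = O(n + √s),
-- and a divisor x > 1 of an input that has no prime factor below 2^h - 1 must itself be prime. So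
-- it suffices to find least prime factors below 2^h - 1. For each bit position b < h let B_b
-- (`bitProd`) be the product of the odd primes below 2^h - 1 whose bit b is zero. If gcd(y, B_b)
-- can be computed for every odd divisor y of an input, the least prime factor of an odd x is found
-- bit by bit from the top: keep a divisor y of x whose small prime factors agree with the answer in
-- the bits already known; if gcd(y, B_b) > 1, the next bit is zero and y is replaced by this gcd,
-- otherwise the bit is one (`Search.step`). Without a small prime factor all bits come out as one,
-- and the value 2^h - 1 signals that x is prime (`Search.final`).
--
-- The gcds come from a product tree over the odd parts of the inputs and, for each bit, a remainder
-- tree with root B_b. Division is replaced by Montgomery reduction, which needs only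
-- multiplications, additions and shifts. It alters residues by powers of two, but these are units
-- modulo the odd nodes, so gcds with divisors of a leaf survive (`redc_gcd`, `rtree_gcd`). The
-- primes themselves come from a sieve of cost 2^h times a power of h.
--
-- A tree level holds at most 2^(g+h) bits, where leaves of 2^g = O(h) bits suffice, so products
-- must be computed in quasi-linear time although the machine charges schoolbook cost.
-- Multiplication is therefore programmed with shifts and additions: split the factors into digits,
-- transform over the integers modulo 2^K + 1, where 2 is a root of unity of order 2K and twiddle
-- factors are shifts, and multiply the values recursively (`up_correct`). As the machine has no
-- recursion, all subproblems of one depth are treated together. A depth step enlarges the total bit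
-- length at most 32-fold, and factors of 2^(f+5) bits lead to only about log f depths, so the loss
-- is polynomial in f (`levCount_mul_le`, `Prog.mulProg_run`).
--
-- Time is counted on two scales. A word length W = 1000 h bounds all addresses and small numbers,
-- and only these are multiplied or divided by the machine's own instructions; long integers have a
-- budget of S ≥ W^2 bits and meet only operations of linear cost. The total is O(W^12 2^(g+h))
-- (`Prog.factorAll_run`), hence O(h^13 2^h), with h = O(log(n + √s)).

infixl:65 " +ₑ " => Expr.bin Op.add
infixl:65 " -ₑ " => Expr.bin Op.sub
infixl:70 " *ₑ " => Expr.bin Op.mul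
infixl:70 " /ₑ " => Expr.bin Op.div
infixl:70 " %ₑ " => Expr.bin Op.mod
infixl:75 " <<ₑ " => Expr.bin Op.shl
infixl:75 " >>ₑ " => Expr.bin Op.shr
infix:50 " <ₑ " => Expr.bin Op.lt
infix:50 " =ₑ " => Expr.bin Op.eq
infixr:30 " ;; " => Prog.seq
infix:40 " ::= " => Prog.set

/-! ### Costs of expressions -/

/-- The number of nodes of an expression. -/
def Expr.nodes : Expr → ℕ
  | .lit _ => 1
  | .var _ => 1
  | .read e => e.nodes + 1
  | .bin _ a b => a.nodes + b.nodes + 1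

/-- Operations of linear bit cost. -/
def Op.lin : Op → Bool
  | .mul => false
  | .div => false
  | .mod => false
  | _ => true

/-- Expressions all of whose operations have linear bit cost. -/
def Expr.lin : Expr → Bool
  | .lit _ => true
  | .var _ => true
  | .read e => e.lin
  | .bin o a b => o.lin && a.lin && b.lin

/-- All leaves of the expression, and all shift distances to the left, have at most `S` bits (or
value at most `S`, respectively). -/
def Expr.Small (σ : State) (S : ℕ) : Expr → Prop
  | .lit k => k.size ≤ S
  | .var r => (σ.reg r).size ≤ S
  | .read e => e.Small σ S ∧ (σ.mem (e.eval σ)).size ≤ S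
  | .bin o a b => a.Small σ S ∧ b.Small σ S ∧ (o = .shl → b.eval σ ≤ S)

theorem Expr.nodes_pos (e : Expr) : 1 ≤ e.nodes := by
  cases e <;> simp [Expr.nodes]

theorem size_add_le (a b : ℕ) : (a + b).size ≤ a.size + b.size + 1 := by
  rw [Nat.size_le, pow_succ, pow_add]
  have h1 := Nat.lt_size_self a
  have h2 := Nat.lt_size_self b
  have h3 := Nat.one_le_two_pow (n := a.size)
  have h4 := Nat.one_le_two_pow (n := b.size)
  nlinarith

theorem size_mul_le (a b : ℕ) : (a * b).size ≤ a.size + b.size := by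
  rw [Nat.size_le, pow_add]
  exact Nat.mul_lt_mul'' (Nat.lt_size_self a) (Nat.lt_size_self b)

theorem size_mul_two_pow_le (a b : ℕ) : (a * 2 ^ b).size ≤ a.size + b := by
  rw [Nat.size_le, pow_add]
  exact Nat.mul_lt_mul_of_pos_right (Nat.lt_size_self a) (by positivity)

/-- A left shift is the exception because its result grows with the value of the second operand, not
with its bit length. This is why `Expr.Small` bounds shift distances by value. -/
theorem Op.size_eval_le (o : Op) (a b : ℕ) (h : o ≠ .shl) :
    (o.eval a b).size ≤ a.size + b.size + 1 := by
  cases o with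
  | add => exact size_add_le a b
  | sub => exact (Nat.size_le_size (Nat.sub_le a b)).trans (by omega)
  | mul => exact (size_mul_le a b).trans (by omega)
  | div => exact (Nat.size_le_size (Nat.div_le_self a b)).trans (by omega)
  | mod => exact (Nat.size_le_size (Nat.mod_le a b)).trans (by omega)
  | shl => exact absurd rfl h
  | shr => exact (Nat.size_le_size (Nat.div_le_self a _)).trans (by omega)
  | lt => simp only [Op.eval]; split <;> simp
  | eq => simp only [Op.eval]; split <;> simp

theorem Op.size_eval_le' {o : Op} {a b S : ℕ} (h : o = .shl → b ≤ S) (hS : 1 ≤ S) :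
    (o.eval a b).size ≤ a.size + b.size + S := by
  by_cases ho : o = .shl
  · subst ho
    exact (size_mul_two_pow_le a b).trans (by have := h rfl; omega)
  · exact (o.size_eval_le a b ho).trans (by omega)

theorem Expr.size_eval_le {σ : State} {S : ℕ} (hS : 1 ≤ S) :
    ∀ {e : Expr}, e.Small σ S → (e.eval σ).size ≤ e.nodes * S
  | .lit k, h => by simpa [Expr.nodes, Expr.eval, Expr.Small] using h
  | .var r, h => by simpa [Expr.nodes, Expr.eval, Expr.Small] using h
  | .read e, h => by
    simp only [Expr.nodes, Expr.eval]
    exact h.2.trans (Nat.le_mul_of_pos_left _ (by omega))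
  | .bin o a b, h => by
    have ha := Expr.size_eval_le hS h.1
    have hb := Expr.size_eval_le hS h.2.1
    have := Op.size_eval_le' (a := a.eval σ) h.2.2 hS
    simp only [Expr.nodes, Expr.eval]
    nlinarith

/-- A subexpression with k nodes has a value of at most k * S bits, so each operation costs O(k *
S); summing over the nodes gives the square. -/
theorem Expr.cost_le_lin {σ : State} {S : ℕ} (hS : 1 ≤ S) :
    ∀ {e : Expr}, e.lin = true → e.Small σ S → e.cost σ ≤ 4 * e.nodes ^ 2 * S
  | .lit k, _, h => by
    have : k.size ≤ S := h
    simp only [Expr.nodes, Expr.cost]; omega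
  | .var r, _, h => by
    have : (σ.reg r).size ≤ S := h
    simp only [Expr.nodes, Expr.cost]; omega
  | .read e, hl, h => by
    have h1 := Expr.cost_le_lin hS (e := e) hl h.1
    have h2 := Expr.size_eval_le hS h.1
    have h3 := h.2
    simp only [Expr.nodes, Expr.cost]
    nlinarith [e.nodes_pos]
  | .bin o a b, hl, h => by
    simp only [Expr.lin, Bool.and_eq_true] at hl
    have ha := Expr.size_eval_le hS h.1
    have hb := Expr.size_eval_le hS h.2.1
    have h1 := Expr.cost_le_lin hS hl.1.2 h.1
    have h2 := Expr.cost_le_lin hS hl.2 h.2.1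
    have h3 := Op.size_eval_le' (a := a.eval σ) h.2.2 hS
    have hc : o.cost (a.eval σ) (b.eval σ) =
        1 + (a.eval σ).size + (b.eval σ).size + (o.eval (a.eval σ) (b.eval σ)).size := by
      cases o <;> first | rfl | simp [Op.lin] at hl
    simp only [Expr.nodes, Expr.cost, hc]
    nlinarith [a.nodes_pos, b.nodes_pos, Nat.zero_le (a.nodes * b.nodes * S),
      Nat.zero_le (a.nodes * S), Nat.zero_le (b.nodes * S)]

/-- The same induction, now with products of bit lengths, which brings in the square of `S`. -/
theorem Expr.cost_le_sq {σ : State} {S : ℕ} (hS : 1 ≤ S) :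
    ∀ {e : Expr}, e.Small σ S → e.cost σ ≤ 4 * e.nodes ^ 2 * S ^ 2
  | .lit k, h => by
    have : k.size ≤ S := h
    simp only [Expr.nodes, Expr.cost]; nlinarith
  | .var r, h => by
    have : (σ.reg r).size ≤ S := h
    simp only [Expr.nodes, Expr.cost]; nlinarith
  | .read e, h => by
    have h1 := Expr.cost_le_sq hS (e := e) h.1
    have h2 := Expr.size_eval_le hS h.1
    have h3 := h.2
    have h4 : S ≤ S ^ 2 := by nlinarith
    simp only [Expr.nodes, Expr.cost]
    nlinarith [e.nodes_pos, Nat.mul_le_mul_left e.nodes h4]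
  | .bin o a b, h => by
    have ha := Expr.size_eval_le hS h.1
    have hb := Expr.size_eval_le hS h.2.1
    have h1 := Expr.cost_le_sq hS h.1
    have h2 := Expr.cost_le_sq hS h.2.1
    have h3 := Op.size_eval_le' (a := a.eval σ) h.2.2 hS
    have h4 : S ≤ S ^ 2 := by nlinarith
    have hc : o.cost (a.eval σ) (b.eval σ) ≤
        1 + (a.eval σ).size + (b.eval σ).size + (o.eval (a.eval σ) (b.eval σ)).size ∨
        o.cost (a.eval σ) (b.eval σ) = (1 + (a.eval σ).size) * (1 + (b.eval σ).size) := by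
      cases o <;> simp [Op.cost]
    simp only [Expr.nodes, Expr.cost]
    have ha4 := Nat.mul_le_mul_left a.nodes h4
    have hb4 := Nat.mul_le_mul_left b.nodes h4
    have hab := Nat.zero_le (a.nodes * b.nodes * S ^ 2)
    rcases hc with hc | hc
    · nlinarith [a.nodes_pos, b.nodes_pos]
    · have h5 : (1 + (a.eval σ).size) * (1 + (b.eval σ).size) ≤
          ((a.nodes + 1) * S) * ((b.nodes + 1) * S) :=
        Nat.mul_le_mul (by nlinarith) (by nlinarith)
      nlinarith [a.nodes_pos, b.nodes_pos]

/-- An expression is acceptable for the word length `W` and the budget `S` if its data have at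
most `S` bits, and at most `W` bits in case it multiplies or divides. -/
def Expr.Ok (W S : ℕ) (σ : State) (e : Expr) : Prop :=
  if e.lin = true then e.Small σ S else e.Small σ W

/-- One budget `S` covers both kinds of expressions: long numbers meet linear operations only, and
schoolbook operations on words of `W` bits cost at most a multiple of `W ^ 2 ≤ S`. -/
theorem Expr.cost_le {σ : State} {W S : ℕ} (hW : 1 ≤ W) (hS : W ^ 2 ≤ S) {e : Expr}
    (h : e.Ok W S σ) : e.cost σ ≤ 4 * e.nodes ^ 2 * S := by
  unfold Expr.Ok at h
  split at h
  · exact Expr.cost_le_lin (le_trans (Nat.one_le_pow _ _ hW) hS) ‹_› h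
  · exact (Expr.cost_le_sq hW h).trans (Nat.mul_le_mul_left _ hS)

/-! ### Loop-free programs -/

/-- The program contains no loop. -/
def Prog.lf : Prog → Bool
  | .seq p q => p.lf && q.lf
  | .ite _ p q => p.lf && q.lf
  | .while _ _ => false
  | _ => true

/-- The state with a changed register. -/
def State.setReg (σ : State) (r v : ℕ) : State :=
  { σ with reg := Function.update σ.reg r v }

/-- The state with a changed memory cell. -/
def State.setMem (σ : State) (a v : ℕ) : State :=
  { σ with mem := Function.update σ.mem a v }

/-- The state with one more number printed. -/
def State.emit (σ : State) (v : ℕ) : State := { σ with out := σ.out ++ [v] }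

/-- The final state of a loop-free program. -/
def Prog.den : Prog → State → State
  | .skip, σ => σ
  | .set r e, σ => σ.setReg r (e.eval σ)
  | .store a e, σ => σ.setMem (a.eval σ) (e.eval σ)
  | .print e, σ => σ.emit (e.eval σ)
  | .seq p q, σ => q.den (p.den σ)
  | .ite e p q, σ => if e.eval σ ≠ 0 then p.den σ else q.den σ
  | .while _ _, σ => σ

/-- All expressions that a loop-free program evaluates are acceptable. -/
def Prog.Ok (W S : ℕ) : Prog → State → Prop
  | .skip, _ => True
  | .set _ e, σ => e.Ok W S σ
  | .store a e, σ => a.Ok W S σ ∧ e.Ok W S σ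
  | .print e, σ => e.Ok W S σ
  | .seq p q, σ => p.Ok W S σ ∧ q.Ok W S (p.den σ)
  | .ite e p q, σ => e.Ok W S σ ∧ if e.eval σ ≠ 0 then p.Ok W S σ else q.Ok W S σ
  | .while _ _, _ => True

/-- A weight that bounds the cost of a loop-free program relative to the budget. -/
def Prog.wt : Prog → ℕ
  | .skip => 1
  | .set _ e => 1 + 4 * e.nodes ^ 2
  | .store a e => 1 + 4 * a.nodes ^ 2 + 4 * e.nodes ^ 2
  | .print e => 1 + 4 * e.nodes ^ 2
  | .seq p q => p.wt + q.wt
  | .ite e p q => 1 + 4 * e.nodes ^ 2 + p.wt + q.wt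
  | .while _ _ => 0

/-- This turns a statement about executions into two goals that can be simplified by computation:
the final state `den` and the side conditions `Ok`. The constant `wt` depends on the program text
alone. -/
theorem Prog.exec_den {W S : ℕ} (hW : 1 ≤ W) (hS : W ^ 2 ≤ S) :
    ∀ {p : Prog} {σ : State}, p.lf = true → p.Ok W S σ →
      ∃ t, Exec p σ t (p.den σ) ∧ t ≤ p.wt * S := by
  have h1 : 1 ≤ S := le_trans (Nat.one_le_pow _ _ hW) hS
  intro p
  induction p with
  | skip => exact fun _ _ => ⟨1, .skip _, by simpa [Prog.wt] using h1⟩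
  | set r e =>
    intro σ _ h
    refine ⟨_, .set r e σ, ?_⟩
    have := Expr.cost_le hW hS h
    simp only [Prog.wt]; linarith
  | store a e =>
    intro σ _ h
    refine ⟨_, .store a e σ, ?_⟩
    have := Expr.cost_le hW hS h.1
    have := Expr.cost_le hW hS h.2
    simp only [Prog.wt]; linarith
  | print e =>
    intro σ _ h
    refine ⟨_, .print e σ, ?_⟩
    have := Expr.cost_le hW hS h
    simp only [Prog.wt]; linarith
  | seq p q ihp ihq =>
    intro σ hl h
    simp only [Prog.lf, Bool.and_eq_true] at hl
    obtain ⟨t, ht, ht'⟩ := ihp hl.1 h.1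
    obtain ⟨u, hu, hu'⟩ := ihq hl.2 h.2
    refine ⟨_, .seq ht hu, ?_⟩
    simp only [Prog.wt]; linarith
  | ite e p q ihp ihq =>
    intro σ hl h
    simp only [Prog.lf, Bool.and_eq_true] at hl
    have hc := Expr.cost_le hW hS h.1
    have h2 := h.2
    simp only [Prog.den]
    split at h2
    · obtain ⟨t, ht, ht'⟩ := ihp hl.1 h2
      rw [if_pos ‹_›]
      refine ⟨_, .iteTrue ‹_› ht, ?_⟩
      simp only [Prog.wt]
      nlinarith [Nat.zero_le (q.wt * S)]
    · obtain ⟨t, ht, ht'⟩ := ihq hl.2 h2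
      rw [if_neg ‹_›]
      refine ⟨_, .iteFalse (not_not.mp ‹_›) ht, ?_⟩
      simp only [Prog.wt]
      nlinarith [Nat.zero_le (p.wt * S)]
  | _ => intro _ h; simp [Prog.lf] at h

/-! ### Total correctness with time bounds -/

/-- The program halts within time `T` in a state satisfying `Q`. -/
def Run (p : Prog) (σ : State) (T : ℕ) (Q : State → Prop) : Prop :=
  ∃ t σ', Exec p σ t σ' ∧ t ≤ T ∧ Q σ'

theorem Run.mono {p : Prog} {σ : State} {T T' : ℕ} {Q Q' : State → Prop} (h : Run p σ T Q)
    (hT : T ≤ T') (hQ : ∀ σ', Q σ' → Q' σ') : Run p σ T' Q' := by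
  obtain ⟨t, σ', h1, h2, h3⟩ := h
  exact ⟨t, σ', h1, h2.trans hT, hQ _ h3⟩

theorem Run.seq {p q : Prog} {σ : State} {T₁ T₂ : ℕ} {Q R : State → Prop} (hp : Run p σ T₁ Q)
    (hq : ∀ σ', Q σ' → Run q σ' T₂ R) : Run (p ;; q) σ (T₁ + T₂) R := by
  obtain ⟨t, σ', h1, h2, h3⟩ := hp
  obtain ⟨u, σ'', h4, h5, h6⟩ := hq _ h3
  exact ⟨_, σ'', .seq h1 h4, add_le_add h2 h5, h6⟩

theorem Run.of_lf {W S : ℕ} (hW : 1 ≤ W) (hS : W ^ 2 ≤ S) {p : Prog} {σ : State}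
    (hl : p.lf = true) (h : p.Ok W S σ) {Q : State → Prop} (hQ : Q (p.den σ)) :
    Run p σ (p.wt * S) Q := by
  obtain ⟨t, h1, h2⟩ := Prog.exec_den hW hS hl h
  exact ⟨t, _, h1, h2, hQ⟩

theorem Run.ite {e : Expr} {p q : Prog} {σ : State} {T Tc : ℕ} {Q : State → Prop}
    (hc : e.cost σ ≤ Tc) (hp : e.eval σ ≠ 0 → Run p σ T Q) (hq : e.eval σ = 0 → Run q σ T Q) :
    Run (.ite e p q) σ (1 + Tc + T) Q := by
  by_cases h : e.eval σ = 0
  · obtain ⟨t, σ', h1, h2, h3⟩ := hq h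
    exact ⟨_, σ', .iteFalse h h1, by omega, h3⟩
  · obtain ⟨t, σ', h1, h2, h3⟩ := hp h
    exact ⟨_, σ', .iteTrue h h1, by omega, h3⟩

/-- Loops with an invariant indexed by the number of iterations. -/
theorem Run.while_aux {e : Expr} {p : Prog} {Tc T n : ℕ} {I : ℕ → State → Prop}
    {Q : State → Prop}
    (hc : ∀ k σ, k ≤ n → I k σ → e.cost σ ≤ Tc)
    (hQ : ∀ k σ, k ≤ n → I k σ → e.eval σ = 0 → Q σ)
    (hb : ∀ k σ, k ≤ n → I k σ → e.eval σ ≠ 0 → k < n ∧ Run p σ T (I (k + 1))) :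
    ∀ (d k : ℕ) (σ : State), k + d = n → I k σ →
      Run (.while e p) σ (d * (1 + Tc + T) + (1 + Tc)) Q := by
  intro d
  induction d with
  | zero =>
    intro k σ hk hI
    by_cases h : e.eval σ = 0
    · refine ⟨_, σ, .whileFalse h, ?_, hQ k σ (by omega) hI h⟩
      have := hc k σ (by omega) hI
      omega
    · have := (hb k σ (by omega) hI h).1
      omega
  | succ d ih =>
    intro k σ hk hI
    have hcost := hc k σ (by omega) hI
    by_cases h : e.eval σ = 0
    · refine ⟨_, σ, .whileFalse h, ?_, hQ k σ (by omega) hI h⟩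
      have : 0 ≤ (d + 1) * (1 + Tc + T) := Nat.zero_le _
      omega
    · obtain ⟨hlt, t, σ', h1, h2, h3⟩ := hb k σ (by omega) hI h
      obtain ⟨u, σ'', h4, h5, h6⟩ := ih (k + 1) σ' (by omega) h3
      refine ⟨_, σ'', .whileTrue h h1 h4, ?_, h6⟩
      rw [Nat.add_mul]
      omega

theorem Run.while {e : Expr} {p : Prog} {σ : State} {Tc T n : ℕ} (I : ℕ → State → Prop)
    {Q : State → Prop} (h0 : I 0 σ)
    (hc : ∀ k σ, k ≤ n → I k σ → e.cost σ ≤ Tc)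
    (hQ : ∀ k σ, k ≤ n → I k σ → e.eval σ = 0 → Q σ)
    (hb : ∀ k σ, k ≤ n → I k σ → e.eval σ ≠ 0 → k < n ∧ Run p σ T (I (k + 1))) :
    Run (.while e p) σ (n * (1 + Tc + T) + (1 + Tc)) Q :=
  Run.while_aux hc hQ hb n 0 σ (by omega) h0

/-- Counting loop: register `i` runs up to the content of register `n`. -/
def Prog.loop (i n : ℕ) (p : Prog) : Prog :=
  .while (.var i <ₑ .var n) (p ;; i ::= .var i +ₑ .lit 1)

theorem cost_lt_vars {σ : State} {i n S : ℕ} (hS : 1 ≤ S) (hi : (σ.reg i).size ≤ S)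
    (hn : (σ.reg n).size ≤ S) : (Expr.var i <ₑ .var n).cost σ ≤ 36 * S :=
  Expr.cost_le_lin (e := .var i <ₑ .var n) hS rfl ⟨hi, hn, by simp⟩

theorem Run.loop {i n a b T S : ℕ} {p : Prog} {σ : State} (I : ℕ → State → Prop)
    (hab : a ≤ b) (hS : 1 ≤ S) (hb : b.size ≤ S)
    (hr : ∀ k σ, I k σ → σ.reg i = k ∧ σ.reg n = b) (h0 : I a σ)
    (hp : ∀ k σ, a ≤ k → k < b → I k σ →
      Run p σ T (fun σ' => σ'.reg i = k ∧ I (k + 1) (σ'.setReg i (k + 1)))) :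
    Run (.loop i n p) σ ((b - a) * (T + 74 * S) + 37 * S) (I b) := by
  -- The test and the increment are expressions of three nodes, so each costs at most 4 * 3 ^ 2 * S
  -- = 36 * S; together with the unit costs of the steps this stays below 74 * S.
  have key : Run (.loop i n p) σ ((b - a) * (1 + 36 * S + (T + 37 * S)) + (1 + 36 * S)) (I b) := by
    refine Run.while (I := fun k σ => I (a + k) σ) (n := b - a) h0 ?_ ?_ ?_
    · intro k σ hk hI
      obtain ⟨h1, h2⟩ := hr _ _ hI
      exact cost_lt_vars hS (h1 ▸ (Nat.size_le_size (by omega)).trans hb) (h2 ▸ hb)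
    · intro k σ hk hI he
      obtain ⟨h1, h2⟩ := hr _ _ hI
      simp only [Expr.eval, Op.eval, h1, h2] at he
      split at he
      · omega
      · have : a + k = b := by omega
        rwa [this] at hI
    · intro k σ hk hI he
      obtain ⟨h1, h2⟩ := hr _ _ hI
      simp only [Expr.eval, Op.eval, h1, h2] at he
      have hlt : a + k < b := by
        by_contra hcon
        simp [hcon] at he
      refine ⟨by omega, ?_⟩
      refine Run.seq (hp _ σ (by omega) hlt hI) ?_
      rintro σ' ⟨h3, h4⟩
      refine ⟨_, _, .set _ _ _, ?_, ?_⟩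
      · have : (Expr.var i +ₑ .lit 1).cost σ' ≤ 4 * 3 ^ 2 * S := by
          refine Expr.cost_le_lin (e := .var i +ₑ .lit 1) hS rfl ⟨?_, ?_, by simp⟩
          · show (σ'.reg i).size ≤ S
            exact h3 ▸ (Nat.size_le_size (by omega)).trans hb
          · simpa [Expr.Small] using hS
        omega
      · simpa [Expr.eval, Op.eval, h3, State.setReg, Nat.add_assoc] using h4
  refine key.mono ?_ (fun _ h => h)
  have : 1 + 36 * S + (T + 37 * S) ≤ T + 74 * S := by omega
  have := Nat.mul_le_mul_left (b - a) this
  omega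

/-! ### Frames and filling loops -/

/-- Registers below `R` and the output are as in `σ₀`. -/
def Frame (R : ℕ) (σ₀ σ : State) : Prop := (∀ r < R, σ.reg r = σ₀.reg r) ∧ σ.out = σ₀.out

theorem Frame.refl (R : ℕ) (σ : State) : Frame R σ σ := ⟨fun _ _ => rfl, rfl⟩

theorem Frame.trans {R R' : ℕ} {σ₀ σ₁ σ₂ : State} (h₁ : Frame R σ₀ σ₁) (h₂ : Frame R' σ₁ σ₂)
    (h : R ≤ R') : Frame R σ₀ σ₂ :=
  ⟨fun r hr => (h₂.1 r (by omega)).trans (h₁.1 r hr), h₂.2.trans h₁.2⟩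

theorem Frame.mono {R R' : ℕ} {σ₀ σ₁ : State} (h₁ : Frame R' σ₀ σ₁) (h : R ≤ R') :
    Frame R σ₀ σ₁ := ⟨fun r hr => h₁.1 r (by omega), h₁.2⟩

theorem Frame.setReg {R r v : ℕ} {σ₀ σ : State} (h : Frame R σ₀ σ) (hr : R ≤ r) :
    Frame R σ₀ (σ.setReg r v) :=
  ⟨fun x hx => by
    have : x ≠ r := by omega
    simp [State.setReg, this, h.1 x hx], h.2⟩

theorem Frame.setMem {R a v : ℕ} {σ₀ σ : State} (h : Frame R σ₀ σ) :
    Frame R σ₀ (σ.setMem a v) := ⟨fun x hx => h.1 x hx, h.2⟩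

theorem Frame.setReg_iff {R r v : ℕ} {σ₀ σ : State} (hr : R ≤ r) :
    Frame R σ₀ (σ.setReg r v) ↔ Frame R σ₀ σ :=
  ⟨fun h => ⟨fun x hx => by
    have h1 := h.1 x hx
    have : x ≠ r := by omega
    simpa [State.setReg, this] using h1, h.2⟩, fun h => h.setReg hr⟩

theorem Frame.setMem_iff {R a v : ℕ} {σ₀ σ : State} :
    Frame R σ₀ (σ.setMem a v) ↔ Frame R σ₀ σ := Iff.rfl

@[simp] theorem State.setReg_mem (σ : State) (r v : ℕ) : (σ.setReg r v).mem = σ.mem := rfl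
@[simp] theorem State.setReg_out (σ : State) (r v : ℕ) : (σ.setReg r v).out = σ.out := rfl
@[simp] theorem State.setMem_reg (σ : State) (r v : ℕ) : (σ.setMem r v).reg = σ.reg := rfl
@[simp] theorem State.setMem_out (σ : State) (r v : ℕ) : (σ.setMem r v).out = σ.out := rfl
@[simp] theorem State.emit_reg (σ : State) (v : ℕ) : (σ.emit v).reg = σ.reg := rfl
@[simp] theorem State.emit_mem (σ : State) (v : ℕ) : (σ.emit v).mem = σ.mem := rfl
@[simp] theorem State.emit_out (σ : State) (v : ℕ) : (σ.emit v).out = σ.out ++ [v] := rfl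
@[simp] theorem State.setMem_mem (σ : State) (a v : ℕ) :
    (σ.setMem a v).mem = Function.update σ.mem a v := rfl

@[simp] theorem State.setReg_reg (σ : State) (r v x : ℕ) :
    (σ.setReg r v).reg x = if x = r then v else σ.reg x := by
  simp [State.setReg, Function.update_apply]

@[simp] theorem State.setReg_setReg (σ : State) (r v w : ℕ) :
    (σ.setReg r v).setReg r w = σ.setReg r w := by
  simp [State.setReg]

/-- The memory `m` with the cells `b, …, b + k - 1` overwritten by `F 0, …, F (k - 1)`. -/
def fillMem (m : ℕ → ℕ) (b k : ℕ) (F : ℕ → ℕ) : ℕ → ℕ :=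
  fun x => if b ≤ x ∧ x < b + k then F (x - b) else m x

theorem fillMem_zero (m : ℕ → ℕ) (b : ℕ) (F : ℕ → ℕ) : fillMem m b 0 F = m := by
  funext x; simp only [fillMem]; rw [if_neg (by omega)]

theorem fillMem_succ (m : ℕ → ℕ) (b k : ℕ) (F : ℕ → ℕ) :
    Function.update (fillMem m b k F) (b + k) (F k) = fillMem m b (k + 1) F := by
  funext x
  simp only [fillMem, Function.update_apply]
  by_cases h : x = b + k
  · subst h; simp
  · rw [if_neg h]
    exact if_congr (by omega) rfl rfl

theorem fillMem_in {m : ℕ → ℕ} {b k : ℕ} {F : ℕ → ℕ} {u : ℕ} (hu : u < k) :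
    fillMem m b k F (b + u) = F u := by
  simp [fillMem, hu]

theorem fillMem_out {m : ℕ → ℕ} {b k : ℕ} {F : ℕ → ℕ} {x : ℕ} (h : x < b ∨ b + k ≤ x) :
    fillMem m b k F x = m x := by
  simp only [fillMem]; rw [if_neg (by omega)]

/-- Fill consecutive memory cells. -/
def Prog.fill (i n : ℕ) (p : Prog) : Prog := i ::= .lit 0 ;; .loop i n p

/-- The body runs on memory whose first `k` target cells are already overwritten. It may use all
registers from `R` on freely, but must restore the counter `i` and change just one cell. -/
theorem Run.fill {i n R N b T S : ℕ} {p : Prog} {σ₀ : State} (F : ℕ → ℕ)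
    (hi : R ≤ i) (hn : n < R) (hN : σ₀.reg n = N) (hS : 1 ≤ S) (hNS : N.size ≤ S)
    (hp : ∀ k σ, k < N → Frame R σ₀ σ → σ.reg i = k → σ.mem = fillMem σ₀.mem b k F →
      Run p σ T (fun σ' => Frame R σ₀ σ' ∧ σ'.reg i = k ∧
        σ'.mem = Function.update σ.mem (b + k) (F k))) :
    Run (.fill i n p) σ₀ (N * (T + 74 * S) + 39 * S)
      (fun σ' => Frame R σ₀ σ' ∧ σ'.mem = fillMem σ₀.mem b N F) := by
  have h1 : Run (i ::= .lit 0) σ₀ 2 (fun σ' => σ' = σ₀.setReg i 0) :=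
    ⟨_, _, .set _ _ _, by simp [Expr.cost], rfl⟩
  have h2 : ∀ σ', σ' = σ₀.setReg i 0 → Run (.loop i n p) σ' ((N - 0) * (T + 74 * S) + 37 * S)
      (fun σ' => (Frame R σ₀ σ' ∧ σ'.mem = fillMem σ₀.mem b N F) ∧ σ'.reg i = N) := by
    rintro _ rfl
    refine Run.loop (I := fun k σ => (Frame R σ₀ σ ∧ σ.mem = fillMem σ₀.mem b k F) ∧ σ.reg i = k)
      (Nat.zero_le N) hS hNS ?_ ?_ ?_
    · rintro k σ ⟨⟨h, _⟩, h'⟩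
      exact ⟨h', (h.1 n hn).trans hN⟩
    · exact ⟨⟨(Frame.refl R σ₀).setReg hi, by simp [fillMem_zero]⟩, by simp⟩
    · rintro k σ - hk ⟨⟨hf, hm⟩, hik⟩
      refine (hp k σ hk hf hik hm).mono le_rfl ?_
      rintro σ' ⟨hf', hi', hm'⟩
      refine ⟨hi', ⟨hf'.setReg hi, ?_⟩, by simp⟩
      rw [State.setReg_mem, hm', hm, fillMem_succ]
  refine (Run.seq h1 h2).mono ?_ (fun _ h => h.1)
  simp only [Nat.sub_zero]
  omega

/-! ### Reduction modulo `2 ^ L - 1` -/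

/-- One step of reduction modulo `2 ^ L - 1`. -/
def foldStep (L a : ℕ) : ℕ := a - a / 2 ^ L * 2 ^ L + a / 2 ^ L

/-- Reduction of numbers of at most `4 * L` bits modulo `2 ^ L - 1` to `L` bits. -/
def red (L a : ℕ) : ℕ := (foldStep L)^[5] a

theorem foldStep_eq (L a : ℕ) : foldStep L a = a % 2 ^ L + a / 2 ^ L := by
  have := Nat.div_add_mod' a (2 ^ L)
  unfold foldStep
  omega

theorem foldStep_lt {L a m : ℕ} (h : a < 2 ^ (L + m)) : foldStep L a < 2 ^ L + 2 ^ m := by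
  rw [foldStep_eq]
  have h1 : a % 2 ^ L < 2 ^ L := Nat.mod_lt _ (by positivity)
  have h2 : a / 2 ^ L < 2 ^ m := by
    rw [Nat.div_lt_iff_lt_mul (by positivity), ← pow_add]
    rwa [add_comm]
  omega

theorem two_pow_add_lt {a b c x : ℕ} (h : x < 2 ^ a + 2 ^ b) (ha : a + 1 ≤ c) (hb : b + 1 ≤ c) :
    x < 2 ^ c := by
  have h1 : 2 ^ (a + 1) ≤ 2 ^ c := Nat.pow_le_pow_right (by norm_num) ha
  have h2 : 2 ^ (b + 1) ≤ 2 ^ c := Nat.pow_le_pow_right (by norm_num) hb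
  rw [pow_succ] at h1 h2
  omega

/-- The folds shrink 4L bits to at most 3L + 1, then 2L + 2, then L + 3 bits, and the fourth result
is below 2^L + 8. In the fifth round the high part is 0 or 1, and if it is 1 the low part is below
8, so no carry remains. The result need not be the least residue, since 2^L - 1 is a fixed point. -/
theorem red_lt {L a : ℕ} (hL : 4 ≤ L) (h : a < 2 ^ (4 * L)) : red L a < 2 ^ L := by
  have h1 := foldStep_lt (L := L) (m := 3 * L) (a := a) (by convert h using 2; omega)
  have h2 := foldStep_lt (L := L) (m := 2 * L + 1)
    (two_pow_add_lt h1 (c := L + (2 * L + 1)) (by omega) (by omega))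
  have h3 := foldStep_lt (L := L) (m := L + 2)
    (two_pow_add_lt h2 (c := L + (L + 2)) (by omega) (by omega))
  have h4 := foldStep_lt (L := L) (m := 3)
    (two_pow_add_lt h3 (c := L + 3) (by omega) (by omega))
  show foldStep L _ < _
  change foldStep L (foldStep L (foldStep L (foldStep L a))) < 2 ^ L + 2 ^ 3 at h4
  set y := foldStep L (foldStep L (foldStep L (foldStep L a)))
  show foldStep L y < _
  have h5 : 2 ^ 4 ≤ 2 ^ L := Nat.pow_le_pow_right (by norm_num) hL
  rw [foldStep_eq]
  by_cases hy : y < 2 ^ L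
  · rw [Nat.mod_eq_of_lt hy, Nat.div_eq_of_lt hy]; omega
  · have e1 : y / 2 ^ L = 1 := by
      rw [Nat.div_eq_iff (by positivity)]; omega
    have e2 := Nat.div_add_mod' y (2 ^ L)
    rw [e1] at e2 ⊢
    omega

/-- Stated in any ring with 2^L = 1, so that it applies in `ZMod (2 ^ K + 1)` with L = 2K: working
modulo 2^L - 1 is a redundant representation of that ring. -/
theorem cast_foldStep {R : Type*} [CommRing R] {L : ℕ} (h : (2 : R) ^ L = 1) (a : ℕ) :
    (foldStep L a : R) = a := by
  rw [foldStep_eq]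
  conv_rhs => rw [← Nat.div_add_mod a (2 ^ L)]
  push_cast
  rw [h]; ring

theorem cast_red {R : Type*} [CommRing R] {L : ℕ} (h : (2 : R) ^ L = 1) (a : ℕ) :
    (red L a : R) = a := by
  simp only [red, Function.iterate_succ, Function.iterate_zero, Function.comp, id]
  simp only [cast_foldStep h]

/-! ### The Fourier transform with roots of unity that are powers of two -/

/-- The transform in a ring, level by level. -/
def ringFft {R : Type*} [CommRing R] (l : ℕ) (v : ℕ → R) : ℕ → ℕ → R
  | 0, u => v u
  | j + 1, u =>
    let m := 2 ^ (l - (j + 1))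
    let t := u % m
    let lo := u / (2 * m) * (2 * m) + t
    if u / m % 2 = 0 then ringFft l v j lo + ringFft l v j (lo + m)
    else (ringFft l v j lo - ringFft l v j (lo + m)) * 2 ^ (t * 2 ^ j)

/-- The transform on natural numbers modulo `2 ^ 2 ^ l - 1`. -/
def fft (l : ℕ) (v : ℕ → ℕ) : ℕ → ℕ → ℕ
  | 0, u => v u
  | j + 1, u =>
    let m := 2 ^ (l - (j + 1))
    let t := u % m
    let lo := u / (2 * m) * (2 * m) + t
    red (2 ^ l) (if u / m % 2 = 0 then fft l v j lo + fft l v j (lo + m)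
      else (fft l v j lo + fft l v j (lo + m) * 2 ^ 2 ^ (l - 1)) * 2 ^ (t * 2 ^ j))

/-- The inverse transform, up to a power of two, on natural numbers modulo `2 ^ 2 ^ l - 1`. -/
def ifft (l : ℕ) (w : ℕ → ℕ) : ℕ → ℕ → ℕ
  | 0, u => w u
  | i + 1, u =>
    let m := 2 ^ i
    let t := u % m
    let lo := u / (2 * m) * (2 * m) + t
    red (2 ^ l) (if u / m % 2 = 0 then
        ifft l w i lo + ifft l w i (lo + m) * 2 ^ (2 ^ l - t * 2 ^ (l - 1 - i))
      else ifft l w i lo + ifft l w i (lo + m) *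
        2 ^ (2 ^ l + 2 ^ (l - 1) - t * 2 ^ (l - 1 - i)))

/-- The exponents of the evaluation points of the transform. -/
def evalExp : ℕ → ℕ → ℕ
  | 0, _ => 0
  | j + 1, q => evalExp j (q / 2) + q % 2 * 2 ^ j

/-- The exponent depends only on the position within a block of 2^j entries. Hence the two factors
of a product, stored in different blocks, are evaluated at the same points. -/
theorem evalExp_periodic (j q r : ℕ) : evalExp j (q + r * 2 ^ j) = evalExp j q := by
  induction j generalizing q r with
  | zero => rfl
  | succ j ih =>
    simp only [evalExp]
    have e : r * 2 ^ (j + 1) = 2 * (r * 2 ^ j) := by ring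
    have h1 : (q + r * 2 ^ (j + 1)) / 2 = q / 2 + r * 2 ^ j := by omega
    have h2 : (q + r * 2 ^ (j + 1)) % 2 = q % 2 := by omega
    rw [h1, h2, ih]

theorem sum_range_two_mul {R : Type*} [AddCommMonoid R] (f : ℕ → R) (n : ℕ) :
    ∑ k ∈ Finset.range (2 * n), f k = ∑ k ∈ Finset.range n, (f (2 * k) + f (2 * k + 1)) := by
  induction n with
  | zero => simp
  | succ n ih =>
    rw [show 2 * (n + 1) = 2 * n + 1 + 1 from by ring, Finset.sum_range_succ,
      Finset.sum_range_succ, ih, Finset.sum_range_succ, add_assoc]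

theorem lo_facts {m : ℕ} (hm : 0 < m) (u : ℕ) :
    (u / (2 * m) * (2 * m) + u % m) / (2 * m) = u / (2 * m) ∧
    (u / (2 * m) * (2 * m) + u % m) % (2 * m) = u % m ∧
    (u / (2 * m) * (2 * m) + u % m + m) / (2 * m) = u / (2 * m) ∧
    (u / (2 * m) * (2 * m) + u % m + m) % (2 * m) = u % m + m := by
  have ht : u % m < m := Nat.mod_lt _ hm
  refine ⟨?_, ?_, ?_, ?_⟩
  · rw [Nat.add_comm, Nat.add_mul_div_right _ _ (by omega), Nat.div_eq_of_lt (by omega)]; omega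
  · rw [Nat.add_comm, Nat.add_mul_mod_self_right, Nat.mod_eq_of_lt (by omega)]
  · rw [Nat.add_assoc, Nat.add_comm, Nat.add_mul_div_right _ _ (by omega),
      Nat.div_eq_of_lt (by omega)]; omega
  · rw [Nat.add_assoc, Nat.add_comm, Nat.add_mul_mod_self_right, Nat.mod_eq_of_lt (by omega)]

/-- With m = 2^(l-j) and ε the exponent of the current sub-block, entry t of that sub-block is the
coefficient of X^t of the polynomial v(2^ε X) reduced modulo X^m - 1. A level splits X^(2m) - 1 into
X^m - 1 and X^m + 1 and turns the second factor into the first by X ↦ ωX, where ω = 2^(2^j)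
satisfies ω^m = 2^(2^(l-1)) = -1. -/
theorem ringFft_eq_sum {R : Type*} [CommRing R] {l : ℕ} (hK : (2 : R) ^ 2 ^ (l - 1) = -1)
    (v : ℕ → R) (j : ℕ) (hj : j ≤ l) (u : ℕ) :
    ringFft l v j u = ∑ k ∈ Finset.range (2 ^ j),
      v (u / 2 ^ l * 2 ^ l + k * 2 ^ (l - j) + u % 2 ^ (l - j)) *
        2 ^ (evalExp j (u / 2 ^ (l - j)) * (k * 2 ^ (l - j) + u % 2 ^ (l - j))) := by
  induction j generalizing u with
  | zero => simp [ringFft, evalExp, Nat.div_add_mod']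
  | succ j ih =>
    have hl : l - j = (l - (j + 1)) + 1 := by omega
    have hKm : 2 ^ j * 2 ^ (l - (j + 1)) = 2 ^ (l - 1) := by
      rw [← pow_add]; congr 1; omega
    have hLm : 2 ^ l = 2 * 2 ^ (l - (j + 1)) * 2 ^ j := by
      rw [mul_assoc, mul_comm (2 ^ _), hKm, ← pow_succ']; congr 1; omega
    simp only [ringFft, ih (by omega)]
    rw [hl, pow_succ' 2 (l - (j + 1))]
    set m := 2 ^ (l - (j + 1)) with hm
    have hmp : 0 < m := by positivity
    obtain ⟨f1, f2, f3, f4⟩ := lo_facts hmp u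
    have g1 : (u / (2 * m) * (2 * m) + u % m) / 2 ^ l = u / 2 ^ l := by
      rw [hLm, ← Nat.div_div_eq_div_mul, f1, Nat.div_div_eq_div_mul]
    have g2 : (u / (2 * m) * (2 * m) + u % m + m) / 2 ^ l = u / 2 ^ l := by
      rw [hLm, ← Nat.div_div_eq_div_mul, f3, Nat.div_div_eq_div_mul]
    rw [f1, f2, f3, f4, g1, g2, pow_succ' 2 j, sum_range_two_mul]
    have hq : u / m / 2 = u / (2 * m) := by rw [Nat.div_div_eq_div_mul, mul_comm m 2]
    simp only [evalExp, hq]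
    set B := u / 2 ^ l * 2 ^ l
    set t := u % m
    set ε := evalExp j (u / (2 * m))
    split_ifs with hpar
    · rw [hpar, ← Finset.sum_add_distrib]
      refine Finset.sum_congr rfl fun k _ => ?_
      congr 3 <;> ring_nf
    · have hodd : u / m % 2 = 1 := by omega
      rw [hodd, ← Finset.sum_sub_distrib, Finset.sum_mul]
      refine Finset.sum_congr rfl fun k _ => ?_
      -- The exponent contains 2^j * m = 2^(l-1) with multiplicity 2k here and 2k + 1 in `e2`; since
      -- 2^(2^(l-1)) = -1, this yields the signs of the difference.
      have e1 : (2 : R) ^ ((ε + 1 * 2 ^ j) * (2 * k * m + t)) =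
          2 ^ (ε * (k * (2 * m) + t)) * 2 ^ (t * 2 ^ j) := by
        rw [show (ε + 1 * 2 ^ j) * (2 * k * m + t) =
          ε * (k * (2 * m) + t) + t * 2 ^ j + (2 ^ j * m) * (2 * k) from by ring, pow_add, pow_add,
          pow_mul _ (2 ^ j * m), hKm, hK, Even.neg_one_pow ⟨k, by ring⟩]
        ring
      have e2 : (2 : R) ^ ((ε + 1 * 2 ^ j) * ((2 * k + 1) * m + t)) =
          - (2 ^ (ε * (k * (2 * m) + (t + m))) * 2 ^ (t * 2 ^ j)) := by
        rw [show (ε + 1 * 2 ^ j) * ((2 * k + 1) * m + t) =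
          ε * (k * (2 * m) + (t + m)) + t * 2 ^ j + (2 ^ j * m) * (2 * k + 1) from by ring,
          pow_add, pow_add, pow_mul _ (2 ^ j * m), hKm, hK, Odd.neg_one_pow ⟨k, rfl⟩]
        ring
      rw [e1, e2, show B + 2 * k * m + t = B + k * (2 * m) + t from by ring,
        show B + (2 * k + 1) * m + t = B + k * (2 * m) + (t + m) from by ring]
      ring

/-- At the last level each block of 2^l entries holds the values of its polynomial at powers of 2.
They appear in bit-reversed order, which is harmless because the inverse transform undoes the levels
one by one. -/
theorem ringFft_last {R : Type*} [CommRing R] {l : ℕ} (hK : (2 : R) ^ 2 ^ (l - 1) = -1)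
    (v : ℕ → R) (u : ℕ) :
    ringFft l v l u = ∑ k ∈ Finset.range (2 ^ l),
      v (u / 2 ^ l * 2 ^ l + k) * (2 ^ evalExp l u) ^ k := by
  rw [ringFft_eq_sum hK v l le_rfl]
  simp [Nat.mod_one, pow_mul]

/-! ### Convolution, and correctness of the transforms on natural numbers. -/

/-- Convolution. -/
def conv (a b : ℕ → ℕ) (t : ℕ) : ℕ := ∑ i ∈ Finset.range (t + 1), a i * b (t - i)

/-- A product of two polynomials of degree below n has degree below 2n, so 2n terms lose nothing. It
is used twice: at the evaluation points modulo 2^K + 1, and in ℕ at the base of the digits. -/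
theorem sum_conv {R : Type*} [CommSemiring R] {a b : ℕ → ℕ} {n : ℕ} (ha : ∀ i, n ≤ i → a i = 0)
    (hb : ∀ i, n ≤ i → b i = 0) (x : R) :
    ∑ k ∈ Finset.range (2 * n), (conv a b k : R) * x ^ k =
      (∑ k ∈ Finset.range (2 * n), (a k : R) * x ^ k) *
        ∑ k ∈ Finset.range (2 * n), (b k : R) * x ^ k := by
  have trunc : ∀ c : ℕ → ℕ, (∀ i, n ≤ i → c i = 0) →
      ∑ k ∈ Finset.range (2 * n), (c k : R) * x ^ k = ∑ k ∈ Finset.range n, (c k : R) * x ^ k := by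
    intro c hc
    symm
    apply Finset.sum_subset (by intro y; simp; omega)
    intro y _ hy
    rw [hc y (by simpa using hy)]; simp
  rw [trunc a ha, trunc b hb, Finset.sum_mul_sum, ← Finset.sum_product']
  have : ∀ k, (conv a b k : R) * x ^ k =
      ∑ p ∈ Finset.HasAntidiagonal.antidiagonal k, ((a p.1 : R) * x ^ p.1) * ((b p.2 : R) * x ^ p.2) := by
    intro k
    rw [Finset.Nat.sum_antidiagonal_eq_sum_range_succ
      (fun i j => ((a i : R) * x ^ i) * ((b j : R) * x ^ j)), conv, Nat.cast_sum, Finset.sum_mul]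
    refine Finset.sum_congr rfl fun i hi => ?_
    have : k = i + (k - i) := by have := Finset.mem_range.mp hi; omega
    conv_lhs => rw [this, pow_add, ← this]
    push_cast; ring
  simp only [this]
  rw [Finset.sum_sigma']
  symm
  -- The square of pairs with both indices below n and the triangle of pairs with sum below 2n
  -- differ only in pairs where one factor vanishes.
  refine Finset.sum_bij_ne_zero (fun p _ _ => ⟨p.1 + p.2, p⟩) ?_ ?_ ?_ ?_
  · intro p hp _
    simp only [Finset.mem_product, Finset.mem_range] at hp
    simp; omega
  · intro p _ _ q _ _ h
    simpa using congrArg (fun s : Σ _ : ℕ, ℕ × ℕ => s.2) h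
  · rintro ⟨k, p⟩ hp hne
    simp only [Finset.mem_sigma, Finset.mem_range, Finset.HasAntidiagonal.mem_antidiagonal] at hp
    refine ⟨p, ?_, hne, by simp [hp.2]⟩
    simp only [Finset.mem_product, Finset.mem_range]
    by_contra hcon
    apply hne
    rcases Nat.lt_or_ge p.1 n with h1 | h1
    · have h2 : n ≤ p.2 := by
        by_contra h3; exact hcon ⟨h1, by omega⟩
      simp [hb _ h2]
    · simp [ha _ h1]
  · intro p _ _; rfl

/-- At most 2^l terms, each below 2^(2d). Being below 2^K + 1, a coefficient is determined by its
residue modulo 2^K + 1. -/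
theorem conv_lt {a b : ℕ → ℕ} {d l K t : ℕ} (ha : ∀ i, a i < 2 ^ d) (hb : ∀ i, b i < 2 ^ d)
    (ht : t < 2 ^ l) (h : l + 2 * d ≤ K) : conv a b t < 2 ^ K + 1 := by
  have : conv a b t ≤ (t + 1) * 2 ^ (2 * d) := by
    refine (Finset.sum_le_card_nsmul _ _ (2 ^ (2 * d)) ?_).trans (by simp)
    intro i _
    rw [two_mul, pow_add]
    exact (Nat.mul_lt_mul'' (ha _) (hb _)).le
  have h2 : (t + 1) * 2 ^ (2 * d) ≤ 2 ^ l * 2 ^ (2 * d) := Nat.mul_le_mul_right _ ht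
  rw [← pow_add] at h2
  have := Nat.pow_le_pow_right (n := 2) (by norm_num) h
  omega

/-- Natural numbers cannot be subtracted freely, so `fft` adds y * 2^K in place of -y; this is
correct because 2^K = -1 in the ring. -/
theorem cast_fft {R : Type*} [CommRing R] {l : ℕ} (hl : 1 ≤ l) (hK : (2 : R) ^ 2 ^ (l - 1) = -1)
    (v : ℕ → ℕ) (j u : ℕ) :
    (fft l v j u : R) = ringFft l (fun x => (v x : R)) j u := by
  have hL : (2 : R) ^ 2 ^ l = 1 := by
    rw [show l = l - 1 + 1 by omega, pow_succ, pow_mul, hK]; norm_num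
  induction j generalizing u with
  | zero => rfl
  | succ j ih =>
    simp only [fft, ringFft, cast_red hL]
    split_ifs
    · push_cast; rw [ih, ih]
    · push_cast; rw [ih, ih, hK]; ring

theorem lo_cases {m : ℕ} (u : ℕ) :
    (u / m % 2 = 0 → u / (2 * m) * (2 * m) + u % m = u) ∧
    (u / m % 2 ≠ 0 → u / (2 * m) * (2 * m) + u % m + m = u) := by
  have h1 : u / (2 * m) = u / m / 2 := by rw [Nat.div_div_eq_div_mul, mul_comm]
  have h2 := Nat.div_add_mod' u m
  have h3 := Nat.div_add_mod' (u / m) 2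
  rw [h1]
  constructor
  · intro h
    rw [h] at h3
    calc _ = (u / m / 2 * 2 + 0) * m + u % m := by ring
      _ = u := by rw [h3, h2]
  · intro h
    have h' : u / m % 2 = 1 := by omega
    rw [h'] at h3
    calc _ = (u / m / 2 * 2 + 1) * m + u % m := by ring
      _ = u := by rw [h3, h2]

theorem mod_mul_two_pow_le {l i : ℕ} (hi : i < l) (u : ℕ) :
    u % 2 ^ i * 2 ^ (l - 1 - i) ≤ 2 ^ (l - 1) := by
  calc _ ≤ 2 ^ i * 2 ^ (l - 1 - i) := Nat.mul_le_mul_right _ (Nat.mod_lt _ (by positivity)).le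
    _ = 2 ^ (l - 1) := by rw [← pow_add]; congr 1; omega

/-- Each inverse level forms sum and difference without halving, so a factor 2 accumulates per
level. Division by a twiddle factor 2^e is multiplication by 2^(L-e), as 2^L = 1, and the sign is
supplied by a further 2^K. -/
theorem cast_ifft {R : Type*} [CommRing R] {l n : ℕ} (hl : 1 ≤ l)
    (hK : (2 : R) ^ 2 ^ (l - 1) = -1)
    (w : ℕ → ℕ) (h : ℕ → R) (hw : ∀ u < n * 2 ^ l, (w u : R) = ringFft l h l u) (i : ℕ)
    (hi : i ≤ l) (u : ℕ) (hu : u < n * 2 ^ l) :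
    (ifft l w i u : R) = 2 ^ i * ringFft l h (l - i) u := by
  have hL : (2 : R) ^ 2 ^ l = 1 := by
    rw [show l = l - 1 + 1 by omega, pow_succ, pow_mul, hK]; norm_num
  induction i generalizing u with
  | zero => simp [ifft, hw u hu]
  | succ i ih =>
    have hj : l - i = (l - (i + 1)) + 1 := by omega
    have hm : l - (l - (i + 1) + 1) = i := by omega
    have hmp : 0 < 2 ^ i := by positivity
    obtain ⟨f1, f2, f3, f4⟩ := lo_facts hmp u
    have hlt : u / (2 * 2 ^ i) * (2 * 2 ^ i) + u % 2 ^ i + 2 ^ i < n * 2 ^ l := by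
      have e : n * 2 ^ l = n * 2 ^ (l - (i + 1)) * (2 * 2 ^ i) := by
        rw [← pow_succ', mul_assoc, ← pow_add]; congr 2; omega
      rw [e, ← Nat.div_lt_iff_lt_mul (by positivity)] at hu ⊢
      rwa [f3]
    simp only [ifft, cast_red hL]
    have hle := mod_mul_two_pow_le (show i < l by omega) u
    have hle2 : 2 ^ (l - 1) ≤ 2 ^ l := Nat.pow_le_pow_right (by norm_num) (by omega)
    have hlow : ringFft l h (l - i) (u / (2 * 2 ^ i) * (2 * 2 ^ i) + u % 2 ^ i) =
        ringFft l h (l - (i + 1)) (u / (2 * 2 ^ i) * (2 * 2 ^ i) + u % 2 ^ i) +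
        ringFft l h (l - (i + 1)) (u / (2 * 2 ^ i) * (2 * 2 ^ i) + u % 2 ^ i + 2 ^ i) := by
      rw [hj]
      simp only [ringFft, hm]
      set lo := u / (2 * 2 ^ i) * (2 * 2 ^ i) + u % 2 ^ i with hlo
      have e1 : lo % 2 ^ i = u % 2 ^ i := by
        rw [hlo, ← mul_assoc, Nat.add_comm, Nat.add_mul_mod_self_right, Nat.mod_mod]
      have e2 : lo / 2 ^ i % 2 = 0 := by
        rw [hlo, ← mul_assoc, Nat.add_comm, Nat.add_mul_div_right _ _ hmp,
          Nat.div_eq_of_lt (Nat.mod_lt _ hmp)]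
        omega
      rw [if_pos e2, f1, e1]
    have hhigh : ringFft l h (l - i) (u / (2 * 2 ^ i) * (2 * 2 ^ i) + u % 2 ^ i + 2 ^ i) =
        (ringFft l h (l - (i + 1)) (u / (2 * 2 ^ i) * (2 * 2 ^ i) + u % 2 ^ i) -
        ringFft l h (l - (i + 1)) (u / (2 * 2 ^ i) * (2 * 2 ^ i) + u % 2 ^ i + 2 ^ i)) *
        2 ^ (u % 2 ^ i * 2 ^ (l - (i + 1))) := by
      rw [hj]
      simp only [ringFft, hm]
      set lo := u / (2 * 2 ^ i) * (2 * 2 ^ i) + u % 2 ^ i with hlo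
      have e1 : (lo + 2 ^ i) % 2 ^ i = u % 2 ^ i := by
        rw [Nat.add_mod_right, hlo, ← mul_assoc, Nat.add_comm, Nat.add_mul_mod_self_right,
          Nat.mod_mod]
      have e3 : lo / 2 ^ i % 2 = 0 := by
        rw [hlo, ← mul_assoc, Nat.add_comm, Nat.add_mul_div_right _ _ hmp,
          Nat.div_eq_of_lt (Nat.mod_lt _ hmp)]
        omega
      have e2 : ¬ (lo + 2 ^ i) / 2 ^ i % 2 = 0 := by
        rw [Nat.add_div_right _ hmp]
        omega
      rw [if_neg e2, f3, e1]
    have hl1 : l - (i + 1) = l - 1 - i := by omega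
    rw [hl1] at hlow hhigh ⊢
    obtain ⟨c1, c2⟩ := lo_cases (m := 2 ^ i) u
    -- Undoes the twist by 2^e up to 2^E: the choice E = L gives the factor 1, the choice E = L + K
    -- gives -1.
    have cancel : ∀ E, u % 2 ^ i * 2 ^ (l - 1 - i) ≤ E →
        (2 : R) ^ (u % 2 ^ i * 2 ^ (l - 1 - i)) * 2 ^ (E - u % 2 ^ i * 2 ^ (l - 1 - i)) =
          2 ^ E := by
      intro E hE
      rw [← pow_add]; congr 1; omega
    have cA := cancel (2 ^ l) (hle.trans hle2)
    have cB := cancel (2 ^ l + 2 ^ (l - 1)) (by omega)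
    rw [hL] at cA
    rw [pow_add, hL, hK, one_mul] at cB
    split_ifs with hpar
    · push_cast
      rw [ih (by omega) _ (by omega), ih (by omega) _ hlt, hlow, hhigh, c1 hpar]
      linear_combination (2 ^ i * (ringFft l h (l - 1 - i) u -
        ringFft l h (l - 1 - i) (u + 2 ^ i))) * cA
    · push_cast
      rw [ih (by omega) _ (by omega), ih (by omega) _ hlt, hlow, hhigh, c2 hpar]
      linear_combination (2 ^ i *
        (ringFft l h (l - 1 - i) (u / (2 * 2 ^ i) * (2 * 2 ^ i) + u % 2 ^ i) -
        ringFft l h (l - 1 - i) u)) * cB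

/-! ### Splitting into digits and recombination -/

/-- Halving numbers of `d * 2 ^ l` bits `j` times. -/
def split (d l : ℕ) (Z : ℕ → ℕ) : ℕ → ℕ → ℕ
  | 0, u => Z u
  | j + 1, u =>
    let s := d * 2 ^ (l - (j + 1))
    let p := split d l Z j (u / 2)
    if u % 2 = 0 then p - p / 2 ^ s * 2 ^ s else p / 2 ^ s

/-- Recombination of digits to the base `2 ^ d`. -/
def pack (d : ℕ) (h : ℕ → ℕ) : ℕ → ℕ → ℕ
  | 0, u => h u
  | i + 1, u => pack d h i (2 * u) + pack d h i (2 * u + 1) * 2 ^ (d * 2 ^ i)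

/-- Division by `2 ^ l` modulo `2 ^ 2 ^ (l - 1) + 1`, with the smallest residue as result. -/
def unscale (l z : ℕ) : ℕ :=
  let r := red (2 ^ l) (z * 2 ^ (2 ^ l - l))
  let y := r - r / 2 ^ 2 ^ (l - 1) * 2 ^ 2 ^ (l - 1) + (2 ^ 2 ^ (l - 1) + 1) - r / 2 ^ 2 ^ (l - 1)
  if y < 2 ^ 2 ^ (l - 1) + 1 then y else y - (2 ^ 2 ^ (l - 1) + 1)

theorem sub_div_mul (a b : ℕ) : a - a / b * b = a % b := by
  have := Nat.div_add_mod' a b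
  omega

/-- Repeated halving keeps the pieces of one root consecutive and in order, so position `u` holds
digit number `u % 2 ^ j` of root `u / 2 ^ j`. The top digit needs no further reduction because the
roots are bounded. -/
theorem split_eq {d l : ℕ} {Z : ℕ → ℕ} (hZ : ∀ u, Z u < 2 ^ (d * 2 ^ l)) (j : ℕ) (hj : j ≤ l)
    (u : ℕ) :
    split d l Z j u = Z (u / 2 ^ j) / 2 ^ (d * 2 ^ (l - j) * (u % 2 ^ j)) %
      2 ^ (d * 2 ^ (l - j)) := by
  induction j generalizing u with
  | zero => simp [split, Nat.mod_one, Nat.mod_eq_of_lt (hZ u)]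
  | succ j ih =>
    have hl : l - j = (l - (j + 1)) + 1 := by omega
    simp only [split, sub_div_mul, ih (by omega)]
    rw [hl, pow_succ 2 (l - (j + 1)), ← mul_assoc d]
    set s := d * 2 ^ (l - (j + 1))
    have e1 : u / 2 / 2 ^ j = u / 2 ^ (j + 1) := by
      rw [Nat.div_div_eq_div_mul, pow_succ']
    have e2 : u % 2 ^ (j + 1) = 2 * (u / 2 % 2 ^ j) + u % 2 := by
      rw [pow_succ', Nat.mod_mul]; ring
    rw [e1, e2]
    split_ifs with h
    · rw [h, Nat.mod_mod_of_dvd _ (pow_dvd_pow 2 (by omega))]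
      congr 3; ring
    · have : u % 2 = 1 := by omega
      rw [this, show s * 2 = s + s by ring, pow_add 2 s s, Nat.mod_mul_right_div_self,
        Nat.div_div_eq_div_mul, ← pow_add]
      congr 3; ring

theorem split_lt {d l : ℕ} {Z : ℕ → ℕ} (hZ : ∀ u, Z u < 2 ^ (d * 2 ^ l)) (j : ℕ) (hj : j ≤ l)
    (u : ℕ) : split d l Z j u < 2 ^ (d * 2 ^ (l - j)) := by
  rw [split_eq hZ j hj]
  exact Nat.mod_lt _ (by positivity)

theorem sum_digits (a d n : ℕ) :
    ∑ k ∈ Finset.range n, a / 2 ^ (d * k) % 2 ^ d * (2 ^ d) ^ k = a % 2 ^ (d * n) := by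
  induction n with
  | zero => simp [Nat.mod_one]
  | succ n ih =>
    rw [Finset.sum_range_succ, ih, ← pow_mul, mul_add, pow_add, mul_one, Nat.mod_mul]
    ring

theorem pack_eq (d : ℕ) (h : ℕ → ℕ) (i u : ℕ) :
    pack d h i u = ∑ k ∈ Finset.range (2 ^ i), h (u * 2 ^ i + k) * (2 ^ d) ^ k := by
  induction i generalizing u with
  | zero => simp [pack]
  | succ i ih =>
    rw [pack, ih, ih, pow_succ 2 i, mul_two, Finset.sum_range_add, Finset.sum_mul]
    congr 1
    · refine Finset.sum_congr rfl fun k _ => ?_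
      congr 2; ring
    · refine Finset.sum_congr rfl fun k _ => ?_
      rw [show (2 * u + 1) * 2 ^ i + k = u * (2 ^ i + 2 ^ i) + (2 ^ i + k) by ring, mul_assoc]
      congr 1
      rw [pow_add, pow_mul, mul_comm]

/-- The coefficients are longer than a digit and overlap when recombined; each doubling of the block
adds the length of the shift and a single carry bit. -/
theorem pack_lt {d K : ℕ} {h : ℕ → ℕ} {l n : ℕ} (hh : ∀ u < n * 2 ^ l, h u < 2 ^ (K + 1)) (i u : ℕ)
    (hi : i ≤ l) (hu : u < n * 2 ^ (l - i)) :
    pack d h i u < 2 ^ (K + 1 + i + d * 2 ^ i) := by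
  induction i generalizing u with
  | zero => exact (hh u (by simpa using hu)).trans_le (Nat.pow_le_pow_right (by norm_num) (by omega))
  | succ i ih =>
    have e : n * 2 ^ (l - i) = 2 * (n * 2 ^ (l - (i + 1))) := by
      rw [show l - i = l - (i + 1) + 1 by omega, pow_succ]; ring
    have h1 := ih (2 * u) (by omega) (by omega)
    have h2 := ih (2 * u + 1) (by omega) (by omega)
    have h3 : 2 ^ (K + 1 + i + d * 2 ^ i) ≤ 2 ^ (K + 1 + i + d * 2 ^ (i + 1)) := by
      apply Nat.pow_le_pow_right (by norm_num)
      have : d * 2 ^ i ≤ d * 2 ^ (i + 1) :=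
        Nat.mul_le_mul_left _ (Nat.pow_le_pow_right (by norm_num) (by omega))
      omega
    have h4 : 2 ^ (K + 1 + i + d * 2 ^ i) * 2 ^ (d * 2 ^ i) = 2 ^ (K + 1 + i + d * 2 ^ (i + 1)) := by
      rw [← pow_add]; congr 1; ring
    have h5 := Nat.mul_lt_mul_of_pos_right h2 (show 0 < 2 ^ (d * 2 ^ i) by positivity)
    rw [h4] at h5
    have h6 : 2 ^ (K + 1 + (i + 1) + d * 2 ^ (i + 1)) = 2 * 2 ^ (K + 1 + i + d * 2 ^ (i + 1)) := by
      rw [← pow_succ']; congr 1; ring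
    rw [pack, h6]
    omega

theorem four_le_two_pow {l : ℕ} (hl : 2 ≤ l) : 4 ≤ 2 ^ l :=
  le_trans (by norm_num) (Nat.pow_le_pow_right (n := 2) (by norm_num) hl)

theorem two_pow_pred {l : ℕ} (hl : 1 ≤ l) : 2 ^ l = 2 * 2 ^ (l - 1) := by
  rw [← pow_succ']; congr 1; omega

theorem fft_pre_lt {l j x y t : ℕ} (hl : 2 ≤ l) (hx : x < 2 ^ 2 ^ l) (hy : y < 2 ^ 2 ^ l)
    (ht : t * 2 ^ j ≤ 2 ^ (l - 1)) :
    x + y < 2 ^ (4 * 2 ^ l) ∧ (x + y * 2 ^ 2 ^ (l - 1)) < 2 ^ (4 * 2 ^ l) ∧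
    (x + y * 2 ^ 2 ^ (l - 1)) * 2 ^ (t * 2 ^ j) < 2 ^ (4 * 2 ^ l) := by
  have e := two_pow_pred (l := l) (by omega)
  have h4 := four_le_two_pow hl
  have h1 : x + y * 2 ^ 2 ^ (l - 1) < 2 ^ (2 * 2 ^ l) := by
    refine two_pow_add_lt (a := 2 ^ l) (b := 2 ^ l + 2 ^ (l - 1)) ?_ (by omega) (by omega)
    rw [pow_add _ (2 ^ l)]
    have := Nat.mul_lt_mul_of_pos_right hy (show 0 < 2 ^ 2 ^ (l - 1) by positivity)
    omega
  have mono : ∀ a b, a ≤ b → 2 ^ a ≤ 2 ^ b := fun a b => Nat.pow_le_pow_right (by norm_num)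
  refine ⟨?_, h1.trans_le (mono _ _ (by omega)), ?_⟩
  · exact two_pow_add_lt (a := 2 ^ l) (b := 2 ^ l) (by omega) (by omega) (by omega)
  · calc _ < 2 ^ (2 * 2 ^ l) * 2 ^ (t * 2 ^ j) := Nat.mul_lt_mul_of_pos_right h1 (by positivity)
      _ = 2 ^ (2 * 2 ^ l + t * 2 ^ j) := by rw [pow_add]
      _ ≤ _ := mono _ _ (by omega)

theorem fft_lt {l : ℕ} (hl : 2 ≤ l) {v : ℕ → ℕ} (hv : ∀ u, v u < 2 ^ 2 ^ l) (j : ℕ) (hj : j ≤ l)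
    (u : ℕ) : fft l v j u < 2 ^ 2 ^ l := by
  induction j generalizing u with
  | zero => exact hv u
  | succ j ih =>
    apply red_lt (four_le_two_pow hl)
    have ht : u % 2 ^ (l - (j + 1)) * 2 ^ j ≤ 2 ^ (l - 1) := by
      have := mod_mul_two_pow_le (l := l) (i := l - (j + 1)) (by omega) u
      rwa [show l - 1 - (l - (j + 1)) = j by omega] at this
    have := fft_pre_lt hl (ih (by omega) (u / (2 * 2 ^ (l - (j + 1))) * (2 * 2 ^ (l - (j + 1))) +
      u % 2 ^ (l - (j + 1)))) (ih (by omega) (u / (2 * 2 ^ (l - (j + 1))) *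
      (2 * 2 ^ (l - (j + 1))) + u % 2 ^ (l - (j + 1)) + 2 ^ (l - (j + 1)))) ht
    split_ifs
    · exact this.1
    · exact this.2.2

/-- The inputs may have 2L bits: the products of transform values enter the inverse transform
unreduced, and the bound of 4L bits for `red` still holds. -/
theorem ifft_pre_lt {l x y a b : ℕ} (hl : 2 ≤ l) (hx : x < 2 ^ (2 * 2 ^ l))
    (hy : y < 2 ^ (2 * 2 ^ l)) :
    x + y * 2 ^ (2 ^ l - a) < 2 ^ (4 * 2 ^ l) ∧
    x + y * 2 ^ (2 ^ l + 2 ^ (l - 1) - b) < 2 ^ (4 * 2 ^ l) := by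
  have e := two_pow_pred (l := l) (by omega)
  have h4 := four_le_two_pow hl
  have key : ∀ c ≤ 2 ^ l + 2 ^ (l - 1), x + y * 2 ^ c < 2 ^ (4 * 2 ^ l) := by
    intro c hc
    refine two_pow_add_lt (a := 2 * 2 ^ l) (b := 2 * 2 ^ l + c) ?_ (by omega) (by omega)
    rw [pow_add _ (2 * 2 ^ l)]
    have := Nat.mul_lt_mul_of_pos_right hy (show 0 < 2 ^ c by positivity)
    omega
  exact ⟨key _ (by omega), key _ (by omega)⟩

theorem lo_lt {n l i u : ℕ} (hi : i < l) (hu : u < n * 2 ^ l) :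
    u / (2 * 2 ^ i) * (2 * 2 ^ i) + u % 2 ^ i + 2 ^ i < n * 2 ^ l := by
  have e : n * 2 ^ l = n * 2 ^ (l - (i + 1)) * (2 * 2 ^ i) := by
    rw [← pow_succ', mul_assoc, ← pow_add]; congr 2; omega
  rw [e, ← Nat.div_lt_iff_lt_mul (by positivity)] at hu ⊢
  rwa [(lo_facts (show 0 < 2 ^ i by positivity) u).2.2.1]

theorem ifft_lt {l n : ℕ} (hl : 2 ≤ l) {w : ℕ → ℕ} (hw : ∀ u < n * 2 ^ l, w u < 2 ^ (2 * 2 ^ l))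
    (i : ℕ) (hi : i ≤ l) (u : ℕ) (hu : u < n * 2 ^ l) : ifft l w i u < 2 ^ (2 * 2 ^ l) := by
  induction i generalizing u with
  | zero => exact hw u hu
  | succ i ih =>
    have h2 := lo_lt (show i < l by omega) hu
    have h3 := ifft_pre_lt (a := u % 2 ^ i * 2 ^ (l - 1 - i)) (b := u % 2 ^ i * 2 ^ (l - 1 - i)) hl
      (ih (by omega) _ (show u / (2 * 2 ^ i) * (2 * 2 ^ i) + u % 2 ^ i < _ by omega))
      (ih (by omega) _ h2)
    have : ifft l w (i + 1) u < 2 ^ 2 ^ l := by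
      apply red_lt (four_le_two_pow hl)
      split_ifs
      · exact h3.1
      · exact h3.2
    exact this.trans_le (Nat.pow_le_pow_right (by norm_num) (by omega))

theorem ifft_last_lt {l n : ℕ} (hl : 2 ≤ l) {w : ℕ → ℕ}
    (hw : ∀ u < n * 2 ^ l, w u < 2 ^ (2 * 2 ^ l)) (u : ℕ) (hu : u < n * 2 ^ l) :
    ifft l w l u < 2 ^ 2 ^ l := by
  obtain ⟨i, rfl⟩ : ∃ i, l = i + 1 := ⟨l - 1, by omega⟩
  have h2 := lo_lt (show i < i + 1 by omega) hu
  have h3 := ifft_pre_lt (a := u % 2 ^ i * 2 ^ (i + 1 - 1 - i))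
    (b := u % 2 ^ i * 2 ^ (i + 1 - 1 - i)) hl
    (ifft_lt hl hw i (by omega) _ (show u / (2 * 2 ^ i) * (2 * 2 ^ i) + u % 2 ^ i < _ by omega))
    (ifft_lt hl hw i (by omega) _ h2)
  apply red_lt (four_le_two_pow hl)
  split_ifs
  · exact h3.1
  · exact h3.2

theorem unscale_pre_lt {l z : ℕ} (hz : z < 2 ^ 2 ^ l) :
    z * 2 ^ (2 ^ l - l) < 2 ^ (4 * 2 ^ l) := by
  calc _ < 2 ^ 2 ^ l * 2 ^ (2 ^ l - l) := Nat.mul_lt_mul_of_pos_right hz (by positivity)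
    _ = 2 ^ (2 ^ l + (2 ^ l - l)) := by rw [pow_add]
    _ ≤ _ := Nat.pow_le_pow_right (by norm_num) (by omega)

/-- Multiplying by 2^(L-l) divides by 2^l, since 2^L = 1. Writing the result as r₁ 2^K + r₀ with 2^K
= -1 gives the residue r₀ - r₁; adding M = 2^K + 1 makes it positive and below 2M, so one
conditional subtraction of M reaches the least residue. -/
theorem unscale_spec {l z : ℕ} (hl : 2 ≤ l) (hz : z < 2 ^ 2 ^ l) :
    unscale l z < 2 ^ 2 ^ (l - 1) + 1 ∧
    ((unscale l z : ℕ) : ZMod (2 ^ 2 ^ (l - 1) + 1)) * 2 ^ l = z := by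
  have e := two_pow_pred (l := l) (by omega)
  have hr := red_lt (four_le_two_pow hl) (unscale_pre_lt hz)
  set M := 2 ^ 2 ^ (l - 1) + 1 with hM
  have hK : (2 : ZMod M) ^ 2 ^ (l - 1) = -1 := by
    have : ((2 ^ 2 ^ (l - 1) + 1 : ℕ) : ZMod M) = 0 := ZMod.natCast_self M
    push_cast at this
    linear_combination this
  have hL : (2 : ZMod M) ^ 2 ^ l = 1 := by rw [e, mul_comm, pow_mul, hK]; norm_num
  have hcast := cast_red hL (z * 2 ^ (2 ^ l - l))
  unfold unscale
  simp only
  set r := red (2 ^ l) (z * 2 ^ (2 ^ l - l))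
  have hsq : 2 ^ 2 ^ l = 2 ^ 2 ^ (l - 1) * 2 ^ 2 ^ (l - 1) := by rw [← pow_add]; congr 1; omega
  rw [sub_div_mul]
  have h1 : r / 2 ^ 2 ^ (l - 1) < 2 ^ 2 ^ (l - 1) := by
    rw [Nat.div_lt_iff_lt_mul (by positivity)]; omega
  have h0 : r % 2 ^ 2 ^ (l - 1) < 2 ^ 2 ^ (l - 1) := Nat.mod_lt _ (by positivity)
  have hdm := Nat.div_add_mod r (2 ^ 2 ^ (l - 1))
  set y := r % 2 ^ 2 ^ (l - 1) + M - r / 2 ^ 2 ^ (l - 1) with hy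
  have hycast : (y : ZMod M) = r := by
    have h2 : y + r / 2 ^ 2 ^ (l - 1) = r % 2 ^ 2 ^ (l - 1) + M := by omega
    have h3 := congrArg (Nat.cast : ℕ → ZMod M) h2
    have h4 := congrArg (Nat.cast : ℕ → ZMod M) hdm
    push_cast at h3 h4
    rw [hK] at h4
    rw [ZMod.natCast_self] at h3
    linear_combination h3 + h4
  have hfin : (r : ZMod M) * 2 ^ l = z := by
    rw [hcast]
    push_cast
    rw [mul_assoc, ← pow_add, Nat.sub_add_cancel Nat.lt_two_pow_self.le, hL, mul_one]
  split_ifs with hlt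
  · exact ⟨hlt, by rw [hycast, hfin]⟩
  · have hyM : y < M + M :=
      lt_of_le_of_lt (Nat.sub_le _ _) (Nat.add_lt_add_right (h0.trans (Nat.lt_succ_self _)) M)
    have hle : M ≤ y := not_lt.mp hlt
    refine ⟨(tsub_lt_iff_right hle).2 hyM, ?_⟩
    rw [Nat.cast_sub hle, ZMod.natCast_self, sub_zero, hycast, hfin]

/-! ### One level of the recursion -/

/-- Logarithm of the transform length for factors of `2 ^ (f + 5)` bits. -/
def lev (f : ℕ) : ℕ := f / 2 + 5

/-- Number of bits of the digits for factors of `2 ^ (f + 5)` bits. -/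
def dig (f : ℕ) : ℕ := 2 ^ (f - f / 2 + 1)

/-- The factors on the next level of the recursion. -/
def down (f : ℕ) (Z : ℕ → ℕ) : ℕ → ℕ :=
  fft (lev f) (split (dig f) (lev f) Z (lev f)) (lev f)

/-- The products on this level, from the products on the next level. -/
def up (f : ℕ) (W : ℕ → ℕ) : ℕ → ℕ :=
  pack (dig f) (fun u => unscale (lev f) (ifft (lev f) W (lev f) u)) (lev f)

/-- The digits cover twice the length of a factor. The upper half of them is zero, so that the
cyclic convolution computed by the transform is the ordinary one. -/
theorem dig_mul (f : ℕ) : dig f * 2 ^ lev f = 2 * 2 ^ (f + 5) := by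
  rw [dig, lev, ← pow_add, ← pow_succ']; congr 1; omega

theorem two_le_lev (f : ℕ) : 2 ≤ lev f := by unfold lev; omega

/-- This is the condition of `conv_lt` with K = 2^(l-1). Both summands are at most K / 2 =
2^(f/2+3): the exponent of 2 * dig f is f - f/2 + 2 ≤ f/2 + 3, and f/2 + 5 ≤ 2^(f/2+3). -/
theorem lev_add_two_mul_dig_le (f : ℕ) : lev f + 2 * dig f ≤ 2 ^ (lev f - 1) := by
  have h1 : 2 ^ (lev f - 1) = 2 * 2 ^ (f / 2 + 3) := by
    rw [lev, ← pow_succ']; congr 1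
  have h2 : 2 * dig f ≤ 2 ^ (f / 2 + 3) := by
    rw [dig, ← pow_succ']
    exact Nat.pow_le_pow_right (by norm_num) (by omega)
  have h3 : f / 2 + 5 ≤ 2 ^ (f / 2 + 3) := by
    generalize f / 2 = x
    induction x with
    | zero => norm_num
    | succ n ih => rw [show n + 1 + 3 = (n + 3) + 1 by ring, pow_succ]; omega
  unfold lev at *
  omega

theorem lt_dig_mul {f : ℕ} {Z : ℕ → ℕ} (hZ : ∀ u, Z u < 2 ^ 2 ^ (f + 5)) (u : ℕ) :
    Z u < 2 ^ (dig f * 2 ^ lev f) :=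
  (hZ u).trans_le (Nat.pow_le_pow_right (by norm_num) (by rw [dig_mul]; omega))

theorem leaf_lt {f : ℕ} {Z : ℕ → ℕ} (hZ : ∀ u, Z u < 2 ^ 2 ^ (f + 5)) (u : ℕ) :
    split (dig f) (lev f) Z (lev f) u < 2 ^ 2 ^ lev f := by
  have h := split_lt (lt_dig_mul hZ) _ le_rfl u
  have h2 := lev_add_two_mul_dig_le f
  have h3 := two_pow_pred (l := lev f) (by have := two_le_lev f; omega)
  refine h.trans_le (Nat.pow_le_pow_right (by norm_num) ?_)
  simp only [Nat.sub_self, pow_zero, mul_one]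
  omega

theorem down_lt {f : ℕ} {Z : ℕ → ℕ} (hZ : ∀ u, Z u < 2 ^ 2 ^ (f + 5)) (u : ℕ) :
    down f Z u < 2 ^ 2 ^ lev f :=
  fft_lt (two_le_lev f) (leaf_lt hZ) _ le_rfl u

/-- Transform values of the two digit polynomials multiply to the values of the product polynomial.
The inverse transform therefore returns its coefficients modulo M = 2^K + 1, up to the factor 2^l
that `unscale` removes. The true coefficients are below M, so the least residues equal them, and
evaluation at 2^d restores the product of the integers. -/
theorem up_correct {f n : ℕ} {Z W : ℕ → ℕ} (hZ : ∀ u, Z u < 2 ^ 2 ^ (f + 5))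
    (hW : ∀ u < n * 2 ^ lev f, W u = down f Z u * down f Z (u + n * 2 ^ lev f)) (u : ℕ)
    (hu : u < n) : up f W u = Z u * Z (u + n) := by
  have hl := two_le_lev f
  have hlK := lev_add_two_mul_dig_le f
  have hdm := dig_mul f
  have hsplit := split_eq (lt_dig_mul hZ) (lev f) le_rfl
  have hdown : ∀ u, down f Z u = fft (lev f) (split (dig f) (lev f) Z (lev f)) (lev f) u :=
    fun _ => rfl
  have hWlt : ∀ u < n * 2 ^ lev f, W u < 2 ^ (2 * 2 ^ lev f) := by
    intro u hu
    rw [hW u hu, two_mul, pow_add]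
    exact Nat.mul_lt_mul'' (down_lt hZ _) (down_lt hZ _)
  unfold up
  simp only [Nat.sub_self, pow_zero, mul_one] at hsplit
  generalize dig f = d at *
  generalize lev f = l at *
  set v := split d l Z l with hv
  have hvlt : ∀ u, v u < 2 ^ d := fun u => by
    rw [hsplit]; exact Nat.mod_lt _ (by positivity)
  have hL := two_pow_pred (l := l) (by omega)
  -- The digits in the upper half of each block vanish, as the block has room for twice the bits of
  -- `Z q`.
  have hvz : ∀ q i, i < 2 ^ l → 2 ^ (l - 1) ≤ i → v (q * 2 ^ l + i) = 0 := by
    intro q i hi hi'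
    rw [hsplit, Nat.add_comm, Nat.add_mul_div_right _ _ (by positivity), Nat.div_eq_of_lt hi,
      zero_add, Nat.add_mul_mod_self_right, Nat.mod_eq_of_lt hi, Nat.div_eq_of_lt, Nat.zero_mod]
    refine (hZ q).trans_le (Nat.pow_le_pow_right (by norm_num) ?_)
    have : d * 2 ^ (l - 1) ≤ d * i := Nat.mul_le_mul_left _ hi'
    have : d * 2 ^ l = 2 * (d * 2 ^ (l - 1)) := by rw [hL]; ring
    omega
  -- The digits of one number, cut off at the end of its block, since `conv` and `sum_conv` speak of
  -- sequences on all of ℕ.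
  let a : ℕ → ℕ → ℕ := fun q i => if i < 2 ^ l then v (q * 2 ^ l + i) else 0
  have ha0 : ∀ q i, 2 ^ (l - 1) ≤ i → a q i = 0 := by
    intro q i hi
    simp only [a]
    split_ifs with h
    · exact hvz q i h hi
    · rfl
  have halt : ∀ q i, a q i < 2 ^ d := by
    intro q i
    simp only [a]
    split_ifs
    · exact hvlt _
    · positivity
  have hav : ∀ (R : Type) [CommSemiring R] (q : ℕ) (x : R),
      ∑ k ∈ Finset.range (2 ^ l), (a q k : R) * x ^ k =
        ∑ k ∈ Finset.range (2 ^ l), (v (q * 2 ^ l + k) : R) * x ^ k := by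
    intro R _ q x
    refine Finset.sum_congr rfl fun k hk => ?_
    simp only [a, if_pos (Finset.mem_range.mp hk)]
  let h : ℕ → ℕ := fun u => conv (a (u / 2 ^ l)) (a (u / 2 ^ l + n)) (u % 2 ^ l)
  set M := 2 ^ 2 ^ (l - 1) + 1 with hM
  have hhlt : ∀ u, h u < M := fun u =>
    conv_lt (halt _) (halt _) (Nat.mod_lt _ (by positivity)) hlK
  have hK : (2 : ZMod M) ^ 2 ^ (l - 1) = -1 := by
    have : ((2 ^ 2 ^ (l - 1) + 1 : ℕ) : ZMod M) = 0 := ZMod.natCast_self M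
    push_cast at this
    linear_combination this
  have hblock : ∀ q k, k < 2 ^ l → h (q * 2 ^ l + k) = conv (a q) (a (q + n)) k := by
    intro q k hk
    simp only [h]
    rw [Nat.add_comm, Nat.add_mul_div_right _ _ (by positivity), Nat.div_eq_of_lt hk, zero_add,
      Nat.add_mul_mod_self_right, Nat.mod_eq_of_lt hk]
  have hWcast : ∀ u < n * 2 ^ l, (W u : ZMod M) = ringFft l (fun x => (h x : ZMod M)) l u := by
    intro u hu
    rw [hW u hu, hdown, hdown]
    push_cast
    rw [cast_fft (by omega) hK, cast_fft (by omega) hK, ringFft_last hK, ringFft_last hK,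
      ringFft_last hK, evalExp_periodic, Nat.add_mul_div_right _ _ (by positivity),
      ← hav, ← hav, hL, ← sum_conv (ha0 _) (ha0 _), ← hL]
    refine Finset.sum_congr rfl fun k hk => ?_
    rw [hblock _ _ (Finset.mem_range.mp hk)]
  have hfinal : ∀ u < n * 2 ^ l, unscale l (ifft l W l u) = h u := by
    intro u hu
    obtain ⟨h1, h2⟩ := unscale_spec hl (ifft_last_lt hl hWlt u hu)
    rw [cast_ifft (by omega) hK W _ hWcast l le_rfl u hu] at h2
    simp only [Nat.sub_self, ringFft] at h2
    -- The inverse of 2 is -2^(K-1), because 2^K = -1; hence the factor 2^l can be cancelled.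
    have hunit : IsUnit ((2 : ZMod M) ^ l) := by
      apply IsUnit.pow
      apply IsUnit.of_mul_eq_one (-2 ^ (2 ^ (l - 1) - 1))
      have hpos : 0 < 2 ^ (l - 1) := by positivity
      have : (2 : ZMod M) * 2 ^ (2 ^ (l - 1) - 1) = -1 := by
        rw [← pow_succ', ← hK]; congr 1; omega
      linear_combination -this
    rw [mul_comm] at h2
    have h3 := hunit.mul_left_cancel h2
    rw [ZMod.natCast_eq_natCast_iff'] at h3
    rwa [Nat.mod_eq_of_lt h1, Nat.mod_eq_of_lt (hhlt u)] at h3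
  rw [pack_eq]
  have hsum : ∀ q, ∑ k ∈ Finset.range (2 ^ l), (a q k : ℕ) * (2 ^ d) ^ k = Z q := by
    intro q
    have := hav ℕ q (2 ^ d)
    simp only [Nat.cast_id] at this
    rw [this]
    have h1 : ∀ k ∈ Finset.range (2 ^ l), v (q * 2 ^ l + k) * (2 ^ d) ^ k =
        Z q / 2 ^ (d * k) % 2 ^ d * (2 ^ d) ^ k := by
      intro k hk
      have hk := Finset.mem_range.mp hk
      rw [hsplit, Nat.add_comm, Nat.add_mul_div_right _ _ (by positivity), Nat.div_eq_of_lt hk,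
        zero_add, Nat.add_mul_mod_self_right, Nat.mod_eq_of_lt hk]
    rw [Finset.sum_congr rfl h1, sum_digits, Nat.mod_eq_of_lt]
    exact (hZ q).trans_le (Nat.pow_le_pow_right (by norm_num) (by omega))
  -- The convolution identity over ℕ at the base 2^d: carries are resolved by evaluating the
  -- coefficients there.
  have hcv := sum_conv (R := ℕ) (ha0 u) (ha0 (u + n)) (2 ^ d)
  simp only [Nat.cast_id, ← hL, hsum] at hcv
  rw [← hcv]
  refine Finset.sum_congr rfl fun k hk => ?_
  have hk := Finset.mem_range.mp hk
  rw [hfinal _ ?_, hblock _ _ hk]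
  calc u * 2 ^ l + k < u * 2 ^ l + 2 ^ l := by omega
    _ = (u + 1) * 2 ^ l := by ring
    _ ≤ n * 2 ^ l := Nat.mul_le_mul_right _ hu

attribute [simp] Prog.Ok Prog.den Expr.Ok Expr.lin Op.lin Expr.Small Expr.eval Op.eval
  Frame.setReg_iff Frame.setMem_iff

theorem size_le_of_le {x B W : ℕ} (h : x ≤ B) (hB : B.size ≤ W) : x.size ≤ W :=
  (Nat.size_le_size h).trans hB

theorem size_le_of_lt {x a S : ℕ} (h : x < 2 ^ a) (ha : a ≤ S) : x.size ≤ S :=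
  (Nat.size_le.mpr h).trans ha

theorem size_two_le {W : ℕ} (hW : 2 ≤ W) : Nat.size 2 ≤ W :=
  (Nat.size_le.mpr (by norm_num : 2 < 2 ^ 2)).trans hW

/-! ### Inner loops of the multiplication program -/

/-- Halve the blocks of one level of the digit tree. -/
def Prog.splitStep : Prog := .fill 70 64 (
  71 ::= .read (.var 54 +ₑ (.var 64 +ₑ .var 70) >>ₑ .lit 1) ;;
  72 ::= .var 71 >>ₑ .var 61 ;;
  .ite (.var 70 %ₑ .lit 2) (73 ::= .var 72) (73 ::= .var 71 -ₑ .var 72 <<ₑ .var 61) ;;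
  .store (.var 54 +ₑ .var 64 +ₑ .var 70) (.var 73))

theorem fill_cost_le {n S T c : ℕ} (hn : 1 ≤ n) (hT : T ≤ c * S) :
    n * (T + 74 * S) + 39 * S ≤ n * ((c + 113) * S) := by
  have h1 : 39 * S ≤ n * (39 * S) := Nat.le_mul_of_pos_left _ hn
  have h2 : n * (T + 74 * S) ≤ n * (c * S + 74 * S) := Nat.mul_le_mul_left _ (by omega)
  calc _ ≤ n * (c * S + 74 * S) + n * (39 * S) := by omega
    _ = _ := by ring

/-- The digit tree lies in heap order relative to the base `D`: the halves of the number at offset x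
go to the offsets 2x and 2x + 1. So the cell at offset 2n + k is computed from the one at (2n + k) /
2 = n + k / 2. -/
theorem Prog.splitStep_run {σ : State} {D n s W S B : ℕ} {P : ℕ → ℕ} (hW : 2 ≤ W)
    (hWS : W ^ 2 ≤ S) (h54 : σ.reg 54 = D) (h64 : σ.reg 64 = 2 * n) (h61 : σ.reg 61 = s)
    (hB : B.size ≤ W) (hDB : D + 4 * n ≤ B) (hn : 1 ≤ n) (hs : 2 * s ≤ S)
    (hP : ∀ u < n, σ.mem (D + n + u) = P u) (hPs : ∀ u < n, P u < 2 ^ (2 * s)) :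
    Run .splitStep σ (2 * n * (2000 * S)) (fun σ' => Frame 70 σ σ' ∧
      σ'.mem = fillMem σ.mem (D + 2 * n) (2 * n) (fun u =>
        if u % 2 = 0 then P (u / 2) - P (u / 2) / 2 ^ s * 2 ^ s else P (u / 2) / 2 ^ s)) := by
  have hWS' : W ≤ S := le_trans (by nlinarith) hWS
  have sB : ∀ x, x ≤ B → x.size ≤ W := fun x hx => size_le_of_le hx hB
  have sS : ∀ x, x ≤ B → x.size ≤ S := fun x hx => (sB x hx).trans hWS'
  refine (Run.fill (T := 1000 * S) (S := S) (N := 2 * n) _ le_rfl (by norm_num) h64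
    (by omega) (sS _ (by omega)) ?_).mono ((fill_cost_le (by omega) le_rfl).trans
      (Nat.mul_le_mul_left _ (Nat.mul_le_mul_right _ (by norm_num)))) (fun _ h => h)
  intro k σ' hk hf hik hm
  have r54 : σ'.reg 54 = D := (hf.1 54 (by norm_num)).trans h54
  have r64 : σ'.reg 64 = 2 * n := (hf.1 64 (by norm_num)).trans h64
  have r61 : σ'.reg 61 = s := (hf.1 61 (by norm_num)).trans h61
  have hread : σ'.mem (D + (2 * n + k) / 2) = P (k / 2) := by
    rw [hm, fillMem_out (by omega), ← hP _ (by omega)]; congr 1; omega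
  have p0 := hPs (k / 2) (by omega)
  have p1 : (P (k / 2)).size ≤ S := size_le_of_lt p0 hs
  have p2 : (P (k / 2) / 2 ^ s).size ≤ S := size_le_of_le (Nat.div_le_self _ _) p1
  have p3 : (P (k / 2) - P (k / 2) / 2 ^ s * 2 ^ s).size ≤ S := size_le_of_le (Nat.sub_le _ _) p1
  have p4 : s.size ≤ S := size_le_of_lt (a := s) Nat.lt_two_pow_self (by omega)
  refine (Run.of_lf (W := W) (S := S) (by omega) hWS rfl ?_ ?_).mono (T := _ * S)
    (Nat.mul_le_mul_right _ ?_) (fun _ h => h)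
  · have q1 : 1 ≤ S := by omega
    by_cases hpar : k % 2 = 0 <;>
    simp (disch := omega) [r54, r64, r61, hik, hread, p1, p2, p3, p4, q1, hpar, size_two_le hW, sB,
      sS, show s ≤ S by omega]
  · by_cases hpar : k % 2 = 0 <;>
    simp [r54, r64, r61, hik, hread, hpar, hf]
  · simp [Prog.wt, Expr.nodes]

/-- Reduction of register 76 modulo `2 ^ L - 1`, where `L` is in register 55. -/
def Prog.foldProg : Prog :=
  77 ::= .var 76 >>ₑ .var 55 ;; 76 ::= .var 76 -ₑ .var 77 <<ₑ .var 55 +ₑ .var 77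

/-- Iterated reduction of register 76. -/
def Prog.redProg : Prog := foldProg ;; foldProg ;; foldProg ;; foldProg ;; foldProg

theorem foldStep_le (L a : ℕ) : foldStep L a ≤ a := by
  rw [foldStep_eq]
  have h1 := Nat.div_add_mod a (2 ^ L)
  have h2 : a / 2 ^ L ≤ 2 ^ L * (a / 2 ^ L) := Nat.le_mul_of_pos_left _ (by positivity)
  omega

theorem red_le (L a : ℕ) : red L a ≤ a := by
  have h := foldStep_le L
  exact (h _).trans ((h _).trans ((h _).trans ((h _).trans (h _))))

theorem Prog.foldProg_run {σ : State} {L a W S : ℕ} (hW : 2 ≤ W) (hWS : W ^ 2 ≤ S)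
    (h55 : σ.reg 55 = L) (h76 : σ.reg 76 = a) (hL : L ≤ S) (ha : a.size ≤ S) :
    Run foldProg σ (300 * S) (fun σ' => ∃ x, σ' = (σ.setReg 77 x).setReg 76 (foldStep L a)) := by
  have p2 : (a / 2 ^ L).size ≤ S := size_le_of_le (Nat.div_le_self _ _) ha
  have p4 : L.size ≤ S := size_le_of_lt (a := L) Nat.lt_two_pow_self hL
  refine (Run.of_lf (W := W) (S := S) (by omega) hWS rfl ?_ ?_).mono (T := _ * S)
    (Nat.mul_le_mul_right _ ?_) (fun _ h => h)
  · simp [foldProg, h55, h76, ha, p2, p4, hL]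
  · simp only [foldProg, Prog.den, Expr.eval, Op.eval, h55, h76, State.setReg_reg]
    exact ⟨a / 2 ^ L, by simp [foldStep, h55, h76]⟩
  · simp [foldProg, Prog.wt, Expr.nodes]

theorem Prog.redProg_run {σ : State} {L a W S : ℕ} (hW : 2 ≤ W) (hWS : W ^ 2 ≤ S)
    (h55 : σ.reg 55 = L) (h76 : σ.reg 76 = a) (hL : L ≤ S) (ha : a.size ≤ S) :
    Run redProg σ (1500 * S) (fun σ' => ∃ x, σ' = (σ.setReg 77 x).setReg 76 (red L a)) := by
  have step : ∀ b y, b.size ≤ S → Run foldProg ((σ.setReg 77 y).setReg 76 b) (300 * S)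
      (fun σ' => ∃ x, σ' = (σ.setReg 77 x).setReg 76 (foldStep L b)) := by
    intro b y hb
    refine (foldProg_run (L := L) (a := b) hW hWS (by simpa using h55) (by simp) hL hb).mono le_rfl ?_
    rintro σ' ⟨x, rfl⟩
    refine ⟨x, ?_⟩
    simp only [State.setReg, State.mk.injEq, and_true]
    funext r
    simp only [Function.update_apply]
    split_ifs <;> rfl
  have le1 : ∀ b, b.size ≤ S → (foldStep L b).size ≤ S := fun b hb =>
    size_le_of_le (foldStep_le L b) hb
  have h1 := le1 _ ha
  have h2 := le1 _ h1
  have h3 := le1 _ h2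
  refine (Run.seq (foldProg_run hW hWS h55 h76 hL ha) ?_).mono
    (T := 300 * S + (300 * S + (300 * S + (300 * S + 300 * S)))) (by omega) (fun _ h => h)
  rintro _ ⟨x, rfl⟩
  refine Run.seq (step _ x h1) ?_
  rintro _ ⟨x, rfl⟩
  refine Run.seq (step _ x h2) ?_
  rintro _ ⟨x, rfl⟩
  refine Run.seq (step _ x h3) ?_
  rintro _ ⟨x, rfl⟩
  exact step _ x (le1 _ h3)

/-- One level of the Fourier transform. -/
def Prog.fftStep : Prog := .fill 70 53 ((
  71 ::= .var 70 %ₑ .var 61 ;;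
  72 ::= .var 62 +ₑ (.var 70 /ₑ (.lit 2 *ₑ .var 61) *ₑ (.lit 2 *ₑ .var 61) +ₑ .var 71) ;;
  73 ::= .read (.var 72) ;;
  74 ::= .read (.var 72 +ₑ .var 61) ;;
  75 ::= .var 70 /ₑ .var 61 %ₑ .lit 2 ;;
  .ite (.var 75) (76 ::= .var 73 +ₑ .var 74 <<ₑ .var 56 ;; 76 ::= .var 76 <<ₑ (.var 71 <<ₑ .var 60))
    (76 ::= .var 73 +ₑ .var 74)) ;;
  redProg ;;
  .store (.var 63 +ₑ .var 70) (.var 76))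

/-- One level of the inverse Fourier transform. -/
def Prog.ifftStep : Prog := .fill 70 59 ((
  71 ::= .var 70 %ₑ .var 61 ;;
  72 ::= .var 62 +ₑ (.var 70 /ₑ (.lit 2 *ₑ .var 61) *ₑ (.lit 2 *ₑ .var 61) +ₑ .var 71) ;;
  73 ::= .read (.var 72) ;;
  74 ::= .read (.var 72 +ₑ .var 61) ;;
  75 ::= .var 70 /ₑ .var 61 %ₑ .lit 2 ;;
  78 ::= .var 71 <<ₑ .var 66 ;;
  .ite (.var 75) (76 ::= .var 73 +ₑ .var 74 <<ₑ (.var 55 +ₑ .var 56 -ₑ .var 78))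
    (76 ::= .var 73 +ₑ .var 74 <<ₑ (.var 55 -ₑ .var 78))) ;;
  redProg ;;
  .store (.var 63 +ₑ .var 70) (.var 76))

/-- Normalise the coefficients. -/
def Prog.unscaleStep : Prog := .fill 70 59 (
  76 ::= .read (.var 62 +ₑ .var 70) <<ₑ (.var 55 -ₑ .var 51) ;;
  redProg ;;
  77 ::= .var 76 >>ₑ .var 56 ;;
  78 ::= .lit 1 <<ₑ .var 56 +ₑ .lit 1 ;;
  79 ::= .var 76 -ₑ .var 77 <<ₑ .var 56 +ₑ .var 78 -ₑ .var 77 ;;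
  .ite (.var 79 <ₑ .var 78) .skip (79 ::= .var 79 -ₑ .var 78) ;;
  .store (.var 62 +ₑ .var 70) (.var 79))

/-- Recombine pairs of neighbouring blocks. -/
def Prog.packStep : Prog := .fill 70 64 (
  .store (.var 63 +ₑ .var 70) (.read (.var 62 +ₑ .var 70 <<ₑ .lit 1) +ₑ
    .read (.var 62 +ₑ .var 70 <<ₑ .lit 1 +ₑ .lit 1) <<ₑ .var 61))

/-- Source and destination are disjoint blocks, so both inputs of a butterfly are still intact when
read. The budget of 4 * 2^l bits is the size of an unreduced butterfly; the twiddle factor is a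
shift and costs no more. -/
theorem Prog.fftStep_run {σ : State} {src dst N n j l W S B : ℕ} {P : ℕ → ℕ} (hW : 2 ≤ W)
    (hWS : W ^ 2 ≤ S) (h51 : 2 ≤ l) (h53 : σ.reg 53 = n) (h55 : σ.reg 55 = 2 ^ l)
    (h56 : σ.reg 56 = 2 ^ (l - 1)) (h60 : σ.reg 60 = j) (h61 : σ.reg 61 = 2 ^ (l - (j + 1)))
    (h62 : σ.reg 62 = src) (h63 : σ.reg 63 = dst) (hj : j < l) (hnN : n = N * 2 ^ l) (hN : 1 ≤ N)
    (hdst : dst = src + n) (hB : B.size ≤ W) (hDB : dst + n ≤ B) (hS : 4 * 2 ^ l ≤ S)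
    (hP : ∀ u < n, σ.mem (src + u) = P u) (hPs : ∀ u < n, P u < 2 ^ 2 ^ l) :
    Run .fftStep σ (n * (7000 * S)) (fun σ' => Frame 70 σ σ' ∧
      σ'.mem = fillMem σ.mem dst n (fun u =>
        red (2 ^ l) (if u / 2 ^ (l - (j + 1)) % 2 = 0 then
          P (u / (2 * 2 ^ (l - (j + 1))) * (2 * 2 ^ (l - (j + 1))) + u % 2 ^ (l - (j + 1))) +
          P (u / (2 * 2 ^ (l - (j + 1))) * (2 * 2 ^ (l - (j + 1))) + u % 2 ^ (l - (j + 1)) +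
            2 ^ (l - (j + 1)))
        else (P (u / (2 * 2 ^ (l - (j + 1))) * (2 * 2 ^ (l - (j + 1))) + u % 2 ^ (l - (j + 1))) +
          P (u / (2 * 2 ^ (l - (j + 1))) * (2 * 2 ^ (l - (j + 1))) + u % 2 ^ (l - (j + 1)) +
            2 ^ (l - (j + 1))) * 2 ^ 2 ^ (l - 1)) * 2 ^ (u % 2 ^ (l - (j + 1)) * 2 ^ j)))) := by
  have hWS' : W ≤ S := le_trans (by nlinarith) hWS
  have sB : ∀ x, x ≤ B → x.size ≤ W := fun x hx => size_le_of_le hx hB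
  have sS : ∀ x, x ≤ B → x.size ≤ S := fun x hx => (sB x hx).trans hWS'
  have hLn : 2 ^ l ≤ n := hnN ▸ Nat.le_mul_of_pos_left _ hN
  refine (Run.fill (T := 6000 * S) (S := S) (N := n) _ le_rfl (by norm_num) h53
    (by omega) (sS _ (by omega)) ?_).mono ((fill_cost_le (by have := Nat.one_le_two_pow (n := l); omega) le_rfl).trans
      (Nat.mul_le_mul_left _ (Nat.mul_le_mul_right _ (by norm_num)))) (fun _ h => h)
  intro k σ' hk hf hik hm
  have r55 := (hf.1 55 (by norm_num)).trans h55
  have r56 := (hf.1 56 (by norm_num)).trans h56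
  have r60 := (hf.1 60 (by norm_num)).trans h60
  have r61 := (hf.1 61 (by norm_num)).trans h61
  have r62 := (hf.1 62 (by norm_num)).trans h62
  have r63 := (hf.1 63 (by norm_num)).trans h63
  have hlt := lo_lt (i := l - (j + 1)) (l := l) (n := N) (u := k) (by omega) (hnN ▸ hk)
  have ht : k % 2 ^ (l - (j + 1)) * 2 ^ j ≤ 2 ^ (l - 1) := by
    have := mod_mul_two_pow_le (l := l) (i := l - (j + 1)) (by omega) k
    rwa [show l - 1 - (l - (j + 1)) = j by omega] at this
  have hmL : 2 ^ (l - (j + 1)) ≤ 2 ^ l := Nat.pow_le_pow_right (by norm_num) (by omega)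
  have hKL : 2 ^ (l - 1) ≤ 2 ^ l := Nat.pow_le_pow_right (by norm_num) (by omega)
  rw [← hnN] at hlt
  have hm2 : 2 * 2 ^ (l - (j + 1)) ≤ 2 ^ l := by
    rw [← pow_succ']; exact Nat.pow_le_pow_right (by norm_num) (by omega)
  have hjS : j ≤ 2 ^ l := hj.le.trans Nat.lt_two_pow_self.le
  generalize 2 ^ (l - (j + 1)) = m at *
  have hx : σ'.mem (src + (k / (2 * m) * (2 * m) + k % m)) = P (k / (2 * m) * (2 * m) + k % m) := by
    rw [hm, fillMem_out (by omega), hP _ (by omega)]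
  have hy : σ'.mem (src + (k / (2 * m) * (2 * m) + k % m) + m) =
      P (k / (2 * m) * (2 * m) + k % m + m) := by
    rw [hm, fillMem_out (by omega), Nat.add_assoc, hP _ (by omega)]
  have hpx := hPs _ (show k / (2 * m) * (2 * m) + k % m < n by omega)
  have hpy := hPs _ hlt
  have hpre := fft_pre_lt h51 hpx hpy ht
  have hkm : k % m ≤ k := Nat.mod_le _ _
  have hd1 : k / (2 * m) ≤ k := Nat.div_le_self _ _
  generalize hlo : k / (2 * m) * (2 * m) = lo at *
  generalize P (lo + k % m) = x at *
  generalize P (lo + k % m + m) = y at *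
  set pre := if k / m % 2 = 0 then x + y else (x + y * 2 ^ 2 ^ (l - 1)) * 2 ^ (k % m * 2 ^ j)
    with hpredef
  have hpresz : pre.size ≤ S := by
    refine size_le_of_lt (a := 4 * 2 ^ l) ?_ hS
    rw [hpredef]; split_ifs
    · exact hpre.1
    · exact hpre.2.2
  have hxs : x.size ≤ S := size_le_of_lt hpx (by omega)
  have hys : y.size ≤ S := size_le_of_lt hpy (by omega)
  have hmidS : (x + y * 2 ^ 2 ^ (l - 1)).size ≤ S := size_le_of_lt hpre.2.1 hS
  have hb : k / m % 2 < 2 := Nat.mod_lt _ (by norm_num)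
  have h4 := four_le_two_pow h51
  refine (Run.seq (Run.of_lf (W := W) (S := S) (by omega) hWS rfl ?_
    (Q := fun σ₁ => Frame 70 σ σ₁ ∧ σ₁.reg 70 = k ∧ σ₁.reg 76 = pre ∧ σ₁.mem = σ'.mem) ?_)
    fun σ₁ h₁ => Run.seq (Prog.redProg_run (L := 2 ^ l) (a := pre) (S := S) hW hWS
      ((h₁.1.1 55 (by norm_num)).trans h55) h₁.2.2.1 (by omega) hpresz) fun σ₂ h₂ =>
      Run.of_lf (W := W) (S := S) (by omega) hWS rfl ?_ ?_).mono ?_ (fun _ h => h)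
  · by_cases hpar : k / m % 2 = 0 <;>
    simp (disch := omega) [r55, r56, r60, r61, r62, r63, hik, hx, hy, hlo, hpar, hxs, hys, hmidS,
      size_two_le hW, sB, sS, show 1 ≤ S by omega, show 2 ^ (l - 1) ≤ S by omega,
      show k % m * 2 ^ j ≤ S by omega, show j ≤ S by omega]
  · by_cases hpar : k / m % 2 = 0 <;>
    simp [r55, r56, r60, r61, r62, r63, hik, hx, hy, hlo, hpar, hf, hpredef]
  · obtain ⟨x', rfl⟩ := h₂
    simp (disch := omega) [h₁, sS, (h₁.1.1 63 (by norm_num)).trans h63,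
      size_le_of_le (red_le _ _) hpresz]
  · obtain ⟨x', rfl⟩ := h₂
    simp [h₁, (h₁.1.1 63 (by norm_num)).trans h63]
  · rw [← add_mul, ← add_mul]
    refine Nat.mul_le_mul_right _ ?_
    simp [Prog.wt, Expr.nodes]

theorem Prog.ifftStep_run {σ : State} {src dst N n i l W S B : ℕ} {P : ℕ → ℕ} (hW : 2 ≤ W)
    (hWS : W ^ 2 ≤ S) (h51 : 2 ≤ l) (h65 : σ.reg 59 = n) (h55 : σ.reg 55 = 2 ^ l)
    (h56 : σ.reg 56 = 2 ^ (l - 1)) (h66 : σ.reg 66 = l - 1 - i) (h61 : σ.reg 61 = 2 ^ i)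
    (h62 : σ.reg 62 = src) (h63 : σ.reg 63 = dst) (hi : i < l) (hnN : n = N * 2 ^ l) (hN : 1 ≤ N)
    (hdst : dst + n ≤ src) (hB : B.size ≤ W) (hDB : src + 2 * n ≤ B) (hS : 4 * 2 ^ l ≤ S)
    (hP : ∀ u < n, σ.mem (src + u) = P u) (hPs : ∀ u < n, P u < 2 ^ (2 * 2 ^ l)) :
    Run .ifftStep σ (n * (7000 * S)) (fun σ' => Frame 70 σ σ' ∧
      σ'.mem = fillMem σ.mem dst n (fun u =>
        red (2 ^ l) (if u / 2 ^ i % 2 = 0 then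
          P (u / (2 * 2 ^ i) * (2 * 2 ^ i) + u % 2 ^ i) +
          P (u / (2 * 2 ^ i) * (2 * 2 ^ i) + u % 2 ^ i + 2 ^ i) *
            2 ^ (2 ^ l - u % 2 ^ i * 2 ^ (l - 1 - i))
        else P (u / (2 * 2 ^ i) * (2 * 2 ^ i) + u % 2 ^ i) +
          P (u / (2 * 2 ^ i) * (2 * 2 ^ i) + u % 2 ^ i + 2 ^ i) *
            2 ^ (2 ^ l + 2 ^ (l - 1) - u % 2 ^ i * 2 ^ (l - 1 - i))))) := by
  have hWS' : W ≤ S := le_trans (by nlinarith) hWS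
  have sB : ∀ x, x ≤ B → x.size ≤ W := fun x hx => size_le_of_le hx hB
  have sS : ∀ x, x ≤ B → x.size ≤ S := fun x hx => (sB x hx).trans hWS'
  have hLn : 2 ^ l ≤ n := hnN ▸ Nat.le_mul_of_pos_left _ hN
  refine (Run.fill (T := 6000 * S) (S := S) (N := n) _ le_rfl (by norm_num) h65
    (by omega) (sS _ (by omega)) ?_).mono ((fill_cost_le (by have := Nat.one_le_two_pow (n := l); omega) le_rfl).trans
      (Nat.mul_le_mul_left _ (Nat.mul_le_mul_right _ (by norm_num)))) (fun _ h => h)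
  intro k σ' hk hf hik hm
  have r55 := (hf.1 55 (by norm_num)).trans h55
  have r56 := (hf.1 56 (by norm_num)).trans h56
  have r66 := (hf.1 66 (by norm_num)).trans h66
  have r61 := (hf.1 61 (by norm_num)).trans h61
  have r62 := (hf.1 62 (by norm_num)).trans h62
  have r63 := (hf.1 63 (by norm_num)).trans h63
  have hlt := lo_lt (l := l) (n := N) (u := k) hi (hnN ▸ hk)
  have ht := mod_mul_two_pow_le hi k
  have hKL : 2 ^ (l - 1) ≤ 2 ^ l := Nat.pow_le_pow_right (by norm_num) (by omega)
  rw [← hnN] at hlt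
  have hm2 : 2 * 2 ^ i ≤ 2 ^ l := by
    rw [← pow_succ']; exact Nat.pow_le_pow_right (by norm_num) (by omega)
  have hjS : l ≤ 2 ^ l := Nat.lt_two_pow_self.le
  generalize 2 ^ i = m at *
  have hx : σ'.mem (src + (k / (2 * m) * (2 * m) + k % m)) = P (k / (2 * m) * (2 * m) + k % m) := by
    rw [hm, fillMem_out (by omega), hP _ (by omega)]
  have hy : σ'.mem (src + (k / (2 * m) * (2 * m) + k % m) + m) =
      P (k / (2 * m) * (2 * m) + k % m + m) := by
    rw [hm, fillMem_out (by omega), Nat.add_assoc, hP _ (by omega)]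
  have hpx := hPs _ (show k / (2 * m) * (2 * m) + k % m < n by omega)
  have hpy := hPs _ hlt
  have hpre := ifft_pre_lt (a := k % m * 2 ^ (l - 1 - i)) (b := k % m * 2 ^ (l - 1 - i)) h51 hpx hpy
  have hkm : k % m ≤ k := Nat.mod_le _ _
  have hd1 : k / (2 * m) ≤ k := Nat.div_le_self _ _
  generalize hlo : k / (2 * m) * (2 * m) = lo at *
  generalize P (lo + k % m) = x at *
  generalize P (lo + k % m + m) = y at *
  set pre := if k / m % 2 = 0 then x + y * 2 ^ (2 ^ l - k % m * 2 ^ (l - 1 - i))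
    else x + y * 2 ^ (2 ^ l + 2 ^ (l - 1) - k % m * 2 ^ (l - 1 - i)) with hpredef
  have hpresz : pre.size ≤ S := by
    refine size_le_of_lt (a := 4 * 2 ^ l) ?_ hS
    rw [hpredef]; split_ifs
    · exact hpre.1
    · exact hpre.2
  have hxs : x.size ≤ S := size_le_of_lt hpx (by omega)
  have hys : y.size ≤ S := size_le_of_lt hpy (by omega)
  have hb : k / m % 2 < 2 := Nat.mod_lt _ (by norm_num)
  have h4 := four_le_two_pow h51
  refine (Run.seq (Run.of_lf (W := W) (S := S) (by omega) hWS rfl ?_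
    (Q := fun σ₁ => Frame 70 σ σ₁ ∧ σ₁.reg 70 = k ∧ σ₁.reg 76 = pre ∧ σ₁.mem = σ'.mem) ?_)
    fun σ₁ h₁ => Run.seq (Prog.redProg_run (L := 2 ^ l) (a := pre) (S := S) hW hWS
      ((h₁.1.1 55 (by norm_num)).trans h55) h₁.2.2.1 (by omega) hpresz) fun σ₂ h₂ =>
      Run.of_lf (W := W) (S := S) (by omega) hWS rfl ?_ ?_).mono ?_ (fun _ h => h)
  · have e1 : 2 ^ l ≤ S + k % m * 2 ^ (l - 1 - i) := by omega
    have e2 : 2 ^ l + 2 ^ (l - 1) ≤ S + k % m * 2 ^ (l - 1 - i) := by omega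
    by_cases hpar : k / m % 2 = 0 <;>
    simp (disch := omega) [r55, r56, r61, r62, r63, r66, hik, hx, hy, hlo, hpar, hxs, hys,
      size_two_le hW, sB, sS, show 1 ≤ S by omega, e1, e2,
      show k % m * 2 ^ (l - 1 - i) ≤ S by omega, show l - 1 - i ≤ S by omega,
      show l ≤ S + i + 1 by omega, show l ≤ S + 1 + i by omega, show l - 1 ≤ S + i by omega]
  · by_cases hpar : k / m % 2 = 0 <;>
    simp [r55, r56, r61, r62, r63, r66, hik, hx, hy, hlo, hpar, hf, hpredef]
  · obtain ⟨x', rfl⟩ := h₂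
    simp (disch := omega) [h₁, sS, (h₁.1.1 63 (by norm_num)).trans h63,
      size_le_of_le (red_le _ _) hpresz]
  · obtain ⟨x', rfl⟩ := h₂
    simp [h₁, (h₁.1.1 63 (by norm_num)).trans h63]
  · rw [← add_mul, ← add_mul]
    refine Nat.mul_le_mul_right _ ?_
    simp [Prog.wt, Expr.nodes]

/-- This runs in place: round `k` reads only cell `b + k`, just before overwriting it. -/
theorem Prog.unscaleStep_run {σ : State} {b n l W S B : ℕ} {P : ℕ → ℕ} (hW : 2 ≤ W)
    (hWS : W ^ 2 ≤ S) (hl : 2 ≤ l) (h65 : σ.reg 59 = n) (h51 : σ.reg 51 = l)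
    (h55 : σ.reg 55 = 2 ^ l)
    (h56 : σ.reg 56 = 2 ^ (l - 1)) (h62 : σ.reg 62 = b) (hn : 2 ^ l ≤ n)
    (hB : B.size ≤ W) (hDB : b + 2 * n ≤ B) (hS : 4 * 2 ^ l ≤ S)
    (hP : ∀ u < n, σ.mem (b + u) = P u) (hPs : ∀ u < n, P u < 2 ^ 2 ^ l) :
    Run .unscaleStep σ (n * (7000 * S)) (fun σ' => Frame 70 σ σ' ∧
      σ'.mem = fillMem σ.mem b n (fun u => unscale l (P u))) := by
  have hWS' : W ≤ S := le_trans (by nlinarith) hWS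
  have sB : ∀ x, x ≤ B → x.size ≤ W := fun x hx => size_le_of_le hx hB
  have sS : ∀ x, x ≤ B → x.size ≤ S := fun x hx => (sB x hx).trans hWS'
  have h4 := four_le_two_pow hl
  refine (Run.fill (T := 6000 * S) (S := S) (N := n) _ le_rfl (by norm_num) h65
    (by omega) (sS _ (by omega)) ?_).mono ((fill_cost_le (by omega) le_rfl).trans
      (Nat.mul_le_mul_left _ (Nat.mul_le_mul_right _ (by norm_num)))) (fun _ h => h)
  intro k σ' hk hf hik hm
  have r55 := (hf.1 55 (by norm_num)).trans h55
  have r56 := (hf.1 56 (by norm_num)).trans h56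
  have r51 := (hf.1 51 (by norm_num)).trans h51
  have r62 := (hf.1 62 (by norm_num)).trans h62
  have hx : σ'.mem (b + k) = P k := by
    rw [hm, fillMem_out (by omega), hP _ (by omega)]
  have hpx := hPs k hk
  have hpre := unscale_pre_lt hpx
  have hlL : l < 2 ^ l := Nat.lt_two_pow_self
  have hKL := two_pow_pred (l := l) (by omega)
  generalize hPk : P k = x at *
  have hpresz : (x * 2 ^ (2 ^ l - l)).size ≤ S := size_le_of_lt hpre hS
  have hxs : x.size ≤ S := size_le_of_lt hpx (by omega)
  have hred : red (2 ^ l) (x * 2 ^ (2 ^ l - l)) < 2 ^ 2 ^ l := red_lt h4 hpre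
  generalize hr : red (2 ^ l) (x * 2 ^ (2 ^ l - l)) = r at *
  have hsq : 2 ^ 2 ^ l = 2 ^ 2 ^ (l - 1) * 2 ^ 2 ^ (l - 1) := by rw [← pow_add]; congr 1; omega
  have hmono : 2 ^ 2 ^ (l - 1) * 4 ≤ 2 ^ S := by
    rw [show 4 = 2 ^ 2 by norm_num, ← pow_add]
    exact Nat.pow_le_pow_right (by norm_num) (by omega)
  have hy : r - r / 2 ^ 2 ^ (l - 1) * 2 ^ 2 ^ (l - 1) < 2 ^ 2 ^ (l - 1) := by
    rw [sub_div_mul]; exact Nat.mod_lt _ (by positivity)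
  have sr : r.size ≤ S := size_le_of_lt hred (by omega)
  have sh : (r / 2 ^ 2 ^ (l - 1)).size ≤ S := size_le_of_le (Nat.div_le_self _ _) sr
  have hpos : 1 ≤ 2 ^ 2 ^ (l - 1) := Nat.one_le_two_pow
  have sM : (2 ^ 2 ^ (l - 1) + 1).size ≤ S := size_le_of_lt (a := S) (by omega) le_rfl
  have sz : ∀ y, y ≤ r - r / 2 ^ 2 ^ (l - 1) * 2 ^ 2 ^ (l - 1) + (2 ^ 2 ^ (l - 1) + 1) →
      y.size ≤ S := fun y hy' => size_le_of_lt (a := S) (by omega) le_rfl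
  refine (Run.seq (Run.of_lf (W := W) (S := S) (by omega) hWS rfl ?_
    (Q := fun σ₁ => Frame 70 σ σ₁ ∧ σ₁.reg 70 = k ∧ σ₁.reg 76 = x * 2 ^ (2 ^ l - l) ∧
      σ₁.mem = σ'.mem) ?_)
    fun σ₁ h₁ => Run.seq (Prog.redProg_run (L := 2 ^ l) (a := x * 2 ^ (2 ^ l - l)) (S := S) hW hWS
      ((h₁.1.1 55 (by norm_num)).trans h55) h₁.2.2.1 (by omega) hpresz) fun σ₂ h₂ =>
      Run.of_lf (W := W) (S := S) (by omega) hWS rfl ?_ ?_).mono ?_ (fun _ h => h)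
  · simp (disch := omega) [r55, r51, r62, hik, hx, hxs, sS, show 2 ^ l ≤ S + l by omega]
  · simp [r55, r51, r62, hik, hx, hf]
  · obtain ⟨x', rfl⟩ := h₂
    have g56 := (h₁.1.1 56 (by norm_num)).trans h56
    have g62 := (h₁.1.1 62 (by norm_num)).trans h62
    by_cases hc : r - r / 2 ^ 2 ^ (l - 1) * 2 ^ 2 ^ (l - 1) + (2 ^ 2 ^ (l - 1) + 1) -
      r / 2 ^ 2 ^ (l - 1) < 2 ^ 2 ^ (l - 1) + 1 <;>
    simp (disch := omega) [h₁, sS, g56, g62, hc, hr, sr, sh, sM, sz,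
      sz _ (Nat.sub_le _ _), sz _ ((Nat.sub_le _ _).trans (Nat.sub_le _ _)), show 1 ≤ S by omega,
      show 2 ^ (l - 1) ≤ S by omega]
  · obtain ⟨x', rfl⟩ := h₂
    have g56 := (h₁.1.1 56 (by norm_num)).trans h56
    have g62 := (h₁.1.1 62 (by norm_num)).trans h62
    by_cases hc : r - r / 2 ^ 2 ^ (l - 1) * 2 ^ 2 ^ (l - 1) + (2 ^ 2 ^ (l - 1) + 1) -
      r / 2 ^ 2 ^ (l - 1) < 2 ^ 2 ^ (l - 1) + 1 <;>
    simp [h₁, g56, g62, hr, hc, unscale, hPk]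
  · rw [← add_mul, ← add_mul]
    refine Nat.mul_le_mul_right _ ?_
    simp [Prog.wt, Expr.nodes]

theorem Prog.packStep_run {σ : State} {dst src n s t W S B : ℕ} {P : ℕ → ℕ} (hW : 2 ≤ W)
    (hWS : W ^ 2 ≤ S) (h64 : σ.reg 64 = n) (h61 : σ.reg 61 = s) (h62 : σ.reg 62 = src)
    (h63 : σ.reg 63 = dst) (hn : 1 ≤ n) (hd : dst + n ≤ src)
    (hB : B.size ≤ W) (hDB : src + 2 * n ≤ B) (hS : t + s ≤ S)
    (hP : ∀ u < 2 * n, σ.mem (src + u) = P u) (hPs : ∀ u < 2 * n, P u < 2 ^ t) :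
    Run .packStep σ (n * (7000 * S)) (fun σ' => Frame 70 σ σ' ∧
      σ'.mem = fillMem σ.mem dst n (fun u => P (2 * u) + P (2 * u + 1) * 2 ^ s)) := by
  have hWS' : W ≤ S := le_trans (by nlinarith) hWS
  have sB : ∀ x, x ≤ B → x.size ≤ W := fun x hx => size_le_of_le hx hB
  have sS : ∀ x, x ≤ B → x.size ≤ S := fun x hx => (sB x hx).trans hWS'
  refine (Run.fill (T := 6000 * S) (S := S) (N := n) _ le_rfl (by norm_num) h64
    (by omega) (sS _ (by omega)) ?_).mono ((fill_cost_le (by omega) le_rfl).trans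
      (Nat.mul_le_mul_left _ (Nat.mul_le_mul_right _ (by norm_num)))) (fun _ h => h)
  intro k σ' hk hf hik hm
  have r61 := (hf.1 61 (by norm_num)).trans h61
  have r62 := (hf.1 62 (by norm_num)).trans h62
  have r63 := (hf.1 63 (by norm_num)).trans h63
  have hx : σ'.mem (src + k * 2) = P (2 * k) := by
    rw [hm, fillMem_out (by omega), mul_comm, hP _ (by omega)]
  have hy : σ'.mem (src + k * 2 + 1) = P (2 * k + 1) := by
    rw [hm, fillMem_out (by omega), mul_comm, add_assoc, hP _ (by omega)]
  have sx : (P (2 * k)).size ≤ S := size_le_of_lt (hPs _ (by omega)) (by omega)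
  have sy : (P (2 * k + 1)).size ≤ S := size_le_of_lt (hPs _ (by omega)) (by omega)
  have ss : s.size ≤ S := size_le_of_lt (a := s) Nat.lt_two_pow_self (by omega)
  refine (Run.of_lf (W := W) (S := S) (by omega) hWS rfl ?_ ?_).mono (T := _ * S)
    (Nat.mul_le_mul_right _ ?_) (fun _ h => h)
  · simp (disch := omega) [r61, r62, r63, hik, hx, hy, sx, sy, sS, ss, show 1 ≤ S by omega,
      show s ≤ S by omega]
  · simp [r61, r62, r63, hik, hx, hy, hf]
  · simp [Prog.wt, Expr.nodes]

/-! ### The loops over the levels of one transform -/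

/-- Split the numbers at the roots into digits. -/
def Prog.splitLoop : Prog := 60 ::= .lit 0 ;; .loop 60 51 ((
  61 ::= .var 57 <<ₑ (.var 51 -ₑ (.var 60 +ₑ .lit 1)) ;;
  64 ::= .var 52 <<ₑ (.var 60 +ₑ .lit 1)) ;; splitStep)

/-- Transform the digits. -/
def Prog.fftLoop : Prog := 60 ::= .lit 0 ;; .loop 60 51 ((
  61 ::= .lit 1 <<ₑ (.var 51 -ₑ (.var 60 +ₑ .lit 1)) ;;
  62 ::= .var 54 +ₑ .var 53 +ₑ .var 60 *ₑ .var 53 ;;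
  63 ::= .var 62 +ₑ .var 53) ;; fftStep)

/-- Transform back. -/
def Prog.ifftLoop : Prog := 60 ::= .lit 0 ;; .loop 60 51 ((
  61 ::= .lit 1 <<ₑ .var 60 ;;
  66 ::= .var 51 -ₑ .lit 1 -ₑ .var 60 ;;
  63 ::= .var 54 +ₑ .var 53 +ₑ .var 66 *ₑ .var 53 ;;
  62 ::= .var 63 +ₑ .var 53) ;; ifftStep)

/-- Recombine the coefficients. -/
def Prog.packLoop : Prog := 60 ::= .lit 0 ;; .loop 60 51 ((
  61 ::= .var 57 <<ₑ .var 60 ;;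
  64 ::= .var 59 >>ₑ (.var 60 +ₑ .lit 1) ;;
  63 ::= .var 54 +ₑ .var 53 >>ₑ (.var 60 +ₑ .lit 1) ;;
  62 ::= .var 54 +ₑ .var 53 >>ₑ .var 60) ;; packStep)

/-- A counting loop from zero whose body starts with a loop-free part, in the form used for the
levels of the transforms. -/
theorem Run.levelLoop {p q : Prog} {σ₀ : State} {l W S T : ℕ} (J : ℕ → (ℕ → ℕ) → Prop)
    (hW : 2 ≤ W) (h51 : σ₀.reg 51 = l) (hl : l.size ≤ W) (hS : W ^ 2 ≤ S)
    (h0 : J 0 σ₀.mem) (hlf : p.lf = true) (hwt : p.wt ≤ 5000)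
    (hp : ∀ j σ, j < l → Frame 60 σ₀ σ → σ.reg 60 = j → J j σ.mem →
      p.Ok W S σ ∧ Run q (p.den σ) T (fun σ' => Frame 60 σ₀ σ' ∧ σ'.reg 60 = j ∧
        J (j + 1) σ'.mem)) :
    Run (60 ::= .lit 0 ;; .loop 60 51 (p ;; q)) σ₀ (l * (T + 5074 * S) + 39 * S)
      (fun σ' => Frame 60 σ₀ σ' ∧ J l σ'.mem) := by
  have hWS' : W ≤ S := le_trans (by nlinarith) hS
  have h1 : Run (60 ::= .lit 0) σ₀ 2 (fun σ' => σ' = σ₀.setReg 60 0) :=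
    ⟨_, _, .set _ _ _, by simp [Expr.cost], rfl⟩
  have h2 : ∀ σ', σ' = σ₀.setReg 60 0 → Run (.loop 60 51 (p ;; q)) σ'
      ((l - 0) * ((5000 * S + T) + 74 * S) + 37 * S)
      (fun σ' => (Frame 60 σ₀ σ' ∧ J l σ'.mem) ∧ σ'.reg 60 = l) := by
    rintro _ rfl
    refine Run.loop (I := fun k σ => (Frame 60 σ₀ σ ∧ J k σ.mem) ∧ σ.reg 60 = k)
      (Nat.zero_le l) (by omega) (hl.trans hWS') ?_ ?_ ?_
    · rintro k σ ⟨⟨h, _⟩, h'⟩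
      exact ⟨h', (h.1 51 (by norm_num)).trans h51⟩
    · exact ⟨⟨(Frame.refl 60 σ₀).setReg le_rfl, h0⟩, by simp⟩
    · rintro k σ - hk ⟨⟨hf, hm⟩, hik⟩
      obtain ⟨h3, h4⟩ := hp k σ hk hf hik hm
      refine Run.seq ((Run.of_lf (by omega) hS hlf h3 (Q := fun σ' => σ' = p.den σ) rfl).mono
        (Nat.mul_le_mul_right _ hwt) fun _ h => h) ?_
      rintro _ rfl
      refine h4.mono le_rfl ?_
      rintro σ' ⟨hf', hi', hm'⟩
      exact ⟨hi', ⟨hf'.setReg le_rfl, hm'⟩, by simp⟩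
  refine (Run.seq h1 h2).mono ?_ (fun _ h => h.1)
  simp only [Nat.sub_zero]
  have : l * (5000 * S + T + 74 * S) = l * (T + 5074 * S) := by ring
  omega

/-- On every level the number of pieces times their length is c * d * 2^l bits, and d ≤ 2^l; so all
l levels have the same cost bound. -/
theorem splitLoop_run {σ : State} {D c l d W B : ℕ} {Z : ℕ → ℕ} (hW : 2 ≤ W)
    (h51 : σ.reg 51 = l) (h52 : σ.reg 52 = c) (h54 : σ.reg 54 = D) (h57 : σ.reg 57 = d)
    (hl : 1 ≤ l) (hc : 1 ≤ c) (hd : 1 ≤ d) (hdl : d ≤ 2 ^ l)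
    (hB : B.size ≤ W) (hDB : D + 2 * (c * 2 ^ l) ≤ B)
    (hZ : ∀ u < c, σ.mem (D + c + u) = Z u) (hZs : ∀ u, Z u < 2 ^ (d * 2 ^ l)) :
    Run .splitLoop σ (l * (60000 * (W ^ 2 * (c * 2 ^ l * 2 ^ l)))) (fun σ' => Frame 60 σ σ' ∧
      (∀ u < c * 2 ^ l, σ'.mem (D + c * 2 ^ l + u) = split d l Z l u) ∧
      ∀ x < D, σ'.mem x = σ.mem x) := by
  have hX : 1 ≤ c * 2 ^ l * 2 ^ l := Nat.mul_pos (Nat.mul_pos hc (by positivity)) (by positivity)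
  have hlL : l < 2 ^ l := Nat.lt_two_pow_self
  have hLc : 2 ^ l ≤ c * 2 ^ l := Nat.le_mul_of_pos_left _ hc
  have sB : ∀ x, x ≤ B → x.size ≤ W := fun x hx => size_le_of_le hx hB
  have hW2 : W ≤ W ^ 2 := by nlinarith
  have sS : ∀ x, x ≤ B → x.size ≤ W ^ 2 := fun x hx => (sB x hx).trans hW2
  have hlW : l ≤ W := by
    have h1 : (2 ^ l).size ≤ W := sB _ (by omega)
    rw [Nat.size_pow] at h1; omega
  refine (Run.levelLoop (W := W) (S := W ^ 2) (T := 4000 * (W ^ 2 * (c * 2 ^ l * 2 ^ l)))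
    (J := fun j m => (∀ u < c * 2 ^ j, m (D + c * 2 ^ j + u) = split d l Z j u) ∧
      ∀ x < D, m x = σ.mem x) hW h51 (sB _ (by omega)) le_rfl ?_ rfl
      (by simp [Prog.wt, Expr.nodes]) ?_).mono ?_ (fun _ h => h)
  · simpa [split] using hZ
  · rintro j σ' hj hf hik ⟨hm1, hm2⟩
    have r51 := (hf.1 51 (by norm_num)).trans h51
    have r52 := (hf.1 52 (by norm_num)).trans h52
    have r54 := (hf.1 54 (by norm_num)).trans h54
    have r57 := (hf.1 57 (by norm_num)).trans h57
    have hcj : c * 2 ^ (j + 1) ≤ c * 2 ^ l :=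
      Nat.mul_le_mul_left _ (Nat.pow_le_pow_right (by norm_num) hj)
    have hcj1 : c * 2 ^ (j + 1) = 2 * (c * 2 ^ j) := by ring
    have hcj0 : 1 ≤ c * 2 ^ j := Nat.mul_pos hc (by positivity)
    have hc1 : c ≤ c * 2 ^ l := Nat.le_mul_of_pos_right _ (by positivity)
    have hs1 : 1 ≤ d * 2 ^ (l - (j + 1)) := Nat.mul_pos hd (by positivity)
    refine ⟨?_, ?_⟩
    · simp (disch := omega) [r51, r52, r57, hik, sS, show 1 ≤ W ^ 2 by omega,
        show l ≤ W ^ 2 + (j + 1) by omega, show j + 1 ≤ W ^ 2 by omega]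
    · refine (Prog.splitStep_run (D := D) (n := c * 2 ^ j) (s := d * 2 ^ (l - (j + 1))) (W := W)
        (S := W ^ 2 * (2 * (d * 2 ^ (l - (j + 1))))) (B := B) (P := split d l Z j) hW
        (Nat.le_mul_of_pos_right _ (by omega)) ?_ ?_ ?_ hB (by omega) hcj0
        (Nat.le_mul_of_pos_left _ (by positivity)) ?_ ?_).mono ?_ ?_
      · simp [r54]
      · simp [r52, hik, hcj1]
      · simp [r57, r51, hik]
      · intro u hu; simpa using hm1 u hu
      · intro u hu
        have := split_lt hZs j hj.le u
        rwa [show l - j = l - (j + 1) + 1 by omega, pow_succ, ← mul_assoc, mul_comm _ 2] at this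
      · calc _ = 4000 * (W ^ 2 * (c * d * (2 * (2 ^ j * 2 ^ (l - (j + 1)))))) := by ring
          _ = 4000 * (W ^ 2 * (c * d * 2 ^ l)) := by
            rw [← pow_add, ← pow_succ']; congr 5; omega
          _ ≤ 4000 * (W ^ 2 * (c * 2 ^ l * 2 ^ l)) := by gcongr
      · rintro σ'' ⟨hf', hm'⟩
        refine ⟨Frame.trans (by simpa using hf) hf' (by norm_num),
          (hf'.1 60 (by norm_num)).trans (by simpa using hik), ?_, ?_⟩
        · intro u hu
          rw [hm', hcj1, fillMem_in (by omega)]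
          rfl
        · intro x hx
          rw [hm', fillMem_out (by omega), ← hm2 x hx]
          simp
  · have e1 : W ^ 2 ≤ W ^ 2 * (c * 2 ^ l * 2 ^ l) := Nat.le_mul_of_pos_right _ hX
    generalize W ^ 2 * (c * 2 ^ l * 2 ^ l) = X at *
    nlinarith

/-- Each level is written to a fresh block of c * 2^l cells directly after the previous one,
starting at the place where the splitting left the digits. -/
theorem fftLoop_run {σ : State} {D c l W B : ℕ} {v : ℕ → ℕ} (hW : 2 ≤ W)
    (h51 : σ.reg 51 = l) (h53 : σ.reg 53 = c * 2 ^ l) (h54 : σ.reg 54 = D)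
    (h55 : σ.reg 55 = 2 ^ l) (h56 : σ.reg 56 = 2 ^ (l - 1)) (hl : 2 ≤ l) (hc : 1 ≤ c)
    (hB : B.size ≤ W) (hDB : D + l * (c * 2 ^ l) + 2 * (c * 2 ^ l) ≤ B)
    (hv : ∀ u < c * 2 ^ l, σ.mem (D + c * 2 ^ l + u) = v u) (hvs : ∀ u, v u < 2 ^ 2 ^ l) :
    Run .fftLoop σ (l * (60000 * (W ^ 2 * (c * 2 ^ l * 2 ^ l)))) (fun σ' => Frame 60 σ σ' ∧
      (∀ u < c * 2 ^ l, σ'.mem (D + l * (c * 2 ^ l) + c * 2 ^ l + u) = fft l v l u) ∧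
      ∀ x < D, σ'.mem x = σ.mem x) := by
  have hX : 1 ≤ c * 2 ^ l * 2 ^ l := Nat.mul_pos (Nat.mul_pos hc (by positivity)) (by positivity)
  have hlL : l < 2 ^ l := Nat.lt_two_pow_self
  have hLc : 2 ^ l ≤ c * 2 ^ l := Nat.le_mul_of_pos_left _ hc
  have sB : ∀ x, x ≤ B → x.size ≤ W := fun x hx => size_le_of_le hx hB
  have hW2 : W ≤ W ^ 2 := by nlinarith
  have sS : ∀ x, x ≤ B → x.size ≤ W ^ 2 := fun x hx => (sB x hx).trans hW2
  have hlW : l ≤ W := by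
    have h1 : (2 ^ l).size ≤ W := sB _ (by omega)
    rw [Nat.size_pow] at h1; omega
  refine (Run.levelLoop (W := W) (S := W ^ 2) (T := 28000 * (W ^ 2 * (c * 2 ^ l * 2 ^ l)))
    (J := fun j m => (∀ u < c * 2 ^ l, m (D + j * (c * 2 ^ l) + c * 2 ^ l + u) = fft l v j u) ∧
      ∀ x < D, m x = σ.mem x) hW h51 (sB _ (by omega)) le_rfl ?_ rfl
      (by simp [Prog.wt, Expr.nodes]) ?_).mono ?_ (fun _ h => h)
  · simpa [fft] using hv
  · rintro j σ' hj hf hik ⟨hm1, hm2⟩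
    have r51 := (hf.1 51 (by norm_num)).trans h51
    have r53 := (hf.1 53 (by norm_num)).trans h53
    have r54 := (hf.1 54 (by norm_num)).trans h54
    have r55 := (hf.1 55 (by norm_num)).trans h55
    have r56 := (hf.1 56 (by norm_num)).trans h56
    have hjl : (j + 1) * (c * 2 ^ l) ≤ l * (c * 2 ^ l) := Nat.mul_le_mul_right _ hj
    have hj1 : (j + 1) * (c * 2 ^ l) = j * (c * 2 ^ l) + c * 2 ^ l := by ring
    generalize hn : c * 2 ^ l = n at *
    refine ⟨?_, ?_⟩
    · simp (disch := omega) [r51, r53, r54, hik, sB, sS, show 1 ≤ W ^ 2 by omega,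
        show l ≤ W ^ 2 + (j + 1) by omega]
    · refine (Prog.fftStep_run (src := D + n + j * n) (dst := D + n + j * n + n) (N := c)
        (n := n) (j := j) (l := l) (W := W)
        (S := W ^ 2 * (4 * 2 ^ l)) (B := B) (P := fft l v j) hW
        (Nat.le_mul_of_pos_right _ (by omega)) hl ?_ ?_ ?_ ?_ ?_ ?_ ?_ hj hn.symm hc rfl hB (by omega)
        (Nat.le_mul_of_pos_left _ (by positivity)) ?_
        (fun u _ => fft_lt hl hvs j hj.le u)).mono ?_ ?_
      · simpa using r53
      · simpa using r55
      · simpa using r56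
      · simpa using hik
      · simp [r51, hik]
      · simp [r54, r53, hik]
      · simp [r54, r53, hik]
      · intro u hu
        rw [← hm1 u hu, show D + n + j * n = D + j * n + n by ring]
        simp
      · apply le_of_eq; ring
      · rintro σ'' ⟨hf', hm'⟩
        refine ⟨Frame.trans (by simpa using hf) hf' (by norm_num),
          (hf'.1 60 (by norm_num)).trans (by simpa using hik), ?_, ?_⟩
        · intro u hu
          rw [hm', hj1, show D + (j * n + n) + n + u = D + n + j * n + n + u by ring,
            fillMem_in hu]
          rfl
        · intro x hx
          rw [hm', fillMem_out (by omega), ← hm2 x hx]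
          simp
  · have e1 : W ^ 2 ≤ W ^ 2 * (c * 2 ^ l * 2 ^ l) := Nat.le_mul_of_pos_right _ hX
    generalize W ^ 2 * (c * 2 ^ l * 2 ^ l) = X at *
    nlinarith

/-- The blocks of the forward transform are walked through backwards. There are c * 2^l products but
twice as many factors, so the distance between blocks is 2 * (c * 2^l), and the result ends where
the digits were at the start. -/
theorem ifftLoop_run {σ : State} {D c l W B : ℕ} {w : ℕ → ℕ} (hW : 2 ≤ W)
    (h51 : σ.reg 51 = l) (h53 : σ.reg 53 = 2 * (c * 2 ^ l)) (h54 : σ.reg 54 = D)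
    (h55 : σ.reg 55 = 2 ^ l) (h56 : σ.reg 56 = 2 ^ (l - 1)) (h59 : σ.reg 59 = c * 2 ^ l)
    (hl : 2 ≤ l) (hc : 1 ≤ c)
    (hB : B.size ≤ W) (hDB : D + l * (2 * (c * 2 ^ l)) + 2 * (2 * (c * 2 ^ l)) ≤ B)
    (hw : ∀ u < c * 2 ^ l, σ.mem (D + l * (2 * (c * 2 ^ l)) + 2 * (c * 2 ^ l) + u) = w u)
    (hws : ∀ u < c * 2 ^ l, w u < 2 ^ (2 * 2 ^ l)) :
    Run .ifftLoop σ (l * (60000 * (W ^ 2 * (c * 2 ^ l * 2 ^ l)))) (fun σ' => Frame 60 σ σ' ∧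
      (∀ u < c * 2 ^ l, σ'.mem (D + 2 * (c * 2 ^ l) + u) = ifft l w l u) ∧
      ∀ x < D, σ'.mem x = σ.mem x) := by
  have hX : 1 ≤ c * 2 ^ l * 2 ^ l := Nat.mul_pos (Nat.mul_pos hc (by positivity)) (by positivity)
  have hlL : l < 2 ^ l := Nat.lt_two_pow_self
  have hLc : 2 ^ l ≤ c * 2 ^ l := Nat.le_mul_of_pos_left _ hc
  have sB : ∀ x, x ≤ B → x.size ≤ W := fun x hx => size_le_of_le hx hB
  have hW2 : W ≤ W ^ 2 := by nlinarith
  have sS : ∀ x, x ≤ B → x.size ≤ W ^ 2 := fun x hx => (sB x hx).trans hW2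
  have hlW : l ≤ W := by
    have h1 : (2 ^ l).size ≤ W := sB _ (by omega)
    rw [Nat.size_pow] at h1; omega
  refine (Run.levelLoop (W := W) (S := W ^ 2) (T := 28000 * (W ^ 2 * (c * 2 ^ l * 2 ^ l)))
    (J := fun j m => (∀ u < c * 2 ^ l,
      m (D + (l - j) * (2 * (c * 2 ^ l)) + 2 * (c * 2 ^ l) + u) = ifft l w j u) ∧
      ∀ x < D, m x = σ.mem x) hW h51 (sB _ (by omega)) le_rfl ?_ rfl
      (by simp [Prog.wt, Expr.nodes]) ?_).mono ?_ ?_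
  · simpa [ifft] using hw
  · rintro j σ' hj hf hik ⟨hm1, hm2⟩
    have r51 := (hf.1 51 (by norm_num)).trans h51
    have r53 := (hf.1 53 (by norm_num)).trans h53
    have r54 := (hf.1 54 (by norm_num)).trans h54
    have r55 := (hf.1 55 (by norm_num)).trans h55
    have r56 := (hf.1 56 (by norm_num)).trans h56
    have r59 := (hf.1 59 (by norm_num)).trans h59
    have hjl : (l - 1 - j + 1) * (2 * (c * 2 ^ l)) ≤ l * (2 * (c * 2 ^ l)) :=
      Nat.mul_le_mul_right _ (by omega)
    have hj1 : (l - 1 - j + 1) * (2 * (c * 2 ^ l)) =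
      (l - 1 - j) * (2 * (c * 2 ^ l)) + 2 * (c * 2 ^ l) := by ring
    have hlj : l - j = l - 1 - j + 1 := by omega
    have hlj' : l - (j + 1) = l - 1 - j := by omega
    have h2j : 2 ^ j ≤ 2 ^ l := Nat.pow_le_pow_right (by norm_num) hj.le
    rw [hlj] at hm1
    generalize hn : c * 2 ^ l = n at *
    refine ⟨?_, ?_⟩
    · simp (disch := omega) [r51, r53, r54, hik, sB, sS, show 1 ≤ W ^ 2 by omega,
        show j ≤ W ^ 2 by omega]
    · refine (Prog.ifftStep_run (src := D + 2 * n + (l - 1 - j) * (2 * n) + 2 * n)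
        (dst := D + 2 * n + (l - 1 - j) * (2 * n)) (N := c)
        (n := n) (i := j) (l := l) (W := W)
        (S := W ^ 2 * (4 * 2 ^ l)) (B := B) (P := ifft l w j) hW
        (Nat.le_mul_of_pos_right _ (by omega)) hl ?_ ?_ ?_ ?_ ?_ ?_ ?_ hj hn.symm hc (by omega) hB
        (by omega) (Nat.le_mul_of_pos_left _ (by positivity)) ?_
        (fun u hu => ifft_lt hl (n := c) (hn ▸ hws) j hj.le u (hn ▸ hu))).mono ?_ ?_
      · simpa using r59
      · simpa using r55
      · simpa using r56
      · simp [r51, hik]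
      · simp [hik]
      · simp [r51, r54, r53, hik]
      · simp [r51, r54, r53, hik]
      · intro u hu
        rw [← hm1 u hu, show D + 2 * n + (l - 1 - j) * (2 * n) + 2 * n + u =
          D + (l - 1 - j + 1) * (2 * n) + 2 * n + u by ring]
        simp
      · apply le_of_eq; ring
      · rintro σ'' ⟨hf', hm'⟩
        refine ⟨Frame.trans (by simpa using hf) hf' (by norm_num),
          (hf'.1 60 (by norm_num)).trans (by simpa using hik), ?_, ?_⟩
        · intro u hu
          rw [hm', hlj', show D + (l - 1 - j) * (2 * n) + 2 * n + u =
            D + 2 * n + (l - 1 - j) * (2 * n) + u by ring, fillMem_in hu]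
          rfl
        · intro x hx
          rw [hm', fillMem_out (by omega), ← hm2 x hx]
          simp
  · have e1 : W ^ 2 ≤ W ^ 2 * (c * 2 ^ l * 2 ^ l) := Nat.le_mul_of_pos_right _ hX
    generalize W ^ 2 * (c * 2 ^ l * 2 ^ l) = X at *
    nlinarith
  · intro σ' h
    simpa using h

/-- The heap order of the digit tree is climbed from the leaves to the roots. -/
theorem packLoop_run {σ : State} {D c l d K W B : ℕ} {h : ℕ → ℕ} (hW : 2 ≤ W)
    (h51 : σ.reg 51 = l) (h53 : σ.reg 53 = 2 * (c * 2 ^ l)) (h54 : σ.reg 54 = D)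
    (h57 : σ.reg 57 = d) (h59 : σ.reg 59 = c * 2 ^ l)
    (hl : 2 ≤ l) (hc : 1 ≤ c) (hdl : d ≤ 2 ^ l) (hK : K + l ≤ 2 ^ l)
    (hB : B.size ≤ W) (hDB : D + 2 * (2 * (c * 2 ^ l)) ≤ B)
    (hh : ∀ u < c * 2 ^ l, σ.mem (D + 2 * (c * 2 ^ l) + u) = h u)
    (hhs : ∀ u < c * 2 ^ l, h u < 2 ^ (K + 1)) :
    Run .packLoop σ (l * (60000 * (W ^ 2 * (c * 2 ^ l * 2 ^ l)))) (fun σ' => Frame 60 σ σ' ∧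
      (∀ u < c, σ'.mem (D + 2 * c + u) = pack d h l u) ∧
      ∀ x < D, σ'.mem x = σ.mem x) := by
  have hX : 1 ≤ c * 2 ^ l * 2 ^ l := Nat.mul_pos (Nat.mul_pos hc (by positivity)) (by positivity)
  have hlL : l < 2 ^ l := Nat.lt_two_pow_self
  have hLc : 2 ^ l ≤ c * 2 ^ l := Nat.le_mul_of_pos_left _ hc
  have sB : ∀ x, x ≤ B → x.size ≤ W := fun x hx => size_le_of_le hx hB
  have hW2 : W ≤ W ^ 2 := by nlinarith
  have sS : ∀ x, x ≤ B → x.size ≤ W ^ 2 := fun x hx => (sB x hx).trans hW2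
  have hlW : l ≤ W := by
    have h1 : (2 ^ l).size ≤ W := sB _ (by omega)
    rw [Nat.size_pow] at h1; omega
  refine (Run.levelLoop (W := W) (S := W ^ 2) (T := 28000 * (W ^ 2 * (c * 2 ^ l * 2 ^ l)))
    (J := fun j m => (∀ u < c * 2 ^ (l - j),
      m (D + 2 * (c * 2 ^ (l - j)) + u) = pack d h j u) ∧
      ∀ x < D, m x = σ.mem x) hW h51 (sB _ (by omega)) le_rfl ?_ rfl
      (by simp [Prog.wt, Expr.nodes]) ?_).mono ?_ ?_
  · simpa [pack] using hh
  · rintro j σ' hj hf hik ⟨hm1, hm2⟩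
    have r51 := (hf.1 51 (by norm_num)).trans h51
    have r53 := (hf.1 53 (by norm_num)).trans h53
    have r54 := (hf.1 54 (by norm_num)).trans h54
    have r57 := (hf.1 57 (by norm_num)).trans h57
    have r59 := (hf.1 59 (by norm_num)).trans h59
    have hj1 : c * 2 ^ (l - j) = 2 * (c * 2 ^ (l - (j + 1))) := by
      rw [show l - j = l - (j + 1) + 1 by omega]; ring
    have hlj : l - j = l - (j + 1) + 1 := by omega
    have hjn : c * 2 ^ (l - j) ≤ c * 2 ^ l :=
      Nat.mul_le_mul_left _ (Nat.pow_le_pow_right (by norm_num) (by omega))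
    have hn1 : 1 ≤ c * 2 ^ (l - (j + 1)) := Nat.mul_pos hc (by positivity)
    have hdiv : ∀ i ≤ l, c * 2 ^ l / 2 ^ i = c * 2 ^ (l - i) := by
      intro i hi
      rw [← Nat.sub_add_cancel hi, pow_add, ← mul_assoc, Nat.mul_div_cancel _ (by positivity)]
      simp
    have hdiv2 : ∀ i ≤ l, 2 * (c * 2 ^ l) / 2 ^ i = 2 * (c * 2 ^ (l - i)) := by
      intro i hi
      rw [← mul_assoc, ← mul_assoc, ← Nat.sub_add_cancel hi, pow_add, ← mul_assoc,
        Nat.mul_div_cancel _ (by positivity)]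
      simp
    have hdcl : d ≤ B := by omega
    refine ⟨?_, ?_⟩
    · simp (disch := omega) [r53, r54, r57, r59, hik, sB, sS, show 1 ≤ W ^ 2 by omega,
        show j ≤ W ^ 2 by omega]
    · have hpl := fun u hu => pack_lt (d := d) (K := K) (l := l) (n := c) hhs j u hj.le hu
      refine (Prog.packStep_run (src := D + 2 * (c * 2 ^ (l - j)))
        (dst := D + 2 * (c * 2 ^ (l - (j + 1)))) (n := c * 2 ^ (l - (j + 1)))
        (s := d * 2 ^ j) (t := K + 1 + j + d * 2 ^ j) (W := W)
        (S := W ^ 2 * (K + 1 + j + d * 2 ^ j + d * 2 ^ j)) (B := B) (P := pack d h j) hW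
        (Nat.le_mul_of_pos_right _ (by omega)) ?_ ?_ ?_ ?_ hn1 (by omega) hB
        (by omega) (Nat.le_mul_of_pos_left _ (by positivity)) ?_
        (fun u hu => hpl u (by omega))).mono ?_ ?_
      · simp [r59, hik, hdiv _ hj]
      · simp [r57, hik]
      · simp [r53, r54, hik, hdiv2 _ hj.le]
      · simp [r53, r54, hik, hdiv2 _ hj]
      · intro u hu
        rw [← hm1 u (by omega)]
        simp
      · have e1 : 2 ^ (l - (j + 1)) * (K + 1 + j + d * 2 ^ j + d * 2 ^ j) ≤ 2 * (2 ^ l * 2 ^ l) := by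
          have g1 : 2 ^ (l - (j + 1)) * (K + 1 + j) ≤ 2 ^ l * 2 ^ l :=
            Nat.mul_le_mul (Nat.pow_le_pow_right (by norm_num) (by omega)) (by omega)
          have g2 : 2 ^ (l - (j + 1)) * (d * 2 ^ j + d * 2 ^ j) = d * 2 ^ l := by
            calc _ = d * 2 ^ (l - (j + 1) + (j + 1)) := by ring
              _ = _ := by congr 2; omega
          have g3 : d * 2 ^ l ≤ 2 ^ l * 2 ^ l := Nat.mul_le_mul_right _ hdl
          calc _ = 2 ^ (l - (j + 1)) * (K + 1 + j) + 2 ^ (l - (j + 1)) * (d * 2 ^ j + d * 2 ^ j) := by ring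
            _ ≤ _ := by omega
        calc _ = 7000 * (W ^ 2 * (c * (2 ^ (l - (j + 1)) * (K + 1 + j + d * 2 ^ j + d * 2 ^ j)))) := by ring
          _ ≤ 7000 * (W ^ 2 * (c * (2 * (2 ^ l * 2 ^ l)))) := by gcongr
          _ = 14000 * (W ^ 2 * (c * 2 ^ l * 2 ^ l)) := by ring
          _ ≤ _ := Nat.mul_le_mul_right _ (by norm_num)
      · rintro σ'' ⟨hf', hm'⟩
        refine ⟨Frame.trans (by simpa using hf) hf' (by norm_num),
          (hf'.1 60 (by norm_num)).trans (by simpa using hik), ?_, ?_⟩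
        · intro u hu
          rw [hm', fillMem_in hu]
          rfl
        · intro x hx
          rw [hm', fillMem_out (by omega), ← hm2 x hx]
          simp
  · have e1 : W ^ 2 ≤ W ^ 2 * (c * 2 ^ l * 2 ^ l) := Nat.le_mul_of_pos_right _ hX
    generalize W ^ 2 * (c * 2 ^ l * 2 ^ l) = X at *
    nlinarith
  · intro σ' h
    simpa using h

/-! ### Multiplication -/

/-- The parameters of a level, from `f` in register 50. -/
def Prog.levelInit : Prog :=
  51 ::= .var 50 >>ₑ .lit 1 +ₑ .lit 5 ;;
  55 ::= .lit 1 <<ₑ .var 51 ;;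
  56 ::= .lit 1 <<ₑ (.var 51 -ₑ .lit 1) ;;
  57 ::= .lit 1 <<ₑ (.var 50 -ₑ .var 50 >>ₑ .lit 1 +ₑ .lit 1)

/-- Transform the factors on one level. -/
def Prog.downLevel : Prog :=
  (levelInit ;; 53 ::= .var 52 <<ₑ .var 51) ;; splitLoop ;; fftLoop ;;
  54 ::= .var 54 +ₑ .var 51 *ₑ .var 53 ;; 52 ::= .var 53 ;; 50 ::= .var 50 >>ₑ .lit 1 ;;
  58 ::= .var 58 +ₑ .lit 1

/-- Compute the products on one level from those on the next. -/
def Prog.upLevel : Prog :=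
  (58 ::= .var 58 -ₑ .lit 1 ;; 50 ::= .var 31 >>ₑ .var 58 ;; levelInit ;; 53 ::= .var 52 ;;
    52 ::= .var 53 >>ₑ .var 51 ;; 54 ::= .var 54 -ₑ .var 51 *ₑ .var 53 ;;
    59 ::= .var 53 >>ₑ .lit 1) ;;
  ifftLoop ;; 62 ::= .var 54 +ₑ .var 53 ;; unscaleStep ;; packLoop

theorem dig_le (f : ℕ) : dig f ≤ 2 ^ lev f :=
  Nat.pow_le_pow_right (by norm_num) (by unfold lev; omega)

theorem dig_pos (f : ℕ) : 1 ≤ dig f := Nat.one_le_two_pow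

/-- The output has the form of the input, with base, count and `f` replaced by those of the next
level: numbers start at base plus count. Hence the step can be iterated. Memory below the old base,
which holds the earlier levels, is untouched. -/
theorem Prog.downLevel_run {σ : State} {f c D i W B : ℕ} {Z : ℕ → ℕ} (hW : 4 ≤ W)
    (h50 : σ.reg 50 = f) (h52 : σ.reg 52 = c) (h54 : σ.reg 54 = D) (h58 : σ.reg 58 = i)
    (hc : 1 ≤ c) (hB : B.size ≤ W)
    (hDB : D + lev f * (c * 2 ^ lev f) + 2 * (c * 2 ^ lev f) + f + i + 5 ≤ B)
    (hZ : ∀ u < c, σ.mem (D + c + u) = Z u) (hZs : ∀ u, Z u < 2 ^ 2 ^ (f + 5)) :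
    Run .downLevel σ (200000 * (W ^ 3 * (c * 2 ^ lev f * 2 ^ lev f))) (fun σ' => Frame 50 σ σ' ∧
      σ'.reg 50 = f / 2 ∧ σ'.reg 52 = c * 2 ^ lev f ∧
      σ'.reg 54 = D + lev f * (c * 2 ^ lev f) ∧ σ'.reg 58 = i + 1 ∧
      (∀ u < c * 2 ^ lev f,
        σ'.mem (D + lev f * (c * 2 ^ lev f) + c * 2 ^ lev f + u) = down f Z u) ∧
      ∀ x < D, σ'.mem x = σ.mem x) := by
  have hl := two_le_lev f
  have hX : 1 ≤ c * 2 ^ lev f * 2 ^ lev f :=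
    Nat.mul_pos (Nat.mul_pos hc (by positivity)) (by positivity)
  have hlL : lev f < 2 ^ lev f := Nat.lt_two_pow_self
  have hLc : 2 ^ lev f ≤ c * 2 ^ lev f := Nat.le_mul_of_pos_left _ hc
  have hcc : c ≤ c * 2 ^ lev f := Nat.le_mul_of_pos_right _ (by positivity)
  have sB : ∀ x, x ≤ B → x.size ≤ W := fun x hx => size_le_of_le hx hB
  have hW2 : W + 1 ≤ W ^ 2 := by nlinarith
  have sS : ∀ x, x ≤ B → x.size ≤ W ^ 2 := fun x hx => (sB x hx).trans (by omega)
  have hlW : lev f ≤ W := by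
    have h1 : (2 ^ lev f).size ≤ W := sB _ (by omega)
    rw [Nat.size_pow] at h1; omega
  have hlev : f / 2 + 5 = lev f := rfl
  have hdig : 2 ^ (f - f / 2 + 1) = dig f := rfl
  have hdl := dig_le f
  refine (Run.seq (Run.of_lf (W := W) (S := W ^ 2) (by omega) le_rfl rfl ?_
    (Q := fun σ₁ => Frame 50 σ σ₁ ∧ σ₁.mem = σ.mem ∧ σ₁.reg 50 = f ∧ σ₁.reg 51 = lev f ∧
      σ₁.reg 52 = c ∧ σ₁.reg 53 = c * 2 ^ lev f ∧ σ₁.reg 54 = D ∧ σ₁.reg 55 = 2 ^ lev f ∧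
      σ₁.reg 56 = 2 ^ (lev f - 1) ∧ σ₁.reg 57 = dig f ∧ σ₁.reg 58 = i) ?_)
    fun σ₁ ⟨a0, am, a50, a51, a52, a53, a54, a55, a56, a57, a58⟩ =>
      Run.seq (splitLoop_run (Z := Z) (d := dig f) (B := B) (by omega) a51 a52 a54 a57 (by omega) hc
        (dig_pos f) (dig_le f) hB (by omega) (by simpa [am] using hZ) (lt_dig_mul hZs))
      fun σ₂ ⟨b0, bm, bl⟩ =>
      Run.seq (fftLoop_run (σ := σ₂) (D := D) (c := c) (l := lev f) (B := B) (W := W)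
        (v := split (dig f) (lev f) Z (lev f)) (by omega)
        ((b0.1 51 (by norm_num)).trans a51) ((b0.1 53 (by norm_num)).trans a53)
        ((b0.1 54 (by norm_num)).trans a54) ((b0.1 55 (by norm_num)).trans a55)
        ((b0.1 56 (by norm_num)).trans a56) hl hc hB (by omega) bm (leaf_lt hZs))
      fun σ₃ ⟨c0, cm, cl⟩ =>
      Run.of_lf (W := W) (S := W ^ 2) (by omega) le_rfl rfl ?_ ?_).mono ?_ (fun _ h => h)
  · have e1 : f / 2 ≤ f := Nat.div_le_self _ _
    have e2 : 2 ^ (lev f - 1) ≤ 2 ^ lev f := Nat.pow_le_pow_right (by norm_num) (by omega)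
    simp (disch := omega) [Prog.levelInit, h50, h52, hlev, hdig, sS, show lev f ≤ W ^ 2 by omega,
      show lev f ≤ W ^ 2 + 1 by omega, show f - f / 2 + 1 ≤ W ^ 2 by omega,
      show f - f / 2 < W ^ 2 by omega, show 1 ≤ W ^ 2 by omega]
  · simp [Prog.levelInit, h50, h52, h54, h58, hlev, hdig, Frame.refl]
  · have d0 := b0.trans c0 le_rfl
    have d54 := (d0.1 54 (by norm_num)).trans a54
    have d51 := (d0.1 51 (by norm_num)).trans a51
    have d53 := (d0.1 53 (by norm_num)).trans a53
    have d50 := (d0.1 50 (by norm_num)).trans a50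
    have d58 := (d0.1 58 (by norm_num)).trans a58
    simp (disch := omega) [d54, d51, d53, d50, d58, sB, sS, show 1 ≤ W ^ 2 by omega]
  · have d0 := b0.trans c0 le_rfl
    have d54 := (d0.1 54 (by norm_num)).trans a54
    have d51 := (d0.1 51 (by norm_num)).trans a51
    have d53 := (d0.1 53 (by norm_num)).trans a53
    have d50 := (d0.1 50 (by norm_num)).trans a50
    have d58 := (d0.1 58 (by norm_num)).trans a58
    simp [d54, d51, d53, d50, d58, a0.trans (d0.mono (show 50 ≤ 60 by norm_num)) le_rfl]
    refine ⟨cm, fun x hx => ?_⟩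
    rw [cl x hx, bl x hx, am]
  · have e0 : W ^ 2 ≤ W ^ 3 * (c * 2 ^ lev f * 2 ^ lev f) := by
      calc W ^ 2 ≤ W ^ 3 := Nat.pow_le_pow_right (by omega) (by norm_num)
        _ ≤ _ := Nat.le_mul_of_pos_right _ hX
    have e1 : lev f * (60000 * (W ^ 2 * (c * 2 ^ lev f * 2 ^ lev f))) ≤
        60000 * (W ^ 3 * (c * 2 ^ lev f * 2 ^ lev f)) := by
      calc _ ≤ W * (60000 * (W ^ 2 * (c * 2 ^ lev f * 2 ^ lev f))) := Nat.mul_le_mul_right _ hlW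
        _ = _ := by ring
    simp only [Prog.wt, Prog.levelInit, Expr.nodes]
    omega

/-- No recursion stack is needed: the parameters of level `i` are recomputed from `f₀ / 2 ^ i`, and
count and base of the level above follow from the current ones by undoing the arithmetic of
`downLevel`. -/
theorem Prog.upLevel_run {σ : State} {f₀ f n D i W B : ℕ} {Z : ℕ → ℕ} (hW : 4 ≤ W)
    (h31 : σ.reg 31 = f₀) (hfi : f₀ / 2 ^ i = f) (h52 : σ.reg 52 = 2 * (n * 2 ^ lev f))
    (h54 : σ.reg 54 = D + lev f * (2 * (n * 2 ^ lev f))) (h58 : σ.reg 58 = i + 1)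
    (hn : 1 ≤ n) (hf : f₀ ≤ W) (hB : B.size ≤ W)
    (hDB : D + lev f * (2 * (n * 2 ^ lev f)) + 2 * (2 * (n * 2 ^ lev f)) + f₀ + i + 5 ≤ B)
    (hW' : ∀ u < n * 2 ^ lev f,
      σ.mem (D + lev f * (2 * (n * 2 ^ lev f)) + 2 * (n * 2 ^ lev f) + u) =
        down f Z u * down f Z (u + n * 2 ^ lev f))
    (hZs : ∀ u, Z u < 2 ^ 2 ^ (f + 5)) :
    Run .upLevel σ (200000 * (W ^ 3 * (n * 2 ^ lev f * 2 ^ lev f))) (fun σ' => Frame 50 σ σ' ∧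
      σ'.reg 52 = 2 * n ∧ σ'.reg 54 = D ∧ σ'.reg 58 = i ∧
      (∀ u < n, σ'.mem (D + 2 * n + u) = Z u * Z (u + n)) ∧
      ∀ x < D, σ'.mem x = σ.mem x) := by
  have hl := two_le_lev f
  have hX : 1 ≤ n * 2 ^ lev f * 2 ^ lev f :=
    Nat.mul_pos (Nat.mul_pos hn (by positivity)) (by positivity)
  have hlL : lev f < 2 ^ lev f := Nat.lt_two_pow_self
  have hLc : 2 ^ lev f ≤ n * 2 ^ lev f := Nat.le_mul_of_pos_left _ hn
  have hcc : n ≤ n * 2 ^ lev f := Nat.le_mul_of_pos_right _ (by positivity)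
  have sB : ∀ x, x ≤ B → x.size ≤ W := fun x hx => size_le_of_le hx hB
  have hW2 : W + 1 ≤ W ^ 2 := by nlinarith
  have sS : ∀ x, x ≤ B → x.size ≤ W ^ 2 := fun x hx => (sB x hx).trans (by omega)
  have hlW : lev f + 2 ≤ W := by
    have h1 : (2 ^ (lev f + 1)).size ≤ W := sB _ (by rw [pow_succ]; omega)
    rw [Nat.size_pow] at h1; omega
  have hlev : f / 2 + 5 = lev f := rfl
  have hdig : 2 ^ (f - f / 2 + 1) = dig f := rfl
  have hff : f ≤ f₀ := hfi ▸ Nat.div_le_self _ _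
  have hdl := dig_le f
  have hlK := lev_add_two_mul_dig_le f
  have hK2 := two_pow_pred (l := lev f) (by omega)
  have hWlt : ∀ u < n * 2 ^ lev f, down f Z u * down f Z (u + n * 2 ^ lev f) <
      2 ^ (2 * 2 ^ lev f) := by
    intro u hu
    rw [two_mul, pow_add]
    exact Nat.mul_lt_mul'' (down_lt hZs _) (down_lt hZs _)
  refine (Run.seq (Run.of_lf (W := W) (S := W ^ 2) (by omega) le_rfl rfl ?_
    (Q := fun σ₁ => Frame 50 σ σ₁ ∧ σ₁.mem = σ.mem ∧ σ₁.reg 51 = lev f ∧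
      σ₁.reg 52 = 2 * n ∧ σ₁.reg 53 = 2 * (n * 2 ^ lev f) ∧ σ₁.reg 54 = D ∧
      σ₁.reg 55 = 2 ^ lev f ∧
      σ₁.reg 56 = 2 ^ (lev f - 1) ∧ σ₁.reg 57 = dig f ∧ σ₁.reg 58 = i ∧
      σ₁.reg 59 = n * 2 ^ lev f) ?_)
    fun σ₁ ⟨a0, am, a51, a52, a53, a54, a55, a56, a57, a58, a59⟩ =>
      Run.seq (ifftLoop_run (B := B)
        (w := fun u => down f Z u * down f Z (u + n * 2 ^ lev f)) (by omega) a51 a53 a54 a55 a56 a59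
        hl hn hB (by omega) (by simpa [am] using hW') hWlt)
      fun σ₂ ⟨b0, bm, bl⟩ =>
      Run.seq (Q := fun σ₃ => Frame 60 σ₂ σ₃ ∧ σ₃.mem = σ₂.mem ∧ σ₃.reg 62 =
        D + 2 * (n * 2 ^ lev f)) (Run.of_lf (W := W) (S := W ^ 2) (by omega) le_rfl rfl ?_ ?_)
      fun σ₃ ⟨c0, cm, c62⟩ =>
      Run.seq (Prog.unscaleStep_run (W := W) (S := W ^ 2 * (4 * 2 ^ lev f)) (B := B)
        (b := D + 2 * (n * 2 ^ lev f)) (n := n * 2 ^ lev f) (l := lev f)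
        (P := ifft (lev f) (fun u => down f Z u * down f Z (u + n * 2 ^ lev f)) (lev f)) (by omega)
        (Nat.le_mul_of_pos_right _ (by omega)) hl
        (((b0.trans c0 le_rfl).1 59 (by norm_num)).trans a59)
        (((b0.trans c0 le_rfl).1 51 (by norm_num)).trans a51)
        (((b0.trans c0 le_rfl).1 55 (by norm_num)).trans a55)
        (((b0.trans c0 le_rfl).1 56 (by norm_num)).trans a56)
        c62 hLc hB (by omega) (Nat.le_mul_of_pos_left _ (by positivity)) (by rw [cm]; exact bm)
        (ifft_last_lt hl hWlt))
      fun σ₄ ⟨d0, dm⟩ =>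
      (packLoop_run (σ := σ₄) (D := D) (c := n) (l := lev f) (d := dig f)
        (K := 2 ^ (lev f - 1)) (W := W) (B := B)
        (h := fun u => unscale (lev f) (ifft (lev f)
          (fun u => down f Z u * down f Z (u + n * 2 ^ lev f)) (lev f) u)) (by omega)
        (((b0.trans c0 le_rfl).trans d0 (by norm_num)).1 51 (by norm_num) |>.trans a51)
        (((b0.trans c0 le_rfl).trans d0 (by norm_num)).1 53 (by norm_num) |>.trans a53)
        (((b0.trans c0 le_rfl).trans d0 (by norm_num)).1 54 (by norm_num) |>.trans a54)
        (((b0.trans c0 le_rfl).trans d0 (by norm_num)).1 57 (by norm_num) |>.trans a57)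
        (((b0.trans c0 le_rfl).trans d0 (by norm_num)).1 59 (by norm_num) |>.trans a59)
        hl hn hdl (by omega) hB (by omega) (fun u hu => by rw [dm, fillMem_in hu])
        (fun u hu => ?_)).mono le_rfl fun σ₅ ⟨e0, em, el⟩ => ?_).mono ?_ (fun _ h => h)
  · have e1 : f / 2 ≤ f := Nat.div_le_self _ _
    have e2 : 2 ^ (lev f - 1) ≤ 2 ^ lev f := Nat.pow_le_pow_right (by norm_num) (by omega)
    simp (disch := omega) [Prog.levelInit, h31, h52, h54, h58, hfi, hlev, hdig, sB, sS,
      show lev f ≤ W ^ 2 by omega,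
      show lev f ≤ W ^ 2 + 1 by omega, show f - f / 2 + 1 ≤ W ^ 2 by omega,
      show f - f / 2 < W ^ 2 by omega, show 1 ≤ W ^ 2 by omega]
  · have e1 : 2 * (n * 2 ^ lev f) / 2 ^ lev f = 2 * n := by
      rw [← mul_assoc, Nat.mul_div_cancel _ (by positivity)]
    simp [Prog.levelInit, h31, h52, h54, h58, hfi, hlev, hdig, Frame.refl, e1]
  · have d54 := (b0.1 54 (by norm_num)).trans a54
    have d53 := (b0.1 53 (by norm_num)).trans a53
    simp (disch := omega) [d53, d54, sS]
  · have d54 := (b0.1 54 (by norm_num)).trans a54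
    have d53 := (b0.1 53 (by norm_num)).trans a53
    simp [d53, d54, Frame.refl]
  · have := (unscale_spec hl (ifft_last_lt hl hWlt u hu)).1
    have hp : 1 ≤ 2 ^ 2 ^ (lev f - 1) := Nat.one_le_two_pow
    rw [pow_succ]
    omega
  · have e0 : W ^ 2 ≤ W ^ 3 * (n * 2 ^ lev f * 2 ^ lev f) := by
      calc W ^ 2 ≤ W ^ 3 := Nat.pow_le_pow_right (by omega) (by norm_num)
        _ ≤ _ := Nat.le_mul_of_pos_right _ hX
    have e1 : lev f * (60000 * (W ^ 2 * (n * 2 ^ lev f * 2 ^ lev f))) ≤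
        60000 * (W ^ 3 * (n * 2 ^ lev f * 2 ^ lev f)) := by
      calc _ ≤ W * (60000 * (W ^ 2 * (n * 2 ^ lev f * 2 ^ lev f))) :=
            Nat.mul_le_mul_right _ (by omega)
        _ = _ := by ring
    have e2 : n * 2 ^ lev f * (7000 * (W ^ 2 * (4 * 2 ^ lev f))) ≤
        28000 * (W ^ 3 * (n * 2 ^ lev f * 2 ^ lev f)) := by
      calc _ = 28000 * (W ^ 2 * (n * 2 ^ lev f * 2 ^ lev f)) := by ring
        _ ≤ _ := by gcongr <;> omega
    simp only [Prog.wt, Prog.levelInit, Expr.nodes]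
    omega
  · have g1 : Frame 60 σ₁ σ₅ :=
      (b0.trans c0 le_rfl).trans ((d0.mono (by norm_num : 60 ≤ 70)).trans e0 le_rfl) le_rfl
    refine ⟨a0.trans g1 (by norm_num), (g1.1 52 (by norm_num)).trans a52,
      (g1.1 54 (by norm_num)).trans a54, (g1.1 58 (by norm_num)).trans a58, ?_, ?_⟩
    · intro u hu
      rw [em u hu]
      exact up_correct (n := n) hZs (fun _ _ => rfl) u hu
    · intro x hx
      rw [el x hx, dm, fillMem_out (by omega), cm, bl x hx, am]

/-- Multiplication of the contents of registers 40 and 41, of at most `2 ^ (f + 5)` bits, where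
`f` is the content of register 31. The memory from the address in register 30 on is used as
working space. -/
def Prog.mulProg : Prog :=
  (54 ::= .var 30 ;; 52 ::= .lit 2 ;; 50 ::= .var 31 ;; 58 ::= .lit 0 ;;
    .store (.var 30 +ₑ .lit 2) (.var 40) ;; .store (.var 30 +ₑ .lit 3) (.var 41)) ;;
  .while (.var 50) downLevel ;;
  (59 ::= .var 52 >>ₑ .lit 1 ;; 62 ::= .var 54 +ₑ .var 52) ;;
  .fill 70 59 (.store (.var 62 +ₑ .var 70)
    (.read (.var 62 +ₑ .var 70) *ₑ .read (.var 62 +ₑ .var 70 +ₑ .var 59))) ;;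
  .while (.var 58) upLevel ;;
  40 ::= .read (.var 30 +ₑ .lit 2)

/-! ### Sizes in the multiplication recursion, and the multiplication theorem. -/

/-- Half the number of factors on the levels of the multiplication. -/
def levCount (f : ℕ) : ℕ → ℕ
  | 0 => 1
  | k + 1 => levCount f k * 2 ^ lev (f / 2 ^ k)

/-- The base addresses of the levels of the multiplication. -/
def levBase (f M : ℕ) : ℕ → ℕ
  | 0 => M
  | k + 1 => levBase f M k + lev (f / 2 ^ k) * (2 * levCount f (k + 1))

/-- The factors on the levels of the multiplication. -/
def levVal (f a b : ℕ) : ℕ → ℕ → ℕ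
  | 0 => fun u => if u = 0 then a else b
  | k + 1 => down (f / 2 ^ k) (levVal f a b k)

theorem levCount_pos (f k : ℕ) : 1 ≤ levCount f k := by
  induction k with
  | zero => exact le_rfl
  | succ k ih => exact Nat.mul_pos ih (by positivity)

theorem div_two_pow_succ (f k : ℕ) : f / 2 ^ (k + 1) = f / 2 ^ k / 2 := by
  rw [Nat.div_div_eq_div_mul, pow_succ]

theorem levVal_lt {f a b : ℕ} (ha : a < 2 ^ 2 ^ (f + 5)) (hb : b < 2 ^ 2 ^ (f + 5)) (k u : ℕ) :
    levVal f a b k u < 2 ^ 2 ^ (f / 2 ^ k + 5) := by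
  induction k generalizing u with
  | zero => simp only [levVal, pow_zero, Nat.div_one]; split_ifs <;> assumption
  | succ k ih =>
    rw [div_two_pow_succ]
    exact down_lt ih u

/-- With x = f / 2^k the count grows by 2^(x/2+5) while the length drops from 2^(x+5) to 2^(x/2+5)
bits. Since 2 * (x/2) ≤ x, their product grows at most by 2^5 = 32. -/
theorem levCount_mul_le (f k : ℕ) : levCount f k * 2 ^ (f / 2 ^ k + 5) ≤ 2 ^ (f + 5) * 32 ^ k := by
  induction k with
  | zero => simp [levCount]
  | succ k ih =>
    have h : lev (f / 2 ^ k) + (f / 2 ^ (k + 1) + 5) ≤ f / 2 ^ k + 5 + 5 := by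
      rw [div_two_pow_succ, lev]; omega
    calc _ = levCount f k * 2 ^ (lev (f / 2 ^ k) + (f / 2 ^ (k + 1) + 5)) := by
          rw [levCount, pow_add 2 (lev _), mul_assoc]
      _ ≤ levCount f k * 2 ^ (f / 2 ^ k + 5 + 5) := by gcongr; norm_num
      _ = levCount f k * 2 ^ (f / 2 ^ k + 5) * 32 := by rw [pow_add _ _ 5]; ring
      _ ≤ 2 ^ (f + 5) * 32 ^ k * 32 := by gcongr
      _ = _ := by ring

theorem levCount_le {f k : ℕ} (hk : k ≤ f.size) :
    levCount f k * 2 ^ (f / 2 ^ k + 5) ≤ 2 ^ (f + 5) * 32 ^ f.size :=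
  (levCount_mul_le f k).trans
    (Nat.mul_le_mul_left _ (Nat.pow_le_pow_right (by norm_num) hk))

theorem levBase_le (f M : ℕ) {k : ℕ} (hk : k ≤ f.size) :
    levBase f M k ≤ M + k * (f + 5) * (2 ^ (f + 5) * 32 ^ f.size) := by
  induction k with
  | zero => simp [levBase]
  | succ k ih =>
    have h1 := ih (by omega)
    have h2 := levCount_le hk
    have h3 : lev (f / 2 ^ k) ≤ f + 5 := by
      have : f / 2 ^ k ≤ f := Nat.div_le_self _ _
      unfold lev; omega
    have h4 : 2 * levCount f (k + 1) ≤ 2 ^ (f + 5) * 32 ^ f.size := by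
      refine le_trans ?_ h2
      rw [mul_comm]
      exact Nat.mul_le_mul_left _ (by
        calc 2 = 2 ^ 1 := rfl
          _ ≤ _ := Nat.pow_le_pow_right (by norm_num) (Nat.le_add_left_of_le (by norm_num)))
    have h5 := Nat.mul_le_mul h3 h4
    rw [levBase]
    calc _ ≤ M + k * (f + 5) * (2 ^ (f + 5) * 32 ^ f.size) +
          (f + 5) * (2 ^ (f + 5) * 32 ^ f.size) := by omega
      _ = _ := by ring

theorem levBase_mono (f M : ℕ) (k : ℕ) : M ≤ levBase f M k := by
  induction k with
  | zero => exact le_rfl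
  | succ k ih => rw [levBase]; omega

theorem div_two_pow_eq_zero_iff {f k : ℕ} : f / 2 ^ k = 0 ↔ f.size ≤ k := by
  rw [Nat.div_eq_zero_iff, Nat.size_le]
  simp

theorem size_le_self (f : ℕ) : f.size ≤ f := by
  rw [Nat.size_le]; exact Nat.lt_two_pow_self

/-- The depth of the recursion is the bit length of f, and 2 to that power is at most 2f (or is 1),
so the accumulated factor is only a fifth power. -/
theorem pow_size_le {f W : ℕ} (hf : f ≤ W) (hW : 1 ≤ W) : 32 ^ f.size ≤ 243 * W ^ 5 := by
  have h : 2 ^ f.size ≤ 3 * W := by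
    rcases Nat.eq_zero_or_pos f.size with h0 | h0
    · rw [h0]; omega
    · have : 2 ^ (f.size - 1) ≤ f := Nat.lt_size.mp (by omega)
      have h2 : 2 ^ f.size = 2 * 2 ^ (f.size - 1) := by rw [← pow_succ']; congr 1; omega
      omega
  calc 32 ^ f.size = (2 ^ f.size) ^ 5 := by rw [← pow_mul, mul_comm, pow_mul]; norm_num
    _ ≤ (3 * W) ^ 5 := Nat.pow_le_pow_left h 5
    _ = _ := by ring

/-- Every level handles at most a multiple of Y = 2^(f+5) * 32^(size f) bits, at a cost of W^3 per
bit, and there are at most W levels. The hypothesis on `M` says that all addresses of the working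
space are words. -/
theorem Prog.mulProg_run {σ : State} {M f a b W : ℕ} (hW : 32 ≤ W) (h30 : σ.reg 30 = M)
    (h31 : σ.reg 31 = f) (h40 : σ.reg 40 = a) (h41 : σ.reg 41 = b)
    (ha : a < 2 ^ 2 ^ (f + 5)) (hb : b < 2 ^ 2 ^ (f + 5)) (hfW : f ≤ W)
    (hB : (M + (f + 6) ^ 2 * (4 * (2 ^ (f + 5) * 32 ^ f.size))).size ≤ W) :
    Run .mulProg σ (10 ^ 10 * (W ^ 9 * 2 ^ f)) (fun σ' => Frame 40 σ σ' ∧ σ'.reg 40 = a * b ∧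
      ∀ x < M, σ'.mem x = σ.mem x) := by
  set Y := 2 ^ (f + 5) * 32 ^ f.size with hY
  set B := M + (f + 6) ^ 2 * (4 * Y) with hBdef
  have hYf : f + 6 ≤ Y := by
    have h1 : f + 5 < 2 ^ (f + 5) := Nat.lt_two_pow_self
    have h2 : 2 ^ (f + 5) ≤ Y := Nat.le_mul_of_pos_right _ (by positivity)
    omega
  have hfs := size_le_self f
  have sB : ∀ x, x ≤ B → x.size ≤ W := fun x hx => size_le_of_le hx hB
  have hW2 : W + 1 ≤ W ^ 2 := by nlinarith
  have sS : ∀ x, x ≤ B → x.size ≤ W ^ 2 := fun x hx => (sB x hx).trans (by omega)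
  have hbase : ∀ k ≤ f.size, levBase f M k + 4 * Y ≤ B := by
    intro k hk
    have h1 : levBase f M k ≤ M + k * (f + 5) * Y := levBase_le f M hk
    have h2 : k * (f + 5) * Y + 4 * Y ≤ (f + 6) ^ 2 * (4 * Y) := by
      have : k * (f + 5) + 4 ≤ (f + 6) ^ 2 * 4 := by nlinarith
      calc k * (f + 5) * Y + 4 * Y = (k * (f + 5) + 4) * Y := by ring
        _ ≤ ((f + 6) ^ 2 * 4) * Y := Nat.mul_le_mul_right _ this
        _ = _ := by ring
    omega
  have hcount : ∀ k ≤ f.size, 4 * levCount f k ≤ Y := by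
    intro k hk
    refine le_trans ?_ (levCount_le hk)
    rw [mul_comm]
    refine Nat.mul_le_mul_left _ ?_
    calc 4 = 2 ^ 2 := rfl
      _ ≤ _ := Nat.pow_le_pow_right (by norm_num) (Nat.le_add_left_of_le (by norm_num))
  have hX : ∀ k < f.size, levCount f k * 2 ^ lev (f / 2 ^ k) * 2 ^ lev (f / 2 ^ k) ≤ Y := by
    intro k hk
    have := levCount_le (f := f) (k := k + 1) hk
    rwa [div_two_pow_succ] at this
  have hBM : M + 4 ≤ B := by have := hbase 0 (Nat.zero_le _); simp only [levBase] at this; omega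
  have hY1 : 1 ≤ Y := by omega
  have hfB : f ≤ B := by have := hbase 0 (Nat.zero_le _); simp only [levBase] at this; omega
  have hY5 : 2 ^ (f + 5) ≤ Y := Nat.le_mul_of_pos_right _ (by positivity)
  have hsa : a.size ≤ W ^ 2 * (2 ^ (f + 5)) :=
    size_le_of_lt ha (Nat.le_mul_of_pos_left _ (by positivity))
  have hsb : b.size ≤ W ^ 2 * (2 ^ (f + 5)) :=
    size_le_of_lt hb (Nat.le_mul_of_pos_left _ (by positivity))
  have hWS : W ^ 2 ≤ W ^ 2 * 2 ^ (f + 5) := Nat.le_mul_of_pos_right _ (by positivity)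
  have sS' : ∀ x, x ≤ B → x.size ≤ W ^ 2 * 2 ^ (f + 5) := fun x hx => (sS x hx).trans hWS
  let I : ℕ → State → State → Prop := fun k σ₁ σ₂ => Frame 40 σ₁ σ₂ ∧ σ₂.reg 52 = 2 * levCount f k ∧
    σ₂.reg 54 = levBase f M k ∧ σ₂.reg 58 = k ∧ ∀ x < M, σ₂.mem x = σ₁.mem x
  let Id : ℕ → State → Prop := fun k σ₂ => I k σ σ₂ ∧ σ₂.reg 50 = f / 2 ^ k ∧
    ∀ u < 2 * levCount f k, σ₂.mem (levBase f M k + 2 * levCount f k + u) = levVal f a b k u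
  let Iu : ℕ → State → Prop := fun k σ₂ => I k σ σ₂ ∧
    ∀ u < levCount f k, σ₂.mem (levBase f M k + 2 * levCount f k + u) =
      levVal f a b k u * levVal f a b k (u + levCount f k)
  have hinit : Run (54 ::= .var 30 ;; 52 ::= .lit 2 ;; 50 ::= .var 31 ;; 58 ::= .lit 0 ;;
      .store (.var 30 +ₑ .lit 2) (.var 40) ;; .store (.var 30 +ₑ .lit 3) (.var 41)) σ
      (1000 * (W ^ 2 * 2 ^ (f + 5))) (Id 0) := by
    refine (Run.of_lf (W := W) (S := W ^ 2 * 2 ^ (f + 5)) (by omega) hWS rfl ?_ ?_).mono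
      (T := _ * (W ^ 2 * 2 ^ (f + 5)))
      (Nat.mul_le_mul_right _ ?_) (fun _ h => h)
    · simp (disch := omega) [h30, h31, h40, h41, hsa, hsb, sS', sS' f hfB]
    · simp only [Id, I, levCount, levBase, levVal]
      simp [h30, h31, h40, h41, Frame.refl]
      constructor
      · intro x hx
        rw [Function.update_of_ne (by omega), Function.update_of_ne (by omega)]
      · intro u hu
        interval_cases u
        · simp
        · simp
    · simp [Prog.wt, Expr.nodes]
  have hdown : ∀ σ₁, Id 0 σ₁ → Run (.while (.var 50) downLevel) σ₁
      (W * (1 + (1 + W) + 200000 * (W ^ 3 * (2 * Y))) + (1 + (1 + W))) (Id f.size) := by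
    intro σ₁ h
    refine (Run.while (n := f.size) Id h ?_ ?_ ?_).mono
      (Nat.add_le_add_right (Nat.mul_le_mul_right _ (hfs.trans hfW)) _) (fun _ h => h)
    · rintro k σ₂ - h2
      have : (f / 2 ^ k).size ≤ W := sB _ ((Nat.div_le_self _ _).trans (by nlinarith))
      simpa [Expr.cost, h2.2.1] using this
    · rintro k σ₂ hk h2 h0
      simp only [Expr.eval, h2.2.1] at h0
      have := div_two_pow_eq_zero_iff.mp h0
      rwa [show k = f.size by omega] at h2
    · rintro k σ₂ hk ⟨⟨a0, a52, a54, a58, am⟩, a50, ar⟩ h0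
      simp only [Expr.eval, a50, ne_eq, div_two_pow_eq_zero_iff] at h0
      refine ⟨by omega, ?_⟩
      have hb1 := hbase (k + 1) (by omega)
      have hc1 := hcount (k + 1) (by omega)
      have hx1 := hX k (by omega)
      have e2 : 2 * levCount f k * 2 ^ lev (f / 2 ^ k) = 2 * levCount f (k + 1) := by
        rw [levCount, mul_assoc]
      have hfk : f / 2 ^ k ≤ f := Nat.div_le_self _ _
      refine (Prog.downLevel_run (W := W) (B := B) (Z := levVal f a b k) (by omega) a50 a52 a54 a58
        (by have := levCount_pos f k; omega) hB ?_ ar (levVal_lt ha hb k)).mono ?_ ?_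
      · rw [e2]
        simp only [levBase] at hb1
        omega
      · rw [show 2 * levCount f k * 2 ^ lev (f / 2 ^ k) * 2 ^ lev (f / 2 ^ k) =
          2 * (levCount f k * 2 ^ lev (f / 2 ^ k) * 2 ^ lev (f / 2 ^ k)) by ring]
        gcongr
      · rintro σ₃ ⟨b0, b50, b52, b54, b58, br, bm⟩
        rw [e2] at b52 b54 br
        refine ⟨⟨a0.trans b0 (by norm_num), b52, b54, b58, fun x hx => ?_⟩, ?_, ?_⟩
        · rw [bm x (lt_of_lt_of_le hx (levBase_mono f M k)), am x hx]
        · rw [b50, div_two_pow_succ]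
        · exact br
  have hprod : ∀ σ₁, Id f.size σ₁ → Run ((59 ::= .var 52 >>ₑ .lit 1 ;; 62 ::= .var 54 +ₑ .var 52) ;;
      .fill 70 59 (.store (.var 62 +ₑ .var 70)
        (.read (.var 62 +ₑ .var 70) *ₑ .read (.var 62 +ₑ .var 70 +ₑ .var 59)))) σ₁
      (100 * W ^ 2 + Y * (2000 * W ^ 2)) (Iu f.size) := by
    rintro σ₁ ⟨⟨a0, a52, a54, a58, am⟩, a50, ar⟩
    have hb1 := hbase f.size le_rfl
    have hc1 := hcount f.size le_rfl
    have hc0 := levCount_pos f f.size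
    -- At the bottom f / 2^k = 0, so the factors have 2^5 = 32 ≤ W bits and the machine's own
    -- multiplication is affordable.
    have hlt : ∀ u, levVal f a b f.size u < 2 ^ 32 := by
      intro u
      have := levVal_lt ha hb f.size u
      rwa [div_two_pow_eq_zero_iff.mpr le_rfl] at this
    set n := levCount f f.size
    set D := levBase f M f.size
    refine Run.seq (Q := fun σ₂ => Frame 59 σ₁ σ₂ ∧ σ₂.mem = σ₁.mem ∧ σ₂.reg 59 = n ∧
      σ₂.reg 62 = D + 2 * n) ((Run.of_lf (W := W) (S := W ^ 2) (by omega) le_rfl rfl ?_ ?_).mono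
        (T := _ * W ^ 2) (Nat.mul_le_mul_right _ ?_) fun _ h => h) ?_
    · simp (disch := omega) [a52, a54, sS, show 1 ≤ W ^ 2 by omega]
    · simp [a52, a54, Frame.refl]
    · simp [Prog.wt, Expr.nodes]
    · rintro σ₂ ⟨b0, bm, b59, b62⟩
      refine (Run.fill (R := 70) (N := n) (b := D + 2 * n) (T := 1000 * W ^ 2) (S := W ^ 2)
        (fun u => levVal f a b f.size u * levVal f a b f.size (u + n)) le_rfl (by norm_num) b59
        (by omega) (sS _ (by omega)) ?_).mono ((fill_cost_le hc0 le_rfl).trans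
          (Nat.mul_le_mul (by omega) (Nat.mul_le_mul_right _ (by norm_num)))) ?_
      · intro k σ₃ hk hf hik hm
        have r59 := (hf.1 59 (by norm_num)).trans b59
        have r62 := (hf.1 62 (by norm_num)).trans b62
        have m1 : σ₃.mem (D + 2 * n + k) = levVal f a b f.size k := by
          rw [hm, fillMem_out (by omega), bm, ar k (by omega)]
        have m2 : σ₃.mem (D + 2 * n + k + n) = levVal f a b f.size (k + n) := by
          rw [hm, fillMem_out (by omega), bm, Nat.add_assoc _ k n, ar (k + n) (by omega)]
        refine (Run.of_lf (W := W) (S := W ^ 2) (by omega) le_rfl rfl ?_ ?_).mono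
          (T := _ * W ^ 2) (Nat.mul_le_mul_right _ ?_) fun _ h => h
        · have z1 := size_le_of_lt (hlt k) hW
          have z2 := size_le_of_lt (hlt (k + n)) hW
          simp (disch := omega) [r59, r62, hik, m1, m2, sB, sS, z1, z2]
        · simp [r59, r62, hik, m1, m2, hf]
        · simp [Prog.wt, Expr.nodes]
      · rintro σ₃ ⟨c0, cm⟩
        have g : Frame 59 σ₁ σ₃ := b0.trans c0 (by norm_num)
        refine ⟨⟨a0.trans g (by norm_num), (g.1 52 (by norm_num)).trans a52,
          (g.1 54 (by norm_num)).trans a54, (g.1 58 (by norm_num)).trans a58, ?_⟩, ?_⟩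
        · intro x hx
          have := levBase_mono f M f.size
          rw [cm, fillMem_out (by omega), bm, am x hx]
        · intro u hu
          rw [cm, fillMem_in hu]
  have hup : ∀ σ₁, Iu f.size σ₁ → Run (.while (.var 58) upLevel) σ₁
      (W * (1 + (1 + W) + 200000 * (W ^ 3 * Y)) + (1 + (1 + W))) (Iu 0) := by
    intro σ₁ h
    refine (Run.while (n := f.size) (fun k σ => k ≤ f.size ∧ Iu (f.size - k) σ) (by simpa using h)
      ?_ ?_ ?_).mono
      (Nat.add_le_add_right (Nat.mul_le_mul_right _ (hfs.trans hfW)) _) (fun _ h => h)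
    · rintro k σ₂ - ⟨-, h2⟩
      have : (f.size - k).size ≤ W := sB _ (by
        have h1 : f.size - k ≤ f := (Nat.sub_le _ _).trans hfs
        nlinarith)
      simpa [Expr.cost, h2.1.2.2.2.1] using this
    · rintro k σ₂ hk ⟨-, h2⟩ h0
      simp only [Expr.eval, h2.1.2.2.2.1] at h0
      rwa [h0] at h2
    · rintro k' σ₂ hk' ⟨-, ⟨a0, a52, a54, a58, am⟩, ar⟩ h0
      simp only [Expr.eval, a58] at h0
      refine ⟨by omega, ?_⟩
      obtain ⟨k, hk⟩ : ∃ k, f.size - k' = k + 1 := ⟨f.size - k' - 1, by omega⟩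
      rw [hk] at a52 a54 a58 ar
      have hk1 : f.size - (k' + 1) = k := by omega
      have hb1 := hbase (k + 1) (by omega)
      have hc1 := hcount (k + 1) (by omega)
      have hx1 := hX k (by omega)
      have hfk : f / 2 ^ k ≤ f := Nat.div_le_self _ _
      rw [levBase] at a54
      simp only [levCount] at a52 a54 ar hc1
      simp only [levBase, levCount] at hb1 ar
      refine (Prog.upLevel_run (W := W) (B := B) (Z := levVal f a b k) (f₀ := f) (by omega)
        ((a0.1 31 (by norm_num)).trans h31) rfl a52 a54 a58 (levCount_pos f k) hfW hB (by omega) ar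
        (levVal_lt ha hb k)).mono ?_ ?_
      · gcongr
      · rintro σ₃ ⟨b0, b52, b54, b58, br, bm⟩
        refine ⟨by omega, ?_⟩
        rw [hk1]
        exact ⟨⟨a0.trans b0 (by norm_num), b52, b54, b58, fun x hx => by
          rw [bm x (lt_of_lt_of_le hx (levBase_mono f M k)), am x hx]⟩, br⟩
  have hlast : ∀ σ₁, Iu 0 σ₁ → Run (40 ::= .read (.var 30 +ₑ .lit 2)) σ₁
      (1000 * (W ^ 2 * (2 * 2 ^ (f + 5)))) (fun σ' => Frame 40 σ σ' ∧ σ'.reg 40 = a * b ∧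
      ∀ x < M, σ'.mem x = σ.mem x) := by
    rintro σ₁ ⟨⟨a0, a52, a54, a58, am⟩, ar⟩
    have r30 := (a0.1 30 (by norm_num)).trans h30
    have hr : σ₁.mem (M + 2) = a * b := by
      have := ar 0 (by simp [levCount])
      simpa [levCount, levBase, levVal] using this
    have hab : (a * b).size ≤ W ^ 2 * (2 * 2 ^ (f + 5)) := by
      refine size_le_of_lt (a := 2 * 2 ^ (f + 5)) ?_ (Nat.le_mul_of_pos_left _ (by positivity))
      rw [two_mul, pow_add]
      exact Nat.mul_lt_mul'' ha hb
    have hWS2 : W ^ 2 ≤ W ^ 2 * (2 * 2 ^ (f + 5)) := Nat.le_mul_of_pos_right _ (by positivity)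
    have sS2 : ∀ x, x ≤ B → x.size ≤ W ^ 2 * (2 * 2 ^ (f + 5)) := fun x hx => (sS x hx).trans hWS2
    refine (Run.of_lf (W := W) (S := W ^ 2 * (2 * 2 ^ (f + 5))) (by omega) hWS2 rfl ?_ ?_).mono
      (T := _ * (W ^ 2 * (2 * 2 ^ (f + 5)))) (Nat.mul_le_mul_right _ ?_) (fun _ h => h)
    · simp (disch := omega) [r30, hr, hab, sS2]
    · simp only [Prog.den, Expr.eval, Op.eval, r30, hr]
      exact ⟨a0.setReg le_rfl, by simp, am⟩
    · simp [Prog.wt, Expr.nodes]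
  have assoc : ∀ {p q r : Prog} {σ : State} {T : ℕ} {Q : State → Prop}, Run ((p ;; q) ;; r) σ T Q →
      Run (p ;; q ;; r) σ T Q := by
    rintro p q r σ T Q ⟨t, σ', h1, h2, h3⟩
    cases h1 with
    | seq h4 h5 =>
      cases h4 with
      | seq h6 h7 => exact ⟨_, σ', .seq h6 (.seq h7 h5), by omega, h3⟩
  refine (Run.seq hinit fun σ₁ h₁ => Run.seq (hdown σ₁ h₁) fun σ₂ h₂ => assoc (Run.seq (hprod σ₂ h₂)
    fun σ₃ h₃ => Run.seq (hup σ₃ h₃) hlast)).mono ?_ (fun _ h => h)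
  -- 7776 = 32 * 243, with 32 from 2^(f+5) and 243 from `pow_size_le`.
  have hYW : Y ≤ 7776 * (W ^ 5 * 2 ^ f) := by
    have := pow_size_le hfW (by omega)
    calc Y ≤ 2 ^ (f + 5) * (243 * W ^ 5) := Nat.mul_le_mul_left _ this
      _ = _ := by ring
  have t1 : W ^ 2 * 2 ^ (f + 5) ≤ W ^ 4 * Y := Nat.mul_le_mul (Nat.pow_le_pow_right (by omega) (by norm_num)) hY5
  have t2 : W ^ 2 ≤ W ^ 4 * Y := (Nat.pow_le_pow_right (by omega) (by norm_num)).trans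
    (Nat.le_mul_of_pos_right _ hY1)
  have t3 : Y * W ^ 2 ≤ W ^ 4 * Y := by
    rw [mul_comm]; exact Nat.mul_le_mul_right _ (Nat.pow_le_pow_right (by omega) (by norm_num))
  have t4 : W ^ 4 * Y ≤ 7776 * (W ^ 9 * 2 ^ f) := by
    calc _ ≤ W ^ 4 * (7776 * (W ^ 5 * 2 ^ f)) := Nat.mul_le_mul_left _ hYW
      _ = _ := by ring
  have t5 : W * (1 + (1 + W) + 200000 * (W ^ 3 * (2 * Y))) = 2 * W + W ^ 2 + 400000 * (W ^ 4 * Y) := by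
    ring
  have t6 : W * (1 + (1 + W) + 200000 * (W ^ 3 * Y)) = 2 * W + W ^ 2 + 200000 * (W ^ 4 * Y) := by
    ring
  have t7 : W ^ 2 * (2 * 2 ^ (f + 5)) = 2 * (W ^ 2 * 2 ^ (f + 5)) := by ring
  have t8 : Y * (2000 * W ^ 2) = 2000 * (Y * W ^ 2) := by ring
  rw [t5, t6, t7, t8]
  generalize W ^ 9 * 2 ^ f = G at *
  norm_num
  omega

/-! ### Product trees and remainder trees -/

open Finset in
/-- The node at depth `j` and position `u` of the product tree with the `2 ^ h` leaves `L`. -/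
def node (h : ℕ) (L : ℕ → ℕ) (j u : ℕ) : ℕ := ∏ t ∈ range (2 ^ (h - j)), L (u * 2 ^ (h - j) + t)

theorem node_leaf (h : ℕ) (L : ℕ → ℕ) (u : ℕ) : node h L h u = L u := by simp [node]

theorem node_root (h : ℕ) (L : ℕ → ℕ) : node h L 0 0 = ∏ t ∈ Finset.range (2 ^ h), L t := by
  simp [node]

theorem node_split {h j : ℕ} (L : ℕ → ℕ) (u : ℕ) (hj : j < h) :
    node h L j u = node h L (j + 1) (2 * u) * node h L (j + 1) (2 * u + 1) := by
  obtain ⟨d, rfl⟩ : ∃ d, h = j + 1 + d := ⟨h - (j + 1), by omega⟩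
  simp only [node, show j + 1 + d - j = d + 1 by omega, show j + 1 + d - (j + 1) = d by omega]
  rw [pow_succ, mul_two, Finset.prod_range_add]
  congr 1 <;> refine Finset.prod_congr rfl fun t _ => congrArg L (by ring)

theorem node_lt {h g j u : ℕ} {L : ℕ → ℕ} (hL : ∀ t < 2 ^ h, L t < 2 ^ 2 ^ g) (hj : j ≤ h)
    (hu : u < 2 ^ j) : node h L j u < 2 ^ 2 ^ (g + h - j) := by
  have hle : ∀ t ∈ Finset.range (2 ^ (h - j)), L (u * 2 ^ (h - j) + t) ≤ 2 ^ 2 ^ g - 1 := by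
    intro t ht
    have ht := Finset.mem_range.mp ht
    have h2 : 2 ^ h = 2 ^ j * 2 ^ (h - j) := by rw [← pow_add]; congr 1; omega
    have := hL (u * 2 ^ (h - j) + t) (by rw [h2]; nlinarith)
    omega
  calc node h L j u ≤ (2 ^ 2 ^ g - 1) ^ 2 ^ (h - j) := by
        simpa [node] using Finset.prod_le_pow_card _ _ _ hle
    _ < (2 ^ 2 ^ g) ^ 2 ^ (h - j) := by
        have : 1 ≤ 2 ^ 2 ^ g := Nat.one_le_two_pow
        exact Nat.pow_lt_pow_left (by omega) (by positivity)
    _ = 2 ^ 2 ^ (g + h - j) := by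
        rw [← pow_mul, ← pow_add]; congr 2; omega

theorem leaf_dvd_node {h j : ℕ} (L : ℕ → ℕ) (i : ℕ) : L i ∣ node h L j (i / 2 ^ (h - j)) := by
  have h2 := Nat.div_add_mod i (2 ^ (h - j))
  have h1 : L i = L (i / 2 ^ (h - j) * 2 ^ (h - j) + i % 2 ^ (h - j)) := by
    rw [mul_comm, h2]
  rw [h1]
  exact Finset.dvd_prod_of_mem (fun t => L (i / 2 ^ (h - j) * 2 ^ (h - j) + t))
    (Finset.mem_range.mpr (Nat.mod_lt _ (by positivity)))

theorem node_odd {h j u : ℕ} {L : ℕ → ℕ} (hL : ∀ t, Odd (L t)) : Odd (node h L j u) := by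
  unfold node
  exact Finset.prod_induction _ Odd (fun _ _ => Odd.mul) odd_one (fun _ _ => hL _)

/-! ### Montgomery reduction and gcds in the remainder tree. -/

/-- Newton iteration for the inverse of `-X` modulo `2 ^ N`. -/
def newton (N X : ℕ) : ℕ → ℕ
  | 0 => 1
  | t + 1 => newton N X t * ((2 + X * newton N X t) % 2 ^ N) % 2 ^ N

theorem newton_lt {N : ℕ} (hN : 1 ≤ N) (X t : ℕ) : newton N X t < 2 ^ N := by
  cases t with
  | zero => exact Nat.one_lt_two_pow (by omega)
  | succ t => exact Nat.mod_lt _ (by positivity)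

/-- If e = X y + 1, the new iterate y (2 + X y) has error X y (2 + X y) + 1 = e^2, so the power of
two dividing the error is squared in each step. The start y = 1 works because X + 1 is even. -/
theorem newton_spec {N X t : ℕ} (hX : Odd X) (ht : 2 ^ t ≤ N) :
    2 ^ 2 ^ t ∣ X * newton N X t + 1 := by
  induction t with
  | zero =>
    obtain ⟨a, rfl⟩ := hX
    exact ⟨a + 1, by simp [newton]; ring⟩
  | succ t ih =>
    have ih := ih ((Nat.pow_le_pow_right (by norm_num) (Nat.le_succ t)).trans ht)
    have hd : 2 ^ 2 ^ (t + 1) ∣ 2 ^ N := pow_dvd_pow _ ht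
    have h1 : X * newton N X (t + 1) + 1 ≡
        (X * newton N X t + 1) * (X * newton N X t + 1) [MOD 2 ^ N] := by
      have : (X * newton N X t + 1) * (X * newton N X t + 1) =
        X * (newton N X t * (2 + X * newton N X t)) + 1 := by ring
      rw [this]
      exact ((((Nat.mod_modEq _ _).trans ((Nat.mod_modEq _ _).mul_left _))).mul_left X).add_right 1
    rw [(h1.of_dvd hd).dvd_iff dvd_rfl, pow_succ, mul_two, pow_add]
    exact mul_dvd_mul ih ih

/-- Montgomery reduction of `R` modulo the odd number `X`, for words of `2 ^ e` bits. -/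
def redc (e R X : ℕ) : ℕ :=
  let A := (R + R % 2 ^ 2 ^ e * newton (2 ^ e) X e % 2 ^ 2 ^ e * X) / 2 ^ 2 ^ e
  if A < 2 ^ 2 ^ e then A else A - X

/-- With N = 2^(2^e), R < N^2 and q < N the quotient (R + q X) / N is below N + X, so a single
subtraction suffices. The result is bounded by N, not by X, which is all the tree needs. -/
theorem redc_lt {e R X : ℕ} (hR : R < 2 ^ 2 ^ (e + 1)) (hX : X < 2 ^ 2 ^ e) :
    redc e R X < 2 ^ 2 ^ e := by
  have hq : R % 2 ^ 2 ^ e * newton (2 ^ e) X e % 2 ^ 2 ^ e < 2 ^ 2 ^ e :=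
    Nat.mod_lt _ (by positivity)
  rw [pow_succ, mul_two, pow_add] at hR
  simp only [redc]
  generalize R % 2 ^ 2 ^ e * newton (2 ^ e) X e % 2 ^ 2 ^ e = q at *
  generalize 2 ^ 2 ^ e = N at *
  split_ifs with h
  · exact h
  · have h1 : R + q * X < N * (N + X) := by nlinarith
    have h2 := Nat.div_lt_of_lt_mul h1
    omega

/-- q is chosen with q X ≡ -R modulo N, so the division by N is exact and N * A ≡ R modulo X. A
divisor y of the odd number X is coprime to N, so neither the factor N nor a multiple of X changes
the gcd with y. -/
theorem redc_gcd {e R X y : ℕ} (hX : Odd X) (hXN : X < 2 ^ 2 ^ e) (hy : y ∣ X) : Nat.gcd y (redc e R X) = Nat.gcd y R := by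
  have hdvd : 2 ^ 2 ^ e ∣ R + R % 2 ^ 2 ^ e * newton (2 ^ e) X e % 2 ^ 2 ^ e * X := by
    have h1 := newton_spec (t := e) hX le_rfl
    have h2 : R + R % 2 ^ 2 ^ e * newton (2 ^ e) X e % 2 ^ 2 ^ e * X ≡
        R * (X * newton (2 ^ e) X e + 1) [MOD 2 ^ 2 ^ e] := by
      have : R * (X * newton (2 ^ e) X e + 1) = R + R * newton (2 ^ e) X e * X := by ring
      rw [this]
      exact (((Nat.mod_modEq _ _).trans ((Nat.mod_modEq _ _).mul_right _)).mul_right X).add_left R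
    exact (h2.dvd_iff dvd_rfl).mpr (h1.mul_left R)
  obtain ⟨A, hA⟩ := hdvd
  have hyo : Nat.Coprime y (2 ^ 2 ^ e) :=
    Nat.Coprime.pow_right _ (Nat.coprime_two_right.mpr (hX.of_dvd_nat hy))
  have hAeq : (R + R % 2 ^ 2 ^ e * newton (2 ^ e) X e % 2 ^ 2 ^ e * X) / 2 ^ 2 ^ e = A := by
    rw [hA, Nat.mul_div_cancel_left _ (by positivity)]
  have hgA : Nat.gcd y A = Nat.gcd y R := by
    obtain ⟨z, rfl⟩ := hy
    rw [← Nat.Coprime.gcd_mul_left_cancel_right A hyo.symm, ← hA]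
    rw [show ∀ q, R + q * (y * z) = R + y * (z * q) by intro q; ring]
    exact Nat.gcd_add_mul_left_right _ _ _
  simp only [redc, hAeq]
  split_ifs with h
  · exact hgA
  · have hXA : X ≤ A := by omega
    rw [← hgA]
    obtain ⟨z, rfl⟩ := hy
    conv_rhs => rw [show A = A - y * z + y * z by omega]
    exact (Nat.gcd_add_mul_left_right _ _ _).symm

/-- The nodes of the remainder tree that belongs to the product tree `X` and the root `P`. -/
def rtree (g h : ℕ) (X : ℕ → ℕ → ℕ) (P : ℕ) : ℕ → ℕ → ℕ
  | 0, _ => P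
  | j + 1, u => redc (g + h - (j + 1)) (rtree g h X P j (u / 2)) (X (j + 1) u)

/-- A node at depth j + 1 works with half the word length of its parent, so the parent's bound is
exactly the double-length bound required by `redc_lt`. -/
theorem rtree_lt {g h j u P : ℕ} {L : ℕ → ℕ} (hL : ∀ t < 2 ^ h, L t < 2 ^ 2 ^ g)
    (hP : P < 2 ^ 2 ^ (g + h)) (hj : j ≤ h) (hu : u < 2 ^ j) :
    rtree g h (node h L) P j u < 2 ^ 2 ^ (g + h - j) := by
  induction j generalizing u with
  | zero => simpa [rtree] using hP
  | succ j ih =>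
    refine redc_lt ?_ (node_lt hL hj hu)
    have := ih (u := u / 2) (by omega) (by rw [pow_succ] at hu; omega)
    rwa [show g + h - (j + 1) + 1 = g + h - j by omega]

/-- A divisor of leaf `i` divides every node of the product tree on the path to that leaf, so
`redc_gcd` applies at each step of the descent. -/
theorem rtree_gcd {g h i y P : ℕ} {L : ℕ → ℕ} (hL : ∀ t < 2 ^ h, L t < 2 ^ 2 ^ g)
    (hodd : ∀ t, Odd (L t)) (hi : i < 2 ^ h) (hy : y ∣ L i) :
    Nat.gcd y (rtree g h (node h L) P h i) = Nat.gcd y P := by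
  have key : ∀ j ≤ h, Nat.gcd y (rtree g h (node h L) P j (i / 2 ^ (h - j))) = Nat.gcd y P := by
    intro j
    induction j with
    | zero => intro _; rfl
    | succ j ih =>
      intro hj
      have hlt : i / 2 ^ (h - (j + 1)) < 2 ^ (j + 1) := by
        rw [Nat.div_lt_iff_lt_mul (by positivity), ← pow_add]
        rwa [show j + 1 + (h - (j + 1)) = h by omega]
      rw [rtree, redc_gcd (node_odd hodd) (node_lt hL hj hlt) (hy.trans (leaf_dvd_node L i)),
        Nat.div_div_eq_div_mul, ← pow_succ, show h - (j + 1) + 1 = h - j by omega]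
      exact ih (by omega)
  simpa using key h le_rfl

/-! ### More rules for programs -/

/-- Loops with an invariant indexed by the number of iterations, whose costs are summed up. -/
theorem Run.while_sum {e : Expr} {p : Prog} {σ : State} {Tc n : ℕ} {T : ℕ → ℕ}
    (I : ℕ → State → Prop) {Q : State → Prop} (h0 : I 0 σ)
    (hc : ∀ k σ, k ≤ n → I k σ → e.cost σ ≤ Tc)
    (hQ : ∀ k σ, k ≤ n → I k σ → e.eval σ = 0 → Q σ)
    (hb : ∀ k σ, k ≤ n → I k σ → e.eval σ ≠ 0 → k < n ∧ Run p σ (T k) (I (k + 1))) :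
    Run (.while e p) σ (∑ k ∈ Finset.range n, (1 + Tc + T k) + (1 + Tc)) Q := by
  have key : ∀ (d k : ℕ) (σ : State), k + d = n → I k σ →
      Run (.while e p) σ (∑ t ∈ Finset.range d, (1 + Tc + T (k + t)) + (1 + Tc)) Q := by
    intro d
    induction d with
    | zero =>
      intro k σ hk hI
      by_cases h : e.eval σ = 0
      · exact ⟨_, σ, .whileFalse h, by have := hc k σ (by omega) hI; omega,
          hQ k σ (by omega) hI h⟩
      · have := (hb k σ (by omega) hI h).1
        omega
    | succ d ih =>
      intro k σ hk hI
      have hcost := hc k σ (by omega) hI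
      rw [Finset.sum_range_succ']
      by_cases h : e.eval σ = 0
      · exact ⟨_, σ, .whileFalse h, by omega, hQ k σ (by omega) hI h⟩
      · obtain ⟨hlt, t, σ', h1, h2, h3⟩ := hb k σ (by omega) hI h
        obtain ⟨u, σ'', h4, h5, h6⟩ := ih (k + 1) σ' (by omega) h3
        refine ⟨_, σ'', .whileTrue h h1 h4, ?_, h6⟩
        simp only [Nat.add_right_comm k 1, Nat.add_assoc k _ 1] at h5 ⊢
        simp only [add_zero]
        omega
  simpa using key n 0 σ (by omega) h0

/-- Fill consecutive memory cells below `M`, with no regard to the memory from `M` on. -/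
theorem Run.fillBelow {i n R N b M T S : ℕ} {p : Prog} {σ₀ : State} (F : ℕ → ℕ)
    (hi : R ≤ i) (hn : n < R) (hN : σ₀.reg n = N) (hS : 1 ≤ S) (hNS : N.size ≤ S)
    (hp : ∀ k σ, k < N → Frame R σ₀ σ → σ.reg i = k →
      (∀ x < M, σ.mem x = fillMem σ₀.mem b k F x) →
      Run p σ T (fun σ' => Frame R σ₀ σ' ∧ σ'.reg i = k ∧
        ∀ x < M, σ'.mem x = Function.update σ.mem (b + k) (F k) x)) :
    Run (.fill i n p) σ₀ (N * (T + 74 * S) + 39 * S)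
      (fun σ' => Frame R σ₀ σ' ∧ ∀ x < M, σ'.mem x = fillMem σ₀.mem b N F x) := by
  have h1 : Run (i ::= .lit 0) σ₀ 2 (fun σ' => σ' = σ₀.setReg i 0) :=
    ⟨_, _, .set _ _ _, by simp [Expr.cost], rfl⟩
  have h2 : ∀ σ', σ' = σ₀.setReg i 0 → Run (.loop i n p) σ' ((N - 0) * (T + 74 * S) + 37 * S)
      (fun σ' => (Frame R σ₀ σ' ∧ ∀ x < M, σ'.mem x = fillMem σ₀.mem b N F x) ∧ σ'.reg i = N) := by
    rintro _ rfl
    refine Run.loop (I := fun k σ => (Frame R σ₀ σ ∧ ∀ x < M, σ.mem x = fillMem σ₀.mem b k F x) ∧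
      σ.reg i = k) (Nat.zero_le N) hS hNS ?_ ?_ ?_
    · rintro k σ ⟨⟨h, _⟩, h'⟩
      exact ⟨h', (h.1 n hn).trans hN⟩
    · exact ⟨⟨(Frame.refl R σ₀).setReg hi, by simp [fillMem_zero]⟩, by simp⟩
    · rintro k σ - hk ⟨⟨hf, hm⟩, hik⟩
      refine (hp k σ hk hf hik hm).mono le_rfl ?_
      rintro σ' ⟨hf', hi', hm'⟩
      refine ⟨hi', ⟨hf'.setReg hi, fun x hx => ?_⟩, by simp⟩
      rw [State.setReg_mem, hm' x hx, ← fillMem_succ]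
      simp only [Function.update_apply, hm x hx]
  refine (Run.seq h1 h2).mono ?_ (fun _ h => h.1)
  simp only [Nat.sub_zero]
  omega

/-! ### Parameters, memory layout and the programs for the trees. -/

/-- The parameters of the main algorithm: tables of `2 ^ h` cells whose entries have at most `2 ^ g`
bits, the beginning `M` of the working space of the multiplication, and the word length `W`. -/
structure Params (g h M W : ℕ) : Prop where
  two_le : 2 ≤ h
  five_le : 5 ≤ g
  le_W : 32 ≤ W
  pow_le_W : 2 ^ g ≤ W
  le_pow : 2 * h ≤ 2 ^ g
  add_le_W : 2 * (g + h) + 4 ≤ W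
  -- Memory in units of 2^h cells: inputs in unit 0, sieve flags in unit 1, the product tree of the
  -- inputs in units 2 and 3, the product tree for the current bit in units 4 and 5, then two units
  -- for each of the h remainder trees. Trees are in heap order. Beyond `M` lies the working space
  -- of the multiplication, all of whose addresses are words by the next field.
  hM : M = (6 + 2 * h) * 2 ^ h
  size_le : (M + (g + h + 6) ^ 2 * (4 * (2 ^ (g + h + 5) * 32 ^ (g + h).size))).size ≤ W

theorem Params.size_le_of_le {g h M W x : ℕ} (H : Params g h M W) (hx : x ≤ M + 4) : x.size ≤ W := by
  refine LogRAM.size_le_of_le (hx.trans (Nat.add_le_add_left ?_ _)) H.size_le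
  calc 4 = 1 * (4 * (1 * 1)) := rfl
    _ ≤ _ := Nat.mul_le_mul (Nat.one_le_pow _ _ (by omega)) (Nat.mul_le_mul_left _
      (Nat.mul_le_mul Nat.one_le_two_pow (Nat.one_le_pow _ _ (by norm_num))))

/-- Multiplication of the values of two expressions; register `rf` holds the size parameter. -/
def Prog.mulCall (rf : ℕ) (e₁ e₂ : Expr) : Prog :=
  (40 ::= e₁ ;; 41 ::= e₂ ;; 30 ::= .var 4 ;; 31 ::= .var rf) ;; mulProg

/-- The second operand is evaluated after register 40 has received the first one. The premises allow
operands that are extracted from longer numbers by shifts. -/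
theorem Prog.mulCall_run {σ : State} {g h M W a b f rf : ℕ} {e₁ e₂ : Expr} (H : Params g h M W)
    (h4 : σ.reg 4 = M) (hrf : rf < 30) (hf : σ.reg rf = f) (hfg : f ≤ g + h)
    (n₁ : e₁.nodes ≤ 10) (n₂ : e₂.nodes ≤ 10) (ha : e₁.eval σ = a)
    (hb : e₂.eval (σ.setReg 40 a) = b) (o₁ : e₁.Ok W (W ^ 2 * 2 ^ (f + 8)) σ)
    (o₂ : e₂.Ok W (W ^ 2 * 2 ^ (f + 8)) (σ.setReg 40 a))
    (la : a < 2 ^ 2 ^ (f + 5)) (lb : b < 2 ^ 2 ^ (f + 5)) :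
    Run (mulCall rf e₁ e₂) σ (2 * 10 ^ 10 * (W ^ 9 * 2 ^ f)) (fun σ' => Frame 30 σ σ' ∧
      σ'.reg 40 = a * b ∧ ∀ x < M, σ'.mem x = σ.mem x) := by
  have h32 := H.le_W
  have hWS : W ^ 2 ≤ W ^ 2 * 2 ^ (f + 8) := Nat.le_mul_of_pos_right _ (by positivity)
  have hW' : W ≤ W ^ 2 := by nlinarith
  have sM : M.size ≤ W := H.size_le_of_le (by omega)
  have sf : f.size ≤ W := size_le_of_lt (a := f) Nat.lt_two_pow_self (by have := H.add_le_W; omega)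
  refine (Run.seq (Q := fun σ₁ => Frame 30 σ σ₁ ∧ σ₁.reg 30 = M ∧ σ₁.reg 31 = f ∧ σ₁.reg 40 = a ∧
    σ₁.reg 41 = b ∧ σ₁.mem = σ.mem) ((Run.of_lf (W := W) (S := W ^ 2 * 2 ^ (f + 8)) (by omega) hWS rfl
      ?_ ?_).mono (T := _ * (W ^ 2 * 2 ^ (f + 8))) (T' := 1000 * (W ^ 2 * 2 ^ (f + 8))) (Nat.mul_le_mul_right _ ?_) fun _ h => h) ?_).mono
      (T := 1000 * (W ^ 2 * 2 ^ (f + 8)) + 10 ^ 10 * (W ^ 9 * 2 ^ f)) ?_ fun _ h => h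
  · simp only [Prog.Ok, Prog.den, ha, hb]
    refine ⟨o₁, o₂, ?_, ?_⟩
    · simp [h4]; omega
    · simp [hf, show rf ≠ 30 by omega, show rf ≠ 41 by omega, show rf ≠ 40 by omega]; omega
  · simp only [Prog.den, ha, hb]
    simp [h4, hf, show rf ≠ 30 by omega, show rf ≠ 41 by omega, show rf ≠ 40 by omega, Frame.refl]
  · simp only [Prog.wt, Expr.nodes]
    have := Nat.pow_le_pow_left n₁ 2
    have := Nat.pow_le_pow_left n₂ 2
    omega
  · rintro σ₁ ⟨c0, c30, c31, c40, c41, cm⟩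
    refine (mulProg_run h32 c30 c31 c40 c41 la lb (by have := H.add_le_W; omega) ?_).mono le_rfl ?_
    · refine LogRAM.size_le_of_le ?_ H.size_le
      have := Nat.size_le_size hfg
      gcongr
      all_goals norm_num
    · rintro σ₂ ⟨d0, d40, dm⟩
      exact ⟨c0.trans d0 (by norm_num), d40, fun x hx => (dm x hx).trans (by rw [cm])⟩
  · have : W ^ 2 * 2 ^ (f + 8) ≤ 256 * (W ^ 9 * 2 ^ f) := by
      have : W ^ 2 ≤ W ^ 9 := Nat.pow_le_pow_right (by omega) (by norm_num)
      calc W ^ 2 * 2 ^ (f + 8) = 256 * (W ^ 2 * 2 ^ f) := by ring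
        _ ≤ _ := by gcongr
    norm_num
    omega

/-- Compute the inner nodes of the product tree whose base address is in register 10. -/
def Prog.prodTree : Prog := 13 ::= .var 1 ;; .while (.var 13) ((
  13 ::= .var 13 -ₑ .lit 1 ;; 11 ::= .lit 1 <<ₑ .var 13 ;;
  12 ::= .var 3 +ₑ .var 1 -ₑ .var 13 -ₑ .lit 6) ;;
  .fill 16 11 (
    17 ::= .var 10 +ₑ .var 11 +ₑ .var 16 ;;
    mulCall 12 (.read (.var 17 +ₑ (.var 11 +ₑ .var 16)))
      (.read (.var 17 +ₑ (.var 11 +ₑ .var 16) +ₑ .lit 1)) ;;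
    .store (.var 17) (.var 40)))

/-- At depth j there are 2^j products of factors with 2^(f+5) bits, f = g + h - j - 6, which is not
truncated since g ≥ 5. As 2^j * 2^f ≤ 2^(g+h), each of the h levels costs O(W^9 * 2^(g+h)). -/
theorem Prog.prodTree_run {σ : State} {g h M W T : ℕ} {L : ℕ → ℕ} (H : Params g h M W)
    (h1 : σ.reg 1 = h) (h3 : σ.reg 3 = g) (h4 : σ.reg 4 = M) (h10 : σ.reg 10 = T)
    (hT : T + 2 * 2 ^ h ≤ M) (hL : ∀ t < 2 ^ h, L t < 2 ^ 2 ^ g)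
    (hm : ∀ u < 2 ^ h, σ.mem (T + 2 ^ h + u) = L u) :
    Run .prodTree σ (10 ^ 11 * (W ^ 10 * 2 ^ (g + h))) (fun σ' => Frame 11 σ σ' ∧
      (∀ j ≤ h, ∀ u < 2 ^ j, σ'.mem (T + 2 ^ j + u) = node h L j u) ∧
      ∀ x < M, (x < T ∨ T + 2 * 2 ^ h ≤ x) → σ'.mem x = σ.mem x) := by
  have h32 := H.le_W
  have hg := H.five_le
  have haW := H.add_le_W
  have hW' : W ≤ W ^ 2 := by nlinarith
  have sB : ∀ x, x ≤ M + 4 → x.size ≤ W := fun x hx => H.size_le_of_le hx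
  have sS : ∀ x, x ≤ M + 4 → x.size ≤ W ^ 2 := fun x hx => (sB x hx).trans hW'
  have sl : ∀ x, x ≤ W → x.size ≤ W ^ 2 := fun x hx =>
    (size_le_of_lt (a := x) Nat.lt_two_pow_self hx).trans hW'
  let I : ℕ → State → Prop := fun k σ₁ => k ≤ h ∧ Frame 11 σ σ₁ ∧ σ₁.reg 13 = h - k ∧
    (∀ j ≤ h, h - k ≤ j → ∀ u < 2 ^ j, σ₁.mem (T + 2 ^ j + u) = node h L j u) ∧
    ∀ x < M, (x < T ∨ T + 2 * 2 ^ h ≤ x) → σ₁.mem x = σ.mem x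
  have hinit : Run (13 ::= .var 1) σ (5 * W ^ 2) (I 0) := by
    refine (Run.of_lf (W := W) (S := W ^ 2) (by omega) le_rfl rfl ?_ ?_).mono (T := _ * W ^ 2)
      (Nat.mul_le_mul_right _ ?_) fun _ h => h
    · simp (disch := omega) [h1, sl]
    · simp only [I]
      simp [h1, Frame.refl]
      intro j hj1 hj2
      obtain rfl : j = h := by omega
      simpa [node_leaf] using hm
    · simp [Prog.wt, Expr.nodes]
  refine (Run.seq hinit fun σ₁ hσ₁ => Run.while (n := h) (Tc := 1 + W)
    (T := 500 * W ^ 2 + 2 ^ (g + h) * (4 * 10 ^ 10 * W ^ 9)) I hσ₁ ?_ ?_ ?_).mono ?_ fun _ h => h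
  · rintro k σ₂ - ⟨-, -, r13, -⟩
    simp only [Expr.cost, r13]
    have := size_le_of_lt (x := h - k) (a := h) (S := W)
      (lt_of_le_of_lt (Nat.sub_le _ _) Nat.lt_two_pow_self) (by omega)
    omega
  · rintro k σ₂ - ⟨hk, c0, r13, cn, cm⟩ h0
    simp only [Expr.eval, r13] at h0
    exact ⟨c0, fun j hj u hu => cn j hj (by omega) u hu, cm⟩
  · rintro k σ₂ - ⟨hk, c0, r13, cn, cm⟩ h0
    simp only [Expr.eval, r13] at h0
    refine ⟨by omega, ?_⟩
    obtain ⟨j, hj⟩ : ∃ j, h - k = j + 1 := ⟨h - k - 1, by omega⟩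
    have hj' : h - (k + 1) = j := by omega
    have r1 := (c0.1 1 (by norm_num)).trans h1
    have r3 := (c0.1 3 (by norm_num)).trans h3
    have r4 := (c0.1 4 (by norm_num)).trans h4
    have r10 := (c0.1 10 (by norm_num)).trans h10
    rw [hj] at r13
    have h2j : 2 ^ (j + 1) ≤ 2 ^ h := Nat.pow_le_pow_right (by norm_num) (by omega)
    have h2j' : 2 ^ (j + 1) = 2 * 2 ^ j := by rw [pow_succ, mul_comm]
    have hjpos : 1 ≤ 2 ^ j := Nat.one_le_two_pow
    refine (Run.seq (T₁ := 500 * W ^ 2) (Q := fun σ₃ => Frame 11 σ σ₃ ∧ σ₃.reg 13 = j ∧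
      σ₃.reg 11 = 2 ^ j ∧ σ₃.reg 12 = g + h - j - 6 ∧ σ₃.mem = σ₂.mem)
      ((Run.of_lf (W := W) (S := W ^ 2) (by omega) le_rfl rfl ?_ ?_).mono (T := _ * W ^ 2)
      (Nat.mul_le_mul_right _ ?_) fun _ h => h) ?_).mono le_rfl fun _ h => h
    · simp (disch := omega) [r1, r3, r13, sl]
      omega
    · simp [r1, r3, r13, c0]
    · simp [Prog.wt, Expr.nodes]
    · rintro σ₃ ⟨d0, d13, d11, d12, dm⟩
      have hnode : ∀ u < 2 ^ (j + 1), node h L (j + 1) u < 2 ^ 2 ^ (g + h - j - 6 + 5) := by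
        intro u hu
        have := node_lt hL (by omega) hu
        rwa [show g + h - (j + 1) = g + h - j - 6 + 5 by omega] at this
      have hf : g + h - j - 6 ≤ g + h := by omega
      have hgh : 2 ^ j * 2 ^ (g + h - j - 6) ≤ 2 ^ (g + h) := by
        rw [← pow_add]; exact Nat.pow_le_pow_right (by norm_num) (by omega)
      generalize g + h - j - 6 = f at *
      have hWS : W ^ 2 ≤ W ^ 2 * 2 ^ (f + 8) := Nat.le_mul_of_pos_right _ (by positivity)
      have sS' : ∀ x, x ≤ M + 4 → x.size ≤ W ^ 2 * 2 ^ (f + 8) := fun x hx => (sS x hx).trans hWS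
      have e8 : 2 ^ (f + 8) = 8 * 2 ^ (f + 5) := by ring
      have s8 : ∀ x, x < 2 ^ (2 * 2 ^ (f + 5)) → x.size ≤ W ^ 2 * 2 ^ (f + 8) := by
        intro x hx
        refine (Nat.size_le.mpr hx).trans ?_
        rw [e8]
        calc 2 * 2 ^ (f + 5) ≤ 1 * (8 * 2 ^ (f + 5)) := by omega
          _ ≤ _ := Nat.mul_le_mul_right _ (Nat.one_le_pow _ _ (by omega))
      refine (Run.fillBelow (R := 16) (N := 2 ^ j) (b := T + 2 ^ j) (M := M)
        (T := 3 * 10 ^ 10 * (W ^ 9 * 2 ^ f)) (S := W ^ 2)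
        (fun u => node h L j u) le_rfl (by norm_num) d11
        (by omega) (sS _ (by omega)) ?_).mono ?_ ?_
      · intro u σ₄ hu e0 e16 em
        have f0 := d0.trans e0 (by norm_num)
        have q4 := (f0.1 4 (by norm_num)).trans h4
        have q10 := (f0.1 10 (by norm_num)).trans h10
        have q11 := (e0.1 11 (by norm_num)).trans d11
        have q12 := (e0.1 12 (by norm_num)).trans d12
        have m1 : σ₄.mem (T + 2 ^ j + u + (2 ^ j + u)) = node h L (j + 1) (2 * u) := by
          rw [em _ (by omega), fillMem_out (by omega), dm, ← cn (j + 1) (by omega) (by omega) _ (by omega)]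
          congr 1; omega
        have m2 : σ₄.mem (T + 2 ^ j + u + (2 ^ j + u) + 1) = node h L (j + 1) (2 * u + 1) := by
          rw [em _ (by omega), fillMem_out (by omega), dm, ← cn (j + 1) (by omega) (by omega) _ (by omega)]
          congr 1; omega
        have l1 := hnode (2 * u) (by omega)
        have l2 := hnode (2 * u + 1) (by omega)
        have hsp := node_split L u (show j < h by omega)
        generalize node h L (j + 1) (2 * u) = a at *
        generalize node h L (j + 1) (2 * u + 1) = b at *
        have sa : a.size ≤ W ^ 2 * 2 ^ (f + 8) := s8 a (l1.trans_le
          (Nat.pow_le_pow_right (by norm_num) (by omega)))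
        have sb : b.size ≤ W ^ 2 * 2 ^ (f + 8) := s8 b (l2.trans_le
          (Nat.pow_le_pow_right (by norm_num) (by omega)))
        have sab : (a * b).size ≤ W ^ 2 * 2 ^ (f + 8) := s8 _ (by
          rw [two_mul, pow_add]; exact Nat.mul_lt_mul'' l1 l2)
        refine (Run.seq (T₁ := 150 * W ^ 2) (Q := fun σ₅ => σ₅ = σ₄.setReg 17 (T + 2 ^ j + u))
          ((Run.of_lf (W := W) (S := W ^ 2) (by omega) le_rfl rfl ?_ ?_).mono (T := _ * W ^ 2)
          (Nat.mul_le_mul_right _ ?_) fun _ h => h) fun σ₅ hσ₅ =>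
          Run.seq (mulCall_run (a := a) (b := b) (f := f) H (by simpa [hσ₅] using q4) (by norm_num)
          (by simpa [hσ₅] using q12) hf (by simp [Expr.nodes]) (by simp [Expr.nodes]) ?_ ?_ ?_ ?_ l1 l2)
          fun σ₆ hσ₆ => (Run.of_lf (W := W) (S := W ^ 2 * 2 ^ (f + 8)) (by omega) hWS rfl ?_ ?_).mono
            (T := _ * (W ^ 2 * 2 ^ (f + 8))) (T' := 10 * (W ^ 2 * 2 ^ (f + 8)))
            (Nat.mul_le_mul_right _ ?_) fun _ h => h).mono ?_ fun _ h => h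
        · simp (disch := omega) [q10, q11, e16, sS]
        · simp [q10, q11, e16]
        · simp [Prog.wt, Expr.nodes]
        · simp [hσ₅, q11, e16, m1]
        · simp [hσ₅, q11, e16, m2]
        · simp (disch := omega) [hσ₅, q11, e16, m1, sS', sa]
        · simp (disch := omega) [hσ₅, q11, e16, m2, sS', sb, show 1 ≤ W ^ 2 * 2 ^ (f + 8) by omega]
        · have p17 := hσ₆.1.1 17 (by norm_num)
          simp [hσ₅] at p17
          simp (disch := omega) [p17, hσ₆.2.1, sS', sab]
        · have p17 := hσ₆.1.1 17 (by norm_num)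
          have p16 := hσ₆.1.1 16 (by norm_num)
          simp [hσ₅] at p17 p16
          have p0 : Frame 16 σ₃ σ₆ := by
            refine e0.trans (Frame.trans ?_ hσ₆.1 (by norm_num : 16 ≤ 30)) le_rfl
            rw [hσ₅]; exact (Frame.refl _ _).setReg (by norm_num)
          simp [p17, p16, hσ₆.2.1, p0, e16, hsp]
          intro x hx
          have := hσ₆.2.2 x hx
          simp only [hσ₅, State.setReg_mem] at this
          simp [Function.update_apply, this]
        · simp [Prog.wt, Expr.nodes]
        · have t1 : W ^ 2 ≤ W ^ 2 * 2 ^ f := Nat.le_mul_of_pos_right _ (by positivity)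
          have t2 : W ^ 2 * 2 ^ f ≤ W ^ 9 * 2 ^ f :=
            Nat.mul_le_mul_right _ (Nat.pow_le_pow_right (by omega) (by norm_num))
          have t3 : W ^ 2 * 2 ^ (f + 8) = 256 * (W ^ 2 * 2 ^ f) := by ring
          norm_num
          omega
      · refine (fill_cost_le (c := 3 * 10 ^ 10 * (W ^ 7 * 2 ^ f)) hjpos (le_of_eq (by ring))).trans ?_
        have t1 : 1 ≤ W ^ 7 * 2 ^ f := Nat.mul_pos (by positivity) (by positivity)
        calc 2 ^ j * ((3 * 10 ^ 10 * (W ^ 7 * 2 ^ f) + 113) * W ^ 2)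
            ≤ 2 ^ j * ((4 * 10 ^ 10 * (W ^ 7 * 2 ^ f)) * W ^ 2) := by gcongr; norm_num; omega
          _ = (2 ^ j * 2 ^ f) * (4 * 10 ^ 10 * W ^ 9) := by ring
          _ ≤ _ := Nat.mul_le_mul_right _ hgh
      · rintro σ₄ ⟨e0, em⟩
        refine ⟨by omega, d0.trans e0 (by norm_num), by rw [e0.1 13 (by norm_num), d13, hj'], ?_, ?_⟩
        · intro i hi hi' u hu
          rw [hj'] at hi'
          have h2i : 2 ^ i ≤ 2 ^ h := Nat.pow_le_pow_right (by norm_num) hi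
          rw [em _ (by omega)]
          rcases hi'.eq_or_lt with rfl | hlt
          · rw [fillMem_in hu]
          · have h2ij : 2 ^ (j + 1) ≤ 2 ^ i := Nat.pow_le_pow_right (by norm_num) hlt
            rw [fillMem_out (by omega), dm, cn i hi (by omega) u hu]
        · intro x hx hx'
          rw [em x hx, fillMem_out (by omega), dm, cm x hx hx']
  · have t1 : 1 ≤ 2 ^ (g + h) := Nat.one_le_two_pow
    have t2 : W ^ 2 ≤ W ^ 9 := Nat.pow_le_pow_right (by omega) (by norm_num)
    have t3 : W ^ 9 ≤ 2 ^ (g + h) * W ^ 9 := Nat.le_mul_of_pos_left _ t1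
    have t4 : W ^ 10 * 2 ^ (g + h) = W * (2 ^ (g + h) * W ^ 9) := by ring
    have t5 : 2 ^ (g + h) * (4 * 10 ^ 10 * W ^ 9) = 4 * 10 ^ 10 * (2 ^ (g + h) * W ^ 9) := by ring
    rw [t4, t5]
    generalize 2 ^ (g + h) * W ^ 9 = Z at *
    have t6 : h * (1 + (1 + W) + (500 * W ^ 2 + 4 * 10 ^ 10 * Z)) ≤ W * (5 * 10 ^ 10 * Z) := by
      refine Nat.mul_le_mul (by omega) ?_
      norm_num
      omega
    have t7 : Z ≤ W * Z := Nat.le_mul_of_pos_left _ (by omega)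
    have t8 : W * (5 * 10 ^ 10 * Z) = 5 * 10 ^ 10 * (W * Z) := by ring
    norm_num at *
    omega

/-- Montgomery reduction of register 18 modulo register 19, with the result in register 22. -/
def Prog.redcProg : Prog := (20 ::= .lit 1 ;; 21 ::= .var 15) ;;
  .while (.var 21) (mulCall 12 (.var 19) (.var 20) ;;
    (21 ::= .var 21 -ₑ .lit 1 ;; 22 ::= .lit 2 +ₑ .var 40 ;;
      22 ::= .var 22 -ₑ .var 22 >>ₑ .var 14 <<ₑ .var 14) ;;
    mulCall 12 (.var 20) (.var 22) ;; 20 ::= .var 40 -ₑ .var 40 >>ₑ .var 14 <<ₑ .var 14) ;;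
  mulCall 12 (.var 18 -ₑ .var 18 >>ₑ .var 14 <<ₑ .var 14) (.var 20) ;;
  22 ::= .var 40 -ₑ .var 40 >>ₑ .var 14 <<ₑ .var 14 ;;
  mulCall 12 (.var 22) (.var 19) ;;
  22 ::= (.var 18 +ₑ .var 40) >>ₑ .var 14 ;;
  .ite (.var 22 <ₑ .lit 1 <<ₑ .var 14) .skip (22 ::= .var 22 -ₑ .var 19)

theorem redc_cost_le {W Z S e : ℕ} (hW : 32 ≤ W) (he : e ≤ W) (hZ : W ≤ Z) (hS : S ≤ 256 * Z) :
    10 * S + (e * (1 + (1 + W) + (4 * 10 ^ 10 * Z + 600 * S)) + (1 + (1 + W)) +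
      (4 * 10 ^ 10 * Z + 600 * S)) ≤ 10 ^ 11 * (W * Z) := by
  have h1 : e * (1 + (1 + W) + (4 * 10 ^ 10 * Z + 600 * S)) ≤ W * (5 * 10 ^ 10 * Z) := by
    refine Nat.mul_le_mul he ?_
    norm_num
    omega
  have h2 : 32 * Z ≤ W * Z := Nat.mul_le_mul_right _ hW
  have h3 : W * (5 * 10 ^ 10 * Z) = 5 * 10 ^ 10 * (W * Z) := by ring
  norm_num at *
  omega

set_option maxHeartbeats 1000000 in
-- All f + 5 Newton steps are carried out at full precision instead of doubling it; this costs one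
-- more factor W, which is harmless.
theorem Prog.redcProg_run {σ : State} {g h M W f R X : ℕ} (H : Params g h M W)
    (h4 : σ.reg 4 = M) (h12 : σ.reg 12 = f) (h14 : σ.reg 14 = 2 ^ (f + 5)) (h15 : σ.reg 15 = f + 5)
    (h18 : σ.reg 18 = R) (h19 : σ.reg 19 = X) (hf : f + 5 ≤ g + h) (hR : R < 2 ^ 2 ^ (f + 5 + 1))
    (hX : X < 2 ^ 2 ^ (f + 5)) :
    Run .redcProg σ (10 ^ 11 * (W ^ 10 * 2 ^ f)) (fun σ' => Frame 20 σ σ' ∧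
      σ'.reg 22 = redc (f + 5) R X ∧ ∀ x < M, σ'.mem x = σ.mem x) := by
  have h32 := H.le_W
  have haW := H.add_le_W
  have hW' : W ≤ W ^ 2 := by nlinarith
  have hWS : W ^ 2 ≤ W ^ 2 * 2 ^ (f + 8) := Nat.le_mul_of_pos_right _ (by positivity)
  have e8 : W ^ 2 * 2 ^ (f + 8) = W ^ 2 * (8 * 2 ^ (f + 5)) := by ring
  have hS8 : 8 * 2 ^ (f + 5) ≤ W ^ 2 * 2 ^ (f + 8) := by
    rw [e8]; exact Nat.le_mul_of_pos_left _ (by positivity)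
  have hcost : W ^ 2 * 2 ^ (f + 8) ≤ 256 * (W ^ 9 * 2 ^ f) := by
    have : W ^ 2 ≤ W ^ 9 := Nat.pow_le_pow_right (by omega) (by norm_num)
    calc W ^ 2 * 2 ^ (f + 8) = 256 * (W ^ 2 * 2 ^ f) := by ring
      _ ≤ _ := by gcongr
  have sl : ∀ x, x ≤ W → x.size ≤ W ^ 2 * 2 ^ (f + 8) := fun x hx =>
    ((size_le_of_lt (a := x) Nat.lt_two_pow_self hx).trans hW').trans hWS
  have hmul : ∀ a b, a < 2 ^ 2 ^ (f + 5) → b < 2 ^ 2 ^ (f + 5) → a * b < 2 ^ (2 * 2 ^ (f + 5)) := by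
    intro a b ha hb
    rw [two_mul, pow_add]; exact Nat.mul_lt_mul'' ha hb
  rw [pow_succ, mul_comm _ 2] at hR
  have hN1 : 1 ≤ 2 ^ (f + 5) := Nat.one_le_two_pow
  have hredc : redc (f + 5) R X =
    if (R + R % 2 ^ 2 ^ (f + 5) * newton (2 ^ (f + 5)) X (f + 5) % 2 ^ 2 ^ (f + 5) * X) / 2 ^ 2 ^ (f + 5)
      < 2 ^ 2 ^ (f + 5) then
      (R + R % 2 ^ 2 ^ (f + 5) * newton (2 ^ (f + 5)) X (f + 5) % 2 ^ 2 ^ (f + 5) * X) / 2 ^ 2 ^ (f + 5)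
    else (R + R % 2 ^ 2 ^ (f + 5) * newton (2 ^ (f + 5)) X (f + 5) % 2 ^ 2 ^ (f + 5) * X) /
      2 ^ 2 ^ (f + 5) - X := rfl
  have hnl := newton_lt hN1 X
  have hY0 : newton (2 ^ (f + 5)) X 0 = 1 := rfl
  have hns : ∀ t, newton (2 ^ (f + 5)) X (t + 1) = newton (2 ^ (f + 5)) X t *
    ((2 + X * newton (2 ^ (f + 5)) X t) % 2 ^ 2 ^ (f + 5)) % 2 ^ 2 ^ (f + 5) := fun _ => rfl
  generalize newton (2 ^ (f + 5)) X = Y at *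
  rw [hredc]
  have hNS : 8 * 2 ^ (f + 5) ≤ W ^ 2 * 2 ^ (f + 8) := hS8
  have hf5 : f + 5 ≤ 2 ^ (f + 5) := Nat.lt_two_pow_self.le
  have hmod : ∀ x, x % 2 ^ 2 ^ (f + 5) < 2 ^ 2 ^ (f + 5) := fun x => Nat.mod_lt _ (by positivity)
  -- Remainders modulo 2^N are taken by two shifts and a subtraction, since `%` on long numbers
  -- would cost the product of the bit lengths.
  have hsub : ∀ x, x - x / 2 ^ 2 ^ (f + 5) * 2 ^ 2 ^ (f + 5) = x % 2 ^ 2 ^ (f + 5) :=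
    fun x => sub_div_mul x _
  have s2 : ∀ x, x < 2 ^ (2 * 2 ^ (f + 5)) * 4 → x.size ≤ W ^ 2 * 2 ^ (f + 8) := by
    intro x hx
    refine size_le_of_lt (a := 2 * 2 ^ (f + 5) + 2) (by rwa [pow_add]) (by omega)
  have sqr : 2 ^ (2 * 2 ^ (f + 5)) = 2 ^ 2 ^ (f + 5) * 2 ^ 2 ^ (f + 5) := by rw [two_mul, pow_add]
  have hQ2 : 2 ≤ 2 ^ 2 ^ (f + 5) := by
    calc 2 = 2 ^ 1 := rfl
      _ ≤ _ := Nat.pow_le_pow_right (by norm_num) hN1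
  have hQle : 2 ^ 2 ^ (f + 5) ≤ 2 ^ (2 * 2 ^ (f + 5)) := by rw [sqr]; nlinarith
  have sN : (2 ^ (f + 5)).size ≤ W ^ 2 * 2 ^ (f + 8) :=
    size_le_of_lt (a := 2 ^ (f + 5)) Nat.lt_two_pow_self (by omega)
  set S := W ^ 2 * 2 ^ (f + 8) with hSdef
  have hfg : f ≤ g + h := by omega
  have sdiv : ∀ x, x < 2 ^ (2 * 2 ^ (f + 5)) * 4 → (x / 2 ^ 2 ^ (f + 5)).size ≤ S := fun x hx =>
    size_le_of_le (Nat.div_le_self _ _) (s2 x hx)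
  let I : ℕ → State → Prop := fun k σ₁ => k ≤ f + 5 ∧ Frame 20 σ σ₁ ∧ σ₁.reg 20 = Y k ∧
    σ₁.reg 21 = f + 5 - k ∧ ∀ x < M, σ₁.mem x = σ.mem x
  have hinit : Run (20 ::= .lit 1 ;; 21 ::= .var 15) σ (10 * S) (I 0) := by
    refine (Run.of_lf (W := W) (S := S) (by omega) hWS rfl ?_ ?_).mono (T := _ * S)
      (Nat.mul_le_mul_right _ ?_) fun _ h => h
    · simp (disch := omega) [h15, sl]; omega
    · simp only [I]
      simp [h15, Frame.refl, hY0]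
    · simp [Prog.wt, Expr.nodes]
  have hloop : ∀ σ₁, I 0 σ₁ → Run (.while (.var 21) (mulCall 12 (.var 19) (.var 20) ;;
    (21 ::= .var 21 -ₑ .lit 1 ;; 22 ::= .lit 2 +ₑ .var 40 ;;
      22 ::= .var 22 -ₑ .var 22 >>ₑ .var 14 <<ₑ .var 14) ;;
    mulCall 12 (.var 20) (.var 22) ;; 20 ::= .var 40 -ₑ .var 40 >>ₑ .var 14 <<ₑ .var 14)) σ₁
    ((f + 5) * (1 + (1 + W) + (4 * 10 ^ 10 * (W ^ 9 * 2 ^ f) + 600 * S)) + (1 + (1 + W)))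
    (I (f + 5)) := by
    intro σ₁ hσ₁
    refine Run.while I hσ₁ ?_ ?_ ?_
    · rintro k σ₂ - ⟨-, -, -, r21, -⟩
      simp only [Expr.cost, r21]
      have := size_le_of_lt (x := f + 5 - k) (a := f + 5) (S := W)
        (lt_of_le_of_lt (Nat.sub_le _ _) Nat.lt_two_pow_self) (by omega)
      omega
    · rintro k σ₂ - ⟨hk, hI⟩ h0
      simp only [Expr.eval, hI.2.2.1] at h0
      obtain rfl : k = f + 5 := by omega
      exact ⟨hk, hI⟩
    · rintro k σ₂ - ⟨hk, c0, r20, r21, cm⟩ h0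
      simp only [Expr.eval, r21] at h0
      refine ⟨by omega, ?_⟩
      have r4 := (c0.1 4 (by norm_num)).trans h4
      have r12 := (c0.1 12 (by norm_num)).trans h12
      have r14 := (c0.1 14 (by norm_num)).trans h14
      have r19 := (c0.1 19 (by norm_num)).trans h19
      have hy := hnl k
      have hns := hns k
      generalize Y k = y at *
      have hxy := hmul X y hX hy
      have hyz := hmul y ((2 + X * y) % 2 ^ 2 ^ (f + 5)) hy (hmod _)
      refine (Run.seq (mulCall_run (a := X) (b := y) (f := f) H r4 (by norm_num) r12 hfg
          (by simp [Expr.nodes]) (by simp [Expr.nodes]) (by simp [r19]) (by simp [r20])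
          (by simpa [r19] using s2 X (by omega)) (by simpa [r20] using s2 y (by omega)) hX hy)
        fun σ₃ h₃ => Run.seq (Q := fun σ₄ => σ₄ = ((σ₃.setReg 21 (f + 5 - k - 1)).setReg 22
          ((2 + X * y) % 2 ^ 2 ^ (f + 5)))) ((Run.of_lf (W := W) (S := S) (by omega) hWS rfl ?_ ?_).mono
            (T := _ * S) (T' := 400 * S) (Nat.mul_le_mul_right _ ?_) fun _ h => h)
        fun σ₄ h₄ => Run.seq (mulCall_run (a := y) (b := (2 + X * y) % 2 ^ 2 ^ (f + 5)) (f := f) H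
          ?_ (by norm_num) ?_ hfg
          (by simp [Expr.nodes]) (by simp [Expr.nodes]) ?_ ?_ ?_ ?_ hy (hmod _))
        fun σ₅ h₅ => (Run.of_lf (W := W) (S := S) (by omega) hWS rfl ?_ ?_).mono
            (T := _ * S) (T' := 200 * S) (Nat.mul_le_mul_right _ ?_) fun _ h => h).mono ?_ fun _ h => h
      · have p14 := (h₃.1.1 14 (by norm_num)).trans r14
        have p21 := (h₃.1.1 21 (by norm_num)).trans r21
        simp (disch := omega) [p14, p21, h₃.2.1, sl, s2, sdiv, sN]
        omega
      · have p14 := (h₃.1.1 14 (by norm_num)).trans r14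
        have p21 := (h₃.1.1 21 (by norm_num)).trans r21
        simp [p14, p21, h₃.2.1, hsub]
      · simp [Prog.wt, Expr.nodes]
      · simpa [h₄] using (h₃.1.1 4 (by norm_num)).trans r4
      · simpa [h₄] using (h₃.1.1 12 (by norm_num)).trans r12
      · simpa [h₄] using (h₃.1.1 20 (by norm_num)).trans r20
      · simp [h₄]
      · have p20 := (h₃.1.1 20 (by norm_num)).trans r20
        simpa [h₄, p20] using s2 y (by omega)
      · simpa [h₄] using s2 _ (by have := hmod (2 + X * y); omega)
      · have p14 := h₅.1.1 14 (by norm_num)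
        simp [h₄, (h₃.1.1 14 (by norm_num)).trans r14] at p14
        simp (disch := omega) [p14, h₅.2.1, s2, sdiv, sN]
        omega
      · have p14 := h₅.1.1 14 (by norm_num)
        simp [h₄, (h₃.1.1 14 (by norm_num)).trans r14] at p14
        have p21 := (h₅.1.1 21 (by norm_num))
        simp [h₄] at p21
        have f0 : Frame 20 σ σ₅ := by
          refine (c0.trans h₃.1 (by norm_num)).trans (Frame.trans (R := 20) ?_ h₅.1 (by norm_num)) le_rfl
          rw [h₄]
          exact ((Frame.refl _ _).setReg (by norm_num)).setReg (by norm_num)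
        simp only [I]
        simp [p14, p21, h₅.2.1, hsub, hns, f0]
        refine ⟨by omega, by omega, fun x hx => ?_⟩
        rw [h₅.2.2 x hx, h₄]
        simp [h₃.2.2 x hx, cm x hx]
      · simp [Prog.wt, Expr.nodes]
      · norm_num; omega
  have hfin : ∀ σ₁, I (f + 5) σ₁ → Run (
    mulCall 12 (.var 18 -ₑ .var 18 >>ₑ .var 14 <<ₑ .var 14) (.var 20) ;;
    22 ::= .var 40 -ₑ .var 40 >>ₑ .var 14 <<ₑ .var 14 ;;
    mulCall 12 (.var 22) (.var 19) ;;
    22 ::= (.var 18 +ₑ .var 40) >>ₑ .var 14 ;;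
    .ite (.var 22 <ₑ .lit 1 <<ₑ .var 14) .skip (22 ::= .var 22 -ₑ .var 19)) σ₁
    (4 * 10 ^ 10 * (W ^ 9 * 2 ^ f) + 600 * S) (fun σ' => Frame 20 σ σ' ∧
      σ'.reg 22 = redc (f + 5) R X ∧ ∀ x < M, σ'.mem x = σ.mem x) := by
    rintro σ₂ ⟨-, c0, r20, r21, cm⟩
    have r4 := (c0.1 4 (by norm_num)).trans h4
    have r12 := (c0.1 12 (by norm_num)).trans h12
    have r14 := (c0.1 14 (by norm_num)).trans h14
    have r18 := (c0.1 18 (by norm_num)).trans h18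
    have r19 := (c0.1 19 (by norm_num)).trans h19
    have hy := hnl (f + 5)
    rw [hredc]
    generalize Y (f + 5) = y at *
    have hr := hmod R
    have hry := hmul _ y hr hy
    have hq := hmod (R % 2 ^ 2 ^ (f + 5) * y)
    have hqX := hmul _ X hq hX
    refine (Run.seq (mulCall_run (a := R % 2 ^ 2 ^ (f + 5)) (b := y) (f := f) H r4 (by norm_num) r12
        hfg (by simp [Expr.nodes]) (by simp [Expr.nodes]) (by simp [r18, r14, hsub]) (by simp [r20])
        ?_ (by simpa [r20] using s2 y (by omega)) hr hy)
      fun σ₃ h₃ => Run.seq (Q := fun σ₄ => σ₄ = σ₃.setReg 22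
        (R % 2 ^ 2 ^ (f + 5) * y % 2 ^ 2 ^ (f + 5))) ((Run.of_lf (W := W) (S := S) (by omega) hWS rfl
          ?_ ?_).mono (T := _ * S) (T' := 200 * S) (Nat.mul_le_mul_right _ ?_) fun _ h => h)
      fun σ₄ h₄ => Run.seq (mulCall_run (a := R % 2 ^ 2 ^ (f + 5) * y % 2 ^ 2 ^ (f + 5)) (b := X)
        (f := f) H ?_ (by norm_num) ?_ hfg
        (by simp [Expr.nodes]) (by simp [Expr.nodes]) ?_ ?_ ?_ ?_ hq hX)
      fun σ₅ h₅ => (Run.of_lf (W := W) (S := S) (by omega) hWS rfl ?_ ?_).mono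
          (T := _ * S) (T' := 400 * S) (Nat.mul_le_mul_right _ ?_) fun _ h => h).mono ?_ fun _ h => h
    · have q1 : R.size ≤ S := s2 R (by omega)
      simp (disch := omega) [r18, r14, q1, sN]
      omega
    · have p14 := (h₃.1.1 14 (by norm_num)).trans r14
      simp (disch := omega) [p14, h₃.2.1, s2, sN]
      omega
    · have p14 := (h₃.1.1 14 (by norm_num)).trans r14
      simp [p14, h₃.2.1, hsub]
    · simp [Prog.wt, Expr.nodes]
    · simpa [h₄] using (h₃.1.1 4 (by norm_num)).trans r4
    · simpa [h₄] using (h₃.1.1 12 (by norm_num)).trans r12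
    · simp [h₄]
    · simpa [h₄] using (h₃.1.1 19 (by norm_num)).trans r19
    · simpa [h₄] using s2 _ (by omega)
    · simpa [h₄, (h₃.1.1 19 (by norm_num)).trans r19] using s2 X (by omega)
    · generalize R % 2 ^ 2 ^ (f + 5) * y % 2 ^ 2 ^ (f + 5) = q at *
      have p14 := h₅.1.1 14 (by norm_num)
      have p18 := h₅.1.1 18 (by norm_num)
      have p19 := h₅.1.1 19 (by norm_num)
      simp [h₄, (h₃.1.1 14 (by norm_num)).trans r14] at p14
      simp [h₄, (h₃.1.1 18 (by norm_num)).trans r18] at p18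
      simp [h₄, (h₃.1.1 19 (by norm_num)).trans r19] at p19
      have q1 : R.size ≤ S := s2 R (by omega)
      have q2 : (q * X).size ≤ S := s2 _ (by omega)
      have q3 := sdiv (R + q * X) (by omega)
      have q4 : X.size ≤ S := s2 X (by omega)
      have q5 : 1 ≤ S ∧ 2 ^ (f + 5) ≤ S := by omega
      by_cases hc : (R + q * X) / 2 ^ 2 ^ (f + 5) <
        2 ^ 2 ^ (f + 5) <;>
      simp [p14, p18, p19, h₅.2.1, hc, q1, q2, q3, q4, q5, sN]
    · generalize R % 2 ^ 2 ^ (f + 5) * y % 2 ^ 2 ^ (f + 5) = q at *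
      have p14 := h₅.1.1 14 (by norm_num)
      have p18 := h₅.1.1 18 (by norm_num)
      have p19 := h₅.1.1 19 (by norm_num)
      simp [h₄, (h₃.1.1 14 (by norm_num)).trans r14] at p14
      simp [h₄, (h₃.1.1 18 (by norm_num)).trans r18] at p18
      simp [h₄, (h₃.1.1 19 (by norm_num)).trans r19] at p19
      have f0 : Frame 20 σ σ₅ := by
        refine (c0.trans h₃.1 (by norm_num)).trans (Frame.trans (R := 20) ?_ h₅.1 (by norm_num)) le_rfl
        rw [h₄]
        exact (Frame.refl _ _).setReg (by norm_num)
      have fm : ∀ x < M, σ₅.mem x = σ.mem x := by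
        intro x hx
        rw [h₅.2.2 x hx, h₄, State.setReg_mem, h₃.2.2 x hx, cm x hx]
      by_cases hc : (R + q * X) / 2 ^ 2 ^ (f + 5) <
        2 ^ 2 ^ (f + 5)
      · simp [p14, p18, p19, h₅.2.1, hc, f0]
        exact fm
      · simp [p14, p18, p19, h₅.2.1, hc, f0]
        exact fm
    · simp [Prog.wt, Expr.nodes]
    · norm_num; omega
  refine (Run.seq hinit fun σ₁ h₁ => Run.seq (hloop σ₁ h₁) hfin).mono ?_ fun _ h => by
    rwa [hredc] at h
  have t1 : W ^ 10 * 2 ^ f = W * (W ^ 9 * 2 ^ f) := by ring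
  have t2 : W ≤ W ^ 9 * 2 ^ f := (Nat.le_self_pow (by norm_num) W).trans
    (Nat.le_mul_of_pos_right _ (by positivity))
  rw [t1]
  exact redc_cost_le h32 (by omega) t2 hcost

/-- Compute the remainder tree at the address in register 9, whose root is given, for the product
tree at the address in register 10. -/
def Prog.rTree : Prog := 13 ::= .lit 0 ;; .loop 13 1 ((
  11 ::= .lit 1 <<ₑ (.var 13 +ₑ .lit 1) ;; 15 ::= .var 3 +ₑ .var 1 -ₑ (.var 13 +ₑ .lit 1) ;;
  12 ::= .var 15 -ₑ .lit 5 ;; 14 ::= .lit 1 <<ₑ .var 15) ;;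
  .fill 16 11 ((17 ::= .var 11 +ₑ .var 16 ;; 18 ::= .read (.var 9 +ₑ .var 17 >>ₑ .lit 1) ;;
    19 ::= .read (.var 10 +ₑ .var 17)) ;; redcProg ;; .store (.var 9 +ₑ .var 17) (.var 22)))

/-- In heap order the parent of the node at offset 2^(j+1) + u is at half that offset, in both trees
alike. The sum over a level is again at most 2^(g+h), with W^10 for each reduction. -/
theorem Prog.rTree_run {σ : State} {g h M W T Rb P : ℕ} {L : ℕ → ℕ} (H : Params g h M W)
    (h1 : σ.reg 1 = h) (h3 : σ.reg 3 = g) (h4 : σ.reg 4 = M) (h9 : σ.reg 9 = Rb)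
    (h10 : σ.reg 10 = T) (hT : T + 2 * 2 ^ h ≤ Rb) (hRb : Rb + 2 * 2 ^ h ≤ M)
    (hL : ∀ t < 2 ^ h, L t < 2 ^ 2 ^ g)
    (hX : ∀ j ≤ h, ∀ u < 2 ^ j, σ.mem (T + 2 ^ j + u) = node h L j u)
    (hP : P < 2 ^ 2 ^ (g + h)) (hroot : σ.mem (Rb + 1) = P) :
    Run .rTree σ (10 ^ 12 * (W ^ 11 * 2 ^ (g + h))) (fun σ' => Frame 11 σ σ' ∧
      (∀ u < 2 ^ h, σ'.mem (Rb + 2 ^ h + u) = rtree g h (node h L) P h u) ∧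
      ∀ x < M, (x < Rb ∨ Rb + 2 * 2 ^ h ≤ x) → σ'.mem x = σ.mem x) := by
  have h32 := H.le_W
  have hg := H.five_le
  have haW := H.add_le_W
  have hW' : W ≤ W ^ 2 := by nlinarith
  have sB : ∀ x, x ≤ M + 4 → x.size ≤ W := fun x hx => H.size_le_of_le hx
  have sS : ∀ x, x ≤ M + 4 → x.size ≤ W ^ 2 := fun x hx => (sB x hx).trans hW'
  have sl : ∀ x, x ≤ W → x.size ≤ W ^ 2 := fun x hx =>
    (size_le_of_lt (a := x) Nat.lt_two_pow_self hx).trans hW'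
  let I : ℕ → State → Prop := fun k σ₁ => (Frame 11 σ σ₁ ∧
    (∀ j ≤ k, ∀ u < 2 ^ j, σ₁.mem (Rb + 2 ^ j + u) = rtree g h (node h L) P j u) ∧
    ∀ x < M, (x < Rb ∨ Rb + 2 * 2 ^ h ≤ x) → σ₁.mem x = σ.mem x) ∧ σ₁.reg 13 = k
  have hinit : Run (13 ::= .lit 0) σ (5 * W ^ 2) (I 0) := by
    refine (Run.of_lf (W := W) (S := W ^ 2) (by omega) le_rfl rfl ?_ ?_).mono (T := _ * W ^ 2)
      (Nat.mul_le_mul_right _ ?_) fun _ h => h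
    · simp
    · simp only [I]
      simp [Frame.refl, rtree, hroot]
    · simp [Prog.wt, Expr.nodes]
  refine (Run.seq hinit fun σ₁ hσ₁ => Run.loop (S := W)
    (T := 1000 * W ^ 2 + 2 ^ (g + h) * (2 * 10 ^ 11 * W ^ 10)) I (Nat.zero_le h) (by omega)
    (size_le_of_lt (a := h) Nat.lt_two_pow_self (by omega)) ?_ hσ₁ ?_).mono ?_ fun σ' hσ' =>
      ⟨hσ'.1.1, hσ'.1.2.1 h le_rfl, hσ'.1.2.2⟩
  · rintro k σ₂ ⟨⟨c0, -⟩, r13⟩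
    exact ⟨r13, (c0.1 1 (by norm_num)).trans h1⟩
  · rintro j σ₂ - hj ⟨⟨c0, cn, cm⟩, r13⟩
    have r1 := (c0.1 1 (by norm_num)).trans h1
    have r3 := (c0.1 3 (by norm_num)).trans h3
    have h2j : 2 ^ (j + 1) ≤ 2 ^ h := Nat.pow_le_pow_right (by norm_num) (by omega)
    have h2j' : 2 ^ (j + 1) = 2 * 2 ^ j := by rw [pow_succ, mul_comm]
    have hjpos : 1 ≤ 2 ^ j := Nat.one_le_two_pow
    have hRt : ∀ u < 2 ^ j, rtree g h (node h L) P j u < 2 ^ 2 ^ (g + h - j) :=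
      fun u hu => rtree_lt hL hP (by omega) hu
    have hXt : ∀ u < 2 ^ (j + 1), node h L (j + 1) u < 2 ^ 2 ^ (g + h - (j + 1)) :=
      fun u hu => node_lt hL (by omega) hu
    have hrt : ∀ u, rtree g h (node h L) P (j + 1) u = redc (g + h - (j + 1))
      (rtree g h (node h L) P j (u / 2)) (node h L (j + 1) u) := fun _ => rfl
    obtain ⟨f, hf⟩ : ∃ f, g + h - (j + 1) = f + 5 := ⟨g + h - (j + 1) - 5, by omega⟩
    have hf' : g + h - j = f + 5 + 1 := by omega
    refine (Run.seq (T₁ := 1000 * W ^ 2) (Q := fun σ₃ => Frame 11 σ σ₃ ∧ σ₃.reg 13 = j ∧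
      σ₃.reg 11 = 2 ^ (j + 1) ∧ σ₃.reg 12 = f ∧ σ₃.reg 14 = 2 ^ (f + 5) ∧ σ₃.reg 15 = f + 5 ∧
      σ₃.mem = σ₂.mem)
      ((Run.of_lf (W := W) (S := W ^ 2) (by omega) le_rfl rfl ?_ ?_).mono (T := _ * W ^ 2)
      (Nat.mul_le_mul_right _ ?_) fun _ h => h) ?_).mono le_rfl fun _ h => h
    · simp (disch := omega) [r1, r3, r13, sl, hf]
      omega
    · simp [r1, r3, r13, c0, hf]
    · simp [Prog.wt, Expr.nodes]
    · rintro σ₃ ⟨d0, d13, d11, d12, d14, d15, dm⟩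
      have hgh : 2 ^ (j + 1) * 2 ^ f ≤ 2 ^ (g + h) := by
        rw [← pow_add]; exact Nat.pow_le_pow_right (by norm_num) (by omega)
      rw [hf] at hXt
      rw [hf'] at hRt
      have hWS : W ^ 2 ≤ W ^ 2 * 2 ^ (f + 8) := Nat.le_mul_of_pos_right _ (by positivity)
      have sS' : ∀ x, x ≤ M + 4 → x.size ≤ W ^ 2 * 2 ^ (f + 8) := fun x hx => (sS x hx).trans hWS
      have e8 : 2 ^ (f + 8) = 8 * 2 ^ (f + 5) := by ring
      have e6 : 2 ^ (f + 5 + 1) = 2 * 2 ^ (f + 5) := by ring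
      have s8 : ∀ x, x < 2 ^ 2 ^ (f + 5 + 1) → x.size ≤ W ^ 2 * 2 ^ (f + 8) := by
        intro x hx
        refine (Nat.size_le.mpr hx).trans ?_
        rw [e8]
        calc 2 ^ (f + 5 + 1) ≤ 1 * (8 * 2 ^ (f + 5)) := by omega
          _ ≤ _ := Nat.mul_le_mul_right _ (Nat.one_le_pow _ _ (by omega))
      refine (Run.fillBelow (R := 16) (N := 2 ^ (j + 1)) (b := Rb + 2 ^ (j + 1)) (M := M)
        (T := 15 * 10 ^ 10 * (W ^ 10 * 2 ^ f)) (S := W ^ 2)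
        (fun u => rtree g h (node h L) P (j + 1) u) le_rfl (by norm_num) d11
        (by omega) (sS _ (by omega)) ?_).mono ?_ ?_
      · intro u σ₄ hu e0 e16 em
        have f0 := d0.trans e0 (by norm_num)
        have q4 := (f0.1 4 (by norm_num)).trans h4
        have q9 := (f0.1 9 (by norm_num)).trans h9
        have q10 := (f0.1 10 (by norm_num)).trans h10
        have q11 := (e0.1 11 (by norm_num)).trans d11
        have q12 := (e0.1 12 (by norm_num)).trans d12
        have q14 := (e0.1 14 (by norm_num)).trans d14
        have q15 := (e0.1 15 (by norm_num)).trans d15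
        have hu2 : (2 ^ (j + 1) + u) / 2 = 2 ^ j + u / 2 := by omega
        have m1 : σ₄.mem (Rb + (2 ^ j + u / 2)) = rtree g h (node h L) P j (u / 2) := by
          rw [em _ (by omega), fillMem_out (by omega), dm, ← cn j le_rfl _ (by omega)]
          congr 1; omega
        have m2 : σ₄.mem (T + (2 ^ (j + 1) + u)) = node h L (j + 1) u := by
          rw [em _ (by omega), fillMem_out (by omega), dm, cm _ (by omega) (by omega),
            ← hX (j + 1) (by omega) _ hu]
          congr 1; omega
        have l1 := hRt (u / 2) (by omega)
        have l2 := hXt u hu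
        have hsp := hrt u
        rw [hf] at hsp
        generalize rtree g h (node h L) P j (u / 2) = a at *
        generalize node h L (j + 1) u = b at *
        have hmono : 2 ^ 2 ^ (f + 5) ≤ 2 ^ 2 ^ (f + 5 + 1) :=
          Nat.pow_le_pow_right (by norm_num) (by omega)
        have sa : a.size ≤ W ^ 2 * 2 ^ (f + 8) := s8 a l1
        have sb : b.size ≤ W ^ 2 * 2 ^ (f + 8) := s8 b (by omega)
        have sr : (redc (f + 5) a b).size ≤ W ^ 2 * 2 ^ (f + 8) :=
          s8 _ ((redc_lt l1 l2).trans_le hmono)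
        refine (Run.seq (T₁ := 500 * (W ^ 2 * 2 ^ (f + 8))) (Q := fun σ₅ => σ₅ =
            ((σ₄.setReg 17 (2 ^ (j + 1) + u)).setReg 18 a).setReg 19 b)
          ((Run.of_lf (W := W) (S := W ^ 2 * 2 ^ (f + 8)) (by omega) hWS rfl ?_ ?_).mono
            (T := _ * (W ^ 2 * 2 ^ (f + 8))) (Nat.mul_le_mul_right _ ?_) fun _ h => h) fun σ₅ hσ₅ =>
          Run.seq (redcProg_run (R := a) (X := b) (f := f) H (by simpa [hσ₅] using q4)
            (by simpa [hσ₅] using q12) (by simpa [hσ₅] using q14) (by simpa [hσ₅] using q15)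
            (by simp [hσ₅]) (by simp [hσ₅]) (by omega) l1 l2)
          fun σ₆ hσ₆ => (Run.of_lf (W := W) (S := W ^ 2 * 2 ^ (f + 8)) (by omega) hWS rfl ?_ ?_).mono
            (T := _ * (W ^ 2 * 2 ^ (f + 8))) (T' := 100 * (W ^ 2 * 2 ^ (f + 8)))
            (Nat.mul_le_mul_right _ ?_) fun _ h => h).mono ?_ fun _ h => h
        · simp (disch := omega) [q9, q10, q11, e16, sS', hu2, m1, m2, sa, sb]
          omega
        · simp [q9, q10, q11, e16, hu2, m1, m2]
        · simp [Prog.wt, Expr.nodes]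
        · have p17 := hσ₆.1.1 17 (by norm_num)
          have p9 := hσ₆.1.1 9 (by norm_num)
          simp [hσ₅] at p17 p9
          simp (disch := omega) [p17, p9, q9, hσ₆.2.1, sS', sr]
        · have p17 := hσ₆.1.1 17 (by norm_num)
          have p16 := hσ₆.1.1 16 (by norm_num)
          have p9 := hσ₆.1.1 9 (by norm_num)
          simp [hσ₅] at p17 p16 p9
          have p0 : Frame 16 σ₃ σ₆ := by
            refine e0.trans (Frame.trans ?_ hσ₆.1 (by norm_num : 16 ≤ 20)) le_rfl
            rw [hσ₅]
            exact (((Frame.refl _ _).setReg (by norm_num)).setReg (by norm_num)).setReg (by norm_num)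
          simp [p17, p16, p9, q9, hσ₆.2.1, p0, e16, hsp]
          intro x hx
          have := hσ₆.2.2 x hx
          simp only [hσ₅, State.setReg_mem] at this
          simp [Function.update_apply, this, add_assoc]
        · simp [Prog.wt, Expr.nodes]
        · have t2 : W ^ 2 * 2 ^ f ≤ W ^ 10 * 2 ^ f :=
            Nat.mul_le_mul_right _ (Nat.pow_le_pow_right (by omega) (by norm_num))
          have t3 : W ^ 2 * 2 ^ (f + 8) = 256 * (W ^ 2 * 2 ^ f) := by ring
          clear_value I
          clear * - t2 t3
          norm_num
          omega
      · refine (fill_cost_le (c := 15 * 10 ^ 10 * (W ^ 8 * 2 ^ f)) (by omega)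
          (le_of_eq (by ring))).trans ?_
        have t1 : 1 ≤ W ^ 8 * 2 ^ f := Nat.mul_pos (by positivity) (by positivity)
        calc 2 ^ (j + 1) * ((15 * 10 ^ 10 * (W ^ 8 * 2 ^ f) + 113) * W ^ 2)
            ≤ 2 ^ (j + 1) * ((2 * 10 ^ 11 * (W ^ 8 * 2 ^ f)) * W ^ 2) := by gcongr; norm_num; omega
          _ = (2 ^ (j + 1) * 2 ^ f) * (2 * 10 ^ 11 * W ^ 10) := by ring
          _ ≤ _ := Nat.mul_le_mul_right _ hgh
      · rintro σ₄ ⟨e0, em⟩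
        refine ⟨(e0.1 13 (by norm_num)).trans d13, ⟨(d0.trans e0 (by norm_num)).setReg (by norm_num),
          ?_, ?_⟩, by simp⟩
        · intro i hi u hu
          have h2i : 2 ^ i ≤ 2 ^ h := Nat.pow_le_pow_right (by norm_num) (by omega)
          rw [State.setReg_mem, em _ (by omega)]
          rcases hi.eq_or_lt with rfl | hlt
          · rw [fillMem_in hu]
          · have h2ij : 2 ^ (i + 1) ≤ 2 ^ (j + 1) := Nat.pow_le_pow_right (by norm_num) hlt
            rw [fillMem_out (by omega), dm, cn i (by omega) u hu]
        · intro x hx hx'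
          rw [State.setReg_mem, em x hx, fillMem_out (by omega), dm, cm x hx hx']
  · have t1 : 1 ≤ 2 ^ (g + h) := Nat.one_le_two_pow
    have t2 : W ^ 2 ≤ W ^ 10 := Nat.pow_le_pow_right (by omega) (by norm_num)
    have t3 : W ^ 10 ≤ 2 ^ (g + h) * W ^ 10 := Nat.le_mul_of_pos_left _ t1
    have t4 : W ^ 11 * 2 ^ (g + h) = W * (2 ^ (g + h) * W ^ 10) := by ring
    have t5 : 2 ^ (g + h) * (2 * 10 ^ 11 * W ^ 10) = 2 * 10 ^ 11 * (2 ^ (g + h) * W ^ 10) := by ring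
    rw [t4, t5, Nat.sub_zero]
    generalize 2 ^ (g + h) * W ^ 10 = Z at *
    have t6 : h * (1000 * W ^ 2 + 2 * 10 ^ 11 * Z + 74 * W) ≤ W * (3 * 10 ^ 11 * Z) := by
      refine Nat.mul_le_mul (by omega) ?_
      norm_num
      omega
    have t7 : Z ≤ W * Z := Nat.le_mul_of_pos_left _ (by omega)
    have t8 : W * (3 * 10 ^ 11 * Z) = 3 * 10 ^ 11 * (W * Z) := by ring
    norm_num at *
    omega

/-! ### The products of primes with a given zero bit, and their remainders. -/

/-- `t` if it is an odd prime below `2 ^ h - 1` whose bit number `b` is zero, and `1` otherwise. -/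
def bitLeaf (h b t : ℕ) : ℕ :=
  if t.Prime ∧ t ≠ 2 ∧ t + 1 < 2 ^ h ∧ t / 2 ^ b % 2 = 0 then t else 1

/-- Write the leaves `bitLeaf h b t`, where `b` is in register 8. -/
def Prog.leafFill : Prog := .fill 16 2 ((17 ::= .lit 1 ;; 18 ::=
    (.lit 1 <ₑ .var 16) *ₑ (.var 16 +ₑ .lit 1 <ₑ .var 2) *ₑ (.var 16 %ₑ .lit 2) *ₑ
    (.read (.var 2 +ₑ .var 16) =ₑ .lit 0) *ₑ ((.var 16 >>ₑ .var 8) %ₑ .lit 2 =ₑ .lit 0)) ;;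
  .ite (.var 18) (17 ::= .var 16) .skip ;; .store (.var 10 +ₑ .var 2 +ₑ .var 16) (.var 17))

theorem Prog.leafFill_run {σ : State} {g h M W b T : ℕ} (H : Params g h M W)
    (h2 : σ.reg 2 = 2 ^ h) (h8 : σ.reg 8 = b) (h10 : σ.reg 10 = T) (hb : b ≤ h)
    (hT : 2 * 2 ^ h ≤ T + 2 ^ h) (hTM : T + 2 * 2 ^ h ≤ M)
    (hflag : ∀ t < 2 ^ h, 2 ≤ t → (σ.mem (2 ^ h + t) = 0 ↔ t.Prime))
    (hfs : ∀ t < 2 ^ h, σ.mem (2 ^ h + t) ≤ 1) :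
    Run .leafFill σ (10 ^ 4 * (W ^ 2 * 2 ^ h)) (fun σ' => Frame 16 σ σ' ∧
      σ'.mem = fillMem σ.mem (T + 2 ^ h) (2 ^ h) (bitLeaf h b)) := by
  have h32 := H.le_W
  have haW := H.add_le_W
  have hW' : W ≤ W ^ 2 := by nlinarith
  have sB : ∀ x, x ≤ M + 4 → x.size ≤ W := fun x hx => H.size_le_of_le hx
  have sS : ∀ x, x ≤ M + 4 → x.size ≤ W ^ 2 := fun x hx => (sB x hx).trans hW'
  have sl : ∀ x, x ≤ W → x.size ≤ W := fun x hx => size_le_of_lt (a := x) Nat.lt_two_pow_self hx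
  have hpos : 1 ≤ 2 ^ h := Nat.one_le_two_pow
  refine (Run.fill (R := 16) (N := 2 ^ h) (b := T + 2 ^ h) (T := 5000 * W ^ 2) (S := W ^ 2)
    (bitLeaf h b) le_rfl (by norm_num) h2 (by omega) (sS _ (by omega)) ?_).mono
    ((fill_cost_le hpos le_rfl).trans (by
      calc 2 ^ h * ((5000 + 113) * W ^ 2) ≤ 2 ^ h * (10 ^ 4 * W ^ 2) := by gcongr; norm_num
        _ = _ := by ring)) fun _ h => h
  intro t σ₁ ht c0 c16 cm
  have r2 := (c0.1 2 (by norm_num)).trans h2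
  have r8 := (c0.1 8 (by norm_num)).trans h8
  have r10 := (c0.1 10 (by norm_num)).trans h10
  have m1 : σ₁.mem (2 ^ h + t) = σ.mem (2 ^ h + t) := by rw [cm, fillMem_out (by omega)]
  have hf := hfs t ht
  have hp := hflag t ht
  -- The form that the program tests: the flags are meaningful only from 2 on, whence 1 < t, and for
  -- a prime t ≠ 2 amounts to being odd. A product of tests with values 0 and 1 acts as their
  -- conjunction.
  have hleaf : bitLeaf h b t = if 1 < t ∧ t + 1 < 2 ^ h ∧ t % 2 = 1 ∧ σ.mem (2 ^ h + t) = 0 ∧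
      t / 2 ^ b % 2 = 0 then t else 1 := by
    unfold bitLeaf
    refine if_congr ⟨?_, ?_⟩ rfl rfl
    · rintro ⟨p1, p2, p3, p4⟩
      have := p1.two_le
      exact ⟨by omega, p3, by have := p1.eq_two_or_odd; omega, (hp this).mpr p1, p4⟩
    · rintro ⟨p1, p2, p3, p4, p5⟩
      exact ⟨(hp (by omega)).mp p4, by omega, p2, p5⟩
  generalize σ.mem (2 ^ h + t) = x at *
  have hval : ((if 1 < t then 1 else 0) * (if t + 1 < 2 ^ h then 1 else 0) * (t % 2) *
      (if x = 0 then 1 else 0) * (if t / 2 ^ b % 2 = 0 then 1 else 0) = 0) ↔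
      ¬(1 < t ∧ t + 1 < 2 ^ h ∧ t % 2 = 1 ∧ x = 0 ∧ t / 2 ^ b % 2 = 0) := by
    have := Nat.mod_two_eq_zero_or_one t
    simp only [mul_eq_zero, ite_eq_right_iff, one_ne_zero, imp_false]
    omega
  have hle : (if 1 < t then 1 else 0) * (if t + 1 < 2 ^ h then 1 else 0) * (t % 2) *
      (if x = 0 then 1 else 0) * (if t / 2 ^ b % 2 = 0 then 1 else 0) ≤ 1 := by
    have := Nat.mod_two_eq_zero_or_one t
    have hi : ∀ (p : Prop) [Decidable p], (if p then 1 else 0) ≤ 1 := fun p _ => by split_ifs <;> simp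
    calc _ ≤ 1 * 1 * 1 * 1 * 1 := by
          refine Nat.mul_le_mul (Nat.mul_le_mul (Nat.mul_le_mul (Nat.mul_le_mul ?_ ?_) ?_) ?_) ?_ <;>
            first | exact hi _ | omega
      _ = 1 := rfl
  refine (Run.seq (T₁ := 4000 * W ^ 2) (Q := fun σ₂ => σ₂ = (σ₁.setReg 17 1).setReg 18
      ((if 1 < t then 1 else 0) * (if t + 1 < 2 ^ h then 1 else 0) * (t % 2) *
      (if x = 0 then 1 else 0) * (if t / 2 ^ b % 2 = 0 then 1 else 0)))
    ((Run.of_lf (W := W) (S := W ^ 2) (by omega) le_rfl rfl ?_ ?_).mono (T := _ * W ^ 2)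
      (Nat.mul_le_mul_right _ ?_) fun _ h => h) fun σ₂ hσ₂ =>
    (Run.of_lf (W := W) (S := W ^ 2) (by omega) le_rfl rfl ?_ ?_).mono (T := _ * W ^ 2)
      (T' := 1000 * W ^ 2) (Nat.mul_le_mul_right _ ?_) fun _ h => h).mono (by omega) fun _ h => h
  · have q1 : 1 ≤ W := by omega
    have q2 : 1 ≤ W ^ 2 := by omega
    have q3 := sB 2 (by omega)
    have q4 := sB t (by omega)
    have q5 := sB (2 ^ h) (by omega)
    have q6 := sl b (by omega)
    have q7 := sB x (by omega)
    simp [c16, r2, r8, m1, q1, q2, q3, q4, q5, q6, q7]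
  · simp [c16, r2, r8, m1]
  · simp [Prog.wt, Expr.nodes]
  · generalize (if 1 < t then 1 else 0) * (if t + 1 < 2 ^ h then 1 else 0) * (t % 2) *
      (if x = 0 then 1 else 0) * (if t / 2 ^ b % 2 = 0 then 1 else 0) = v at *
    by_cases hv : v = 0 <;>
    simp (disch := omega) [hσ₂, c16, r2, r10, sS, hv, show 1 ≤ W ^ 2 by omega]
  · generalize (if 1 < t then 1 else 0) * (if t + 1 < 2 ^ h then 1 else 0) * (t % 2) *
      (if x = 0 then 1 else 0) * (if t / 2 ^ b % 2 = 0 then 1 else 0) = v at *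
    rw [hleaf]
    by_cases hv : v = 0
    · rw [if_neg (hval.mp hv)]
      simp [hσ₂, c16, r2, r10, hv, c0]
    · rw [if_pos (not_not.mp (mt hval.mpr hv))]
      simp [hσ₂, c16, r2, r10, hv, c0]
  · simp [Prog.wt, Expr.nodes]

/-- For each bit, compute the product of the primes with a zero bit there and its remainders. -/
def Prog.bitStage : Prog := 8 ::= .lit 0 ;; .loop 8 1 (
  10 ::= .var 2 <<ₑ .lit 2 ;; leafFill ;; prodTree ;;
  (9 ::= .lit 6 *ₑ .var 2 +ₑ .lit 2 *ₑ .var 2 *ₑ .var 8 ;;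
    .store (.var 9 +ₑ .lit 1) (.read (.var 10 +ₑ .lit 1)) ;; 10 ::= .var 2 <<ₑ .lit 1) ;; rTree)

/-- The tree of primes is rebuilt in the same place for every bit; only its root is kept, as the
root of the remainder tree for that bit. The factor h for the bits turns W^11 into W^12. -/
theorem Prog.bitStage_run {σ : State} {g h M W : ℕ} {L : ℕ → ℕ} (H : Params g h M W)
    (h1 : σ.reg 1 = h) (h2 : σ.reg 2 = 2 ^ h) (h3 : σ.reg 3 = g) (h4 : σ.reg 4 = M)
    (hhg : h ≤ 2 ^ g) (hflag : ∀ t < 2 ^ h, 2 ≤ t → (σ.mem (2 ^ h + t) = 0 ↔ t.Prime))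
    (hfs : ∀ t < 2 ^ h, σ.mem (2 ^ h + t) ≤ 1) (hL : ∀ t < 2 ^ h, L t < 2 ^ 2 ^ g)
    (hX : ∀ j ≤ h, ∀ u < 2 ^ j, σ.mem (2 * 2 ^ h + 2 ^ j + u) = node h L j u) :
    Run .bitStage σ (10 ^ 13 * (W ^ 12 * 2 ^ (g + h))) (fun σ' => Frame 8 σ σ' ∧
      (∀ b < h, ∀ u < 2 ^ h, σ'.mem (6 * 2 ^ h + 2 * 2 ^ h * b + 2 ^ h + u) =
        rtree g h (node h L) (node h (bitLeaf h b) 0 0) h u) ∧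
      ∀ x < 4 * 2 ^ h, σ'.mem x = σ.mem x) := by
  have h32 := H.le_W
  have hg := H.five_le
  have haW := H.add_le_W
  have hW' : W ≤ W ^ 2 := by nlinarith
  have sB : ∀ x, x ≤ M + 4 → x.size ≤ W := fun x hx => H.size_le_of_le hx
  have sl : ∀ x, x ≤ W → x.size ≤ W := fun x hx => size_le_of_lt (a := x) Nat.lt_two_pow_self hx
  have hpos : 1 ≤ 2 ^ h := Nat.one_le_two_pow
  have hM : M = 6 * 2 ^ h + 2 * 2 ^ h * h := by rw [H.hM]; ring
  let I : ℕ → State → Prop := fun k σ₁ => (Frame 8 σ σ₁ ∧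
    (∀ b < k, ∀ u < 2 ^ h, σ₁.mem (6 * 2 ^ h + 2 * 2 ^ h * b + 2 ^ h + u) =
        rtree g h (node h L) (node h (bitLeaf h b) 0 0) h u) ∧
      ∀ x < 4 * 2 ^ h, σ₁.mem x = σ.mem x) ∧ σ₁.reg 8 = k
  have hinit : Run (8 ::= .lit 0) σ (5 * W ^ 2) (I 0) := by
    refine (Run.of_lf (W := W) (S := W ^ 2) (by omega) le_rfl rfl ?_ ?_).mono (T := _ * W ^ 2)
      (Nat.mul_le_mul_right _ ?_) fun _ h => h
    · simp
    · simp only [I]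
      simp [Frame.refl]
    · simp [Prog.wt, Expr.nodes]
  refine (Run.seq hinit fun σ₁ hσ₁ => Run.loop (S := W)
    (T := 2 * 10 ^ 12 * (W ^ 11 * 2 ^ (g + h))) I (Nat.zero_le h) (by omega)
    (size_le_of_lt (a := h) Nat.lt_two_pow_self (by omega)) ?_ hσ₁ ?_).mono ?_ fun σ' hσ' => hσ'.1
  · rintro k σ₂ ⟨⟨c0, -⟩, r8⟩
    exact ⟨r8, (c0.1 1 (by norm_num)).trans h1⟩
  · rintro b σ₂ - hb ⟨⟨c0, cn, cm⟩, r8⟩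
    have hbh : 2 * 2 ^ h * b + 2 * 2 ^ h ≤ 2 * 2 ^ h * h := by
      calc 2 * 2 ^ h * b + 2 * 2 ^ h = 2 * 2 ^ h * (b + 1) := by ring
        _ ≤ _ := Nat.mul_le_mul_left _ hb
    have hbl : ∀ t < 2 ^ h, bitLeaf h b t < 2 ^ 2 ^ g := by
      intro t ht
      have h5 : bitLeaf h b t < 2 ^ h := by
        have h4 : 2 ^ 2 ≤ 2 ^ h := Nat.pow_le_pow_right (by norm_num) H.two_le
        unfold bitLeaf; split_ifs <;> omega
      exact h5.trans_le (Nat.pow_le_pow_right (by norm_num) hhg)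
    have hP := node_lt hbl (Nat.zero_le h) (u := 0) (by norm_num)
    rw [Nat.sub_zero] at hP
    have hWS : W ^ 2 ≤ W ^ 2 * 2 ^ (g + h) := Nat.le_mul_of_pos_right _ (by positivity)
    have regs : ∀ {σ₃ σ₄ σ₅}, σ₃ = σ₂.setReg 10 (4 * 2 ^ h) → Frame 16 σ₃ σ₄ → Frame 11 σ₄ σ₅ →
        Frame 8 σ σ₅ ∧ σ₅.reg 1 = h ∧ σ₅.reg 2 = 2 ^ h ∧ σ₅.reg 3 = g ∧ σ₅.reg 4 = M ∧
        σ₅.reg 8 = b ∧ σ₅.reg 10 = 4 * 2 ^ h := by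
      rintro σ₃ σ₄ σ₅ rfl f1 f2
      have f3 : Frame 11 _ σ₅ := (f1.mono (by norm_num : 11 ≤ 16)).trans f2 le_rfl
      have f4 : Frame 8 σ σ₅ := (c0.setReg (by norm_num)).trans f3 (by norm_num)
      exact ⟨f4, (f4.1 1 (by norm_num)).trans h1, (f4.1 2 (by norm_num)).trans h2,
        (f4.1 3 (by norm_num)).trans h3, (f4.1 4 (by norm_num)).trans h4,
        (f3.1 8 (by norm_num)).trans (by simp [r8]), (f3.1 10 (by norm_num)).trans (by simp)⟩
    refine (Run.seq (T₁ := 100 * W ^ 2) (Q := fun σ₃ => σ₃ = σ₂.setReg 10 (4 * 2 ^ h))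
      ((Run.of_lf (W := W) (S := W ^ 2) (by omega) le_rfl rfl ?_ ?_).mono (T := _ * W ^ 2)
      (Nat.mul_le_mul_right _ ?_) fun _ h => h) fun σ₃ h₃ =>
      Run.seq (leafFill_run (b := b) (T := 4 * 2 ^ h) H ?_ ?_ ?_ hb.le (by omega) (by omega) ?_ ?_)
        fun σ₄ h₄ =>
      Run.seq (prodTree_run (T := 4 * 2 ^ h) (L := bitLeaf h b) H ?_ ?_ ?_ ?_ (by omega) hbl ?_)
        fun σ₅ h₅ =>
      Run.seq (T₁ := 1000 * (W ^ 2 * 2 ^ (g + h))) (Q := fun σ₆ => σ₆ =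
        ((σ₅.setReg 9 (6 * 2 ^ h + 2 * 2 ^ h * b)).setMem (6 * 2 ^ h + 2 * 2 ^ h * b + 1)
          (node h (bitLeaf h b) 0 0)).setReg 10 (2 * 2 ^ h))
        ((Run.of_lf (W := W) (S := W ^ 2 * 2 ^ (g + h)) (by omega) hWS rfl ?_ ?_).mono
          (T := _ * (W ^ 2 * 2 ^ (g + h))) (Nat.mul_le_mul_right _ ?_) fun _ h => h) fun σ₆ h₆ =>
      (rTree_run (T := 2 * 2 ^ h) (Rb := 6 * 2 ^ h + 2 * 2 ^ h * b) (L := L) H ?_ ?_ ?_ ?_ ?_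
        (by omega) (by omega) hL ?_ hP ?_).mono le_rfl ?_).mono ?_ fun _ h => h
    · have q1 := (sB (2 ^ h) (by omega)).trans hW'
      have q2 := (sB 2 (by omega)).trans hW'
      have q3 : 2 ≤ W ^ 2 := by omega
      simp [(c0.1 2 (by norm_num)).trans h2, q1, q2, q3]
    · simp [(c0.1 2 (by norm_num)).trans h2, mul_comm]
    · simp [Prog.wt, Expr.nodes]
    · simpa [h₃] using (c0.1 2 (by norm_num)).trans h2
    · simpa [h₃] using r8
    · simp [h₃]
    · intro t ht
      rw [h₃, State.setReg_mem, cm _ (by omega)]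
      exact hflag t ht
    · intro t ht
      rw [h₃, State.setReg_mem, cm _ (by omega)]
      exact hfs t ht
    · rw [h₄.1.1 1 (by norm_num), h₃]
      simpa using (c0.1 1 (by norm_num)).trans h1
    · rw [h₄.1.1 3 (by norm_num), h₃]
      simpa using (c0.1 3 (by norm_num)).trans h3
    · rw [h₄.1.1 4 (by norm_num), h₃]
      simpa using (c0.1 4 (by norm_num)).trans h4
    · rw [h₄.1.1 10 (by norm_num), h₃]
      simp
    · intro u hu
      rw [h₄.2, fillMem_in hu]
    · obtain ⟨-, q1, q2, q3, q4, q8, q10⟩ := regs h₃ h₄.1 h₅.1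
      have hr := h₅.2.1 0 (Nat.zero_le _) 0 (by norm_num)
      simp only [pow_zero, add_zero] at hr
      have hs : (node h (bitLeaf h b) 0 0).size ≤ W ^ 2 * 2 ^ (g + h) :=
        size_le_of_lt hP (Nat.le_mul_of_pos_left _ (by positivity))
      have sW : ∀ x, x ≤ M + 4 → x.size ≤ W ^ 2 * 2 ^ (g + h) := fun x hx =>
        ((sB x hx).trans hW').trans hWS
      simp (disch := omega) [q2, q8, q10, hr, hs, sB, sW]
      have := sl b (by omega)
      omega
    · obtain ⟨-, q1, q2, q3, q4, q8, q10⟩ := regs h₃ h₄.1 h₅.1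
      have hr := h₅.2.1 0 (Nat.zero_le _) 0 (by norm_num)
      simp only [pow_zero, add_zero] at hr
      simp [q2, q8, q10, hr]
      rw [mul_comm (2 ^ h)]
    · simp [Prog.wt, Expr.nodes]
    · simpa [h₆] using (regs h₃ h₄.1 h₅.1).2.1
    · simpa [h₆] using (regs h₃ h₄.1 h₅.1).2.2.2.1
    · simpa [h₆] using (regs h₃ h₄.1 h₅.1).2.2.2.2.1
    · simp [h₆]
    · simp [h₆]
    · intro j hj u hu
      have : 2 ^ j ≤ 2 ^ h := Nat.pow_le_pow_right (by norm_num) hj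
      rw [h₆, State.setReg_mem, State.setMem_mem, Function.update_of_ne (by omega), State.setReg_mem,
        h₅.2.2 _ (by omega) (by omega), h₄.2, fillMem_out (by omega), h₃, State.setReg_mem,
        cm _ (by omega), hX j hj u hu]
    · simp [h₆]
    · intro σ₇ h₇
      obtain ⟨f5, q1, q2, q3, q4, q8, q10⟩ := regs h₃ h₄.1 h₅.1
      have f7 : Frame 9 σ₅ σ₇ := by
        refine Frame.trans ?_ h₇.1 (by norm_num)
        rw [h₆]
        exact (((Frame.refl _ _).setReg (by norm_num)).setMem).setReg (by norm_num)
      have mem7 : ∀ x < M, (x < 4 * 2 ^ h ∨ 6 * 2 ^ h ≤ x ∧ x < 6 * 2 ^ h + 2 * 2 ^ h * b) →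
          σ₇.mem x = σ₂.mem x := by
        intro x hx hx'
        rw [h₇.2.2 x hx (by omega), h₆, State.setReg_mem, State.setMem_mem,
          Function.update_of_ne (by omega), State.setReg_mem,
          h₅.2.2 _ (by omega) (by omega), h₄.2, fillMem_out (by omega), h₃, State.setReg_mem]
      refine ⟨(f7.1 8 (by norm_num)).trans q8, ⟨(f5.trans f7 (by norm_num)).setReg le_rfl, ?_, ?_⟩,
        by simp⟩
      · intro b' hb' u hu
        rw [State.setReg_mem]
        rcases (Nat.lt_succ_iff.mp hb').eq_or_lt with rfl | hlt
        · exact h₇.2.1 u hu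
        · have hbb : 2 * 2 ^ h * b' + 2 * 2 ^ h ≤ 2 * 2 ^ h * b := by
            calc 2 * 2 ^ h * b' + 2 * 2 ^ h = 2 * 2 ^ h * (b' + 1) := by ring
              _ ≤ _ := Nat.mul_le_mul_left _ hlt
          rw [mem7 _ (by omega) (by omega), cn b' hlt u hu]
      · intro x hx
        rw [State.setReg_mem, mem7 x (by omega) (by omega), cm x hx]
    · have t1 : W ^ 2 ≤ W ^ 2 * 2 ^ (g + h) := Nat.le_mul_of_pos_right _ (by positivity)
      have t2 : W ^ 2 * 2 ^ (g + h) ≤ W ^ 11 * 2 ^ (g + h) :=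
        Nat.mul_le_mul_right _ (Nat.pow_le_pow_right (by omega) (by norm_num))
      have t3 : W ^ 10 * 2 ^ (g + h) ≤ W ^ 11 * 2 ^ (g + h) :=
        Nat.mul_le_mul_right _ (Nat.pow_le_pow_right (by omega) (by norm_num))
      have t4 : W ^ 2 * 2 ^ h ≤ W ^ 2 * 2 ^ (g + h) :=
        Nat.mul_le_mul_left _ (Nat.pow_le_pow_right (by norm_num) (by omega))
      clear * - t1 t2 t3 t4
      norm_num
      omega
  · have t1 : 1 ≤ 2 ^ (g + h) := Nat.one_le_two_pow
    have t2 : W ≤ W ^ 11 := Nat.le_self_pow (by norm_num) W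
    have t2' : W ^ 2 ≤ W ^ 11 := Nat.pow_le_pow_right (by omega) (by norm_num)
    have t3 : W ^ 11 ≤ W ^ 11 * 2 ^ (g + h) := Nat.le_mul_of_pos_right _ t1
    have t4 : W ^ 12 * 2 ^ (g + h) = W * (W ^ 11 * 2 ^ (g + h)) := by ring
    rw [t4, Nat.sub_zero]
    generalize W ^ 11 * 2 ^ (g + h) = Z at *
    have t6 : h * (2 * 10 ^ 12 * Z + 74 * W) ≤ W * (3 * 10 ^ 12 * Z) := by
      refine Nat.mul_le_mul (by omega) ?_
      norm_num
      omega
    have t7 : Z ≤ W * Z := Nat.le_mul_of_pos_left _ (by omega)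
    have t8 : W * (3 * 10 ^ 12 * Z) = 3 * 10 ^ 12 * (W * Z) := by ring
    norm_num at *
    omega

/-! ### Finding prime factors -/

/-- The product of the odd primes below `2 ^ h - 1` whose bit number `b` is zero. -/
abbrev bitProd (h b : ℕ) : ℕ := node h (bitLeaf h b) 0 0

theorem prime_dvd_bitProd {h b q : ℕ} (hq : q.Prime) :
    q ∣ bitProd h b ↔ q ≠ 2 ∧ q + 1 < 2 ^ h ∧ q / 2 ^ b % 2 = 0 := by
  rw [bitProd, node_root, hq.prime.dvd_finsetProd_iff]
  constructor
  · rintro ⟨t, -, hd⟩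
    unfold bitLeaf at hd
    split_ifs at hd with hc
    · rw [(Nat.prime_dvd_prime_iff_eq hq hc.1).mp hd]
      exact hc.2
    · exact absurd (Nat.dvd_one.mp hd) hq.one_lt.ne'
  · rintro ⟨h1, h2, h3⟩
    refine ⟨q, Finset.mem_range.mpr (by omega), ?_⟩
    rw [bitLeaf, if_pos ⟨hq, h1, h2, h3⟩]

/-- The value that the bitwise search for the least prime factor of `x` finds. -/
def searchValue (h x : ℕ) : ℕ := if x.minFac + 1 < 2 ^ h then x.minFac else 2 ^ h - 1

/-- The invariant of the bitwise search: the bits from `b` on are known, and `y` is a divisor whose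
small prime factors have these bits. -/
structure Search (h x b y p : ℕ) : Prop where
  pos : 0 < y
  dvd : y ∣ x
  val : p = searchValue h x / 2 ^ b * 2 ^ b
  bits : ∀ q, q.Prime → q + 1 < 2 ^ h → q ∣ y → q / 2 ^ b = searchValue h x / 2 ^ b
  minFac : x.minFac + 1 < 2 ^ h → x.minFac ∣ y

theorem searchValue_lt (h x : ℕ) : searchValue h x < 2 ^ h := by
  have : 1 ≤ 2 ^ h := Nat.one_le_two_pow
  unfold searchValue; split_ifs <;> omega

theorem Search.init {h x : ℕ} (hx : 0 < x) : Search h x h x 0 where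
  pos := hx
  dvd := dvd_rfl
  val := by rw [Nat.div_eq_of_lt (searchValue_lt h x), zero_mul]
  bits := fun q _ hq _ => by
    rw [Nat.div_eq_of_lt (searchValue_lt h x), Nat.div_eq_of_lt (by omega)]
  minFac := fun _ => Nat.minFac_dvd x

theorem div_two_pow_succ' (a b : ℕ) : a / 2 ^ b = 2 * (a / 2 ^ (b + 1)) + a / 2 ^ b % 2 := by
  rw [pow_succ, ← Nat.div_div_eq_div_mul]
  omega

/-- Let v be the search value. If bit b of v is 0, then v is the least prime factor; it divides both
y and B_b, and all prime factors of the gcd have bit b zero. If the bit is 1, every small prime q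
dividing y has q ≥ v and the same higher bits as v, so its bit b is 1 too and the gcd is 1. -/
theorem Search.step {h x b y p : ℕ} (hb : b < h) (hx : Odd x) (hx1 : x ≠ 1)
    (H : Search h x (b + 1) y p) :
    if 1 < Nat.gcd y (bitProd h b) then Search h x b (Nat.gcd y (bitProd h b)) p
    else Search h x b y (p + 2 ^ b) := by
  have hv := div_two_pow_succ' (searchValue h x) b
  have hxpos : 0 < x := hx.pos
  have hodd : ∀ q, q.Prime → q ∣ x → q ≠ 2 := by
    rintro q - hd rfl
    exact (Nat.not_even_iff_odd.mpr hx) (even_iff_two_dvd.mpr hd)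
  have hge : ∀ q, q.Prime → q + 1 < 2 ^ h → q ∣ x → searchValue h x ≤ q := by
    intro q hq hqh hd
    have := Nat.minFac_le_of_dvd hq.two_le hd
    rw [searchValue, if_pos (by omega)]
    exact this
  rcases Nat.mod_two_eq_zero_or_one (searchValue h x / 2 ^ b) with h0 | h1
  -- Otherwise v = 2^h - 1, all of whose bits below h are one.
  · have hmf : x.minFac + 1 < 2 ^ h := by
      by_contra hcon
      rw [searchValue, if_neg hcon] at h0
      have : (2 ^ h - 1) / 2 ^ b = 2 ^ (h - b) - 1 := by
        have e : 2 ^ h = 2 ^ (h - b) * 2 ^ b := by rw [← pow_add]; congr 1; omega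
        have e1 : 1 ≤ 2 ^ b := Nat.one_le_two_pow
        have e2 : 1 ≤ 2 ^ (h - b) := Nat.one_le_two_pow
        rw [e]
        refine Nat.div_eq_of_lt_le ?_ ?_
        · rw [Nat.sub_mul]; omega
        · rw [Nat.sub_add_cancel e2]
          have := Nat.mul_pos e2 e1
          omega
      rw [this] at h0
      have e : 2 ^ (h - b) = 2 * 2 ^ (h - b - 1) := by rw [← pow_succ']; congr 1; omega
      have e2 : 1 ≤ 2 ^ (h - b - 1) := Nat.one_le_two_pow
      omega
    have hsv : searchValue h x = x.minFac := if_pos hmf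
    have hmp := Nat.minFac_prime hx1
    have hdg : x.minFac ∣ Nat.gcd y (bitProd h b) := Nat.dvd_gcd (H.minFac hmf)
      ((prime_dvd_bitProd hmp).mpr ⟨hodd _ hmp (Nat.minFac_dvd x), hmf, hsv ▸ h0⟩)
    have hgpos : 0 < Nat.gcd y (bitProd h b) := Nat.gcd_pos_of_pos_left _ H.pos
    rw [if_pos (hmp.one_lt.trans_le (Nat.le_of_dvd hgpos hdg))]
    refine ⟨hgpos, (Nat.gcd_dvd_left _ _).trans H.dvd, ?_, ?_, fun _ => hdg⟩
    · rw [H.val, hv, h0, pow_succ]; ring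
    · intro q hq hqh hd
      have h3 := H.bits q hq hqh (hd.trans (Nat.gcd_dvd_left _ _))
      have h4 := ((prime_dvd_bitProd hq).mp (hd.trans (Nat.gcd_dvd_right _ _))).2.2
      rw [div_two_pow_succ' q b, hv, h3, h4, h0]
  · have hbit : ∀ q, q.Prime → q + 1 < 2 ^ h → q ∣ y → q / 2 ^ b % 2 ≠ 0 := by
      intro q hq hqh hd h2
      have h3 := H.bits q hq hqh hd
      have h4 := Nat.div_le_div_right (c := 2 ^ b) (hge q hq hqh (hd.trans H.dvd))
      have h5 := div_two_pow_succ' q b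
      omega
    have hg : ¬ 1 < Nat.gcd y (bitProd h b) := by
      intro hg
      obtain ⟨q, hq, hd⟩ := Nat.exists_prime_and_dvd hg.ne'
      have h4 := (prime_dvd_bitProd hq).mp (hd.trans (Nat.gcd_dvd_right _ _))
      exact hbit q hq h4.2.1 (hd.trans (Nat.gcd_dvd_left _ _)) h4.2.2
    rw [if_neg hg]
    refine ⟨H.pos, H.dvd, ?_, ?_, H.minFac⟩
    · rw [H.val, hv, h1, pow_succ]; ring
    · intro q hq hqh hd
      have h3 := H.bits q hq hqh hd
      have h4 := hbit q hq hqh hd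
      have h5 := div_two_pow_succ' q b
      omega

/-- If the search ends with 2^h - 1, the least prime factor is at least 2^h - 1, and a composite x
would be at least (2^h - 1)^2. The value is unambiguous because 2^h - 1 itself, even if prime, is
excluded from the tables. -/
theorem Search.final {h x y p : ℕ} (H : Search h x 0 y p) (hx : 1 < x) (hxh : x < (2 ^ h - 1) ^ 2) :
    (if p + 1 = 2 ^ h then x else p) = x.minFac := by
  have hv := H.val
  rw [pow_zero, Nat.div_one, mul_one] at hv
  rw [hv, searchValue]
  have : 1 ≤ 2 ^ h := Nat.one_le_two_pow
  split_ifs with h1 h2 h2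
  · omega
  · rfl
  · symm
    rw [← Nat.prime_def_minFac.trans ⟨fun h => h.2, fun h => ⟨hx, h⟩⟩]
    by_contra hnp
    have h3 := Nat.minFac_sq_le_self (by omega) hnp
    have h4 : (2 ^ h - 1) ^ 2 ≤ x.minFac ^ 2 := Nat.pow_le_pow_left (by omega) 2
    omega
  · omega

/-! ### Programs for gcds, least prime factors and the printed output. -/

/-- The greatest common divisor of registers 12 and 15, which is put into register 14. -/
def Prog.gcdProg : Prog := (14 ::= .var 12 ;; 15 ::= .var 15 %ₑ .var 12) ;;
  .while (.var 15) (16 ::= .var 14 %ₑ .var 15 ;; 14 ::= .var 15 ;; 15 ::= .var 16)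

/-- In Euclid's algorithm b * (a % b) ≤ a * b / 2 for b < a, so the product of the two numbers at
least halves in each round. It starts at no more than y^2 < 2^(2W), which allows 2W rounds. -/
theorem Prog.gcdProg_run {σ : State} {W y r : ℕ} (hW : 32 ≤ W) (h12 : σ.reg 12 = y)
    (h15 : σ.reg 15 = r) (hy : 0 < y) (hyW : y.size ≤ W) (hrW : r.size ≤ W) :
    Run .gcdProg σ (1000 * W ^ 3) (fun σ' => Frame 14 σ σ' ∧ σ'.reg 14 = Nat.gcd y r ∧
      σ'.mem = σ.mem) := by
  have hW' : W ≤ W ^ 2 := by nlinarith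
  have sy : ∀ x, x ≤ y → x.size ≤ W := fun x hx => size_le_of_le hx hyW
  have sy' : ∀ x, x ≤ y → x.size ≤ W ^ 2 := fun x hx => (sy x hx).trans hW'
  have hy2 : y < 2 ^ W := Nat.size_le.mp hyW
  let I : ℕ → State → Prop := fun k σ₁ => Frame 14 σ σ₁ ∧ σ₁.mem = σ.mem ∧
    σ₁.reg 15 < σ₁.reg 14 ∧ σ₁.reg 14 ≤ y ∧ Nat.gcd (σ₁.reg 14) (σ₁.reg 15) = Nat.gcd y r ∧
    (σ₁.reg 14 * σ₁.reg 15) * 2 ^ k ≤ y * y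
  refine (Run.seq (T₁ := 100 * W ^ 2) (Q := I 0) ((Run.of_lf (W := W) (S := W ^ 2) (by omega) le_rfl
    rfl ?_ ?_).mono (T := _ * W ^ 2) (Nat.mul_le_mul_right _ ?_) fun _ h => h) fun σ₁ h₁ =>
    Run.while (n := 2 * W) (Tc := 1 + W) (T := 100 * W ^ 2) I h₁ ?_ ?_ ?_).mono ?_ fun _ h => h
  · simp [h12, h15, hyW, hrW, hyW.trans hW']
  · simp only [I]
    simp [h12, h15, Frame.refl]
    refine ⟨Nat.mod_lt _ hy, (Nat.gcd_comm _ _).trans (Nat.gcd_rec y r).symm, ?_⟩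
    exact Nat.mul_le_mul_left _ (Nat.mod_lt _ hy).le
  · simp [Prog.wt, Expr.nodes]
  · rintro k σ₂ - ⟨-, -, h3, h4, -⟩
    have := sy (σ₂.reg 15) (by omega)
    simp only [Expr.cost]
    omega
  · rintro k σ₂ - ⟨c0, cm, h3, h4, h5, -⟩ h0
    simp only [Expr.eval] at h0
    rw [h0, Nat.gcd_zero_right] at h5
    exact ⟨c0, h5, cm⟩
  · rintro k σ₂ - ⟨c0, cm, h3, h4, h5, h6⟩ h0
    simp only [Expr.eval] at h0
    constructor
    · have h7 : 2 ^ k ≤ y * y := le_trans (Nat.le_mul_of_pos_left _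
        (Nat.mul_pos (by omega) (by omega))) h6
      have h8 : y * y < 2 ^ (2 * W) := by
        rw [two_mul, pow_add]; exact Nat.mul_lt_mul'' hy2 hy2
      exact (Nat.pow_lt_pow_iff_right (by norm_num)).mp (h7.trans_lt h8)
    · refine (Run.of_lf (W := W) (S := W ^ 2) (by omega) le_rfl rfl ?_ ?_).mono (T := _ * W ^ 2)
        (Nat.mul_le_mul_right _ ?_) fun _ h => h
      · have hm : σ₂.reg 14 % σ₂.reg 15 ≤ σ₂.reg 14 := Nat.mod_le _ _
        simp (disch := omega) [sy, sy']
      · simp only [I]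
        simp [c0, cm]
        generalize σ₂.reg 14 = a at *
        generalize σ₂.reg 15 = b at *
        have hm : a % b < b := Nat.mod_lt _ (by omega)
        refine ⟨hm, by omega,
          ((Nat.gcd_comm _ _).trans (Nat.gcd_rec b a).symm).trans ((Nat.gcd_comm _ _).trans h5), ?_⟩
        have hd := Nat.div_add_mod a b
        have h1 : 1 ≤ a / b := Nat.div_pos h3.le (by omega)
        have h2 : 2 * (a % b) ≤ a := by nlinarith
        calc b * (a % b) * 2 ^ (k + 1) = (2 * (a % b)) * b * 2 ^ k := by ring
          _ ≤ a * b * 2 ^ k := by gcongr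
          _ ≤ y * y := h6
      · simp [Prog.wt, Expr.nodes]
  · have t1 : W ^ 3 = W * W ^ 2 := by ring
    have t2 : 2 * W * (1 + (1 + W) + 100 * W ^ 2) ≤ 2 * W * (102 * W ^ 2) :=
      Nat.mul_le_mul_left _ (by nlinarith)
    have t3 : W ^ 2 ≤ W * W ^ 2 := Nat.le_mul_of_pos_left _ (by omega)
    have t4 : 2 * W * (102 * W ^ 2) = 204 * (W * W ^ 2) := by ring
    omega

/-- Put the least prime factor of register 10 into register 11. -/
def Prog.minFacProg : Prog := .ite (.var 10 %ₑ .lit 2) (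
    (11 ::= .lit 0 ;; 12 ::= .var 10 ;; 13 ::= .var 1) ;;
    .while (.var 13) ((13 ::= .var 13 -ₑ .lit 1 ;; 15 ::= .read (.lit 6 *ₑ .var 2 +ₑ
        .lit 2 *ₑ .var 2 *ₑ .var 13 +ₑ .var 2 +ₑ .var 8)) ;; gcdProg ;;
      .ite (.lit 1 <ₑ .var 14) (12 ::= .var 14) (11 ::= .var 11 +ₑ .lit 1 <<ₑ .var 13)) ;;
    .ite (.var 11 +ₑ .lit 1 =ₑ .var 2) (11 ::= .var 10) .skip)
  (11 ::= .lit 2)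

/-- Even numbers are settled by the parity test, since the tables contain only odd primes and serve
only odd divisors. For odd `x` the hypothesis on gcds lets table entries stand in for the huge
products B_b. -/
theorem Prog.minFacProg_run {σ : State} {g h M W i x : ℕ} (H : Params g h M W)
    (h1 : σ.reg 1 = h) (h2 : σ.reg 2 = 2 ^ h) (h8 : σ.reg 8 = i) (hi : i < 2 ^ h)
    (h10 : σ.reg 10 = x) (hx : 1 < x) (hxh : x < (2 ^ h - 1) ^ 2)
    (hs : ∀ b < h, σ.mem (6 * 2 ^ h + 2 * 2 ^ h * b + 2 ^ h + i) < 2 ^ 2 ^ g)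
    (hg : Odd x → ∀ b < h, ∀ y, y ∣ x →
      Nat.gcd y (σ.mem (6 * 2 ^ h + 2 * 2 ^ h * b + 2 ^ h + i)) = Nat.gcd y (bitProd h b)) :
    Run .minFacProg σ (10 ^ 4 * W ^ 4) (fun σ' => Frame 11 σ σ' ∧ σ'.mem = σ.mem ∧
      σ'.reg 11 = x.minFac) := by
  have h32 := H.le_W
  have haW := H.add_le_W
  have hW' : W ≤ W ^ 2 := by nlinarith
  have hW2 : 2 * h ≤ W := H.le_pow.trans H.pow_le_W
  have hxW : x < 2 ^ W := by
    refine hxh.trans_le ((Nat.pow_le_pow_left (Nat.sub_le _ 1) 2).trans ?_)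
    rw [← pow_mul]
    exact Nat.pow_le_pow_right (by norm_num) (by omega)
  have hM : M = 6 * 2 ^ h + 2 * 2 ^ h * h := by rw [H.hM]; ring
  have hpos : 1 ≤ 2 ^ h := Nat.one_le_two_pow
  have sB : ∀ x, x ≤ M + 4 → x.size ≤ W := fun x hx => H.size_le_of_le hx
  have sl : ∀ x, x ≤ W → x.size ≤ W := fun x hx => size_le_of_lt (a := x) Nat.lt_two_pow_self hx
  have sx : ∀ y, y ≤ x → y.size ≤ W := fun y hy => size_le_of_le hy (Nat.size_le.mpr hxW)
  have hc : (Expr.var 10 %ₑ .lit 2).cost σ ≤ 100 * W ^ 2 := by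
    refine (Expr.cost_le_sq (S := W) (e := .var 10 %ₑ .lit 2) (by omega) ?_).trans ?_
    · simp [h10, sx x le_rfl, size_two_le (show 2 ≤ W by omega)]
    · exact Nat.mul_le_mul_right _ (by simp [Expr.nodes])
  refine (Run.ite (T := 9000 * W ^ 4) hc (fun hne => ?_) (fun heq => ?_)).mono ?_ fun _ h => h
  · simp only [Expr.eval, Op.eval, h10] at hne
    have hodd : Odd x := Nat.odd_iff.mpr (by omega)
    let I : ℕ → State → Prop := fun k σ₁ => k ≤ h ∧ Frame 11 σ σ₁ ∧ σ₁.mem = σ.mem ∧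
      σ₁.reg 13 = h - k ∧ Search h x (h - k) (σ₁.reg 12) (σ₁.reg 11)
    refine (Run.seq (T₁ := 100 * W ^ 2) (Q := I 0) ((Run.of_lf (W := W) (S := W ^ 2) (by omega) le_rfl
      rfl ?_ ?_).mono (T := _ * W ^ 2) (Nat.mul_le_mul_right _ ?_) fun _ h => h) fun σ₁ h₁ =>
      Run.seq (Q := I h) (Run.while (n := h) (Tc := 1 + W) (T := 7000 * W ^ 2 + 1000 * W ^ 3) I h₁
        ?_ ?_ ?_) fun σ₃ h₃ => (Run.of_lf (W := W) (S := W ^ 2) (by omega) le_rfl rfl ?_ ?_).mono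
        (T := _ * W ^ 2) (T' := 500 * W ^ 2) (Nat.mul_le_mul_right _ ?_) fun _ h => h).mono ?_
        fun _ h => h
    · have q1 := (sx x le_rfl).trans hW'
      have q2 := (sl h (by omega)).trans hW'
      simp [h10, h1, q1, q2]
    · simp only [I]
      simp [h10, h1, Frame.refl, Search.init (show 0 < x by omega)]
    · simp [Prog.wt, Expr.nodes]
    · rintro k σ₂ - ⟨-, -, -, r13, -⟩
      simp only [Expr.cost, r13]
      have := sl (h - k) (by omega)
      omega
    · rintro k σ₂ - ⟨hk, hI⟩ h0
      simp only [Expr.eval, hI.2.2.1] at h0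
      obtain rfl : k = h := by omega
      exact ⟨hk, hI⟩
    · rintro k σ₂ - ⟨hk, c0, cm, r13, hS⟩ h0
      simp only [Expr.eval, r13] at h0
      refine ⟨by omega, ?_⟩
      obtain ⟨b, hb⟩ : ∃ b, h - k = b + 1 := ⟨h - k - 1, by omega⟩
      have hb' : h - (k + 1) = b := by omega
      rw [hb] at r13 hS
      have hbh : 2 * 2 ^ h * b + 2 * 2 ^ h ≤ 2 * 2 ^ h * h := by
        calc 2 * 2 ^ h * b + 2 * 2 ^ h = 2 * 2 ^ h * (b + 1) := by ring
          _ ≤ _ := Nat.mul_le_mul_left _ (by omega)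
      have r2 := (c0.1 2 (by norm_num)).trans h2
      have r8 := (c0.1 8 (by norm_num)).trans h8
      have hr := hs b (by omega)
      have hgr := hg hodd b (by omega)
      rw [← cm] at hr hgr
      have hstep := hS.step (by omega) hodd (by omega)
      have hyx := Nat.le_of_dvd (by omega) hS.dvd
      have hypos := hS.pos
      rw [← hgr _ hS.dvd] at hstep
      have hple : σ₂.reg 11 ≤ 2 ^ h := by
        rw [hS.val]
        exact (Nat.div_mul_le_self _ _).trans (searchValue_lt h x).le
      generalize hrdef : σ₂.mem (6 * 2 ^ h + 2 * 2 ^ h * b + 2 ^ h + i) = r at *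
      have sr : r.size ≤ W := size_le_of_lt hr H.pow_le_W
      refine (Run.seq (T₁ := 3000 * W ^ 2) (Q := fun σ₃ => σ₃ = (σ₂.setReg 13 b).setReg 15 r)
        ((Run.of_lf (W := W) (S := W ^ 2) (by omega) le_rfl
        rfl ?_ ?_).mono (T := _ * W ^ 2) (Nat.mul_le_mul_right _ ?_) fun _ h => h) fun σ₃ h₃ =>
        Run.seq (gcdProg_run (y := σ₂.reg 12) (r := r) h32 (by simp [h₃]) (by simp [h₃]) hypos
          (sx _ hyx) sr) fun σ₄ h₄ => (Run.of_lf (W := W) (S := W ^ 2) (by omega) le_rfl rfl ?_ ?_).mono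
        (T := _ * W ^ 2) (T' := 1000 * W ^ 2) (Nat.mul_le_mul_right _ ?_) fun _ h => h).mono (by omega)
        fun _ h => h
      · have q1 := (sl (b + 1) (by omega)).trans hW'
        have q2 := sl b (by omega)
        simp (disch := omega) [r13, r2, r8, hrdef, q1, q2, sr, sB]
        omega
      · simp [r13, r2, r8, hrdef]
      · simp [Prog.wt, Expr.nodes]
      · have p11 := h₄.1.1 11 (by norm_num)
        have p13 := h₄.1.1 13 (by norm_num)
        simp [h₃] at p11 p13
        have hgy : Nat.gcd (σ₂.reg 12) r ≤ σ₂.reg 12 := Nat.le_of_dvd hypos (Nat.gcd_dvd_left _ _)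
        have q1 := (sx (Nat.gcd (σ₂.reg 12) r) (by omega)).trans hW'
        have q2 := (sB (σ₂.reg 11) (by omega)).trans hW'
        have q3 := (sl b (by omega)).trans hW'
        have q4 : b ≤ W ^ 2 := by omega
        have q5 : 1 ≤ W ^ 2 := by omega
        by_cases hc : 1 < Nat.gcd (σ₂.reg 12) r <;>
        simp [h₄.2.1, hc, p11, p13, q1, q2, q3, q4, q5]
      · have p11 := h₄.1.1 11 (by norm_num)
        have p12 := h₄.1.1 12 (by norm_num)
        have p13 := h₄.1.1 13 (by norm_num)
        simp [h₃] at p11 p12 p13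
        have f0 : Frame 11 σ σ₄ := by
          refine c0.trans (Frame.trans (R := 11) ?_ h₄.1 (by norm_num)) le_rfl
          rw [h₃]
          exact ((Frame.refl _ _).setReg (by norm_num)).setReg (by norm_num)
        have fm : σ₄.mem = σ.mem := by rw [h₄.2.2, h₃]; exact cm
        simp only [I, hb']
        by_cases hc : 1 < Nat.gcd (σ₂.reg 12) r
        · rw [if_pos hc] at hstep
          simp [h₄.2.1, hc, p11, p13, f0, fm, hstep]
          omega
        · rw [if_neg hc] at hstep
          simp [h₄.2.1, hc, p11, p12, p13, f0, fm, hstep]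
          omega
      · simp [Prog.wt, Expr.nodes]
    · obtain ⟨-, c0, cm, r13, hS⟩ := h₃
      have r2 := (c0.1 2 (by norm_num)).trans h2
      have r10 := (c0.1 10 (by norm_num)).trans h10
      have hple : σ₃.reg 11 ≤ 2 ^ h := by
        rw [hS.val]
        exact (Nat.div_mul_le_self _ _).trans (searchValue_lt h x).le
      have q1 := (sx x le_rfl).trans hW'
      have q2 := (sB (σ₃.reg 11) (by omega)).trans hW'
      have q3 := (sB (2 ^ h) (by omega)).trans hW'
      have q5 : 1 ≤ W ^ 2 := by omega
      by_cases hc : σ₃.reg 11 + 1 = 2 ^ h <;>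
      simp [r2, r10, hc, q1, q2, q3, q5]
    · obtain ⟨-, c0, cm, r13, hS⟩ := h₃
      have r2 := (c0.1 2 (by norm_num)).trans h2
      have r10 := (c0.1 10 (by norm_num)).trans h10
      rw [Nat.sub_self] at hS
      have hfin := hS.final hx hxh
      by_cases hc : σ₃.reg 11 + 1 = 2 ^ h
      · rw [if_pos hc] at hfin
        simp [r2, r10, hc, c0, cm, ← hfin]
      · rw [if_neg hc] at hfin
        simp [r2, r10, hc, c0, cm, ← hfin]
    · simp [Prog.wt, Expr.nodes]
    · have t1 : W ^ 4 = W * W ^ 3 := by ring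
      have t3 : W ^ 3 = W * W ^ 2 := by ring
      have t0 : 32 * W ^ 2 ≤ W * W ^ 2 := Nat.mul_le_mul_right _ h32
      have t4 : 32 * W ^ 3 ≤ W * W ^ 3 := Nat.mul_le_mul_right _ h32
      have t2 : h * (1 + (1 + W) + (7000 * W ^ 2 + 1000 * W ^ 3)) ≤ W * (1500 * W ^ 3) :=
        Nat.mul_le_mul (by omega) (by omega)
      have t5 : W * (1500 * W ^ 3) = 1500 * (W * W ^ 3) := by ring
      omega
  · simp only [Expr.eval, Op.eval, h10] at heq
    have h3 : x.minFac = 2 := (Nat.minFac_eq_two_iff x).mpr (Nat.dvd_of_mod_eq_zero heq)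
    refine (Run.of_lf (W := W) (S := W ^ 2) (by omega) le_rfl rfl ?_ ?_).mono (T := _ * W ^ 2)
      (T' := _) ?_ fun _ h => h
    · have q2 := (sB 2 (by omega)).trans hW'
      simp [q2]
    · simp [Frame.refl, h3]
    · simp only [Prog.wt, Expr.nodes]
      have : W ^ 2 ≤ W ^ 4 := Nat.pow_le_pow_right (by omega) (by norm_num)
      omega
  · have : W ^ 2 ≤ W ^ 4 := Nat.pow_le_pow_right (by omega) (by norm_num)
    omega

theorem primeFactorsList_eq_cons {x : ℕ} (hx : 1 < x) :
    x.primeFactorsList = x.minFac :: (x / x.minFac).primeFactorsList := by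
  obtain ⟨k, rfl⟩ : ∃ k, x = k + 2 := ⟨x - 2, by omega⟩
  rw [Nat.primeFactorsList]

/-- Every prime factor is at least 2, so each division at least halves the cofactor; this bounds the
number of rounds by the bit length of m. -/
theorem div_minFac {x m k : ℕ} (hx : 1 < x) (hd : x ∣ m) (hk : x * 2 ^ k ≤ m) :
    0 < x / x.minFac ∧ x / x.minFac ∣ m ∧ x / x.minFac * 2 ^ (k + 1) ≤ m := by
  have h1 := Nat.minFac_dvd x
  have h2 := (Nat.minFac_prime hx.ne').two_le
  refine ⟨Nat.div_pos (Nat.minFac_le (by omega)) (by omega), (Nat.div_dvd_of_dvd h1).trans hd, ?_⟩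
  refine le_trans ?_ hk
  have h3 := Nat.div_mul_cancel h1
  calc x / x.minFac * 2 ^ (k + 1) = x / x.minFac * 2 * 2 ^ k := by ring
    _ ≤ x / x.minFac * x.minFac * 2 ^ k := by gcongr
    _ = _ := by rw [h3]

/-- The tables with the remainders of the products of primes, for the number `m` at position `i`. -/
structure Table (g h : ℕ) (mem : ℕ → ℕ) (i m : ℕ) : Prop where
  lt : i < 2 ^ h
  val : mem i = m
  pos : 0 < m
  bound : m < (2 ^ h - 1) ^ 2
  size : ∀ b < h, mem (6 * 2 ^ h + 2 * 2 ^ h * b + 2 ^ h + i) < 2 ^ 2 ^ g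
  gcd : ∀ b < h, ∀ y, Odd y → y ∣ m →
    Nat.gcd y (mem (6 * 2 ^ h + 2 * 2 ^ h * b + 2 ^ h + i)) = Nat.gcd y (bitProd h b)

theorem Prog.minFacProg_run' {σ : State} {g h M W i m x : ℕ} (H : Params g h M W)
    (h1 : σ.reg 1 = h) (h2 : σ.reg 2 = 2 ^ h) (h8 : σ.reg 8 = i) (hT : Table g h σ.mem i m)
    (h10 : σ.reg 10 = x) (hx : 1 < x) (hd : x ∣ m) :
    Run .minFacProg σ (10 ^ 4 * W ^ 4) (fun σ' => Frame 11 σ σ' ∧ σ'.mem = σ.mem ∧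
      σ'.reg 11 = x.minFac) :=
  minFacProg_run H h1 h2 h8 hT.lt h10 hx ((Nat.le_of_dvd hT.pos hd).trans_lt hT.bound) hT.size
    fun hodd b hb y hy => hT.gcd b hb y (hodd.of_dvd_nat hy) (hy.trans hd)

/-- Print the factorization of the number whose index is in register 8. -/
def Prog.factorOne : Prog := (10 ::= .read (.var 8) ;; 9 ::= .lit 0) ;;
  .while (.lit 1 <ₑ .var 10) (minFacProg ;; 10 ::= .var 10 /ₑ .var 11 ;; 9 ::= .var 9 +ₑ .lit 1) ;;
  (.print (.var 9) ;; 10 ::= .read (.var 8)) ;;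
  .while (.lit 1 <ₑ .var 10) (minFacProg ;; .print (.var 11) ;; 10 ::= .var 10 /ₑ .var 11)

/-- The number of prime factors must be printed before the factors, so the factorization is computed
twice: once for counting and once for printing. -/
theorem Prog.factorOne_run {σ : State} {g h M W i m : ℕ} (H : Params g h M W)
    (h1 : σ.reg 1 = h) (h2 : σ.reg 2 = 2 ^ h) (h8 : σ.reg 8 = i) (hT : Table g h σ.mem i m) :
    Run .factorOne σ (10 ^ 5 * W ^ 5) (fun σ' => (∀ r < 9, σ'.reg r = σ.reg r) ∧ σ'.mem = σ.mem ∧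
      σ'.out = σ.out ++ (m.primeFactorsList.length :: m.primeFactorsList)) := by
  have h32 := H.le_W
  have haW := H.add_le_W
  have hW' : W ≤ W ^ 2 := by nlinarith
  have hW2 : 2 * h ≤ W := H.le_pow.trans H.pow_le_W
  have hmW : m < 2 ^ W := by
    refine hT.bound.trans_le ((Nat.pow_le_pow_left (Nat.sub_le _ 1) 2).trans ?_)
    rw [← pow_mul]
    exact Nat.pow_le_pow_right (by norm_num) (by omega)
  have hM : M = 6 * 2 ^ h + 2 * 2 ^ h * h := by rw [H.hM]; ring
  have sB : ∀ x, x ≤ M + 4 → x.size ≤ W := fun x hx => H.size_le_of_le hx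
  have sl : ∀ x, x ≤ W → x.size ≤ W := fun x hx => size_le_of_lt (a := x) Nat.lt_two_pow_self hx
  have sm : ∀ y, y ≤ m → y.size ≤ W := fun y hy => size_le_of_le hy (Nat.size_le.mpr hmW)
  have hmpos := hT.pos
  have hilt := hT.lt
  have hmval := hT.val
  have hcost : ∀ σ₁ : State, σ₁.reg 10 ≤ m → (Expr.lit 1 <ₑ .var 10).cost σ₁ ≤ 36 * W := by
    intro σ₁ hm
    exact Expr.cost_le_lin (e := .lit 1 <ₑ .var 10) (by omega) rfl
      ⟨sm 1 (by omega), sm _ hm, by simp⟩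
  have hend : ∀ {x}, 0 < x → (if 1 < x then 1 else 0) = 0 → x = 1 := by
    intro x h0 h1
    split_ifs at h1
    omega
  have hgo : ∀ {x : ℕ}, (if 1 < x then 1 else 0) ≠ 0 → 1 < x := by
    intro x h1
    by_contra hcon
    simp [hcon] at h1
  have hcount : ∀ {x k}, 1 < x → x * 2 ^ k ≤ m → k < W := by
    intro x k h0 h1
    refine (Nat.pow_lt_pow_iff_right (a := 2) (by norm_num)).mp (lt_of_le_of_lt ?_ hmW)
    exact (Nat.le_mul_of_pos_left _ (by omega)).trans h1
  let J : ℕ → State → Prop := fun k σ₁ => (∀ r < 9, σ₁.reg r = σ.reg r) ∧ σ₁.mem = σ.mem ∧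
    0 < σ₁.reg 10 ∧ σ₁.reg 10 ∣ m ∧ σ₁.reg 10 * 2 ^ k ≤ m
  let I₁ : ℕ → State → Prop := fun k σ₁ => J k σ₁ ∧ σ₁.out = σ.out ∧ σ₁.reg 9 = k ∧
    k + (σ₁.reg 10).primeFactorsList.length = m.primeFactorsList.length
  let I₂ : ℕ → State → Prop := fun k σ₁ => J k σ₁ ∧ σ₁.out ++ (σ₁.reg 10).primeFactorsList =
    σ.out ++ (m.primeFactorsList.length :: m.primeFactorsList)
  have hbody : ∀ k σ₁, J k σ₁ → 1 < σ₁.reg 10 → Run .minFacProg σ₁ (10 ^ 4 * W ^ 4) (fun σ' =>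
      Frame 11 σ₁ σ' ∧ σ'.mem = σ₁.mem ∧ σ'.reg 11 = (σ₁.reg 10).minFac) := by
    rintro k σ₁ ⟨c0, cm, -, hd, -⟩ hx
    exact minFacProg_run' H ((c0 1 (by norm_num)).trans h1) ((c0 2 (by norm_num)).trans h2)
      ((c0 8 (by norm_num)).trans h8) (cm ▸ hT) rfl hx hd
  have hJ : ∀ k σ₁ σ₂ v, J k σ₁ → 1 < σ₁.reg 10 → Frame 11 σ₁ σ₂ → σ₂.mem = σ₁.mem →
      J (k + 1) ((σ₂.setReg 9 v).setReg 10 (σ₁.reg 10 / (σ₁.reg 10).minFac)) := by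
    rintro k σ₁ σ₂ v ⟨c0, cm, h3, hd, h4⟩ hx f0 fm
    refine ⟨fun r hr => ?_, ?_, ?_⟩
    · simp [show r ≠ 10 by omega, show r ≠ 9 by omega, f0.1 r (by omega), c0 r hr]
    · simp [fm, cm]
    · simpa using div_minFac hx hd h4
  refine (Run.seq (T₁ := 100 * W ^ 2) (Q := I₁ 0) ((Run.of_lf (W := W) (S := W ^ 2) (by omega) le_rfl
    rfl ?_ ?_).mono (T := _ * W ^ 2) (Nat.mul_le_mul_right _ ?_) fun _ h => h) fun σ₁ hσ₁ =>
    Run.seq (Q := fun σ₂ => ∃ k ≤ W, I₁ k σ₂ ∧ σ₂.reg 10 = 1) (Run.while (n := W) (Tc := 36 * W)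
      (T := 10 ^ 4 * W ^ 4 + 200 * W ^ 2) I₁ hσ₁ ?_ ?_ ?_) fun σ₂ hσ₂ =>
    Run.seq (T₁ := 100 * W ^ 2) (Q := I₂ 0) ((Run.of_lf (W := W) (S := W ^ 2) (by omega) le_rfl
    rfl ?_ ?_).mono (T := _ * W ^ 2) (Nat.mul_le_mul_right _ ?_) fun _ h => h) fun σ₃ hσ₃ =>
    Run.while (n := W) (Tc := 36 * W)
      (T := 10 ^ 4 * W ^ 4 + 200 * W ^ 2) I₂ hσ₃ ?_ ?_ ?_).mono ?_ fun _ h => h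
  · have q1 := (sB i (by omega)).trans hW'
    have q2 := (sm m le_rfl).trans hW'
    simp [h8, hmval, q1, q2]
  · simp only [I₁, J]
    simp [h8, hmval, hmpos]
    intro r hr
    simp [show r ≠ 9 by omega, show r ≠ 10 by omega]
  · simp [Prog.wt, Expr.nodes]
  · rintro k σ₂ - ⟨⟨-, -, -, hd, -⟩, -⟩
    exact hcost _ (Nat.le_of_dvd hmpos hd)
  · rintro k σ₂ hk hI h0
    exact ⟨k, hk, hI, hend hI.1.2.2.1 h0⟩
  · rintro k σ₂ - ⟨hj, ho, r9, hl⟩ h0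
    have hx : 1 < σ₂.reg 10 := hgo h0
    have hkW := hcount hx hj.2.2.2.2
    refine ⟨hkW, Run.seq (hbody k σ₂ hj hx) fun σ₃ h₃ => (Run.of_lf (W := W) (S := W ^ 2)
      (by omega) le_rfl rfl ?_ ?_).mono (T := _ * W ^ 2) (Nat.mul_le_mul_right _ ?_) fun _ h => h⟩
    · have hle := Nat.le_of_dvd hmpos hj.2.2.2.1
      have q1 := sm _ hle
      have q2 := sm _ ((Nat.minFac_le (by omega)).trans hle)
      have q3 := (sl k hkW.le).trans hW'
      have q4 : 1 ≤ W ^ 2 := by omega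
      simp [h₃, h₃.1.1 10, h₃.1.1 9, r9, q1, q2, q3, q4]
    · have := hJ k σ₂ σ₃ (k + 1) hj hx h₃.1 h₃.2.1
      rw [primeFactorsList_eq_cons hx, List.length_cons] at hl
      simp only [I₁]
      simp [h₃, h₃.1.1 10, h₃.1.1 9, r9]
      refine ⟨?_, h₃.1.2.trans ho, by omega⟩
      convert this using 1
      simp only [State.setReg, State.mk.injEq, and_true]
      exact Function.update_comm (by norm_num) _ _ _
    · simp [Prog.wt, Expr.nodes]
  · obtain ⟨k, hkW, ⟨⟨c0, cm, -⟩, -, r9, -⟩, -⟩ := hσ₂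
    have q1 := (sB i (by omega)).trans hW'
    have q2 := (sm m le_rfl).trans hW'
    have q3 := (sl k hkW).trans hW'
    simp [c0 8, h8, cm, hmval, r9, q1, q2, q3]
  · obtain ⟨k, hkW, ⟨⟨c0, cm, -⟩, ho, r9, hl⟩, r10⟩ := hσ₂
    rw [r10, Nat.primeFactorsList_one, List.length_nil, add_zero] at hl
    simp only [I₂, J]
    simp [c0 8, h8, cm, hmval, hmpos, r9, hl, ho]
    intro r hr
    simp [show r ≠ 10 by omega, c0 r hr]
  · simp [Prog.wt, Expr.nodes]
  · rintro k σ₂ - ⟨⟨-, -, -, hd, -⟩, -⟩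
    exact hcost _ (Nat.le_of_dvd hmpos hd)
  · rintro k σ₂ hk ⟨⟨c0, cm, h3, -⟩, ho⟩ h0
    rw [hend h3 h0, Nat.primeFactorsList_one, List.append_nil] at ho
    exact ⟨c0, cm, ho⟩
  · rintro k σ₂ - ⟨hj, ho⟩ h0
    have hx : 1 < σ₂.reg 10 := hgo h0
    have hkW := hcount hx hj.2.2.2.2
    refine ⟨hkW, Run.seq (hbody k σ₂ hj hx) fun σ₃ h₃ => (Run.of_lf (W := W) (S := W ^ 2)
      (by omega) le_rfl rfl ?_ ?_).mono (T := _ * W ^ 2) (Nat.mul_le_mul_right _ ?_) fun _ h => h⟩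
    · have hle := Nat.le_of_dvd hmpos hj.2.2.2.1
      have q1 := sm _ hle
      have q2 := sm _ ((Nat.minFac_le (by omega)).trans hle)
      simp [h₃, h₃.1.1 10, q1, q2, q2.trans hW']
    · have := hJ k σ₂ σ₃ (σ₃.reg 9) hj hx h₃.1 h₃.2.1
      rw [primeFactorsList_eq_cons hx] at ho
      simp only [I₂, J] at this ⊢
      simp [h₃, h₃.1.1 10, h₃.1.2] at this ⊢
      simp only [← ho, and_true]
      refine ⟨fun r hr => ?_, this.2⟩
      have := this.1 r hr
      by_cases h9 : r = 9
      · subst h9; omega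
      · simpa [h9] using this
    · simp [Prog.wt, Expr.nodes]
  · have t1 : W ^ 5 = W * W ^ 4 := by ring
    have t2 : W ^ 2 ≤ W ^ 4 := Nat.pow_le_pow_right (by omega) (by norm_num)
    have t3 : W * (1 + 36 * W + (10 ^ 4 * W ^ 4 + 200 * W ^ 2)) ≤ W * (11000 * W ^ 4) :=
      Nat.mul_le_mul_left _ (by omega)
    have t4 : W * (11000 * W ^ 4) = 11000 * (W * W ^ 4) := by ring
    have t5 : W ^ 4 ≤ W * W ^ 4 := Nat.le_mul_of_pos_left _ (by omega)
    norm_num at *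
    omega

/-- Print the factorizations of all input numbers. -/
def Prog.factorStage : Prog := 8 ::= .lit 0 ;; .loop 8 0 factorOne

theorem Prog.factorStage_run {σ : State} {g h M W : ℕ} {m : List ℕ} (H : Params g h M W)
    (h0 : σ.reg 0 = m.length) (h1 : σ.reg 1 = h) (h2 : σ.reg 2 = 2 ^ h) (hm : m.length ≤ 2 ^ h)
    (hT : ∀ (i) (hi : i < m.length), Table g h σ.mem i m[i]) :
    Run .factorStage σ (10 ^ 6 * (W ^ 5 * 2 ^ h))
      (fun σ' => σ'.out = σ.out ++ factorizations m) := by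
  have h32 := H.le_W
  have hM : M = 6 * 2 ^ h + 2 * 2 ^ h * h := by rw [H.hM]; ring
  have hpos : 1 ≤ 2 ^ h := Nat.one_le_two_pow
  let I : ℕ → State → Prop := fun k σ₁ => ((∀ r < 8, σ₁.reg r = σ.reg r) ∧ σ₁.mem = σ.mem ∧
    σ₁.out = σ.out ++ factorizations (m.take k)) ∧ σ₁.reg 8 = k
  refine (Run.seq (T₁ := 5 * W ^ 2) (Q := I 0) ((Run.of_lf (W := W) (S := W ^ 2) (by omega) le_rfl
    rfl ?_ ?_).mono (T := _ * W ^ 2) (Nat.mul_le_mul_right _ ?_) fun _ h => h) fun σ₁ hσ₁ =>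
    Run.loop (S := W) (T := 10 ^ 5 * W ^ 5) I (Nat.zero_le m.length) (by omega)
    (H.size_le_of_le (by omega)) ?_ hσ₁ ?_).mono ?_ fun σ' hσ' => by
      have := hσ'.1.2.2
      rwa [List.take_length] at this
  · simp
  · simp only [I]
    simp [factorizations]
    intro r hr
    simp [show r ≠ 8 by omega]
  · simp [Prog.wt, Expr.nodes]
  · rintro k σ₂ ⟨⟨c0, -⟩, r8⟩
    exact ⟨r8, (c0 0 (by norm_num)).trans h0⟩
  · rintro k σ₂ - hk ⟨⟨c0, cm, co⟩, r8⟩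
    refine (factorOne_run H ((c0 1 (by norm_num)).trans h1) ((c0 2 (by norm_num)).trans h2) r8
      (cm ▸ hT k hk)).mono le_rfl ?_
    rintro σ₃ ⟨d0, dm, dout⟩
    refine ⟨(d0 8 (by norm_num)).trans r8, ⟨fun r hr => ?_, dm.trans cm, ?_⟩, by simp⟩
    · simp [show r ≠ 8 by omega, d0 r (by omega), c0 r hr]
    · rw [State.setReg_out, dout, co, ← List.take_append_getElem hk, List.append_assoc]
      simp only [factorizations, List.flatMap_append, List.flatMap_singleton]
  · have t1 : 1 ≤ W ^ 5 := Nat.one_le_pow _ _ (by omega)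
    have t2 : W ^ 2 ≤ W ^ 5 := Nat.pow_le_pow_right (by omega) (by norm_num)
    have t3 : W ≤ W ^ 5 := Nat.le_self_pow (by norm_num) W
    have t4 : W ^ 5 ≤ W ^ 5 * 2 ^ h := Nat.le_mul_of_pos_right _ hpos
    have t5 : (m.length - 0) * (10 ^ 5 * W ^ 5 + 74 * W) ≤ 2 ^ h * (2 * 10 ^ 5 * W ^ 5) := by
      refine Nat.mul_le_mul (by omega) ?_
      norm_num
      omega
    have t6 : 2 ^ h * (2 * 10 ^ 5 * W ^ 5) = 2 * 10 ^ 5 * (W ^ 5 * 2 ^ h) := by ring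
    norm_num at *
    omega

/-! ### Choice of the parameters -/

/-- `h` is the least admissible table size for `n` numbers up to `X`. -/
structure IsTableSize (n X h : ℕ) : Prop where
  two_le : 2 ≤ h
  lt : n < 2 ^ h
  bound : X < (2 ^ h - 1) ^ 2
  least : ∀ k, 2 ≤ k → n < 2 ^ k → X < (2 ^ k - 1) ^ 2 → h ≤ k

/-- `g` is the least admissible word size for tables of `2 ^ h` entries. -/
structure IsWordSize (h g : ℕ) : Prop where
  five_le : 5 ≤ g
  le : 2 * h ≤ 2 ^ g
  least : ∀ k, 5 ≤ k → 2 * h ≤ 2 ^ k → g ≤ k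

theorem exists_least {P : ℕ → Prop} {N : ℕ} (h : P N) : ∃ k, P k ∧ ∀ j, P j → k ≤ j := by
  classical
  exact ⟨Nat.find ⟨N, h⟩, Nat.find_spec ⟨N, h⟩, fun j hj => Nat.find_min' _ hj⟩

theorem exists_isTableSize (n X : ℕ) : ∃ h, IsTableSize n X h := by
  have h1 : n + X + 2 < 2 ^ (n + X + 2) := Nat.lt_two_pow_self
  obtain ⟨h, ⟨a, b, c⟩, d⟩ := exists_least (P := fun h => 2 ≤ h ∧ n < 2 ^ h ∧ X < (2 ^ h - 1) ^ 2)
    (N := n + X + 2) ⟨by omega, by omega, by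
      have : X < 2 ^ (n + X + 2) - 1 := by omega
      exact this.trans_le (Nat.le_self_pow (by norm_num) _)⟩
  exact ⟨h, a, b, c, fun k h2 h3 h4 => d k ⟨h2, h3, h4⟩⟩

theorem exists_isWordSize (h : ℕ) : ∃ g, IsWordSize h g := by
  have h1 : 2 * h + 5 < 2 ^ (2 * h + 5) := Nat.lt_two_pow_self
  obtain ⟨g, ⟨a, b⟩, d⟩ := exists_least (P := fun g => 5 ≤ g ∧ 2 * h ≤ 2 ^ g)
    (N := 2 * h + 5) ⟨by omega, by omega⟩
  exact ⟨g, a, b, fun k h2 h3 => d k ⟨h2, h3⟩⟩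

/-- Find the largest input number. -/
def Prog.maxProg : Prog := (10 ::= .lit 0 ;; 8 ::= .lit 0) ;;
  .loop 8 0 (11 ::= .read (.var 8) ;; .ite (.var 10 <ₑ .var 11) (10 ::= .var 11) .skip)

/-- Compute the parameters. -/
def Prog.paramProg : Prog := (1 ::= .lit 2 ;; 2 ::= .lit 4) ;;
  .while ((.var 2 <ₑ .var 0 +ₑ .lit 1) +ₑ
      ((.var 2 -ₑ .lit 1) *ₑ (.var 2 -ₑ .lit 1) <ₑ .var 10 +ₑ .lit 1))
    (1 ::= .var 1 +ₑ .lit 1 ;; 2 ::= .var 2 <<ₑ .lit 1) ;;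
  3 ::= .lit 5 ;;
  .while (.lit 1 <<ₑ .var 3 <ₑ .var 1 <<ₑ .lit 1) (3 ::= .var 3 +ₑ .lit 1) ;;
  4 ::= (.lit 6 +ₑ .lit 2 *ₑ .var 1) *ₑ .var 2

theorem Prog.maxProg_run {σ : State} {W : ℕ} {m : List ℕ} (hW : 32 ≤ W) (h0 : σ.reg 0 = m.length)
    (hn : m.length.size ≤ W) (hX : (m.foldl max 0).size ≤ W)
    (hm : ∀ (i) (hi : i < m.length), σ.mem i = m[i]) :
    Run .maxProg σ (m.length * (400 * W ^ 2) + 100 * W ^ 2) (fun σ' => Frame 8 σ σ' ∧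
      σ'.mem = σ.mem ∧ σ'.reg 10 = m.foldl max 0) := by
  have hW' : W ≤ W ^ 2 := by nlinarith
  have hmono : ∀ k ≤ m.length, (m.take k).foldl max 0 ≤ m.foldl max 0 := by
    intro k hk
    conv_rhs => rw [← List.take_append_drop k m, List.foldl_append]
    generalize (m.take k).foldl max 0 = a
    induction m.drop k generalizing a with
    | nil => exact le_rfl
    | cons x l ih => exact (le_max_left a x).trans (ih _)
  let I : ℕ → State → Prop := fun k σ₁ => (Frame 8 σ σ₁ ∧ σ₁.mem = σ.mem ∧
    σ₁.reg 10 = (m.take k).foldl max 0) ∧ σ₁.reg 8 = k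
  refine (Run.seq (T₁ := 10 * W ^ 2) (Q := I 0) ((Run.of_lf (W := W) (S := W ^ 2) (by omega) le_rfl
    rfl ?_ ?_).mono (T := _ * W ^ 2) (Nat.mul_le_mul_right _ ?_) fun _ h => h) fun σ₁ hσ₁ =>
    Run.loop (S := W) (T := 300 * W ^ 2) I (Nat.zero_le m.length) (by omega)
    hn ?_ hσ₁ ?_).mono ?_ fun σ' hσ' => by
      have := hσ'.1
      rwa [List.take_length] at this
  · simp
  · simp only [I]
    simp [Frame.refl]
  · simp [Prog.wt, Expr.nodes]
  · rintro k σ₂ ⟨⟨c0, -⟩, r8⟩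
    exact ⟨r8, (c0.1 0 (by norm_num)).trans h0⟩
  · rintro k σ₂ - hk ⟨⟨c0, cm, r10⟩, r8⟩
    have htake : (m.take (k + 1)).foldl max 0 = max ((m.take k).foldl max 0) m[k] := by
      rw [← List.take_append_getElem hk, List.foldl_append]; rfl
    have hle := hmono (k + 1) hk
    rw [htake, max_le_iff] at hle
    have hmk := hm k hk
    generalize (m.take k).foldl max 0 = a at *
    have q1 := (size_le_of_le (W := W ^ 2) hk.le (hn.trans hW'))
    have q2 := (size_le_of_le (W := W ^ 2) hle.1 (hX.trans hW'))
    have q3 := (size_le_of_le (W := W ^ 2) hle.2 (hX.trans hW'))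
    refine (Run.of_lf (W := W) (S := W ^ 2) (by omega) le_rfl
      rfl ?_ ?_).mono (T := _ * W ^ 2) (Nat.mul_le_mul_right _ ?_) fun _ h => h
    · by_cases hc : a < m[k] <;>
      simp [r8, r10, cm, hmk, q1, q2, q3, hc]
    · simp only [I, htake]
      by_cases hc : a < m[k]
      · simp [r8, r10, cm, hmk, hc, c0, max_eq_right hc.le]
      · simp [r8, r10, cm, hmk, hc, c0, max_eq_left (not_lt.mp hc)]
    · simp [Prog.wt, Expr.nodes]
  · have t1 : (m.length - 0) * (300 * W ^ 2 + 74 * W) ≤ m.length * (400 * W ^ 2) :=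
      Nat.mul_le_mul (by omega) (by omega)
    omega

/-- The sum of two tests serves as their disjunction in the loop condition of `paramProg`. -/
theorem ite_add_ite_eq_zero {p q : Prop} [Decidable p] [Decidable q] :
    (if p then 1 else 0) + (if q then 1 else 0) = 0 ↔ ¬ p ∧ ¬ q := by
  by_cases hp : p <;> by_cases hq : q <;> simp [hp, hq]

theorem Prog.paramProg_run {σ : State} {g h M W n X : ℕ} (H : Params g h M W) (h0 : σ.reg 0 = n)
    (h10 : σ.reg 10 = X) (hh : IsTableSize n X h) (hg : IsWordSize h g) :
    Run .paramProg σ (10 ^ 4 * W ^ 3) (fun σ' => σ'.out = σ.out ∧ σ'.mem = σ.mem ∧ σ'.reg 0 = n ∧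
      σ'.reg 1 = h ∧ σ'.reg 2 = 2 ^ h ∧ σ'.reg 3 = g ∧ σ'.reg 4 = M) := by
  have h32 := H.le_W
  have haW := H.add_le_W
  have hW' : W ≤ W ^ 2 := by nlinarith
  have hM := H.hM
  have hM6 : 6 * 2 ^ h ≤ M := by rw [hM]; exact Nat.mul_le_mul_right _ (by omega)
  have hpos : 1 ≤ 2 ^ h := Nat.one_le_two_pow
  have hn := hh.lt
  have hX := hh.bound
  have hW2 : 2 * h ≤ W := H.le_pow.trans H.pow_le_W
  have hXW : X < 2 ^ W := by
    refine hX.trans_le ((Nat.pow_le_pow_left (Nat.sub_le _ 1) 2).trans ?_)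
    rw [← pow_mul]
    exact Nat.pow_le_pow_right (by norm_num) (by omega)
  have sX : X.size ≤ W := Nat.size_le.mpr hXW
  have sB : ∀ x, x ≤ M + 4 → x.size ≤ W := fun x hx => H.size_le_of_le hx
  have sl : ∀ x, x ≤ W → x.size ≤ W := fun x hx => size_le_of_lt (a := x) Nat.lt_two_pow_self hx
  let I : ℕ → State → Prop := fun k σ₁ => k + 2 ≤ h ∧ σ₁.out = σ.out ∧ σ₁.mem = σ.mem ∧
    σ₁.reg 0 = n ∧ σ₁.reg 10 = X ∧ σ₁.reg 1 = k + 2 ∧ σ₁.reg 2 = 2 ^ (k + 2)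
  let I' : ℕ → State → Prop := fun k σ₁ => k + 5 ≤ g ∧ σ₁.out = σ.out ∧ σ₁.mem = σ.mem ∧
    σ₁.reg 0 = n ∧ σ₁.reg 1 = h ∧ σ₁.reg 2 = 2 ^ h ∧ σ₁.reg 3 = k + 5
  refine (Run.seq (T₁ := 10 * W ^ 2) (Q := I 0) ((Run.of_lf (W := W) (S := W ^ 2) (by omega) le_rfl
    rfl ?_ ?_).mono (T := _ * W ^ 2) (Nat.mul_le_mul_right _ ?_) fun _ h => h) fun σ₁ hσ₁ =>
    Run.seq (Q := I (h - 2)) (Run.while (n := h - 2) (Tc := 2000 * W ^ 2) (T := 100 * W ^ 2) I hσ₁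
      ?_ ?_ ?_) fun σ₂ hσ₂ => Run.seq (T₁ := 5 * W ^ 2) (Q := I' 0)
    ((Run.of_lf (W := W) (S := W ^ 2) (by omega) le_rfl
    rfl ?_ ?_).mono (T := _ * W ^ 2) (Nat.mul_le_mul_right _ ?_) fun _ h => h) fun σ₃ hσ₃ =>
    Run.seq (Q := I' (g - 5)) (Run.while (n := g - 5) (Tc := 2000 * W ^ 2) (T := 100 * W ^ 2) I' hσ₃
      ?_ ?_ ?_) fun σ₄ hσ₄ => (Run.of_lf (W := W) (S := W ^ 2) (by omega) le_rfl
    rfl ?_ ?_).mono (T := _ * W ^ 2) (T' := 500 * W ^ 2) (Nat.mul_le_mul_right _ ?_) fun _ h => h).mono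
      ?_ fun _ h => h
  · have q1 := (sB 2 (by omega)).trans hW'
    have q2 := (sB 4 (by omega)).trans hW'
    simp [q1, q2]
  · simp only [I]
    simp [h0, h10, hh.two_le]
  · simp [Prog.wt, Expr.nodes]
  · rintro k σ₂ - ⟨hk, -, -, r0, r10, r1, r2⟩
    have h2k : 2 ^ (k + 2) ≤ 2 ^ h := Nat.pow_le_pow_right (by norm_num) hk
    refine (Expr.cost_le_sq (S := W) (by omega) ?_).trans (Nat.mul_le_mul_right _ ?_)
    · have q1 := sB n (by omega)
      have q2 := sB (2 ^ (k + 2)) (by omega)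
      simp [r0, r2, r10, q1, q2, sX, show 1 ≤ W by omega]
    · simp [Expr.nodes]
  · rintro k σ₂ hk' ⟨hk, ho, hm, r0, r10, r1, r2⟩ he
    simp only [Expr.eval, Op.eval, r0, r10, r2] at he
    rw [ite_add_ite_eq_zero] at he
    have := hh.least (k + 2) (by omega) (by omega) (by rw [sq]; omega)
    obtain rfl : k = h - 2 := by omega
    exact ⟨hk, ho, hm, r0, r10, r1, r2⟩
  · rintro k σ₂ hk' ⟨hk, ho, hm, r0, r10, r1, r2⟩ he
    simp only [Expr.eval, Op.eval, r0, r10, r2, ne_eq, ite_add_ite_eq_zero] at he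
    have hlt : k + 2 < h := by
      refine lt_of_le_of_ne hk fun heq => ?_
      rw [heq, ← sq] at he
      omega
    have h2k : 2 ^ (k + 2) ≤ 2 ^ h := Nat.pow_le_pow_right (by norm_num) hk
    refine ⟨by omega, (Run.of_lf (W := W) (S := W ^ 2) (by omega) le_rfl
      rfl ?_ ?_).mono (T := _ * W ^ 2) (Nat.mul_le_mul_right _ ?_) fun _ h => h⟩
    · have q1 := (sl (k + 2) (by omega)).trans hW'
      have q2 := (sB (2 ^ (k + 2)) (by omega)).trans hW'
      simp [r1, r2, q1, q2, show 1 ≤ W ^ 2 by omega]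
    · simp only [I]
      simp [r0, r1, r2, r10, ho, hm]
      exact ⟨by omega, by ring⟩
    · simp [Prog.wt, Expr.nodes]
  · have q1 := (sB 5 (by omega)).trans hW'
    simp [q1]
  · obtain ⟨hk, ho, hm, r0, r10, r1, r2⟩ := hσ₂
    rw [show h - 2 + 2 = h by omega] at r1 r2
    simp only [I']
    simp [ho, hm, r0, r1, r2, hg.five_le]
  · simp [Prog.wt, Expr.nodes]
  · rintro k σ₂ - ⟨hk, -, -, r0, r1, r2, r3⟩
    have h2k : 2 ^ (k + 5) ≤ 2 ^ g := Nat.pow_le_pow_right (by norm_num) hk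
    refine (Expr.cost_le_lin (S := W ^ 2) (by omega) rfl ?_).trans (Nat.mul_le_mul_right _ ?_)
    · have q1 := (sl (k + 5) (by omega)).trans hW'
      have q2 := (sl h (by omega)).trans hW'
      simp [r1, r3, q1, q2, show 1 ≤ W ^ 2 by omega]
      omega
    · simp [Expr.nodes]
  · rintro k σ₂ hk' ⟨hk, ho, hm, r0, r1, r2, r3⟩ he
    simp only [Expr.eval, Op.eval, r1, r3, ite_eq_right_iff, one_ne_zero, imp_false] at he
    have := hg.least (k + 5) (by omega) (by omega)
    obtain rfl : k = g - 5 := by omega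
    exact ⟨hk, ho, hm, r0, r1, r2, r3⟩
  · rintro k σ₂ hk' ⟨hk, ho, hm, r0, r1, r2, r3⟩ he
    simp only [Expr.eval, Op.eval, r1, r3, ne_eq, ite_eq_right_iff, one_ne_zero, imp_false,
      not_not] at he
    have hlt : k + 5 < g := by
      refine lt_of_le_of_ne hk fun heq => ?_
      have := hg.le
      rw [heq] at he
      omega
    refine ⟨by omega, (Run.of_lf (W := W) (S := W ^ 2) (by omega) le_rfl
      rfl ?_ ?_).mono (T := _ * W ^ 2) (Nat.mul_le_mul_right _ ?_) fun _ h => h⟩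
    · have q1 := (sl (k + 5) (by omega)).trans hW'
      simp [r3, q1, show 1 ≤ W ^ 2 by omega]
    · simp only [I']
      simp [r0, r1, r2, r3, ho, hm]
      omega
    · simp [Prog.wt, Expr.nodes]
  · obtain ⟨hk, ho, hm, r0, r1, r2, r3⟩ := hσ₄
    have q1 := sl h (by omega)
    have q2 := sB (2 ^ h) (by omega)
    simp [r1, r2, q1, q2, sB 6 (by omega), size_two_le (show 2 ≤ W by omega)]
  · obtain ⟨hk, ho, hm, r0, r1, r2, r3⟩ := hσ₄
    have := hg.five_le
    simp [r0, r1, r2, r3, ho, hm, hM]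
    omega
  · simp [Prog.wt, Expr.nodes]
  · have t1 : (h - 2) * (1 + 2000 * W ^ 2 + 100 * W ^ 2) ≤ W * (2200 * W ^ 2) :=
      Nat.mul_le_mul (by omega) (by omega)
    have t2 : (g - 5) * (1 + 2000 * W ^ 2 + 100 * W ^ 2) ≤ W * (2200 * W ^ 2) :=
      Nat.mul_le_mul (by omega) (by omega)
    have t3 : W ^ 3 = W * W ^ 2 := by ring
    have t4 : W * (2200 * W ^ 2) = 2200 * (W * W ^ 2) := by ring
    have t5 : 32 * W ^ 2 ≤ W * W ^ 2 := Nat.mul_le_mul_right _ h32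
    norm_num at *
    omega

/-! ### The sieve and the leaves of the product tree -/

/-- A harmonic sum in dyadic blocks: the 2^h terms with index from 2^h on are at most N / 2^h each,
hence contribute at most N in total. -/
theorem sum_div_le (N h : ℕ) : ∑ k ∈ Finset.range (2 ^ h), N / (k + 1) ≤ N * (h + 1) := by
  induction h with
  | zero => simp
  | succ h ih =>
    rw [pow_succ, mul_two, Finset.sum_range_add]
    have h1 : ∑ k ∈ Finset.range (2 ^ h), N / (2 ^ h + k + 1) ≤ 2 ^ h * (N / 2 ^ h) := by
      refine (Finset.sum_le_card_nsmul _ _ (N / 2 ^ h) fun k _ => ?_).trans (by simp)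
      exact Nat.div_le_div_left (c := 2 ^ h) (by omega) (by positivity)
    have h2 := Nat.mul_div_le N (2 ^ h)
    calc _ ≤ N * (h + 1) + N := by omega
      _ = _ := by ring

/-- `t` is a proper multiple of some number from `2` to `d - 1`. -/
def Sieved (d t : ℕ) : Prop := ∃ e, 2 ≤ e ∧ e < d ∧ e ∣ t ∧ e < t

theorem sieved_succ {d t : ℕ} (hd : 2 ≤ d) :
    Sieved (d + 1) t ↔ Sieved d t ∨ d ∣ t ∧ d < t := by
  constructor
  · rintro ⟨e, h1, h2, h3, h4⟩
    rcases (Nat.lt_succ_iff.mp h2).eq_or_lt with rfl | h5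
    · exact .inr ⟨h3, h4⟩
    · exact .inl ⟨e, h1, h5, h3, h4⟩
  · rintro (⟨e, h1, h2, h3, h4⟩ | ⟨h3, h4⟩)
    · exact ⟨e, h1, by omega, h3, h4⟩
    · exact ⟨d, hd, by omega, h3, h4⟩

theorem not_sieved_iff {N t : ℕ} (ht : t < N) (h2 : 2 ≤ t) : ¬ Sieved N t ↔ t.Prime := by
  rw [Nat.prime_def_lt']
  refine ⟨fun h => ⟨h2, fun m hm hlt hd => h ⟨m, hm, by omega, hd, hlt⟩⟩, ?_⟩
  rintro ⟨-, h⟩ ⟨e, h1, -, h3, h4⟩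
  exact h e h1 h4 h3

/-- Mark the composite numbers below the content of register 2. -/
def Prog.sieve : Prog := 10 ::= .lit 2 ;; .while (.var 10 <ₑ .var 2) (
  11 ::= .var 10 <<ₑ .lit 1 ;;
  .while (.var 11 <ₑ .var 2) (.store (.var 2 +ₑ .var 11) (.lit 1) ;; 11 ::= .var 11 +ₑ .var 10) ;;
  10 ::= .var 10 +ₑ .lit 1)

/-- Crossing out the multiples of d takes at most N / d rounds, so by `sum_div_le` the total is N (h
+ 1), with addresses of W bits throughout. -/
theorem Prog.sieve_run {σ : State} {g h M W : ℕ} (H : Params g h M W) (h2 : σ.reg 2 = 2 ^ h)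
    (h0 : ∀ t < 2 ^ h, σ.mem (2 ^ h + t) = 0) :
    Run .sieve σ (10 ^ 4 * (W ^ 3 * 2 ^ h)) (fun σ' => Frame 10 σ σ' ∧
      (∀ t < 2 ^ h, σ'.mem (2 ^ h + t) ≤ 1 ∧ (2 ≤ t → (σ'.mem (2 ^ h + t) = 0 ↔ t.Prime))) ∧
      ∀ x, x < 2 ^ h ∨ 2 * 2 ^ h ≤ x → σ'.mem x = σ.mem x) := by
  have h32 := H.le_W
  have haW := H.add_le_W
  have hW' : W ≤ W ^ 2 := by nlinarith
  have hM6 : 6 * 2 ^ h ≤ M := by rw [H.hM]; exact Nat.mul_le_mul_right _ (by omega)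
  have hpos : 4 ≤ 2 ^ h := by
    calc 4 = 2 ^ 2 := rfl
      _ ≤ _ := Nat.pow_le_pow_right (by norm_num) H.two_le
  have sB : ∀ x, x ≤ M + 4 → x.size ≤ W := fun x hx => H.size_le_of_le hx
  have sS : ∀ x, x ≤ M + 4 → x.size ≤ W ^ 2 := fun x hx => (sB x hx).trans hW'
  generalize hN : 2 ^ h = N at *
  let I : ℕ → State → Prop := fun k σ₁ => Frame 10 σ σ₁ ∧ σ₁.reg 10 = k + 2 ∧ k + 2 ≤ N ∧
    (∀ t < N, σ₁.mem (N + t) ≤ 1 ∧ (σ₁.mem (N + t) = 0 ↔ ¬ Sieved (k + 2) t)) ∧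
      ∀ x, x < N ∨ 2 * N ≤ x → σ₁.mem x = σ.mem x
  refine (Run.seq (T₁ := 5 * W ^ 2) (Q := I 0) ((Run.of_lf (W := W) (S := W ^ 2) (by omega) le_rfl
    rfl ?_ ?_).mono (T := _ * W ^ 2) (Nat.mul_le_mul_right _ ?_) fun _ h => h) fun σ₁ hσ₁ =>
    Run.while_sum (n := N - 2) (Tc := 36 * W) (T := fun k => 600 * W ^ 2 +
      N / (k + 1) * (1000 * W ^ 2)) I hσ₁ ?_ ?_ ?_).mono ?_ fun _ h => h
  · simp [sS 2 (by omega)]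
  · simp only [I]
    simp [Frame.refl]
    refine ⟨by omega, fun t ht => ⟨by simp [h0 t ht], iff_of_true (h0 t ht) ?_⟩⟩
    rintro ⟨e, h1, h2, -⟩
    omega
  · simp [Prog.wt, Expr.nodes]
  · rintro k σ₂ - ⟨c0, r10, hk, -⟩
    exact cost_lt_vars (by omega) (r10 ▸ sB _ (by omega)) ((c0.1 2 (by norm_num)).trans h2 ▸
      sB _ (by omega))
  · rintro k σ₂ - ⟨c0, r10, hk, hs, hm⟩ he
    simp only [Expr.eval, Op.eval, r10, (c0.1 2 (by norm_num)).trans h2, ite_eq_right_iff,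
      one_ne_zero, imp_false] at he
    obtain rfl : N = k + 2 := by omega
    exact ⟨c0, fun t ht => ⟨(hs t ht).1, fun ht2 => (hs t ht).2.trans (not_sieved_iff ht ht2)⟩, hm⟩
  · rintro k σ₂ - ⟨c0, r10, hk, hs, hm⟩ he
    simp only [Expr.eval, Op.eval, r10, (c0.1 2 (by norm_num)).trans h2, ne_eq, ite_eq_right_iff,
      one_ne_zero, imp_false, not_not] at he
    refine ⟨by omega, ?_⟩
    generalize hd : k + 2 = d at *
    -- The multiples of d from 2d up to, but excluding, (j + 2) d are crossed out. The bound (j + 1)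
    -- d ≤ N limits both the number of rounds and the size of register 11, which may overshoot N
    -- once.
    let J : ℕ → State → Prop := fun j σ₃ => Frame 10 σ σ₃ ∧ σ₃.reg 10 = d ∧ σ₃.reg 11 = (j + 2) * d ∧
      (j + 1) * d ≤ N ∧
      (∀ t < N, σ₃.mem (N + t) ≤ 1 ∧ (σ₃.mem (N + t) = 0 ↔
        ¬ (Sieved d t ∨ d ∣ t ∧ d < t ∧ t < (j + 2) * d))) ∧
      ∀ x, x < N ∨ 2 * N ≤ x → σ₃.mem x = σ.mem x
    refine (Run.seq (T₁ := 200 * W ^ 2) (Q := J 0) ((Run.of_lf (W := W) (S := W ^ 2) (by omega) le_rfl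
      rfl ?_ ?_).mono (T := _ * W ^ 2) (Nat.mul_le_mul_right _ ?_) fun _ h => h) fun σ₁ hσ₁ =>
      Run.seq (T₁ := N / d * (1 + 36 * W + 300 * W ^ 2) + (1 + 36 * W))
        (Q := fun σ₃ => Frame 10 σ σ₃ ∧ σ₃.reg 10 = d ∧
          (∀ t < N, σ₃.mem (N + t) ≤ 1 ∧ (σ₃.mem (N + t) = 0 ↔ ¬ Sieved (d + 1) t)) ∧
          ∀ x, x < N ∨ 2 * N ≤ x → σ₃.mem x = σ.mem x)
        (Run.while (n := N / d) (Tc := 36 * W) (T := 300 * W ^ 2) J hσ₁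
      ?_ ?_ ?_) fun σ₃ hσ₃ => (Run.of_lf (W := W) (S := W ^ 2) (by omega) le_rfl
      rfl ?_ ?_).mono (T := _ * W ^ 2) (T' := 100 * W ^ 2) (Nat.mul_le_mul_right _ ?_)
        fun _ h => h).mono ?_ fun _ h => h
    · simp [r10, sS d (by omega), sS 1 (by omega), show 1 ≤ W ^ 2 by omega]
    · simp only [J]
      simp [r10, c0, mul_comm d 2]
      refine ⟨by omega, fun t ht => ⟨(hs t ht).1, (hs t ht).2.trans ?_⟩, hm⟩
      refine (and_iff_left ?_).symm
      rintro ⟨c, rfl⟩ h3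
      rw [mul_comm 2]
      refine Nat.mul_le_mul_left _ ?_
      by_contra hcon
      interval_cases c <;> omega
    · simp [Prog.wt, Expr.nodes]
    · rintro j σ₂ - ⟨c0, r10, r11, hj, -⟩
      refine cost_lt_vars (by omega) (r11 ▸ sB _ ?_) ((c0.1 2 (by norm_num)).trans h2 ▸
        sB _ (by omega))
      calc (j + 2) * d = (j + 1) * d + d := by ring
        _ ≤ _ := by omega
    · rintro j σ₂ - ⟨c0, r10, r11, hj, hs, hm⟩ he
      simp only [Expr.eval, Op.eval, r11, (c0.1 2 (by norm_num)).trans h2, ite_eq_right_iff,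
        one_ne_zero, imp_false] at he
      refine ⟨c0, r10, fun t ht => ⟨(hs t ht).1, (hs t ht).2.trans ?_⟩, hm⟩
      rw [sieved_succ (by omega)]
      have : t < (j + 2) * d := by omega
      simp [this]
    · rintro j σ₂ - ⟨c0, r10, r11, hj, hs, hm⟩ he
      simp only [Expr.eval, Op.eval, r11, (c0.1 2 (by norm_num)).trans h2, ne_eq, ite_eq_right_iff,
        one_ne_zero, imp_false, not_not] at he
      have e1 : (j + 2) * d = (j + 1) * d + d := by ring
      have e2 : (j + 3) * d = (j + 2) * d + d := by ring
      refine ⟨?_, (Run.of_lf (W := W) (S := W ^ 2) (by omega) le_rfl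
        rfl ?_ ?_).mono (T := _ * W ^ 2) (Nat.mul_le_mul_right _ ?_) fun _ h => h⟩
      · exact (Nat.le_div_iff_mul_le (by omega)).mpr (by omega : (j + 1) * d ≤ N)
      · have r2 := (c0.1 2 (by norm_num)).trans h2
        simp (disch := omega) [r2, r10, r11, sS, show 1 ≤ W ^ 2 by omega]
      · have r2 := (c0.1 2 (by norm_num)).trans h2
        simp only [J]
        simp [r2, r10, r11, c0]
        refine ⟨by rw [show j + 1 + 2 = j + 3 by ring]; omega,
          by rw [show j + 1 + 1 = j + 2 by ring]; omega, fun t ht => ?_, fun x hx => ?_⟩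
        · rw [show j + 1 + 2 = j + 3 by ring]
          by_cases ht' : t = (j + 2) * d
          · subst ht'
            rw [Function.update_self]
            have e3 : d < (j + 2) * d := by nlinarith
            simp [e3]
            exact fun _ => by omega
          · rw [Function.update_of_ne (by omega)]
            obtain ⟨hs1, hs2⟩ := hs t ht
            simp only [not_or, not_and, not_lt] at hs2
            refine ⟨hs1, hs2.trans (and_congr_right fun _ => ⟨fun h hdt hlt => ?_, fun h hdt hlt => ?_⟩)⟩
            · have h4 := h hdt hlt
              obtain ⟨c, rfl⟩ := hdt
              rw [mul_comm d c] at h4 ht' ⊢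
              have h5 := Nat.le_of_mul_le_mul_right h4 (by omega)
              have h6 : c ≠ j + 2 := fun h => ht' (by rw [h])
              exact Nat.mul_le_mul_right _ (by omega)
            · have := h hdt hlt
              omega
        · rw [Function.update_of_ne (by omega), hm x hx]
      · simp [Prog.wt, Expr.nodes]
    · simp [hσ₃, sS d (by omega), show 1 ≤ W ^ 2 by omega]
    · simp only [I]
      simp [hσ₃]
      refine ⟨by omega, by omega, ?_⟩
      rw [show k + 1 + 2 = d + 1 by omega]
      exact hσ₃.2.2
    · simp [Prog.wt, Expr.nodes]
    · have : N / d ≤ N / (k + 1) := Nat.div_le_div_left (by omega) (by omega)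
      have t2 : N / d * (1 + 36 * W + 300 * W ^ 2) ≤ N / (k + 1) * (1000 * W ^ 2) :=
        Nat.mul_le_mul this (by omega)
      omega
  · have t1 : ∑ k ∈ Finset.range (N - 2), (1 + 36 * W + (600 * W ^ 2 + N / (k + 1) * (1000 * W ^ 2))) ≤
        N * (700 * W ^ 2) + N * (h + 1) * (1000 * W ^ 2) := by
      calc _ ≤ ∑ k ∈ Finset.range (N - 2), (700 * W ^ 2 + N / (k + 1) * (1000 * W ^ 2)) :=
            Finset.sum_le_sum fun k _ => by omega
        _ ≤ ∑ k ∈ Finset.range (2 ^ h), (700 * W ^ 2 + N / (k + 1) * (1000 * W ^ 2)) :=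
            Finset.sum_le_sum_of_subset (Finset.range_mono (by omega))
        _ = N * (700 * W ^ 2) + (∑ k ∈ Finset.range (2 ^ h), N / (k + 1)) * (1000 * W ^ 2) := by
            rw [Finset.sum_add_distrib, Finset.sum_const, Finset.card_range, smul_eq_mul,
              Finset.sum_mul, hN]
        _ ≤ _ := by
            have := sum_div_le N h
            gcongr
    have t2 : N * (h + 1) * (1000 * W ^ 2) ≤ N * W * (1000 * W ^ 2) := by
      gcongr; omega
    have t3 : N * W * (1000 * W ^ 2) = 1000 * (W ^ 3 * N) := by ring
    have t4 : N * (700 * W ^ 2) = 700 * (W ^ 2 * N) := by ring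
    have t5 : W ^ 2 * N ≤ W ^ 3 * N := Nat.mul_le_mul_right _
      (Nat.pow_le_pow_right (by omega) (by norm_num))
    have t6 : W ^ 2 ≤ W ^ 2 * N := Nat.le_mul_of_pos_right _ (by omega)
    norm_num at *
    omega

/-! ### Odd parts and the product tree of the inputs. -/

/-- The odd part of a positive number. -/
def oddPart (x : ℕ) : ℕ := x / 2 ^ x.factorization 2

theorem oddPart_odd {x : ℕ} (hx : x ≠ 0) : Odd (oddPart x) := by
  rw [← Nat.not_even_iff_odd, even_iff_two_dvd]
  exact Nat.not_dvd_ordCompl Nat.prime_two hx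

theorem oddPart_le (x : ℕ) : oddPart x ≤ x := Nat.div_le_self _ _

theorem oddPart_two_mul (x : ℕ) : oddPart (2 * x) = oddPart x := by
  rcases Nat.eq_zero_or_pos x with rfl | hx
  · rfl
  · unfold oddPart
    rw [Nat.factorization_mul (by norm_num) hx.ne', Finsupp.add_apply, Nat.prime_two.factorization_self,
      pow_add, pow_one, Nat.mul_div_mul_left _ _ (by norm_num)]

theorem oddPart_of_odd {x : ℕ} (hx : ¬ x % 2 = 0) : oddPart x = x := by
  unfold oddPart
  rw [Nat.factorization_eq_zero_of_not_dvd (fun h => hx (Nat.mod_eq_zero_of_dvd h)), pow_zero,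
    Nat.div_one]

/-- An odd divisor is coprime to the power of two split off; thus passing to odd parts loses none of
the divisors for which gcds are needed. -/
theorem dvd_oddPart {x y : ℕ} (hy : Odd y) (hd : y ∣ x) : y ∣ oddPart x := by
  have h1 : 2 ^ x.factorization 2 * oddPart x = x := Nat.ordProj_mul_ordCompl_eq_self x 2
  rw [← h1] at hd
  exact (Nat.Coprime.pow_right _ (Nat.coprime_two_right.mpr hy)).dvd_of_dvd_mul_left hd

theorem max_one_lt {h x : ℕ} (hh : 2 ≤ h) (hx : x < (2 ^ h - 1) ^ 2) : max x 1 < 2 ^ (2 * h) := by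
  refine max_lt (hx.trans_le ((Nat.pow_le_pow_left (Nat.sub_le _ 1) 2).trans_eq ?_)) ?_
  · rw [← pow_mul, mul_comm]
  · exact Nat.one_lt_two_pow (by omega)

theorem oddPart_max_lt {g h M W x : ℕ} (H : Params g h M W) (hx : x < (2 ^ h - 1) ^ 2) :
    oddPart (max x 1) < 2 ^ 2 ^ g :=
  (oddPart_le _).trans_lt ((max_one_lt H.two_le hx).trans_le
    (Nat.pow_le_pow_right (by norm_num) H.le_pow))

/-- Compute the product tree of the odd parts of the input numbers. -/
def Prog.inputTree : Prog := 10 ::= .var 2 <<ₑ .lit 1 ;; .fill 16 2 (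
  (17 ::= .read (.var 16) ;; .ite (.var 17) .skip (17 ::= .lit 1)) ;;
  .while (.var 17 %ₑ .lit 2 =ₑ .lit 0) (17 ::= .var 17 >>ₑ .lit 1) ;;
  .store (.var 10 +ₑ .var 2 +ₑ .var 16) (.var 17)) ;; prodTree

/-- Cells beyond the inputs hold 0 and are replaced by 1, whence `max (v i) 1`. Otherwise the
halving loop would not stop and the product would vanish. -/
theorem Prog.inputTree_run {σ : State} {g h M W : ℕ} {v : ℕ → ℕ} (H : Params g h M W)
    (h1 : σ.reg 1 = h) (h2 : σ.reg 2 = 2 ^ h) (h3 : σ.reg 3 = g) (h4 : σ.reg 4 = M)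
    (hv : ∀ i < 2 ^ h, σ.mem i = v i) (hvh : ∀ i < 2 ^ h, v i < (2 ^ h - 1) ^ 2) :
    Run .inputTree σ (10 ^ 12 * (W ^ 10 * 2 ^ (g + h))) (fun σ' => Frame 10 σ σ' ∧
      (∀ j ≤ h, ∀ u < 2 ^ j, σ'.mem (2 * 2 ^ h + 2 ^ j + u) =
        node h (fun i => oddPart (max (v i) 1)) j u) ∧
      ∀ x < 2 * 2 ^ h, σ'.mem x = σ.mem x) := by
  have h32 := H.le_W
  have haW := H.add_le_W
  have hW' : W ≤ W ^ 2 := by nlinarith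
  have hW2 : 2 * h ≤ W := H.le_pow.trans H.pow_le_W
  have hM6 : 6 * 2 ^ h ≤ M := by rw [H.hM]; exact Nat.mul_le_mul_right _ (by omega)
  have hpos : 1 ≤ 2 ^ h := Nat.one_le_two_pow
  have sB : ∀ x, x ≤ M + 4 → x.size ≤ W := fun x hx => H.size_le_of_le hx
  have sS : ∀ x, x ≤ M + 4 → x.size ≤ W ^ 2 := fun x hx => (sB x hx).trans hW'
  have h2h : ∀ i < 2 ^ h, max (v i) 1 < 2 ^ (2 * h) := fun i hi => max_one_lt H.two_le (hvh i hi)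
  have hL : ∀ i < 2 ^ h, oddPart (max (v i) 1) < 2 ^ 2 ^ g := fun i hi => oddPart_max_lt H (hvh i hi)
  refine (Run.seq (T₁ := 100 * W ^ 2) (Q := fun σ₁ => σ₁ = σ.setReg 10 (2 * 2 ^ h))
    ((Run.of_lf (W := W) (S := W ^ 2) (by omega) le_rfl
      rfl ?_ ?_).mono (T := _ * W ^ 2) (Nat.mul_le_mul_right _ ?_) fun _ h => h) fun σ₁ hσ₁ =>
    Run.seq (Run.fill (R := 16) (N := 2 ^ h) (b := 3 * 2 ^ h) (T := 1000 * W ^ 3) (S := W ^ 2)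
    (fun i => oddPart (max (v i) 1)) le_rfl (by norm_num) (by simpa [hσ₁] using h2)
      (by omega) (sS _ (by omega)) ?_) fun σ₂ hσ₂ => (prodTree_run (T := 2 * 2 ^ h)
      (L := fun i => oddPart (max (v i) 1)) H ?_ ?_ ?_ ?_ (by omega) hL ?_).mono le_rfl ?_).mono ?_
      fun _ h => h
  · simp [h2, sS (2 ^ h) (by omega), sS 1 (by omega), show 1 ≤ W ^ 2 by omega]
  · simp [h2, mul_comm]
  · simp [Prog.wt, Expr.nodes]
  · intro i σ₂ hi c0 c16 cm
    have r2 : σ₂.reg 2 = 2 ^ h := (c0.1 2 (by norm_num)).trans (by simpa [hσ₁] using h2)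
    have r10 : σ₂.reg 10 = 2 * 2 ^ h := (c0.1 10 (by norm_num)).trans (by simp [hσ₁])
    have m1 : σ₂.mem i = v i := by
      rw [cm, fillMem_out (by omega), hσ₁, State.setReg_mem, hv i hi]
    have hlt := (h2h i hi).trans_le (Nat.pow_le_pow_right (by norm_num) hW2)
    have hx1 : 1 ≤ max (v i) 1 := le_max_right _ _
    have hvx : v i ≤ max (v i) 1 := le_max_left _ _
    have hmx : (if v i ≠ 0 then v i else 1) = max (v i) 1 := by
      split_ifs <;> omega
    generalize hx : max (v i) 1 = x at *
    have sx : ∀ y, y ≤ x → y.size ≤ W := fun y hy => size_le_of_le hy (Nat.size_le.mpr hlt)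
    let I : ℕ → State → Prop := fun k σ₃ => Frame 16 σ₁ σ₃ ∧ σ₃.reg 16 = i ∧ σ₃.mem = σ₂.mem ∧
      0 < σ₃.reg 17 ∧ σ₃.reg 17 * 2 ^ k ≤ x ∧ oddPart (σ₃.reg 17) = oddPart x
    have hIle : ∀ {k y}, y * 2 ^ k ≤ x → y ≤ x := fun h =>
      (Nat.le_mul_of_pos_right _ (by positivity)).trans h
    refine (Run.seq (T₁ := 100 * W ^ 2) (Q := I 0) ((Run.of_lf (W := W) (S := W ^ 2) (by omega) le_rfl
      rfl ?_ ?_).mono (T := _ * W ^ 2) (Nat.mul_le_mul_right _ ?_) fun _ h => h) fun σ₃ hσ₃ =>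
      Run.seq (Q := fun σ₄ => Frame 16 σ₁ σ₄ ∧ σ₄.reg 16 = i ∧ σ₄.mem = σ₂.mem ∧
        σ₄.reg 17 = oddPart x) (Run.while (n := W) (Tc := 100 * W ^ 2) (T := 100 * W ^ 2) I hσ₃
        ?_ ?_ ?_) fun σ₄ hσ₄ => (Run.of_lf (W := W) (S := W ^ 2) (by omega) le_rfl
      rfl ?_ ?_).mono (T := _ * W ^ 2) (T' := 200 * W ^ 2) (Nat.mul_le_mul_right _ ?_)
      fun _ h => h).mono ?_ fun _ h => h
    · have q1 := (sx (v i) hvx).trans hW'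
      by_cases h0 : v i = 0 <;>
      simp (disch := omega) [c16, m1, sS, q1, h0, show 1 ≤ W ^ 2 by omega]
    · simp only [I]
      by_cases h0 : v i = 0
      · have : x = 1 := by rw [← hmx, h0]; simp
        simp [c16, m1, h0, this, c0]
      · have : v i = x := by rw [← hmx, if_pos h0]
        have hx0 : x ≠ 0 := by omega
        simp [c16, m1, hx0, c0, this]
        omega
    · simp [Prog.wt, Expr.nodes]
    · rintro k σ₃ - ⟨-, -, -, h5, h6, -⟩
      refine (Expr.cost_le_sq (S := W) (by omega) ?_).trans (Nat.mul_le_mul_right _ ?_)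
      · simp [sx _ (hIle h6), size_two_le (show 2 ≤ W by omega)]
      · simp [Expr.nodes]
    · rintro k σ₃ - ⟨d0, d16, dm, h5, h6, h7⟩ he
      have he' : ¬ σ₃.reg 17 % 2 = 0 := fun hc => by simp [Expr.eval, Op.eval, hc] at he
      rw [oddPart_of_odd he'] at h7
      exact ⟨d0, d16, dm, h7⟩
    · rintro k σ₃ - ⟨d0, d16, dm, h5, h6, h7⟩ he
      have he' : σ₃.reg 17 % 2 = 0 := by
        by_contra hc
        exact he (if_neg hc)
      refine ⟨?_, (Run.of_lf (W := W) (S := W ^ 2) (by omega) le_rfl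
        rfl ?_ ?_).mono (T := _ * W ^ 2) (Nat.mul_le_mul_right _ ?_) fun _ h => h⟩
      · exact (Nat.pow_lt_pow_iff_right (a := 2) (by norm_num)).mp
          (lt_of_le_of_lt ((Nat.le_mul_of_pos_left _ h5).trans h6) hlt)
      · simp [(sx _ (hIle h6)).trans hW', show 1 ≤ W ^ 2 by omega]
      · simp only [I]
        simp [d0, d16, dm]
        have h8 : σ₃.reg 17 = 2 * (σ₃.reg 17 / 2) := by clear * - he'; omega
        generalize σ₃.reg 17 / 2 = y at *
        rw [h8] at h5 h6 h7
        refine ⟨by omega, ?_, ?_⟩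
        · calc y * 2 ^ (k + 1) = 2 * y * 2 ^ k := by ring
            _ ≤ x := h6
        · rw [← h7, oddPart_two_mul]
      · simp [Prog.wt, Expr.nodes]
    · have p2 : σ₄.reg 2 = 2 ^ h := (hσ₄.1.1 2 (by norm_num)).trans (by simpa [hσ₁] using h2)
      have p10 : σ₄.reg 10 = 2 * 2 ^ h := (hσ₄.1.1 10 (by norm_num)).trans (by simp [hσ₁])
      simp (disch := omega) [p2, p10, hσ₄, sS, (sx _ (oddPart_le x)).trans hW']
    · have p2 : σ₄.reg 2 = 2 ^ h := (hσ₄.1.1 2 (by norm_num)).trans (by simpa [hσ₁] using h2)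
      have p10 : σ₄.reg 10 = 2 * 2 ^ h := (hσ₄.1.1 10 (by norm_num)).trans (by simp [hσ₁])
      simp [p2, p10, hσ₄, hx]
      congr 1
      omega
    · simp [Prog.wt, Expr.nodes]
    · have t1 : W ^ 3 = W * W ^ 2 := by ring
      have t2 : W * (1 + 100 * W ^ 2 + 100 * W ^ 2) ≤ W * (201 * W ^ 2) :=
        Nat.mul_le_mul_left _ (by omega)
      have t3 : W * (201 * W ^ 2) = 201 * (W * W ^ 2) := by ring
      have t5 : 32 * W ^ 2 ≤ W * W ^ 2 := Nat.mul_le_mul_right _ h32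
      omega
  · exact (hσ₂.1.1 1 (by norm_num)).trans (by simpa [hσ₁] using h1)
  · exact (hσ₂.1.1 3 (by norm_num)).trans (by simpa [hσ₁] using h3)
  · exact (hσ₂.1.1 4 (by norm_num)).trans (by simpa [hσ₁] using h4)
  · exact (hσ₂.1.1 10 (by norm_num)).trans (by simp [hσ₁])
  · intro u hu
    rw [hσ₂.2, show 2 * 2 ^ h + 2 ^ h + u = 3 * 2 ^ h + u by ring, fillMem_in hu]
  · rintro σ₃ ⟨d0, dn, dm⟩
    have e0 : Frame 10 σ σ₁ := by rw [hσ₁]; exact (Frame.refl _ _).setReg le_rfl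
    refine ⟨(e0.trans hσ₂.1 (by norm_num)).trans d0 (by norm_num), dn, fun x hx => ?_⟩
    rw [dm x (by omega) (by omega), hσ₂.2, fillMem_out (by omega), hσ₁, State.setReg_mem]
  · have t1 : W ^ 3 ≤ W ^ 10 := Nat.pow_le_pow_right (by omega) (by norm_num)
    have t2 : W ^ 2 ≤ W ^ 3 := Nat.pow_le_pow_right (by omega) (by norm_num)
    have t3 : 2 ^ h * (1000 * W ^ 3 + 74 * W ^ 2) ≤ 2 ^ (g + h) * (2000 * W ^ 10) :=
      Nat.mul_le_mul (Nat.pow_le_pow_right (by norm_num) (by omega)) (by omega)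
    have t4 : 2 ^ (g + h) * (2000 * W ^ 10) = 2000 * (W ^ 10 * 2 ^ (g + h)) := by ring
    have t5 : W ^ 10 ≤ W ^ 10 * 2 ^ (g + h) := Nat.le_mul_of_pos_right _ (by positivity)
    norm_num at *
    omega

/-! ### The whole program. -/

/-- Batch factorization. -/
def Prog.factorAll : Prog := maxProg ;; paramProg ;; sieve ;; inputTree ;; bitStage ;; factorStage

/-- For an odd divisor y of an input, y divides the odd part in the leaf, so `rtree_gcd` gives the
gcd condition of `Table`. The remainder trees for all bits dominate the time. -/
theorem Prog.factorAll_run {m : List ℕ} {g h M W : ℕ} (H : Params g h M W)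
    (hm : ∀ x ∈ m, 1 ≤ x) (hh : IsTableSize m.length (m.foldl max 0) h) (hg : IsWordSize h g)
    (hmX : ∀ x ∈ m, x ≤ m.foldl max 0) :
    Run .factorAll (State.init m) (10 ^ 14 * (W ^ 12 * 2 ^ (g + h)))
      (fun σ' => σ'.out = factorizations m) := by
  have h32 := H.le_W
  have hW2 : 2 * h ≤ W := H.le_pow.trans H.pow_le_W
  have hM6 : 6 * 2 ^ h ≤ M := by rw [H.hM]; exact Nat.mul_le_mul_right _ (by omega)
  have hpos : 1 ≤ 2 ^ h := Nat.one_le_two_pow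
  have hn := hh.lt
  have hXW : m.foldl max 0 < 2 ^ W := by
    refine hh.bound.trans_le ((Nat.pow_le_pow_left (Nat.sub_le _ 1) 2).trans ?_)
    rw [← pow_mul]
    exact Nat.pow_le_pow_right (by norm_num) (by omega)
  have hget : ∀ (i) (hi : i < m.length), (State.init m).mem i = m[i] := by
    intro i hi
    simp [State.init, hi]
  have hout : ∀ i, m.length ≤ i → (State.init m).mem i = 0 := by
    intro i hi
    simp [State.init, hi]
  have hvh : ∀ i < 2 ^ h, (State.init m).mem i < (2 ^ h - 1) ^ 2 := by
    intro i _
    refine lt_of_le_of_lt ?_ hh.bound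
    rcases lt_or_ge i m.length with hi | hi
    · rw [hget i hi]; exact hmX _ (List.getElem_mem hi)
    · rw [hout i hi]; exact Nat.zero_le _
  have hL : ∀ t < 2 ^ h, oddPart (max ((State.init m).mem t) 1) < 2 ^ 2 ^ g := fun t ht =>
    oddPart_max_lt H (hvh t ht)
  have hP : ∀ b, node h (bitLeaf h b) 0 0 < 2 ^ 2 ^ (g + h) := by
    intro b
    refine node_lt (j := 0) (fun t ht => ?_) (Nat.zero_le h) (by norm_num)
    have h5 : bitLeaf h b t < 2 ^ h := by
      have h4 : 2 ^ 2 ≤ 2 ^ h := Nat.pow_le_pow_right (by norm_num) H.two_le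
      unfold bitLeaf; split_ifs <;> omega
    exact h5.trans_le (Nat.pow_le_pow_right (by norm_num) (by have := H.le_pow; omega))
  refine (Run.seq (maxProg_run (W := W) (m := m) h32 (by simp [State.init]) (H.size_le_of_le (by omega))
    (Nat.size_le.mpr hXW) hget) fun σ₁ h₁ =>
    Run.seq (paramProg_run H ((h₁.1.1 0 (by norm_num)).trans (by simp [State.init])) h₁.2.2 hh hg)
    fun σ₂ h₂ => Run.seq (sieve_run H h₂.2.2.2.2.1 ?_) fun σ₃ h₃ =>
    Run.seq (inputTree_run (v := (State.init m).mem) H ?_ ?_ ?_ ?_ ?_ hvh) fun σ₄ h₄ =>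
    Run.seq (bitStage_run (L := fun i => oddPart (max ((State.init m).mem i) 1)) H ?_ ?_ ?_ ?_ ?_ ?_ ?_
      ?_ h₄.2.1) fun σ₅ h₅ =>
    (factorStage_run (m := m) H ?_ ?_ ?_ hn.le ?_).mono le_rfl ?_).mono ?_ fun _ h => h
  · intro t ht
    rw [h₂.2.1, h₁.2.1, hout _ (by omega)]
  · exact (h₃.1.1 1 (by norm_num)).trans h₂.2.2.2.1
  · exact (h₃.1.1 2 (by norm_num)).trans h₂.2.2.2.2.1
  · exact (h₃.1.1 3 (by norm_num)).trans h₂.2.2.2.2.2.1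
  · exact (h₃.1.1 4 (by norm_num)).trans h₂.2.2.2.2.2.2
  · intro i hi
    rw [h₃.2.2 i (.inl hi), h₂.2.1, h₁.2.1]
  · exact ((h₃.1.trans h₄.1 le_rfl).1 1 (by norm_num)).trans h₂.2.2.2.1
  · exact ((h₃.1.trans h₄.1 le_rfl).1 2 (by norm_num)).trans h₂.2.2.2.2.1
  · exact ((h₃.1.trans h₄.1 le_rfl).1 3 (by norm_num)).trans h₂.2.2.2.2.2.1
  · exact ((h₃.1.trans h₄.1 le_rfl).1 4 (by norm_num)).trans h₂.2.2.2.2.2.2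
  · have := H.le_pow
    omega
  · intro t ht
    rw [h₄.2.2 _ (by omega)]
    exact (h₃.2.1 t ht).2
  · intro t ht
    rw [h₄.2.2 _ (by omega)]
    exact (h₃.2.1 t ht).1
  · exact hL
  · exact ((h₃.1.mono (by norm_num : 8 ≤ 10)).trans ((h₄.1.mono (by norm_num)).trans h₅.1 le_rfl)
      le_rfl).1 0 (by norm_num) |>.trans h₂.2.2.1
  · exact ((h₃.1.mono (by norm_num : 8 ≤ 10)).trans ((h₄.1.mono (by norm_num)).trans h₅.1 le_rfl)
      le_rfl).1 1 (by norm_num) |>.trans h₂.2.2.2.1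
  · exact ((h₃.1.mono (by norm_num : 8 ≤ 10)).trans ((h₄.1.mono (by norm_num)).trans h₅.1 le_rfl)
      le_rfl).1 2 (by norm_num) |>.trans h₂.2.2.2.2.1
  · intro i hi
    have hpos' : 1 ≤ m[i] := hm _ (List.getElem_mem hi)
    have hmem : σ₅.mem i = m[i] := by
      rw [h₅.2.2 i (by omega), h₄.2.2 i (by omega), h₃.2.2 i (.inl (by omega)), h₂.2.1, h₁.2.1,
        hget i hi]
    refine ⟨by omega, hmem, hpos', (hmX _ (List.getElem_mem hi)).trans_lt hh.bound, ?_, ?_⟩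
    · intro b hb
      rw [h₅.2.1 b hb i (by omega)]
      have := rtree_lt hL (hP b) le_rfl (show i < 2 ^ h by omega)
      rwa [Nat.add_sub_cancel] at this
    · intro b hb y hy hym
      rw [h₅.2.1 b hb i (by omega), rtree_gcd hL (fun t => oddPart_odd (by omega)) (by omega)
        (dvd_oddPart hy ?_)]
      rwa [hget i hi, max_eq_left hpos']
  · rintro σ' h₆
    rw [h₆, h₅.1.2, h₄.1.2, h₃.1.2, h₂.1, h₁.1.2]
    rfl
  · have t1 : 2 ^ h ≤ 2 ^ (g + h) := Nat.pow_le_pow_right (by norm_num) (by omega)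
    -- The cost of each stage is a multiple of W^a * x with a ≤ 12 and x ≤ 2^(g+h), so all are
    -- compared with the same quantity.
    have hle : ∀ a ≤ 12, ∀ x ≤ 2 ^ (g + h), W ^ a * x ≤ W ^ 12 * 2 ^ (g + h) := fun a ha x hx =>
      Nat.mul_le_mul (Nat.pow_le_pow_right (by omega) ha) hx
    have e1 : m.length * (400 * W ^ 2) = 400 * (W ^ 2 * m.length) := by ring
    have q1 := hle 2 (by norm_num) m.length (by omega)
    have q2 := hle 2 (by norm_num) 1 (by omega)
    have q3 := hle 3 (by norm_num) 1 (by omega)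
    have q4 := hle 3 (by norm_num) _ t1
    have q5 := hle 10 (by norm_num) _ le_rfl
    have q6 := hle 5 (by norm_num) _ t1
    rw [mul_one] at q2 q3
    clear * - e1 q1 q2 q3 q4 q5 q6
    norm_num
    omega

/-! ### The time bound -/

/-- Either g = 5, and 32 ≤ 16 h because h ≥ 2, or g - 1 was not admissible, and then 2^g < 4 h. -/
theorem IsWordSize.pow_le {h g : ℕ} (hh : 2 ≤ h) (hg : IsWordSize h g) : 2 ^ g ≤ 16 * h := by
  rcases hg.five_le.eq_or_lt with rfl | h5
  · omega
  · have h1 : ¬ 2 * h ≤ 2 ^ (g - 1) := fun hc => by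
      have := hg.least (g - 1) (by omega) hc
      omega
    have h2 : 2 ^ g = 2 * 2 ^ (g - 1) := by rw [← pow_succ']; congr 1; omega
    omega

/-- Since g < 2^g ≤ 16 h, the exponent e = g + h is at most 17 h. The working space then ends below
an address of roughly 8e + 19 ≤ 136 h + 19 bits, so 1000 h is generous. -/
theorem IsWordSize.params {h g : ℕ} (hh : 2 ≤ h) (hg : IsWordSize h g) :
    Params g h ((6 + 2 * h) * 2 ^ h) (1000 * h) := by
  have hg16 := hg.pow_le hh
  have hg' : g < 2 ^ g := Nat.lt_two_pow_self
  refine ⟨hh, hg.five_le, by omega, by omega, hg.le, by omega, rfl, Nat.size_le.mpr ?_⟩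
  have he : g + h ≤ 17 * h := by omega
  generalize g + h = e at *
  have h1 : (6 + 2 * h) * 2 ^ h ≤ 2 ^ (6 + 2 * h) * 2 ^ h :=
    Nat.mul_le_mul_right _ Nat.lt_two_pow_self.le
  have h2 : (e + 6) ^ 2 * (4 * (2 ^ (e + 5) * 32 ^ e.size)) ≤
      (2 ^ (e + 6)) ^ 2 * (4 * (2 ^ (e + 5) * 32 ^ e)) := by
    have : e + 6 < 2 ^ (e + 6) := Nat.lt_two_pow_self
    have : e.size ≤ e := Nat.size_le.mpr Nat.lt_two_pow_self
    gcongr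
    norm_num
  have h3 : (2 ^ (e + 6)) ^ 2 * (4 * (2 ^ (e + 5) * 32 ^ e)) = 2 ^ (8 * e + 19) := by
    rw [show (4 : ℕ) = 2 ^ 2 by norm_num, show (32 : ℕ) = 2 ^ 5 by norm_num, ← pow_mul, ← pow_mul,
      ← pow_add, ← pow_add, ← pow_add]
    congr 1
    ring
  have h4 : 2 ^ (8 * e + 19) ≤ 2 ^ (1000 * h - 1) := Nat.pow_le_pow_right (by norm_num) (by omega)
  have h5 : 2 ^ (6 + 2 * h) * 2 ^ h < 2 ^ (1000 * h - 1) := by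
    rw [← pow_add]
    exact Nat.pow_lt_pow_right (by norm_num) (by omega)
  have h6 : 2 ^ (1000 * h) = 2 * 2 ^ (1000 * h - 1) := by rw [← pow_succ']; congr 1; omega
  omega

theorem le_foldl_max {m : List ℕ} {a : ℕ} : a ≤ m.foldl max a ∧ ∀ x ∈ m, x ≤ m.foldl max a := by
  induction m generalizing a with
  | nil => simp
  | cons y l ih =>
    obtain ⟨h1, h2⟩ := ih (a := max a y)
    refine ⟨(le_max_left _ _).trans h1, fun x hx => ?_⟩
    rcases List.mem_cons.mp hx with rfl | hx
    · exact (le_max_right _ _).trans h1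
    · exact h2 x hx

theorem foldl_max_le {m : List ℕ} {a s : ℕ} (ha : a ≤ s) (hm : ∀ x ∈ m, x ≤ s) :
    m.foldl max a ≤ s := by
  induction m generalizing a with
  | nil => exact ha
  | cons y l ih =>
    exact ih (max_le ha (hm y List.mem_cons_self)) fun x hx => hm x (List.mem_cons_of_mem _ hx)

/-- If h > 2, then h - 1 was not admissible: either n ≥ 2^(h-1), or (2^(h-1) - 1)^2 ≤ s and hence
2^h ≤ 2 √s + 2. For h = 2 the bound is 4 ≤ 4 (n + √s). -/
theorem IsTableSize.pow_le {n X s h : ℕ} (hh : IsTableSize n X h) (hX : X ≤ s) (hn : 1 ≤ n)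
    (hs : 1 ≤ s) : (2 ^ h : ℝ) ≤ 4 * (n + √s) := by
  have hn' : (1 : ℝ) ≤ n := by exact_mod_cast hn
  have hs' : (1 : ℝ) ≤ √s := Real.one_le_sqrt.mpr (by exact_mod_cast hs)
  rcases hh.two_le.eq_or_lt with rfl | h2
  · linarith
  · have e : (2 ^ h : ℝ) = 2 * 2 ^ (h - 1) := by rw [← pow_succ']; congr 1; omega
    by_cases h1 : n < 2 ^ (h - 1)
    · have h3 : (2 ^ (h - 1) - 1) ^ 2 ≤ X := by
        by_contra hc
        have := hh.least (h - 1) (by omega) h1 (by omega)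
        omega
      have h4 : ((2 ^ (h - 1) - 1 : ℕ) : ℝ) ≤ √s :=
        Real.le_sqrt_of_sq_le (by exact_mod_cast h3.trans hX)
      have h5 : 1 ≤ 2 ^ (h - 1) := Nat.one_le_two_pow
      push_cast [h5] at h4
      linarith
    · have h3 : (2 ^ (h - 1) : ℝ) ≤ n := by exact_mod_cast not_lt.mp h1
      linarith

/-- For A ≥ 2 we have 4A ≤ A^3, so h log 2 ≤ 3 log A, and 3 / log 2 < 5. -/
theorem le_five_mul_log {h : ℕ} {A : ℝ} (hA : 2 ≤ A) (hh : 2 ^ h ≤ 4 * A) :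
    (h : ℝ) ≤ 5 * Real.log A := by
  have h0 : 4 * A ≤ A ^ 3 := by
    have h1 : 2 ^ 2 ≤ A ^ 2 := by gcongr
    calc 4 * A = 2 ^ 2 * A := by ring
      _ ≤ A ^ 2 * A := by gcongr
      _ = A ^ 3 := by ring
  have h1 : Real.log (2 ^ h) ≤ Real.log (A ^ 3) :=
    Real.log_le_log (by positivity) (hh.trans h0)
  rw [Real.log_pow, Real.log_pow] at h1
  have h2 := Real.log_two_gt_d9
  have h3 : (0 : ℝ) ≤ h := h.cast_nonneg
  push_cast at h1
  nlinarith

end LogRAM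

theorem theorem3p6 :
    ∃ (P : LogRAM.Prog) (C : ℝ) (c : ℕ),
      ∀ (m : List ℕ) (s : ℕ), m ≠ [] → (∀ x ∈ m, 1 ≤ x ∧ x ≤ s) →
        ∃ (t : ℕ) (σ : LogRAM.State),
          LogRAM.Exec P (LogRAM.State.init m) t σ ∧
          σ.out = LogRAM.factorizations m ∧
          (t : ℝ) ≤ C * ((m.length : ℝ) + Real.sqrt s) *
            Real.log ((m.length : ℝ) + Real.sqrt s) ^ c := by
  -- The factors come from 10^14 * W^12 * 2^(g+h) with W = 1000 h, then 2^g ≤ 16 h, then h ≤ 5 log A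
  -- for the thirteen factors h, and finally 2^h ≤ 4 A, where A = n + √s.
  refine ⟨.factorAll, 10 ^ 14 * 1000 ^ 12 * 16 * 5 ^ 13 * 4, 13, fun m s hne hm => ?_⟩
  obtain ⟨h, hh⟩ := LogRAM.exists_isTableSize m.length (m.foldl max 0)
  obtain ⟨g, hg⟩ := LogRAM.exists_isWordSize h
  have hn : 1 ≤ m.length := List.length_pos_iff.mpr hne
  have hs : 1 ≤ s := by
    obtain ⟨x, hx⟩ := List.exists_mem_of_ne_nil m hne
    exact (hm x hx).1.trans (hm x hx).2
  obtain ⟨t, σ, he, ht, ho⟩ := LogRAM.Prog.factorAll_run (hg.params hh.two_le)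
    (fun x hx => (hm x hx).1) hh hg LogRAM.le_foldl_max.2
  refine ⟨t, σ, he, ho, ?_⟩
  have hA := hh.pow_le (LogRAM.foldl_max_le (Nat.zero_le s) fun x hx => (hm x hx).2) hn hs
  have hA2 : 2 ≤ (m.length : ℝ) + √s := by
    have hn' : (1 : ℝ) ≤ m.length := by exact_mod_cast hn
    have hs' : (1 : ℝ) ≤ √s := Real.one_le_sqrt.mpr (by exact_mod_cast hs)
    linarith
  have hl := LogRAM.le_five_mul_log hA2 hA
  generalize (m.length : ℝ) + √s = A at *
  have h1 : (t : ℝ) ≤ 10 ^ 14 * ((1000 * h) ^ 12 * (16 * h * 2 ^ h)) := by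
    have h2 := hg.pow_le hh.two_le
    have h3 : 10 ^ 14 * ((1000 * h) ^ 12 * 2 ^ (g + h)) ≤
        10 ^ 14 * ((1000 * h) ^ 12 * (16 * h * 2 ^ h)) := by
      rw [pow_add]
      gcongr
    exact_mod_cast ht.trans h3
  calc (t : ℝ) ≤ 10 ^ 14 * ((1000 * h) ^ 12 * (16 * h * 2 ^ h)) := h1
    _ = 10 ^ 14 * 1000 ^ 12 * 16 * ((h : ℝ) ^ 13 * 2 ^ h) := by ring
    _ ≤ 10 ^ 14 * 1000 ^ 12 * 16 * ((5 * Real.log A) ^ 13 * (4 * A)) := by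
        gcongr
        exact pow_nonneg (h.cast_nonneg.trans hl) _
    _ = _ := by ring
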